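/- **Setting.** Graphs are finite, simple and undirected, with vertex set $[n]=\{1,\dots,n\}$, $n\ge 1$, and all degrees at most $d$, $d\ge 1$. A local algorithm is given $n$, $d$ and its parameters and random seed, and accesses a connected graph $G$ by probes: a probe $(v,i)$ returns the $i$-th neighbour of $v$ (in an arbitrary fixed order) or reports that there is none. It is an *$(\epsilon,q,\delta)$-local sparse spanning graph algorithm* for a family $\mathcal C$ if, for every connected $G\in\mathcal C$ on $[n]$ with degrees at most $d$, there is a subgraph $G'=([n],E')$ of $G$, determined by $G$ and the random seed, such that $G'$ is always connected, $|E'|<(1+\epsilon)n$ with probability at least $1-\delta$, and, on every query $\{u,v\}\in E(G)$, the algorithm decides whether $\{u,v\}\in E'$ with at most $q$ probes (so that all answers are consistent with the same $G'$). The running time is measured per query on a word-RAM with words of any length at least a suitable absolute constant times $\log(n+d+h/\epsilon+2)$. A graph $H$ is a minor of $G$ if it is obtained, up to isomorphism, from a subgraph of $G$ by edge contractions; $G$ is $H$-minor-free if it has no minor $H$. **The graph $G'$.** Let $\gamma\in(0,1)$ and let $k,s>1$ be integers. Let $W\subseteq[n]$ be a random set of *centers* which contains each vertex with probability $\lceil\gamma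 q_n\rceil/q_n$, $2kd$-wise independently: $v\in W$ iff the value at $v$ of a uniformly random polynomial of degree less than $2kd$ over $\mathbb Z/q_n$ is less than $\lceil\gamma q_n\rceil$, where $q_n$ is the smallest prime above $n$; the $2kd$ coefficients are the random seed. For a vertex $v$ let $B_k(v)$ be the set of vertices at distance at most $\ell$ from $v$, with $\ell$ minimal such that these are at least $k$ vertices or all vertices. A vertex $v$ is *remote* if $B_k(v)\cap W=\emptyset$; every remote vertex forms a part by itself. Assign every other vertex to its closest center (ties broken by smallest identifier), and for $w\in W$ let $T(w)$ be the BFS tree, rooted at $w$, of the subgraph induced by the non-remote vertices assigned to $w$; in every BFS tree the parent of a vertex is the neighbour of smallest identifier on the previous level. Decompose $T(w)$ recursively, starting at the root $v=w$: let $\ell$ be the least level such that at least $s$ vertices, or all vertices, of the subtree at $v$ lie at most $\ell$ levels below $v$; the part with *sub-center* $v$ consists of these vertices together with those subtrees rooted $\ell+1$ levels below $v$ that have fewer than $s$ vertices; recurse on the subtrees rooted $\ell+1$ levels below $v$ that have at least $s$ vertices. The graph $G'$ consists of the BFS tree of each part (in its induced subgraph, rooted at its sub-center) and, for any two parts joined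 by an edge of $G$, of the edge $\{x,y\}$ between them for which $(\min\{x,y\},\max\{x,y\})$ is lexicographically smallest. **Theorem.** There are a word-RAM program, absolute constants $c>0$ and $a\in\mathbb N$, and parameters $\gamma=\gamma(\epsilon,h)\in(0,1)$, $k=k(\epsilon,h,d)>1$, $s=s(\epsilon,h)>1$ such that the following holds for every $0<\epsilon\le 1$ and every graph $H$ on $h\ge1$ vertices. With these parameters (and $n$, $d$, $2kd$, $q_n$, $\lceil\gamma q_n\rceil$) as given numbers, the program is an $(\epsilon,q,\delta)$-local sparse spanning graph algorithm for the family of $H$-minor-free graphs, giving query access to the graph $G'$ described above, with probe complexity $$q\le c\,(h/\epsilon)^4 d^5\log^a(hd/\epsilon+2)=\tilde O\big((h/\epsilon)^4d^5\big),$$ error probability $$\delta\le \frac{c\,(h/\epsilon)\log^a(h/\epsilon+2)}{n}$$ (which is $1/\Omega(n)$ for fixed $\epsilon$ and $h$), and running time per query at most $$c\,(h/\epsilon)^5 d^5\log^a(hd/\epsilon+2)=\tilde O\big((h/\epsilon)^5d^5\big).$$ The random seed has at most $c\,(h/\epsilon)\,d\,\log(n+1)\log^a(hd/\epsilon+2)=\tilde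 O((h/\epsilon)d\log n)$ bits. Moreover, for every random seed, the stretch of $G'$ is at most $c\,(h/\epsilon)\log(d+1)\log^a(h/\epsilon+2)=\tilde O(h\log d/\epsilon)$, that is, $\mathrm{dist}_{G'}(u,v)$ is at most this factor times $\mathrm{dist}_G(u,v)$ for all vertices $u,v$. -/

import Mathlib

namespace SSG

/-! ### Minors -/

/-- `H` is a minor of `G`: there are a subgraph `S` of `G` and a map from the vertices of `S` onto the
vertices of `H` all of whose fibres are connected in `S`, such that contracting every fibre to a point
(deleting loops and merging parallel edges) turns `S` into `H`. -/
def IsMinor {U V : Type} (H : SimpleGraph U) (G : SimpleGraph V) : Prop :=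
  ∃ (S : G.Subgraph) (f : S.verts → U),
    (∀ a, (S.coe.induce (f ⁻¹' {a})).Connected) ∧
    ∀ a b, H.Adj a b ↔ a ≠ b ∧ ∃ x y, S.coe.Adj x y ∧ f x = a ∧ f y = b

/-- The family of `H`-minor-free graphs, as a family of graphs on the vertex sets `Fin n`. -/
def MinorFree {U : Type} (H : SimpleGraph U) (n : ℕ) (G : SimpleGraph (Fin n)) : Prop :=
  ¬ IsMinor H G

/-- `G'` is a `t`-spanner of `G` (for connected graphs on the same vertices). -/
def HasStretch {V : Type} (G G' : SimpleGraph V) (t : ℝ) : Prop :=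
  ∀ u v, (G'.dist u v : ℝ) ≤ t * G.dist u v

/-! ### The partition and the sparse spanning graph

The vertices are `Fin n`, with its order as the order of the identifiers. `W` is the set of centers. -/

section Partition

variable {n : ℕ}

/-- The set of vertices at distance at most `ℓ` from `v`. -/
def ball (G : SimpleGraph (Fin n)) (v : Fin n) (ℓ : ℕ) : Set (Fin n) := {u | G.dist v u ≤ ℓ}

/-- The least depth at which the BFS from `v` has seen at least `k` vertices, or (if the graph has fewer
than `k` vertices) has seen all of them. -/
noncomputable def bfsDepth (G : SimpleGraph (Fin n)) (k : ℕ) (v : Fin n) : ℕ :=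
  sInf {ℓ | k ≤ (ball G v ℓ).ncard ∨ ball G v ℓ = Set.univ}

/-- `B_k(v)`: the vertices of the BFS tree from `v` of depth `bfsDepth G k v`. -/
def bfsBall (G : SimpleGraph (Fin n)) (k : ℕ) (v : Fin n) : Set (Fin n) :=
  ball G v (bfsDepth G k v)

/-- The remote vertices: those `v` for which `B_k(v)` contains no center. -/
def remote (G : SimpleGraph (Fin n)) (W : Set (Fin n)) (k : ℕ) : Set (Fin n) :=
  {v | bfsBall G k v ∩ W = ∅}

/-- `w` is the center of `v`: the closest vertex of `W`, ties being broken by identifiers. -/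
def IsCenter (G : SimpleGraph (Fin n)) (W : Set (Fin n)) (v w : Fin n) : Prop :=
  w ∈ W ∧ ∀ w' ∈ W, G.dist w v < G.dist w' v ∨ (G.dist w v = G.dist w' v ∧ w ≤ w')

/-- The cell of `w` without the remote vertices. -/
def cell (G : SimpleGraph (Fin n)) (W : Set (Fin n)) (k : ℕ) (w : Fin n) : Set (Fin n) :=
  {v | IsCenter G W v w} \ remote G W k

/-- The neighbours of `x` in `S` that are one step closer to `r` than `x` in the subgraph induced by `S`. -/
def bfsPred (G : SimpleGraph (Fin n)) (S : Set (Fin n)) (r x : Fin n) : Set (Fin n) :=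
  {y | y ∈ S ∧ G.Adj y x ∧
    (G.induce S).spanningCoe.dist r y + 1 = (G.induce S).spanningCoe.dist r x}

/-- `p` is the parent of `x` in the BFS tree, rooted at `r`, of the subgraph induced by `S`: among the
possible parents of `x`, the one with the smallest identifier. -/
def IsBFSParent (G : SimpleGraph (Fin n)) (S : Set (Fin n)) (r p x : Fin n) : Prop :=
  x ∈ S ∧ IsLeast (bfsPred G S r x) p

/-- In the rooted tree with parent relation `T` (`T p x`: `p` is the parent of `x`), the vertices
`j` levels below `v`. -/
def treeLevel (T : Fin n → Fin n → Prop) (v : Fin n) : ℕ → Set (Fin n)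
  | 0 => {v}
  | j + 1 => {x | ∃ p ∈ treeLevel T v j, T p x}

/-- The vertices at most `ℓ` levels below `v`. -/
def treeBall (T : Fin n → Fin n → Prop) (v : Fin n) (ℓ : ℕ) : Set (Fin n) :=
  {x | ∃ j ≤ ℓ, x ∈ treeLevel T v j}

/-- The subtree rooted at `v`. -/
def subtree (T : Fin n → Fin n → Prop) (v : Fin n) : Set (Fin n) := {x | ∃ j, x ∈ treeLevel T v j}

/-- The least level at which the BFS from `v` in its subtree has seen at least `s` vertices, or
(if there are fewer than `s`) all of them. -/
noncomputable def treeDepth (T : Fin n → Fin n → Prop) (s : ℕ) (v : Fin n) : ℕ :=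
  sInf {ℓ | s ≤ (treeBall T v ℓ).ncard ∨ treeBall T v ℓ = subtree T v}

/-- The vertices on which the recursive tree decomposition of the tree rooted at `w` is called:
`w` itself and, when it is called on `v`, those vertices on the level just below the one where the BFS
from `v` stops whose subtrees have at least `s` vertices. (A tree with at most `s` vertices is left
undivided.) -/
inductive IsSubCenter (T : Fin n → Fin n → Prop) (s : ℕ) (w : Fin n) : Fin n → Prop
  | root : IsSubCenter T s w w
  | child {v u : Fin n} : IsSubCenter T s w v → u ∈ treeLevel T v (treeDepth T s v + 1) →
      s ≤ (subtree T u).ncard → IsSubCenter T s w u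

/-- The part with sub-center `v`: the vertices reached by the BFS from `v`, together with the subtrees
on the next level that have fewer than `s` vertices. -/
def piece (T : Fin n → Fin n → Prop) (s : ℕ) (v : Fin n) : Set (Fin n) :=
  treeBall T v (treeDepth T s v) ∪
    {x | ∃ u ∈ treeLevel T v (treeDepth T s v + 1), (subtree T u).ncard < s ∧ x ∈ subtree T u}

/-- `X` is a part with sub-center `c` obtained by decomposing the BFS tree of the cell of some center. -/
def IsRootedPart (G : SimpleGraph (Fin n)) (W : Set (Fin n)) (k s : ℕ) (c : Fin n)
    (X : Set (Fin n)) : Prop :=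
  ∃ w ∈ W, IsSubCenter (IsBFSParent G (cell G W k w) w) s w c ∧
    X = piece (IsBFSParent G (cell G W k w) w) s c

/-- The final partition: the remote vertices as singletons, and the parts of the cells. -/
def parts (G : SimpleGraph (Fin n)) (W : Set (Fin n)) (k s : ℕ) : Set (Set (Fin n)) :=
  {X | (∃ v ∈ remote G W k, X = {v}) ∨ ∃ c, IsRootedPart G W k s c X}

/-- The rank of the edge `{x, y}`: edges are ordered lexicographically by smaller and larger endpoint. -/
def edgeRank (x y : Fin n) : Fin n ×ₗ Fin n := toLex (min x y, max x y)

/-- `{x, y}` is the edge of minimum rank between the parts `X` and `Y`. -/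
def IsMinEdge (G : SimpleGraph (Fin n)) (X Y : Set (Fin n)) (x y : Fin n) : Prop :=
  x ∈ X ∧ y ∈ Y ∧ G.Adj x y ∧
    ∀ x' ∈ X, ∀ y' ∈ Y, G.Adj x' y' → edgeRank x y ≤ edgeRank x' y'

/-- The sparse spanning graph: the BFS tree of each part, rooted at its sub-center, and for any two
parts joined by an edge the one of minimum rank. -/
def sparseSpanningGraph (G : SimpleGraph (Fin n)) (W : Set (Fin n)) (k s : ℕ) :
    SimpleGraph (Fin n) where
  Adj x y :=
    (∃ c X, IsRootedPart G W k s c X ∧ (IsBFSParent G X c x y ∨ IsBFSParent G X c y x)) ∨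
    (∃ X ∈ parts G W k s, ∃ Y ∈ parts G W k s, X ≠ Y ∧ IsMinEdge G X Y x y)
  symm := ⟨by
    rintro x y (⟨c, X, h, h'⟩ | ⟨X, hX, Y, hY, hne, h1, h2, h3, h4⟩)
    · exact Or.inl ⟨c, X, h, h'.symm⟩
    · refine Or.inr ⟨Y, hY, X, hX, hne.symm, h2, h1, h3.symm, fun x' hx' y' hy' ha => ?_⟩
      have := h4 y' hy' x' hx' ha.symm
      simpa [edgeRank, min_comm, max_comm] using this⟩
  loopless := ⟨by
    rintro x (⟨c, X, -, h | h⟩ | ⟨X, -, Y, -, -, -, -, h, -⟩)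
    · exact h.2.1.2.1.ne rfl
    · exact h.2.1.2.1.ne rfl
    · exact h.ne rfl⟩

end Partition

/-! ### The random choice of the centers -/

/-- The smallest prime larger than `n` (it is at most `2 * n` if `n ≥ 1`). -/
noncomputable def primeAbove (n : ℕ) : ℕ := sInf {p | p.Prime ∧ n < p}

/-- The value at `i` of the polynomial of degree less than `t` over the integers modulo `q` whose
coefficients are the `t` words of the seed. For a uniform seed and prime `q`, the values
at distinct points modulo `q` are uniform and `t`-wise independent. -/
def hashValue {t q : ℕ} (ρ : Fin t → Fin q) (i : ℕ) : ℕ := (∑ j, (ρ j : ℕ) * i ^ (j : ℕ)) % q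

/-- The centers: the vertices whose hash value is below the threshold `θ`. The vertex `v : Fin n`
has identifier `v + 1`. If `n < q` and `q` is prime, each vertex is a center with
probability `θ / q`, and these events are `t`-wise independent. -/
def centers {t q : ℕ} (n θ : ℕ) (ρ : Fin t → Fin q) : Set (Fin n) :=
  {v | hashValue ρ (v + 1) < θ}

/-! ### Word-RAM programs with probes -/

/-- Binary operations on words. -/
inductive Op
  | add | sub | mul | div | mod | lt | eq

/-- The operations on words of `w` bits, that is, on numbers below `2 ^ w`. -/
def Op.eval (w : ℕ) : Op → ℕ → ℕ → ℕ
  | .add, a, b => (a + b) % 2 ^ w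
  | .sub, a, b => (a + 2 ^ w - b) % 2 ^ w
  | .mul, a, b => (a * b) % 2 ^ w
  | .div, a, b => a / b
  | .mod, a, b => a % b
  | .lt, a, b => if a < b then 1 else 0
  | .eq, a, b => if a = b then 1 else 0

/-- A memory configuration: registers and a word-addressed memory. -/
structure State where
  reg : ℕ → ℕ
  mem : ℕ → ℕ

/-- Expressions: constants, registers, memory cells and operations. -/
inductive Expr
  | lit (c : ℕ)
  | reg (i : ℕ)
  | mem (a : Expr)
  | op (o : Op) (a b : Expr)

/-- The value of an expression, with words of `w` bits. -/
def Expr.eval (w : ℕ) (σ : State) : Expr → ℕ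
  | .lit c => c % 2 ^ w
  | .reg i => σ.reg i
  | .mem a => σ.mem (a.eval w σ)
  | .op o a b => o.eval w (a.eval w σ) (b.eval w σ)

/-- The number of steps it takes to evaluate an expression: one for each constant, register access,
memory access and operation. -/
def Expr.cost : Expr → ℕ
  | .lit _ => 1
  | .reg _ => 1
  | .mem a => a.cost + 1
  | .op _ a b => a.cost + b.cost + 1

/-- Programs: assignments to a register, writes to memory, probes, and structured control flow. -/
inductive Prog
  | assign (i : ℕ) (e : Expr)
  | store (a e : Expr)
  | probe (i : ℕ) (a b : Expr)
  | seq (p q : Prog)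
  | ite (e : Expr) (p q : Prog)
  | while (e : Expr) (p : Prog)

/-- `Exec w O p σ σ' t m`: with words of `w` bits and oracle `O`, the program `p` started in `σ` halts
in `σ'` after `t` steps, `m` of which are probes. -/
inductive Exec (w : ℕ) (O : ℕ → ℕ → ℕ) : Prog → State → State → ℕ → ℕ → Prop
  | assign (i : ℕ) (e : Expr) (σ : State) :
      Exec w O (.assign i e) σ { σ with reg := Function.update σ.reg i (e.eval w σ) } (e.cost + 1) 0
  | store (a e : Expr) (σ : State) :
      Exec w O (.store a e) σ { σ with mem := Function.update σ.mem (a.eval w σ) (e.eval w σ) }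
        (a.cost + e.cost + 1) 0
  | probe (i : ℕ) (a b : Expr) (σ : State) :
      Exec w O (.probe i a b) σ
        { σ with reg := Function.update σ.reg i (O (a.eval w σ) (b.eval w σ)) }
        (a.cost + b.cost + 1) 1
  | seq {p q : Prog} {σ σ' σ'' : State} {t m t' m' : ℕ} :
      Exec w O p σ σ' t m → Exec w O q σ' σ'' t' m' → Exec w O (.seq p q) σ σ'' (t + t') (m + m')
  | ite_true {e : Expr} {p q : Prog} {σ σ' : State} {t m : ℕ} :
      e.eval w σ ≠ 0 → Exec w O p σ σ' t m → Exec w O (.ite e p q) σ σ' (e.cost + 1 + t) m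
  | ite_false {e : Expr} {p q : Prog} {σ σ' : State} {t m : ℕ} :
      e.eval w σ = 0 → Exec w O q σ σ' t m → Exec w O (.ite e p q) σ σ' (e.cost + 1 + t) m
  | while_true {e : Expr} {p : Prog} {σ σ' σ'' : State} {t m t' m' : ℕ} :
      e.eval w σ ≠ 0 → Exec w O p σ σ' t m → Exec w O (.while e p) σ' σ'' t' m' →
      Exec w O (.while e p) σ σ'' (e.cost + 1 + t + t') (m + m')
  | while_false {e : Expr} {p : Prog} {σ : State} :
      e.eval w σ = 0 → Exec w O (.while e p) σ σ (e.cost + 1) 0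

/-- Execution is deterministic, so the run of a program and its costs are well defined. -/
theorem Exec.det {w : ℕ} {O : ℕ → ℕ → ℕ} {p : Prog} {σ σ₁ σ₂ : State} {t₁ m₁ t₂ m₂ : ℕ}
    (h₁ : Exec w O p σ σ₁ t₁ m₁) (h₂ : Exec w O p σ σ₂ t₂ m₂) :
    σ₁ = σ₂ ∧ t₁ = t₂ ∧ m₁ = m₂ := by
  induction h₁ generalizing σ₂ t₂ m₂ with
  | assign i e σ => cases h₂; exact ⟨rfl, rfl, rfl⟩
  | store a e σ => cases h₂; exact ⟨rfl, rfl, rfl⟩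
  | probe i a b σ => cases h₂; exact ⟨rfl, rfl, rfl⟩
  | seq _ _ ih ih' =>
    cases h₂ with
    | seq h h' =>
      obtain ⟨rfl, rfl, rfl⟩ := ih h
      obtain ⟨rfl, rfl, rfl⟩ := ih' h'
      exact ⟨rfl, rfl, rfl⟩
  | ite_true he _ ih =>
    cases h₂ with
    | ite_true _ h =>
      obtain ⟨rfl, rfl, rfl⟩ := ih h
      exact ⟨rfl, rfl, rfl⟩
    | ite_false he' _ => exact absurd he' he
  | ite_false he _ ih =>
    cases h₂ with
    | ite_true he' _ => exact absurd he he'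
    | ite_false _ h =>
      obtain ⟨rfl, rfl, rfl⟩ := ih h
      exact ⟨rfl, rfl, rfl⟩
  | while_true he _ _ ih ih' =>
    cases h₂ with
    | while_true _ h h' =>
      obtain ⟨rfl, rfl, rfl⟩ := ih h
      obtain ⟨rfl, rfl, rfl⟩ := ih' h'
      exact ⟨rfl, rfl, rfl⟩
    | while_false he' => exact absurd he' he
  | while_false he =>
    cases h₂ with
    | while_true he' _ _ => exact absurd he he'
    | while_false _ => exact ⟨rfl, rfl, rfl⟩

/-! ### Local algorithms -/

/-- An incidence-list representation of `G`: for each vertex, its neighbours in some order. -/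
structure IncidenceLists {n : ℕ} (G : SimpleGraph (Fin n)) where
  nbrs : Fin n → List (Fin n)
  nodup : ∀ v, (nbrs v).Nodup
  mem_iff : ∀ v u, u ∈ nbrs v ↔ G.Adj v u

/-- The oracle for an incidence-list representation: on `(a, i)` with `1 ≤ a ≤ n` and `1 ≤ i` it returns
(the identifier of) the `i`-th neighbour of the vertex with identifier `a`, and `0` if there is none. -/
def IncidenceLists.oracle {n : ℕ} {G : SimpleGraph (Fin n)} (L : IncidenceLists G) (a i : ℕ) : ℕ :=
  if h : 1 ≤ a ∧ a ≤ n ∧ 1 ≤ i then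
    match (L.nbrs ⟨a - 1, by omega⟩)[i - 1]? with
    | some u => u + 1
    | none => 0
  else 0

/-- A local algorithm: a program together with, for given `n` and `d`, the word size, the precomputed
numbers it receives, and the number and range of the words of its random seed. -/
structure LocalAlgorithm where
  prog : Prog
  wordSize : ℕ → ℕ → ℕ
  params : ℕ → ℕ → List ℕ
  seedLength : ℕ → ℕ → ℕ
  seedRange : ℕ → ℕ → ℕ

namespace LocalAlgorithm

/-- The seeds; a random seed is uniformly distributed over this type. -/
abbrev Seed (A : LocalAlgorithm) (n d : ℕ) : Type := Fin (A.seedLength n d) → Fin (A.seedRange n d)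

/-- The length of the seed in bits. -/
def seedBits (A : LocalAlgorithm) (n d : ℕ) : ℕ :=
  A.seedLength n d * Nat.clog 2 (A.seedRange n d)

/-- The probability of an event over the uniformly random seed. -/
noncomputable def prob (A : LocalAlgorithm) (n d : ℕ) (E : Set (A.Seed n d)) : ℝ :=
  (E.ncard : ℝ) / Nat.card (A.Seed n d)

/-- The initial configuration on the query `{u, v}`: the identifiers of `u` and `v` in registers 0 and 1,
the precomputed numbers in the next registers, the seed in the first cells of the memory,
and `0` everywhere else. -/
def init (A : LocalAlgorithm) (n d : ℕ) (ρ : A.Seed n d) (u v : Fin n) : State where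
  reg i := (((u + 1 : ℕ) :: (v + 1 : ℕ) :: A.params n d).getD i 0) % 2 ^ A.wordSize n d
  mem j := if h : j < A.seedLength n d then (ρ ⟨j, h⟩ : ℕ) % 2 ^ A.wordSize n d else 0

/-- With seed `ρ` and input given by `L`, the algorithm answers the query `{u, v}` by `1` (for YES) or
`0` (for NO), according to whether `yes` holds, in at most `t` steps and with at most `m` probes.
Every query starts from the same seed and an otherwise fresh memory. -/
def Answers (A : LocalAlgorithm) {n : ℕ} {G : SimpleGraph (Fin n)} (d : ℕ) (L : IncidenceLists G)
    (ρ : A.Seed n d) (u v : Fin n) (yes : Prop) (t m : ℝ) : Prop :=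
  ∃ (σ : State) (t' m' : ℕ),
    Exec (A.wordSize n d) L.oracle A.prog (A.init n d ρ u v) σ t' m' ∧
    (t' : ℝ) ≤ t ∧ (m' : ℝ) ≤ m ∧ (yes ∧ σ.reg 0 = 1 ∨ ¬ yes ∧ σ.reg 0 = 0)

/-- A candidate for the graphs to which an algorithm gives query access: a graph that is determined
by `n`, `d`, the input graph and the seed. -/
abbrev Output (A : LocalAlgorithm) : Type :=
  (n d : ℕ) → SimpleGraph (Fin n) → A.Seed n d → SimpleGraph (Fin n)

/-- `A` is an `(ε, q, δ)`-local sparse spanning graph algorithm for the family `C`, giving query access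
to `G'`, with running time `T` per query. Here `q`, `δ` and `T` are functions of `n` and `d`. -/
def IsLocalSSG (A : LocalAlgorithm) (G' : A.Output) (ε : ℝ) (q δ T : ℕ → ℕ → ℝ)
    (C : (n : ℕ) → SimpleGraph (Fin n) → Prop) : Prop :=
  ∀ n d : ℕ, 1 ≤ n → 1 ≤ d → ∀ G : SimpleGraph (Fin n), G.Connected →
    (∀ v, (G.neighborSet v).ncard ≤ d) → C n G →
      (∀ ρ, G' n d G ρ ≤ G ∧ (G' n d G ρ).Connected) ∧
      1 - δ n d ≤ A.prob n d {ρ | ((G' n d G ρ).edgeSet.ncard : ℝ) < (1 + ε) * n} ∧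
      ∀ (L : IncidenceLists G) (ρ : A.Seed n d) (u v : Fin n), G.Adj u v →
        A.Answers d L ρ u v ((G' n d G ρ).Adj u v) (T n d) (q n d)

end LocalAlgorithm

/-! ### The algorithm -/

/-- The sparse spanning graph algorithm with parameters `γ`, `k` (depending on `d`) and `s`, implemented
by the program `P` on words of `ω n d` bits: `t = 2 k d` seed words modulo a prime `q` with
`n < q ≤ 2 n`, and the bias `γ` of the centers rounded up to the multiple `⌈γ q⌉ / q` of `1 / q`. -/
noncomputable def algorithm (P : Prog) (γ : ℝ) (k : ℕ → ℕ) (s : ℕ) (ω : ℕ → ℕ → ℕ) :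
    LocalAlgorithm where
  prog := P
  wordSize := ω
  params n d := [n, d, k d, s, 2 * k d * d, primeAbove n, ⌈γ * primeAbove n⌉₊]
  seedLength _ d := 2 * k d * d
  seedRange n _ := primeAbove n

/-- The graph to which it has to give access. -/
noncomputable def output (P : Prog) (γ : ℝ) (k : ℕ → ℕ) (s : ℕ) (ω : ℕ → ℕ → ℕ) :
    (algorithm P γ k s ω).Output :=
  fun n d G ρ => sparseSpanningGraph G (centers n ⌈γ * primeAbove n⌉₊ ρ) (k d) s

end SSG

/-!
# A local algorithm for sparse spanning graphs of minor-free graphs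

**Sparsity.** Every part of the partition is connected, so that contracting the parts turns `G` into a minor
of `G`, and the edges of the sparse spanning graph are those of a spanning forest and at most one for each
edge of this minor. A graph on `m` vertices without a complete minor on `h` vertices has at most
`density h * m` edges, where `density h` is `O(h log h)` (`hasClique_of_density_mul_card_le`): Mader's
reduction leads to a small set of large inner minimum degree, in which logarithmically small connected
dominating sets can be removed one after the other; these are the branch sets (`hasClique_of_dense`).
Hence there are at most `n + density h * p` edges for `p` parts (`ncard_edgeSet_le`), and `p` is at most
the number of remote vertices, plus the number of centers, plus `n / s`, since only the part at the root of
a cell can have fewer than `s` vertices (`ncard_parts_mul_le`).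

**Connectivity and stretch.** Cells are closed under geodesics to their centers, so that breadth-first
search in a cell agrees with distances in `G` (`isBFSParent_cell_iff`), and the tree of a part is a subtree
of the tree of its cell (`isBFSParent_piece_iff`). A part has depth at most `2 * s`, and therefore the
endpoints of an edge of `G` are joined by a walk of length at most `8 * s + 1`
(`dist_sparseSpanningGraph_le`), for every set of centers.

**Concentration.** By Lagrange interpolation the centers are independent within every set of at most
`2 * k * d` vertices (`freq_disjoint_centers`), and `B_k(v)` has at most `k * d` vertices. The number of
centers and the number of remote vertices are both bounded by Chebyshev's inequality
(`freq_two_mul_le_ncard`). For the latter, the events that `u` and that `v` are remote are uncorrelated if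
`B_k(u)` and `B_k(v)` are disjoint, and `B_k(v)` meets at most `2 * d ^ 3 * k ^ (log k + 2)` of these balls
(`ncard_overlap_le`). The probability `exp (-γ * k)` of being remote outweighs this number if `γ * k` is a
large multiple of the square of a logarithm; this is how `ballParam` is chosen (`overlap_mul_exp_le`).

**The program.** It is written in a language with counted loops only, `FProg`, whose meaning and whose
bounds on running time and probes are computed by recursion on the program; `exec_compile` transfers them to
the word RAM. All explorations, of balls in `G` and of subtrees of cells, are instances of one breadth-first
search (`explore_spec`). On top of it, the program computes the center and the parent of a vertex
(`parent_spec`), the depth at which a subtree is cut (`cutDepth_spec`), the sub-center of a vertex, by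
descending from the center (`findSub_spec`), and the vertices of a part (`forPart_spec`). An edge inside a
part is kept if one endpoint is the parent of the other. For an edge between two parts, the vertices of one of them
are marked, and the edges from the other part to marked vertices are scanned for one of smaller rank
(`answer_spec`). The tables used are reset after each exploration, at a cost proportional to the exploration,
because the memory cannot be cleared otherwise within the time allowed.
-/

namespace SSG

/-! ### Clique minors in graphs with many edges -/

/-- `S` is nonempty and any two of its vertices are joined by a walk of `G` inside `S`. -/
def Conn {V : Type*} (G : SimpleGraph V) (S : Set V) : Prop :=
  S.Nonempty ∧ ∀ x ∈ S, ∀ y ∈ S, Relation.ReflTransGen (fun a b => G.Adj a b ∧ b ∈ S) x y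

/-- A model of the complete graph on `h` vertices as a minor of `G[U]`: disjoint connected subsets of `U`,
any two of which are joined by an edge. -/
def HasClique {V : Type*} (h : ℕ) (G : SimpleGraph V) (U : Set V) : Prop :=
  ∃ B : Fin h → Set V, (∀ i, B i ⊆ U ∧ Conn G (B i)) ∧
    ∀ i j, i ≠ j → Disjoint (B i) (B j) ∧ ∃ x ∈ B i, ∃ y ∈ B j, G.Adj x y

section Minors

variable {V W : Type*} {G : SimpleGraph V}

theorem Conn.singleton (x : V) : Conn G {x} :=
  ⟨⟨x, rfl⟩, by rintro _ rfl _ rfl; exact .refl⟩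

theorem reflTransGen_mono_set {S T : Set V} (h : S ⊆ T) {x y : V}
    (hxy : Relation.ReflTransGen (fun a b => G.Adj a b ∧ b ∈ S) x y) :
    Relation.ReflTransGen (fun a b => G.Adj a b ∧ b ∈ T) x y :=
  Relation.ReflTransGen.mono (r := fun a b => G.Adj a b ∧ b ∈ S)
    (fun _ _ hab => ⟨hab.1, h hab.2⟩) _ _ hxy

/-- Expanding the vertices of a connected set to connected sets, with an edge for each edge between them, gives
a connected set. -/
theorem Conn.biUnion {Q : SimpleGraph W} {φ : W → Set V} {B : Set W} (hB : Conn Q B)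
    (hφ : ∀ a ∈ B, Conn G (φ a))
    (hadj : ∀ a ∈ B, ∀ b ∈ B, Q.Adj a b → ∃ x ∈ φ a, ∃ y ∈ φ b, G.Adj x y) :
    Conn G (⋃ a ∈ B, φ a) := by
  obtain ⟨⟨a₀, ha₀⟩, hB⟩ := hB
  refine ⟨?_, ?_⟩
  · obtain ⟨x, hx⟩ := (hφ a₀ ha₀).1
    exact ⟨x, Set.mem_biUnion ha₀ hx⟩
  · intro x hx y hy
    simp only [Set.mem_iUnion, exists_prop] at hx hy
    obtain ⟨a, ha, hx⟩ := hx
    obtain ⟨b, hb, hy⟩ := hy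
    have key : ∀ c, Relation.ReflTransGen (fun a b => Q.Adj a b ∧ b ∈ B) a c → c ∈ B ∧ ∀ y ∈ φ c,
        Relation.ReflTransGen (fun u v => G.Adj u v ∧ v ∈ ⋃ a ∈ B, φ a) x y := by
      intro c hc
      induction hc with
      | refl =>
        exact ⟨ha, fun y hy => reflTransGen_mono_set (Set.subset_biUnion_of_mem (u := φ) ha)
          ((hφ a ha).2 x hx y hy)⟩
      | @tail c d _ hcd ih =>
        refine ⟨hcd.2, fun y hy => ?_⟩
        obtain ⟨u, hu, v, hv, huv⟩ := hadj c ih.1 d hcd.2 hcd.1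
        exact ((ih.2 u hu).tail ⟨huv, Set.mem_biUnion hcd.2 hv⟩).trans
          (reflTransGen_mono_set (Set.subset_biUnion_of_mem (u := φ) hcd.2)
          ((hφ d hcd.2).2 v hv y hy))
    exact (key b (hB a ha b hb)).2 y hy

/-- A clique minor of a graph obtained from `G` by contracting the disjoint connected sets `φ a` is one
of `G`. -/
theorem HasClique.lift {Q : SimpleGraph W} {U' : Set W} {U : Set V} {h : ℕ} (φ : W → Set V)
    (hφ : ∀ a ∈ U', φ a ⊆ U ∧ Conn G (φ a))
    (hdisj : ∀ a ∈ U', ∀ b ∈ U', a ≠ b → Disjoint (φ a) (φ b))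
    (hadj : ∀ a ∈ U', ∀ b ∈ U', Q.Adj a b → ∃ x ∈ φ a, ∃ y ∈ φ b, G.Adj x y)
    (hQ : HasClique h Q U') : HasClique h G U := by
  obtain ⟨B, hB, hBB⟩ := hQ
  refine ⟨fun i => ⋃ a ∈ B i, φ a, fun i => ⟨?_, ?_⟩, fun i j hij => ⟨?_, ?_⟩⟩
  · exact Set.iUnion₂_subset fun a ha => (hφ a ((hB i).1 ha)).1
  · exact (hB i).2.biUnion (fun a ha => (hφ a ((hB i).1 ha)).2)
      (fun a ha b hb => hadj a ((hB i).1 ha) b ((hB i).1 hb))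
  · simp only [Set.disjoint_iUnion_left, Set.disjoint_iUnion_right]
    intro b hb a ha
    refine hdisj _ ((hB i).1 (by assumption)) _ ((hB j).1 (by assumption)) ?_
    rintro rfl
    exact Set.disjoint_left.1 (hBB i j hij).1 (by assumption) (by assumption)
  · obtain ⟨a, ha, b, hb, hab⟩ := (hBB i j hij).2
    obtain ⟨x, hx, y, hy, hxy⟩ := hadj a ((hB i).1 ha) b ((hB j).1 hb) hab
    exact ⟨x, Set.mem_biUnion ha hx, y, Set.mem_biUnion hb hy, hxy⟩

theorem HasClique.mono {G' : SimpleGraph V} {U U' : Set V} {h : ℕ} (hG : G ≤ G') (hU : U ⊆ U')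
    (hc : HasClique h G U) : HasClique h G' U' :=
  hc.lift (fun a => {a}) (fun a ha => ⟨by simpa using hU ha, .singleton a⟩)
    (fun a _ b _ hab => by simpa using hab)
    (fun a _ b _ hab => ⟨a, rfl, b, rfl, hG hab⟩)

theorem Conn.induce_connected {S : Set V} (hS : Conn G S) : (G.induce S).Connected := by
  have : Nonempty S := hS.1.to_subtype
  refine ⟨fun x y => ?_⟩
  rw [SimpleGraph.reachable_iff_reflTransGen]
  have key : ∀ z, Relation.ReflTransGen (fun a b => G.Adj a b ∧ b ∈ S) x z → ∃ hz : z ∈ S,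
      Relation.ReflTransGen (G.induce S).Adj x ⟨z, hz⟩ := by
    intro z hz
    induction hz with
    | refl => exact ⟨x.2, .refl⟩
    | tail _ hcd ih =>
      obtain ⟨hc, ih⟩ := ih
      exact ⟨hcd.2, ih.tail (by simpa using hcd.1)⟩
  exact (key y (hS.2 x x.2 y y.2)).2

theorem conn_of_preconnected {S : Set V} (hne : S.Nonempty) (x₀ : V)
    (h : ∀ x ∈ S, Relation.ReflTransGen (fun a b => G.Adj a b ∧ b ∈ S) x₀ x) (hx₀ : x₀ ∈ S) :
    Conn G S := by
  refine ⟨hne, fun x hx y hy => ?_⟩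
  have key : ∀ z, Relation.ReflTransGen (fun a b => G.Adj a b ∧ b ∈ S) x₀ z → z ∈ S ∧
      Relation.ReflTransGen (fun a b => G.Adj a b ∧ b ∈ S) z x₀ := by
    intro z hz
    induction hz with
    | refl => exact ⟨hx₀, .refl⟩
    | tail _ hcd ih => exact ⟨hcd.2, .head ⟨hcd.1.symm, ih.1⟩ ih.2⟩
  exact (key x (h x hx)).2.trans (h y hy)

theorem Conn.union {S T : Set V} (hS : Conn G S) (hT : Conn G T) (h : (S ∩ T).Nonempty) :
    Conn G (S ∪ T) := by
  obtain ⟨z, hzS, hzT⟩ := h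
  refine conn_of_preconnected ⟨z, .inl hzS⟩ z ?_ (.inl hzS)
  rintro x (hx | hx)
  · exact reflTransGen_mono_set Set.subset_union_left (hS.2 z hzS x hx)
  · exact reflTransGen_mono_set Set.subset_union_right (hT.2 z hzT x hx)

/-- If `G` has a complete minor on `h` vertices then it has every graph on `h` vertices as a minor. -/
theorem HasClique.isMinor {V : Type} {G : SimpleGraph V} {h : ℕ} (hG : HasClique h G Set.univ)
    (H : SimpleGraph (Fin h)) : IsMinor H G := by
  classical
  obtain ⟨B, hB, hBB⟩ := hG
  have huniq : ∀ {i j x}, x ∈ B i → x ∈ B j → i = j := by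
    intro i j x hi hj
    by_contra hij
    exact Set.disjoint_left.1 (hBB i j hij).1 hi hj
  let S : G.Subgraph :=
    { verts := ⋃ i, B i
      Adj := fun x y => G.Adj x y ∧ ∃ i j, x ∈ B i ∧ y ∈ B j ∧ (i = j ∨ H.Adj i j)
      adj_sub := fun h => h.1
      edge_vert := by
        rintro x y ⟨-, i, j, hx, -⟩
        exact Set.mem_iUnion.2 ⟨i, hx⟩
      symm := ⟨by
        rintro x y ⟨hxy, i, j, hx, hy, h⟩
        exact ⟨hxy.symm, j, i, hy, hx, h.imp Eq.symm fun h => h.symm⟩⟩ }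
  have hS : ∀ x : S.verts, ∃ i, x.1 ∈ B i := fun x => Set.mem_iUnion.1 x.2
  choose f hf using hS
  have hfe : ∀ (x : S.verts) i, f x = i ↔ x.1 ∈ B i :=
    fun x i => ⟨fun h => h ▸ hf x, fun h => huniq (hf x) h⟩
  refine ⟨S, f, fun i => ?_, fun i j => ⟨fun hij => ⟨hij.ne, ?_⟩, ?_⟩⟩
  · refine Conn.induce_connected ?_
    obtain ⟨z, hz⟩ := (hB i).2.1
    have hzv : z ∈ S.verts := Set.mem_iUnion.2 ⟨i, hz⟩
    refine conn_of_preconnected ⟨⟨z, hzv⟩, (hfe _ _).2 hz⟩ ⟨z, hzv⟩ ?_ ((hfe _ _).2 hz)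
    intro x hx
    have key : ∀ y, Relation.ReflTransGen (fun a b => G.Adj a b ∧ b ∈ B i) z y →
        y ∈ B i ∧ ∀ hy : y ∈ S.verts,
        Relation.ReflTransGen (fun a b => S.coe.Adj a b ∧ b ∈ f ⁻¹' {i}) ⟨z, hzv⟩ ⟨y, hy⟩ := by
      intro y hy
      induction hy with
      | refl => exact ⟨hz, fun _ => .refl⟩
      | @tail c d _ hcd ih =>
        refine ⟨hcd.2, fun hd => ?_⟩
        have hc : c ∈ S.verts := Set.mem_iUnion.2 ⟨i, ih.1⟩
        exact (ih.2 hc).tail ⟨⟨hcd.1, i, i, ih.1, hcd.2, .inl rfl⟩, (hfe _ _).2 hcd.2⟩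
    exact (key x.1 ((hB i).2.2 z hz x.1 ((hfe _ _).1 hx))).2 x.2
  · obtain ⟨x, hx, y, hy, hxy⟩ := (hBB i j hij.ne).2
    exact ⟨⟨x, Set.mem_iUnion.2 ⟨i, hx⟩⟩, ⟨y, Set.mem_iUnion.2 ⟨j, hy⟩⟩,
      ⟨hxy, i, j, hx, hy, .inr hij⟩, (hfe _ _).2 hx, (hfe _ _).2 hy⟩
  · rintro ⟨hne, x, y, ⟨hxy, i', j', hx, hy, h⟩, hxi, hyj⟩
    obtain rfl := huniq hx ((hfe _ _).1 hxi)
    obtain rfl := huniq hy ((hfe _ _).1 hyj)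
    exact h.resolve_left hne

end Minors


section Density

open Classical in
/-- In a connected set whose inner minimum degree is at least a quarter of its size, any two vertices are
joined by a path with at most 12 vertices: on a longer geodesic, five vertices at pairwise distance at
least three would have disjoint neighbourhoods. -/
theorem exists_short_connection {V : Type*} [Fintype V] {G : SimpleGraph V} {S : Finset V} {δ : ℕ}
    (hS : Conn G (S : Set V)) (hδ : 1 ≤ δ) (hdeg : ∀ v ∈ S, δ ≤ (S.filter (G.Adj v)).card)
    (hcard : S.card ≤ 4 * δ) {a b : V} (ha : a ∈ S) (hb : b ∈ S) :
    ∃ P : Finset V, P ⊆ S ∧ a ∈ P ∧ b ∈ P ∧ Conn G (P : Set V) ∧ P.card ≤ 12 := by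
  set H := G.induce (S : Set V) with hH
  have hconn : H.Connected := hS.induce_connected
  obtain ⟨p, hp⟩ := hconn.exists_walk_length_eq_dist ⟨a, ha⟩ ⟨b, hb⟩
  have hdist : ∀ i ≤ p.length, H.dist ⟨a, ha⟩ (p.getVert i) = i := by
    intro i hi
    have h1 : H.dist ⟨a, ha⟩ (p.getVert i) ≤ i := by
      refine (SimpleGraph.dist_le (p.take i)).trans ?_
      simp [SimpleGraph.Walk.take_length]
    have h2 : H.dist (p.getVert i) ⟨b, hb⟩ ≤ p.length - i := by
      refine (SimpleGraph.dist_le (p.drop i)).trans ?_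
      simp [SimpleGraph.Walk.drop_length]
    have h3 := hconn.dist_triangle (u := ⟨a, ha⟩) (v := p.getVert i) (w := ⟨b, hb⟩)
    omega
  have hlen : p.length < 12 := by
    by_contra hlen
    push Not at hlen
    have hdisj : ∀ i ∈ Finset.range 5, ∀ j ∈ Finset.range 5, i ≠ j →
        Disjoint (S.filter (G.Adj (p.getVert (3 * i)).1)) (S.filter (G.Adj (p.getVert (3 * j)).1)) := by
      intro i hi j hj hij
      rw [Finset.disjoint_left]
      intro z hz hz'
      simp only [Finset.mem_filter, Finset.mem_range] at hz hz' hi hj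
      have e1 : H.Adj (p.getVert (3 * i)) ⟨z, hz.1⟩ := by simpa [hH] using hz.2
      have e2 : H.Adj (p.getVert (3 * j)) ⟨z, hz.1⟩ := by simpa [hH] using hz'.2
      have d1 := hdist (3 * i) (by omega)
      have d2 := hdist (3 * j) (by omega)
      have t1 := hconn.dist_triangle (u := ⟨a, ha⟩) (v := p.getVert (3 * i)) (w := ⟨z, hz.1⟩)
      have t2 := hconn.dist_triangle (u := ⟨a, ha⟩) (v := p.getVert (3 * j)) (w := ⟨z, hz.1⟩)
      have t3 := hconn.dist_triangle (u := ⟨a, ha⟩) (w := p.getVert (3 * i)) (v := ⟨z, hz.1⟩)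
      have t4 := hconn.dist_triangle (u := ⟨a, ha⟩) (w := p.getVert (3 * j)) (v := ⟨z, hz.1⟩)
      have l1 := SimpleGraph.dist_eq_one_iff_adj.2 e1
      have l2 := SimpleGraph.dist_eq_one_iff_adj.2 e2
      have l3 := SimpleGraph.dist_eq_one_iff_adj.2 e1.symm
      have l4 := SimpleGraph.dist_eq_one_iff_adj.2 e2.symm
      omega
    have h1 := Finset.card_biUnion hdisj
    have h2 : ((Finset.range 5).biUnion fun i => S.filter (G.Adj (p.getVert (3 * i)).1)).card
        ≤ S.card := Finset.card_le_card (by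
          intro z hz
          simp only [Finset.mem_biUnion, Finset.mem_filter] at hz
          obtain ⟨_, _, hz, _⟩ := hz
          exact hz)
    have h3 : ∑ _i ∈ Finset.range 5, δ ≤
        ∑ i ∈ Finset.range 5, (S.filter (G.Adj (p.getVert (3 * i)).1)).card :=
      Finset.sum_le_sum fun i _ => hdeg _ (p.getVert (3 * i)).2
    simp only [Finset.sum_const, Finset.card_range, smul_eq_mul] at h3
    omega
  refine ⟨(Finset.range (p.length + 1)).image fun i => (p.getVert i).1, ?_, ?_, ?_, ?_, ?_⟩
  · intro z hz
    simp only [Finset.mem_image] at hz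
    obtain ⟨i, -, rfl⟩ := hz
    exact (p.getVert i).2
  · exact Finset.mem_image.2 ⟨0, by simp, by simp⟩
  · exact Finset.mem_image.2 ⟨p.length, by simp, by simp⟩
  · have hmem : ∀ i ≤ p.length, (p.getVert i).1 ∈
        (((Finset.range (p.length + 1)).image fun i => (p.getVert i).1 : Finset V) : Set V) :=
      fun i hi => Finset.mem_coe.2 (Finset.mem_image.2 ⟨i, Finset.mem_range.2 (by omega), rfl⟩)
    refine conn_of_preconnected ⟨_, hmem 0 (by omega)⟩ (p.getVert 0).1 ?_ (hmem 0 (by omega))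
    intro x hx
    obtain ⟨i, hi, rfl⟩ := Finset.mem_image.1 (Finset.mem_coe.1 hx)
    simp only [Finset.mem_range] at hi
    clear hx
    induction i with
    | zero => exact .refl
    | succ i ih =>
      refine (ih (by omega)).tail ⟨?_, hmem (i + 1) (by omega)⟩
      have := p.adj_getVert_succ (i := i) (by omega)
      simpa [hH] using this
  · refine Finset.card_image_le.trans ?_
    rw [Finset.card_range]; omega

open Classical in
/-- Some vertex of `S` is adjacent to a quarter of the vertices in `U`, hence what it leaves undominated
is at most three quarters of `U`. -/
theorem exists_dominator {V : Type*} [Fintype V] {G : SimpleGraph V} {S U : Finset V} {δ : ℕ}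
    (hne : S.Nonempty) (hU : U ⊆ S) (hdeg : ∀ v ∈ S, δ ≤ (S.filter (G.Adj v)).card)
    (hcard : S.card ≤ 4 * δ) :
    ∃ x ∈ S, 4 * (U.filter fun u => ¬ G.Adj x u).card ≤ 3 * U.card := by
  by_contra hcon
  push Not at hcon
  have h1 : ∀ x ∈ S, 4 * (U.filter (G.Adj x)).card < U.card := by
    intro x hx
    have := Finset.card_filter_add_card_filter_not (s := U) (G.Adj x)
    have := hcon x hx
    omega
  have h2 : ∑ x ∈ S, (U.filter (G.Adj x)).card = ∑ u ∈ U, (S.filter (G.Adj u)).card := by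
    have := Finset.sum_card_bipartiteAbove_eq_sum_card_bipartiteBelow (s := S) (t := U) G.Adj
    simp only [Finset.bipartiteAbove, Finset.bipartiteBelow] at this
    rw [this]
    exact Finset.sum_congr rfl fun u _ => by congr 1; ext; simp [G.adj_comm]
  have h3 : ∑ x ∈ S, 4 * (U.filter (G.Adj x)).card < ∑ x ∈ S, U.card :=
    Finset.sum_lt_sum_of_nonempty hne h1
  have h4 : ∑ u ∈ U, δ ≤ ∑ u ∈ U, (S.filter (G.Adj u)).card :=
    Finset.sum_le_sum fun u hu => hdeg u (hU hu)
  rw [← Finset.mul_sum, h2] at h3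
  simp only [Finset.sum_const, smul_eq_mul] at h3 h4
  have h5 : S.card * U.card ≤ 4 * δ * U.card := Nat.mul_le_mul_right _ hcard
  nlinarith

open Classical in
/-- The greedy construction of a connected dominating set: after `r` rounds a connected set of at most
`12 * r + 1` vertices leaves at most a fraction `(3/4) ^ r` of `S` undominated. -/
theorem exists_connected_almost_dominating {V : Type*} [Fintype V] {G : SimpleGraph V}
    {S : Finset V} {δ : ℕ}
    (hS : Conn G (S : Set V)) (hδ : 1 ≤ δ) (hdeg : ∀ v ∈ S, δ ≤ (S.filter (G.Adj v)).card)
    (hcard : S.card ≤ 4 * δ) (r : ℕ) :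
    ∃ A : Finset V, A ⊆ S ∧ Conn G (A : Set V) ∧ A.card ≤ 12 * r + 1 ∧
      4 ^ r * (S.filter fun u => ∀ a ∈ A, ¬ G.Adj a u).card ≤ 3 ^ r * S.card := by
  induction r with
  | zero =>
    obtain ⟨x, hx⟩ := hS.1
    exact ⟨{x}, by simpa using hx, by simpa using Conn.singleton x, by simp,
      by simpa using Finset.card_filter_le _ _⟩
  | succ r ih =>
    obtain ⟨A, hAS, hA, hAc, hAu⟩ := ih
    obtain ⟨x, hx, hxu⟩ := exists_dominator (G := G) (U := S.filter fun u => ∀ a ∈ A, ¬ G.Adj a u)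
      (by simpa using hS.1) (Finset.filter_subset _ _) hdeg hcard
    obtain ⟨a, ha⟩ := hA.1
    obtain ⟨P, hPS, haP, hxP, hP, hPc⟩ := exists_short_connection hS hδ hdeg hcard (hAS ha) hx
    refine ⟨A ∪ P, Finset.union_subset hAS hPS, ?_, ?_, ?_⟩
    · rw [Finset.coe_union]
      exact hA.union hP ⟨a, ha, haP⟩
    · have := Finset.card_union_le A P
      omega
    · have hsub : (S.filter fun u => ∀ a ∈ A ∪ P, ¬ G.Adj a u) ⊆
          (S.filter fun u => ∀ a ∈ A, ¬ G.Adj a u).filter fun u => ¬ G.Adj x u := by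
        intro u hu
        simp only [Finset.mem_filter, Finset.mem_union] at hu ⊢
        exact ⟨⟨hu.1, fun a ha => hu.2 a (.inl ha)⟩, hu.2 x (.inr hxP)⟩
      have := Finset.card_le_card hsub
      rw [pow_succ, pow_succ]
      calc 4 ^ r * 4 * (S.filter fun u => ∀ a ∈ A ∪ P, ¬ G.Adj a u).card
          ≤ 4 ^ r * (3 * (S.filter fun u => ∀ a ∈ A, ¬ G.Adj a u).card) := by
            rw [mul_assoc]; exact Nat.mul_le_mul_left _ (by omega)
        _ ≤ 3 ^ r * 3 * S.card := by nlinarith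

open Classical in
/-- Once the undominated part of `S` has been shrunk to less than one vertex, by a factor in each round, the
connected set dominates `S`. -/
theorem exists_connected_dominating {V : Type*} [Fintype V] {G : SimpleGraph V}
    {S : Finset V} {δ L : ℕ}
    (hS : Conn G (S : Set V)) (hδ : 1 ≤ δ) (hdeg : ∀ v ∈ S, δ ≤ (S.filter (G.Adj v)).card)
    (hcard : S.card ≤ 4 * δ) (hL : S.card < 2 ^ L) :
    ∃ A : Finset V, A ⊆ S ∧ Conn G (A : Set V) ∧ A.card ≤ 36 * L + 1 ∧
      ∀ u ∈ S, ∃ a ∈ A, G.Adj a u := by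
  obtain ⟨A, hAS, hA, hAc, hAu⟩ := exists_connected_almost_dominating hS hδ hdeg hcard (3 * L)
  refine ⟨A, hAS, hA, by omega, fun u hu => ?_⟩
  by_contra hcon
  push Not at hcon
  have h1 : 1 ≤ (S.filter fun u => ∀ a ∈ A, ¬ G.Adj a u).card :=
    Finset.card_pos.2 ⟨u, Finset.mem_filter.2 ⟨hu, hcon⟩⟩
  have h2 : 4 ^ (3 * L) ≤ 3 ^ (3 * L) * S.card :=
    (Nat.le_mul_of_pos_right _ h1).trans hAu
  have h3 : 3 ^ (3 * L) * S.card < 3 ^ (3 * L) * 2 ^ L := by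
    apply Nat.mul_lt_mul_of_pos_left hL; positivity
  have h4 : 3 ^ (3 * L) * 2 ^ L ≤ 4 ^ (3 * L) := by
    rw [pow_mul, pow_mul, ← mul_pow]
    exact Nat.pow_le_pow_left (by norm_num) L
  omega

open Classical in
/-- A set of at most `m < 2 ^ L` vertices with inner minimum degree at least `m / 4 + h (36 L + 1)` contains
a complete minor on `h` vertices: split off connected dominating sets of components, one after
the other. -/
theorem hasClique_of_dense {V : Type*} [Fintype V] {G : SimpleGraph V} {m L : ℕ} (hL : m < 2 ^ L)
    (h : ℕ) : ∀ (S : Finset V) (δ : ℕ), S.Nonempty → S.card ≤ m → m + 4 * (h * (36 * L + 1)) ≤ 4 * δ →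
      (∀ v ∈ S, δ ≤ (S.filter (G.Adj v)).card) → HasClique h G (S : Set V) := by
  induction h with
  | zero => exact fun S δ _ _ _ _ => ⟨fun i => i.elim0, fun i => i.elim0, fun i => i.elim0⟩
  | succ h ih =>
    intro S δ hne hSm hδ hdeg
    obtain ⟨x, hx⟩ := hne
    -- the component of `x` in the graph induced by `S`
    set C : Finset V := S.filter fun y =>
      Relation.ReflTransGen (fun a b => G.Adj a b ∧ b ∈ (S : Set V)) x y with hC
    have hCS : C ⊆ S := Finset.filter_subset _ _
    have hxC : x ∈ C := Finset.mem_filter.2 ⟨hx, .refl⟩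
    have hCnbr : ∀ v ∈ C, ∀ u ∈ S, G.Adj v u → u ∈ C := by
      intro v hv u hu hvu
      exact Finset.mem_filter.2 ⟨hu, (Finset.mem_filter.1 hv).2.tail ⟨hvu, hu⟩⟩
    have hCconn : Conn G (C : Set V) := by
      refine conn_of_preconnected ⟨x, hxC⟩ x ?_ hxC
      have key : ∀ y, Relation.ReflTransGen (fun a b => G.Adj a b ∧ b ∈ (S : Set V)) x y →
          y ∈ C ∧ Relation.ReflTransGen (fun a b => G.Adj a b ∧ b ∈ (C : Set V)) x y := by
        intro y hy
        induction hy with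
        | refl => exact ⟨hxC, .refl⟩
        | @tail c d _ hcd ih =>
          have hd := hCnbr c ih.1 d hcd.2 hcd.1
          exact ⟨hd, ih.2.tail ⟨hcd.1, hd⟩⟩
      intro y hy
      exact (key y (Finset.mem_filter.1 (Finset.mem_coe.1 hy)).2).2
    have hCdeg : ∀ v ∈ C, δ ≤ (C.filter (G.Adj v)).card := by
      intro v hv
      refine (hdeg v (hCS hv)).trans (Finset.card_le_card ?_)
      intro u hu
      simp only [Finset.mem_filter] at hu
      exact Finset.mem_filter.2 ⟨hCnbr v hv u hu.1 hu.2, hu.2⟩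
    have hCm : C.card ≤ m := (Finset.card_le_card hCS).trans hSm
    have hexp : 4 * ((h + 1) * (36 * L + 1)) = 4 * (h * (36 * L + 1)) + 4 * (36 * L + 1) := by ring
    -- `A` is the first branch set; every vertex loses at most `36 * L + 1` neighbours with it.
    obtain ⟨A, hAC, hA, hAc, hAd⟩ := exists_connected_dominating (L := L) hCconn (by omega) hCdeg
      (by omega) (by omega)
    set T := C \ A with hT
    have hTC : T ⊆ C := Finset.sdiff_subset
    have hTne : T.Nonempty := by
      rw [← Finset.card_pos]
      have h1 := Finset.le_card_sdiff A C
      have h2 := (hCdeg x hxC).trans (Finset.card_filter_le _ _)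
      have h3 : (C.filter (G.Adj x)).card < C.card := by
        refine Finset.card_lt_card ⟨Finset.filter_subset _ _, fun hsub => ?_⟩
        exact G.irrefl (Finset.mem_filter.1 (hsub hxC)).2
      have h4 : 0 < C.card - A.card := by omega
      exact h4.trans_le h1
    obtain ⟨B, hB, hBB⟩ := ih T (δ - (36 * L + 1)) hTne ((Finset.card_le_card hTC).trans hCm)
      (by omega) (by
        intro v hv
        have h1 : (C.filter (G.Adj v)) \ A ⊆ T.filter (G.Adj v) := by
          intro u hu
          simp only [Finset.mem_filter, Finset.mem_sdiff, hT] at hu ⊢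
          tauto
        have h2 := Finset.card_le_card h1
        have h3 := Finset.le_card_sdiff A (C.filter (G.Adj v))
        have h4 := hCdeg v (hTC hv)
        omega)
    have hAB : ∀ i, Disjoint (A : Set V) (B i) := by
      intro i
      rw [Set.disjoint_left]
      intro z hz hz'
      have := (hB i).1 hz'
      simp only [hT, Finset.coe_sdiff, Set.mem_sdiff, Finset.mem_coe] at this
      exact this.2 hz
    have hABe : ∀ i, ∃ x ∈ (A : Set V), ∃ y ∈ B i, G.Adj x y := by
      intro i
      obtain ⟨y, hy⟩ := (hB i).2.1
      obtain ⟨a, ha, hay⟩ := hAd y (hTC ((hB i).1 hy))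
      exact ⟨a, ha, y, hy, hay⟩
    refine ⟨Fin.cons (A : Set V) B, ?_, ?_⟩
    · intro i
      refine Fin.cases ?_ (fun i => ?_) i
      · exact ⟨by simpa using (hAC.trans hCS), by simpa using hA⟩
      · refine ⟨?_, by simpa using (hB i).2⟩
        simp only [Fin.cons_succ]
        exact (hB i).1.trans (by exact_mod_cast hTC.trans hCS)
    · intro i j
      refine Fin.cases ?_ (fun i => ?_) i <;> refine Fin.cases ?_ (fun j => ?_) j
      · simp
      · intro _
        simpa using ⟨hAB j, hABe j⟩
      · intro _
        simp only [Fin.cons_succ, Fin.cons_zero]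
        obtain ⟨x, hx, y, hy, hxy⟩ := hABe i
        exact ⟨(hAB i).symm, y, hy, x, hx, hxy.symm⟩
      · intro hij
        simpa using hBB i j (by simpa using hij)

end Density

section Mader
open Classical

/-- Twice the number of edges, as the number of ordered pairs of adjacent vertices. -/
noncomputable def adjPairs {V : Type*} [Fintype V] (G : SimpleGraph V) : ℕ :=
  (Finset.univ.filter fun p : V × V => G.Adj p.1 p.2).card

/-- `G` with all edges at `v` removed. -/
def isolate {V : Type*} (G : SimpleGraph V) (v : V) : SimpleGraph V where
  Adj a b := G.Adj a b ∧ a ≠ v ∧ b ≠ v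
  symm := ⟨fun _ _ h => ⟨h.1.symm, h.2.2, h.2.1⟩⟩
  loopless := ⟨fun _ h => h.1.ne rfl⟩

/-- The graph obtained by contracting the edge `{x, y}` to `x`; the vertex `y` becomes isolated. -/
def contractEdge {V : Type*} (G : SimpleGraph V) (x y : V) : SimpleGraph V where
  Adj a b := a ≠ b ∧ a ≠ y ∧ b ≠ y ∧ (G.Adj a b ∨ (a = x ∧ G.Adj y b) ∨ (b = x ∧ G.Adj y a))
  symm := ⟨fun _ _ h => ⟨h.1.symm, h.2.2.1, h.2.1, by
    rcases h.2.2.2 with h | h | h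
    exacts [.inl h.symm, .inr (.inr h), .inr (.inl h)]⟩⟩
  loopless := ⟨fun _ h => h.1 rfl⟩

theorem isolate_adj {V : Type*} {G : SimpleGraph V} {v a b : V} :
    (isolate G v).Adj a b ↔ G.Adj a b ∧ a ≠ v ∧ b ≠ v := Iff.rfl

theorem contractEdge_adj {V : Type*} {G : SimpleGraph V} {x y a b : V} :
    (contractEdge G x y).Adj a b ↔ a ≠ b ∧ a ≠ y ∧ b ≠ y ∧
      (G.Adj a b ∨ (a = x ∧ G.Adj y b) ∨ (b = x ∧ G.Adj y a)) := Iff.rfl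

variable {V : Type*} [Fintype V] {G : SimpleGraph V}

theorem adjPairs_le_isolate (G : SimpleGraph V) (v : V) :
    adjPairs G ≤ adjPairs (isolate G v) + 2 * (Finset.univ.filter (G.Adj v)).card := by
  have hsub : (Finset.univ.filter fun p : V × V => G.Adj p.1 p.2) ⊆
      ((Finset.univ.filter fun p : V × V => (isolate G v).Adj p.1 p.2) ∪
        ({v} ×ˢ Finset.univ.filter (G.Adj v))) ∪ (Finset.univ.filter (G.Adj v) ×ˢ {v}) := by
    rintro ⟨a, b⟩ hab
    simp only [Finset.mem_filter, Finset.mem_univ, true_and] at hab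
    simp only [Finset.mem_union, Finset.mem_filter, Finset.mem_univ, true_and, Finset.mem_product,
      Finset.mem_singleton, isolate_adj]
    by_cases ha : a = v
    · subst ha; tauto
    · by_cases hb : b = v
      · subst hb; exact .inr ⟨hab.symm, rfl⟩
      · tauto
  have h1 := Finset.card_le_card hsub
  have h2 := Finset.card_union_le ((Finset.univ.filter fun p : V × V => (isolate G v).Adj p.1 p.2) ∪
        ({v} ×ˢ Finset.univ.filter (G.Adj v))) (Finset.univ.filter (G.Adj v) ×ˢ {v})
  have h3 := Finset.card_union_le (Finset.univ.filter fun p : V × V => (isolate G v).Adj p.1 p.2)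
        ({v} ×ˢ Finset.univ.filter (G.Adj v))
  simp only [Finset.card_product, Finset.card_singleton] at h2 h3
  unfold adjPairs
  omega

/-- Contracting `x y` into `x` loses the edges at `y`, but gains one at `x` for each neighbour of `y` that is not
one of `x`. -/
theorem isolate_add_le_contractEdge {x y : V} (hxy : G.Adj x y) :
    adjPairs (isolate G y) +
      2 * ((Finset.univ.filter (G.Adj y)).filter fun b => ¬ G.Adj x b ∧ b ≠ x).card ≤
      adjPairs (contractEdge G x y) := by
  set N := (Finset.univ.filter (G.Adj y)).filter fun b => ¬ G.Adj x b ∧ b ≠ x with hN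
  have hNmem : ∀ b, b ∈ N ↔ G.Adj y b ∧ ¬ G.Adj x b ∧ b ≠ x := by simp [hN]
  have hd1 : Disjoint (Finset.univ.filter fun p : V × V => (isolate G y).Adj p.1 p.2)
      ({x} ×ˢ N) := by
    rw [Finset.disjoint_left]
    rintro ⟨a, b⟩ hab hab'
    simp only [Finset.mem_filter, Finset.mem_univ, true_and, Finset.mem_product,
      Finset.mem_singleton, isolate_adj, hNmem] at hab hab'
    exact hab'.2.2.1 (hab'.1 ▸ hab.1)
  have hd2 : Disjoint ((Finset.univ.filter fun p : V × V => (isolate G y).Adj p.1 p.2) ∪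
      ({x} ×ˢ N)) (N ×ˢ {x}) := by
    rw [Finset.disjoint_left]
    rintro ⟨a, b⟩ hab hab'
    simp only [Finset.mem_filter, Finset.mem_univ, true_and, Finset.mem_product, Finset.mem_union,
      Finset.mem_singleton, isolate_adj, hNmem] at hab hab'
    obtain ⟨ha, rfl⟩ := hab'
    rcases hab with hab | hab
    · exact ha.2.1 hab.1.symm
    · exact ha.2.2 hab.1
  have hsub : ((Finset.univ.filter fun p : V × V => (isolate G y).Adj p.1 p.2) ∪
      ({x} ×ˢ N)) ∪ (N ×ˢ {x}) ⊆
      (Finset.univ.filter fun p : V × V => (contractEdge G x y).Adj p.1 p.2) := by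
    rintro ⟨a, b⟩ hab
    simp only [Finset.mem_filter, Finset.mem_univ, true_and, Finset.mem_product, Finset.mem_union,
      Finset.mem_singleton, isolate_adj, hNmem] at hab
    simp only [Finset.mem_filter, Finset.mem_univ, true_and, contractEdge_adj]
    rcases hab with (hab | ⟨rfl, hab⟩) | ⟨hab, rfl⟩
    · exact ⟨hab.1.ne, hab.2.1, hab.2.2, .inl hab.1⟩
    · exact ⟨hab.2.2.symm, hxy.ne, hab.1.ne', .inr (.inl ⟨rfl, hab.1⟩)⟩
    · exact ⟨hab.2.2, hab.1.ne', hxy.ne, .inr (.inr ⟨rfl, hab.1⟩)⟩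
  have h1 := Finset.card_le_card hsub
  rw [Finset.card_union_of_disjoint hd2, Finset.card_union_of_disjoint hd1] at h1
  simp only [Finset.card_product, Finset.card_singleton] at h1
  unfold adjPairs
  omega

theorem adjPairs_eq_sum (G : SimpleGraph V) {U : Finset V} (hU : ∀ a b, G.Adj a b → a ∈ U) :
    adjPairs G = ∑ v ∈ U, (Finset.univ.filter (G.Adj v)).card := by
  have hsub : (Finset.univ.filter fun p : V × V => G.Adj p.1 p.2) =
      U.biUnion fun v => ({v} ×ˢ Finset.univ.filter (G.Adj v)) := by
    ext ⟨a, b⟩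
    simp only [Finset.mem_filter, Finset.mem_univ, true_and, Finset.mem_biUnion,
      Finset.mem_product, Finset.mem_singleton]
    exact ⟨fun h => ⟨a, hU a b h, rfl, h⟩, by rintro ⟨_, _, rfl, h⟩; exact h⟩
  unfold adjPairs
  rw [hsub, Finset.card_biUnion]
  · simp
  · intro v _ v' _ hv
    refine Finset.disjoint_left.2 ?_
    rintro ⟨a, b⟩ h1 h2
    simp only [Finset.mem_product, Finset.mem_singleton] at h1 h2
    exact hv (h1.1.symm.trans h2.1)

/-- Mader's reduction: among the minors with average degree at least `2 * D`, a minimal one has a vertex of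
degree at most `2 * D` whose neighbourhood has inner minimum degree at least `D`. -/
theorem hasClique_of_reduction {h D : ℕ} (hD : 1 ≤ D)
    (hdense : ∀ (G : SimpleGraph V) (S : Finset V), S.Nonempty → S.card ≤ 2 * D →
      (∀ v ∈ S, D ≤ (S.filter (G.Adj v)).card) → HasClique h G (S : Set V)) (N : ℕ) :
    ∀ (U : Finset V) (G : SimpleGraph V), (∀ a b, G.Adj a b → a ∈ U) → U.card + adjPairs G ≤ N →
      U.Nonempty → 2 * D * U.card ≤ adjPairs G → HasClique h G (U : Set V) := by
  induction N with
  | zero =>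
    intro U G _ hN hU
    have := Finset.card_pos.2 hU
    omega
  | succ N ih =>
    intro U G hG hN hU hP
    have hUpos := Finset.card_pos.2 hU
    have hPpos : 2 ≤ adjPairs G := le_trans (by nlinarith) hP
    obtain ⟨⟨x₀, y₀⟩, hxy₀⟩ : (Finset.univ.filter fun p : V × V => G.Adj p.1 p.2).Nonempty := by
      rw [← Finset.card_pos]; unfold adjPairs at hPpos; omega
    simp only [Finset.mem_filter, Finset.mem_univ, true_and] at hxy₀
    have hsum := adjPairs_eq_sum G hG
    -- removing a superfluous edge
    by_cases hcase : 2 * D * U.card + 2 ≤ adjPairs G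
    · set G' := G.deleteEdges {s(x₀, y₀)} with hG'
      have hle : G' ≤ G := G.deleteEdges_le _
      have hsub : (Finset.univ.filter fun p : V × V => G.Adj p.1 p.2) ⊆
          (Finset.univ.filter fun p : V × V => G'.Adj p.1 p.2) ∪ {(x₀, y₀), (y₀, x₀)} := by
        rintro ⟨a, b⟩ hab
        simp only [Finset.mem_filter, Finset.mem_univ, true_and] at hab
        simp only [Finset.mem_filter, Finset.mem_univ, true_and, Finset.mem_union, hG',
          SimpleGraph.deleteEdges_adj, Set.mem_singleton_iff, Finset.mem_insert,
          Finset.mem_singleton, Prod.mk.injEq, Sym2.eq_iff, hab]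
        tauto
      have h1 := Finset.card_le_card hsub
      have h2 := Finset.card_union_le (Finset.univ.filter fun p : V × V => G'.Adj p.1 p.2)
        {(x₀, y₀), (y₀, x₀)}
      have h3 : ({(x₀, y₀), (y₀, x₀)} : Finset (V × V)).card ≤ 2 := Finset.card_le_two
      have h4 : adjPairs G' < adjPairs G := by
        refine Finset.card_lt_card ⟨fun p hp => ?_, fun hs => ?_⟩
        · simp only [Finset.mem_filter, Finset.mem_univ, true_and] at hp ⊢
          exact hle hp
        · have := hs (Finset.mem_filter.2 ⟨Finset.mem_univ (x₀, y₀), hxy₀⟩)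
          simp [hG'] at this
      refine (ih U G' (fun a b hab => hG a b (hle hab)) (by omega) hU ?_).mono hle subset_rfl
      have h5 : adjPairs G ≤ adjPairs G' + 2 := by
        refine h1.trans (h2.trans (add_le_add (le_of_eq ?_) h3))
        unfold adjPairs
        congr!
      omega
    -- removing a vertex of small degree
    by_cases hdeg : ∃ v ∈ U, (Finset.univ.filter (G.Adj v)).card ≤ D
    · obtain ⟨v, hv, hvD⟩ := hdeg
      have hle : isolate G v ≤ G := fun a b hab => hab.1
      have h1 := adjPairs_le_isolate G v
      have h2 := Finset.card_erase_of_mem hv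
      have h3 : adjPairs (isolate G v) ≤ adjPairs G := by
        refine Finset.card_le_card fun p hp => ?_
        simp only [Finset.mem_filter, Finset.mem_univ, true_and] at hp ⊢
        exact hle hp
      have hne : (U.erase v).Nonempty := by
        rw [Finset.nonempty_iff_ne_empty]
        intro he
        have hx := hG _ _ hxy₀
        have hy := hG _ _ hxy₀.symm
        rcases (Finset.erase_eq_empty_iff U v).1 he with h | h
        · simp [h] at hx
        · rw [h, Finset.mem_singleton] at hx hy
          exact hxy₀.ne (hx.trans hy.symm)
      refine (ih (U.erase v) (isolate G v) (fun a b hab =>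
        Finset.mem_erase.2 ⟨hab.2.1, hG a b hab.1⟩) (by omega) hne ?_).mono hle
        (by exact_mod_cast Finset.erase_subset v U)
      rw [h2, Nat.mul_sub, mul_one]
      omega
    push Not at hdeg
    -- contracting an edge in few triangles
    by_cases hcon : ∃ x y, G.Adj x y ∧
        (Finset.univ.filter fun z => G.Adj x z ∧ G.Adj y z).card < D
    · obtain ⟨x, y, hxy, hc⟩ := hcon
      have hy : y ∈ U := hG _ _ hxy.symm
      have hx : x ∈ U := hG _ _ hxy
      have h1 := adjPairs_le_isolate G y
      have h2 := Finset.card_erase_of_mem hy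
      have h3 := isolate_add_le_contractEdge hxy
      have h4 : (Finset.univ.filter (G.Adj y)).card ≤
          ((Finset.univ.filter (G.Adj y)).filter fun b => ¬ G.Adj x b ∧ b ≠ x).card +
          ((Finset.univ.filter fun z => G.Adj x z ∧ G.Adj y z).card + 1) := by
        have hsub : (Finset.univ.filter (G.Adj y)) ⊆
            ((Finset.univ.filter (G.Adj y)).filter fun b => ¬ G.Adj x b ∧ b ≠ x) ∪
            ((Finset.univ.filter fun z => G.Adj x z ∧ G.Adj y z) ∪ {x}) := by
          intro z hz
          simp only [Finset.mem_filter, Finset.mem_univ, true_and, Finset.mem_union,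
            Finset.mem_singleton] at hz ⊢
          tauto
        refine (Finset.card_le_card hsub).trans ((Finset.card_union_le _ _).trans ?_)
        refine Nat.add_le_add_left ((Finset.card_union_le _ _).trans ?_) _
        simp
      have h5 : adjPairs (contractEdge G x y) ≤ adjPairs G := by
        have hsub : (Finset.univ.filter fun p : V × V => (contractEdge G x y).Adj p.1 p.2) ⊆
            (Finset.univ.filter fun p : V × V => G.Adj p.1 p.2).image
              fun p => (if p.1 = y then x else p.1, if p.2 = y then x else p.2) := by
          rintro ⟨a, b⟩ hab
          simp only [Finset.mem_filter, Finset.mem_univ, true_and, contractEdge_adj] at hab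
          simp only [Finset.mem_image, Finset.mem_filter, Finset.mem_univ, true_and, Prod.exists,
            Prod.mk.injEq]
          obtain ⟨hne, ha, hb, h | ⟨rfl, h⟩ | ⟨rfl, h⟩⟩ := hab
          · exact ⟨a, b, h, by simp [ha], by simp [hb]⟩
          · exact ⟨y, b, h, by simp, by simp [hb]⟩
          · exact ⟨a, y, h.symm, by simp [ha], by simp⟩
        exact (Finset.card_le_card hsub).trans Finset.card_image_le
      have hclique := ih (U.erase y) (contractEdge G x y) (fun a b hab => by
          refine Finset.mem_erase.2 ⟨hab.2.1, ?_⟩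
          rcases hab.2.2.2 with h | h | h
          · exact hG _ _ h
          · exact h.1 ▸ hx
          · exact hG _ _ h.2.symm) (by omega) ⟨x, Finset.mem_erase.2 ⟨hxy.ne, hx⟩⟩ (by
          rw [h2, Nat.mul_sub, mul_one]
          omega)
      refine hclique.lift (fun a => if a = x then {x, y} else {a}) ?_ ?_ ?_
      · intro a ha
        simp only [Finset.coe_erase, Set.mem_sdiff, Finset.mem_coe, Set.mem_singleton_iff] at ha
        by_cases hax : a = x
        · subst hax
          simp only [if_true]
          refine ⟨by rintro z (rfl | rfl) <;> assumption, ?_⟩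
          refine conn_of_preconnected ⟨a, by simp⟩ a ?_ (by simp)
          rintro z (rfl | rfl)
          · exact .refl
          · exact .single ⟨hxy, by simp⟩
        · simp only [hax, if_false]
          exact ⟨by simpa using ha.1, .singleton a⟩
      · intro a ha b hb hab
        simp only [Finset.coe_erase, Set.mem_sdiff, Finset.mem_coe, Set.mem_singleton_iff] at ha hb
        rw [Set.disjoint_left]
        intro z hz hz'
        split_ifs at hz hz' with h1 h2 h2
        · exact hab (h1.trans h2.symm)
        · simp only [Set.mem_singleton_iff, Set.mem_insert_iff] at hz hz'
          subst hz'; tauto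
        · simp only [Set.mem_singleton_iff, Set.mem_insert_iff] at hz hz'
          subst hz; tauto
        · simp only [Set.mem_singleton_iff] at hz hz'
          exact hab (hz.symm.trans hz')
      · intro a ha b hb hab
        have hmem : ∀ c, c ∈ (if c = x then {x, y} else {c} : Set V) := by
          intro c; split_ifs with hc <;> simp [hc]
        rcases hab.2.2.2 with h | ⟨rfl, h⟩ | ⟨rfl, h⟩
        · exact ⟨a, hmem a, b, hmem b, h⟩
        · exact ⟨y, by simp, b, hmem b, h⟩
        · exact ⟨a, hmem a, y, by simp, h.symm⟩
    push Not at hcon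
    -- in a minimal graph, a vertex of degree at most `2 * D` has a dense neighbourhood
    obtain ⟨x, hx, hx2⟩ : ∃ x ∈ U, (Finset.univ.filter (G.Adj x)).card ≤ 2 * D := by
      by_contra hno
      push Not at hno
      have h1 : ∑ v ∈ U, (2 * D + 1) ≤ ∑ v ∈ U, (Finset.univ.filter (G.Adj v)).card :=
        Finset.sum_le_sum fun v hv => hno v hv
      rw [← hsum, Finset.sum_const, smul_eq_mul] at h1
      have h2 : 2 ≤ U.card := by
        have := Finset.card_le_card (s := {x₀, y₀}) (t := U) (by
          intro z hz
          simp only [Finset.mem_insert, Finset.mem_singleton] at hz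
          rcases hz with rfl | rfl
          exacts [hG _ _ hxy₀, hG _ _ hxy₀.symm])
        rwa [Finset.card_pair hxy₀.ne] at this
      nlinarith
    refine (hdense G (Finset.univ.filter (G.Adj x)) ?_ hx2 ?_).mono le_rfl ?_
    · rw [← Finset.card_pos]
      have := hdeg x hx
      omega
    · intro v hv
      simp only [Finset.mem_filter, Finset.mem_univ, true_and] at hv
      refine (hcon x v hv).trans (Finset.card_le_card ?_)
      intro z hz
      simpa using hz
    · intro z hz
      simp only [Finset.mem_coe, Finset.mem_filter, Finset.mem_univ, true_and] at hz
      exact hG _ _ hz.symm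

/-- A number of edges per vertex that forces a complete minor on `h` vertices. -/
def density (h : ℕ) : ℕ := 1024 * h * (Nat.log 2 h + 1)

/-- Mader's reduction leads to a neighbourhood of linear minimum degree, in which `hasClique_of_dense`
finds the branch sets. -/
theorem hasClique_of_density_mul_card_le {h : ℕ} (hh : 1 ≤ h) [Nonempty V] (G : SimpleGraph V)
    (hG : 2 * density h * Fintype.card V ≤ adjPairs G) : HasClique h G Set.univ := by
  set l := Nat.log 2 h + 1 with hl
  have hD : 1 ≤ density h := Nat.mul_pos (by omega) (by omega)
  have hhl : h < 2 ^ l := Nat.lt_pow_succ_log_self (by norm_num) h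
  have hll : l < 2 ^ l := Nat.lt_two_pow_self
  have := hasClique_of_reduction (V := V) (h := h) hD (fun G S hne hS hdeg => by
    refine hasClique_of_dense (m := 2 * density h) (L := 2 * l + 11) ?_ h S (density h) hne hS ?_ hdeg
    · have h1 : h * l < 2 ^ l * 2 ^ l := Nat.mul_lt_mul'' hhl hll
      have h2 : 2 ^ (2 * l + 11) = 2048 * (2 ^ l * 2 ^ l) := by rw [← pow_add]; ring_nf
      rw [h2]; unfold density; rw [← hl]
      nlinarith
    · unfold density; rw [← hl]
      have h1 : h ≤ h * l := Nat.le_mul_of_pos_right _ (by omega)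
      nlinarith) _ Finset.univ G (fun _ _ _ => Finset.mem_univ _) le_rfl Finset.univ_nonempty
      (by simpa using hG)
  simpa using this

end Mader

/-! ### The recursive decomposition of a rooted tree -/

/-- The parent relation `T` is a forest whose vertices have the levels `lev`. -/
structure IsForest {n : ℕ} (T : Fin n → Fin n → Prop) (lev : Fin n → ℕ) : Prop where
  lev_eq : ∀ {p x}, T p x → lev x = lev p + 1
  uniq : ∀ {p p' x}, T p x → T p' x → p = p'

namespace IsForest

variable {n : ℕ} {T : Fin n → Fin n → Prop} {lev : Fin n → ℕ}

theorem lev_of_mem_treeLevel (hT : IsForest T lev) {v x : Fin n} {j : ℕ} (hx : x ∈ treeLevel T v j) :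
    lev x = lev v + j := by
  induction j generalizing x with
  | zero => obtain rfl : x = v := hx; rfl
  | succ j ih =>
    obtain ⟨p, hp, hpx⟩ := hx
    rw [hT.lev_eq hpx, ih hp]; rfl

theorem _root_.SSG.mem_treeLevel_add {v x : Fin n} {i j : ℕ} :
    x ∈ treeLevel T v (i + j) ↔ ∃ u ∈ treeLevel T v i, x ∈ treeLevel T u j := by
  induction j generalizing x with
  | zero => simp [treeLevel]
  | succ j ih =>
    rw [← add_assoc]
    constructor
    · rintro ⟨p, hp, hpx⟩
      obtain ⟨u, hu, hp⟩ := ih.1 hp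
      exact ⟨u, hu, p, hp, hpx⟩
    · rintro ⟨u, hu, p, hp, hpx⟩
      exact ⟨p, ih.2 ⟨u, hu, hp⟩, hpx⟩

theorem ancestor_unique (hT : IsForest T lev) {v v' x : Fin n} {j : ℕ} (hx : x ∈ treeLevel T v j)
    (hx' : x ∈ treeLevel T v' j) : v = v' := by
  induction j generalizing x with
  | zero => exact (show x = v from hx).symm.trans hx'
  | succ j ih =>
    obtain ⟨p, hp, hpx⟩ := hx
    obtain ⟨p', hp', hpx'⟩ := hx'
    obtain rfl := hT.uniq hpx hpx'
    exact ih hp hp'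

theorem ancestor_comparable (hT : IsForest T lev) {v v' x : Fin n} {i j : ℕ} (hx : x ∈ treeLevel T v i)
    (hx' : x ∈ treeLevel T v' j) (hij : i ≤ j) : v ∈ treeLevel T v' (j - i) := by
  rw [← Nat.sub_add_cancel hij, mem_treeLevel_add] at hx'
  obtain ⟨u, hu, hxu⟩ := hx'
  rwa [hT.ancestor_unique hx hxu]

theorem _root_.SSG.self_mem_subtree (v : Fin n) : v ∈ subtree T v := ⟨0, rfl⟩

theorem _root_.SSG.subtree_subset {u v : Fin n} (hu : u ∈ subtree T v) :
    subtree T u ⊆ subtree T v := by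
  rintro x ⟨j, hx⟩
  obtain ⟨i, hu⟩ := hu
  exact ⟨i + j, mem_treeLevel_add.2 ⟨u, hu, hx⟩⟩

theorem mem_treeLevel_of_mem_subtree (hT : IsForest T lev) {v x : Fin n} (hx : x ∈ subtree T v) :
    x ∈ treeLevel T v (lev x - lev v) := by
  obtain ⟨j, hx⟩ := hx
  have := hT.lev_of_mem_treeLevel hx
  rwa [this, Nat.add_sub_cancel_left]

theorem lev_le_of_mem_subtree (hT : IsForest T lev) {v x : Fin n} (hx : x ∈ subtree T v) : lev v ≤ lev x := by
  obtain ⟨j, hx⟩ := hx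
  have := hT.lev_of_mem_treeLevel hx
  omega

theorem eq_of_mem_subtree_of_lev_le (hT : IsForest T lev) {v x : Fin n} (hx : x ∈ subtree T v) (h : lev x ≤ lev v) :
    x = v := by
  have h1 := hT.mem_treeLevel_of_mem_subtree hx
  rw [Nat.sub_eq_zero_of_le h] at h1
  exact h1

theorem subtree_comparable (hT : IsForest T lev) {v v' x : Fin n} (hx : x ∈ subtree T v) (hx' : x ∈ subtree T v')
    (h : lev v' ≤ lev v) : v ∈ subtree T v' := by
  obtain ⟨i, hx⟩ := hx
  obtain ⟨j, hx'⟩ := hx'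
  have h1 := hT.lev_of_mem_treeLevel hx
  have h2 := hT.lev_of_mem_treeLevel hx'
  exact ⟨_, hT.ancestor_comparable hx hx' (by omega)⟩

theorem mem_treeBall_iff (hT : IsForest T lev) {v x : Fin n} {l : ℕ} :
    x ∈ treeBall T v l ↔ x ∈ subtree T v ∧ lev x ≤ lev v + l := by
  constructor
  · rintro ⟨j, hj, hx⟩
    have := hT.lev_of_mem_treeLevel hx
    exact ⟨⟨j, hx⟩, by omega⟩
  · rintro ⟨⟨j, hx⟩, hl⟩
    have := hT.lev_of_mem_treeLevel hx
    exact ⟨j, by omega, hx⟩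

theorem treeDepth_spec (hT : IsForest T lev) (s : ℕ) (v : Fin n) :
    s ≤ (treeBall T v (treeDepth T s v)).ncard ∨ treeBall T v (treeDepth T s v) = subtree T v := by
  have hne : {l | s ≤ (treeBall T v l).ncard ∨ treeBall T v l = subtree T v}.Nonempty := by
    refine ⟨Finset.univ.sup lev, .inr ?_⟩
    ext x
    rw [hT.mem_treeBall_iff]
    have : lev x ≤ Finset.univ.sup lev := Finset.le_sup (Finset.mem_univ x)
    exact ⟨fun h => h.1, fun h => ⟨h, by omega⟩⟩
  exact Nat.sInf_mem hne

theorem _root_.SSG.of_lt_treeDepth {s l : ℕ} {v : Fin n} (hl : l < treeDepth T s v) :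
    (treeBall T v l).ncard < s ∧ treeBall T v l ≠ subtree T v := by
  have := Nat.notMem_of_lt_sInf hl
  simp only [Set.mem_ofPred_eq, not_or, not_le] at this
  exact this

/-- A set of vertices that meets `m` different levels has at least `m` elements. -/
theorem _root_.SSG.le_ncard_of_levels {f : Fin n → ℕ} {S : Set (Fin n)} {m b : ℕ}
    (h : ∀ i < m, ∃ x ∈ S, f x = b + i) : m ≤ S.ncard := by
  have h1 : (fun i => b + i) '' (Set.Iio m) ⊆ f '' S := by
    rintro _ ⟨i, hi, rfl⟩
    obtain ⟨x, hx, hfx⟩ := h i hi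
    exact ⟨x, hx, hfx⟩
  have h2 := Set.ncard_le_ncard h1 (Set.toFinite _)
  have h3 := Set.ncard_image_le (f := f) (Set.toFinite S)
  rw [Set.ncard_image_of_injective _ (add_right_injective b)] at h2
  simp at h2
  omega

theorem treeDepth_lt (hT : IsForest T lev) {s : ℕ} (hs : 1 ≤ s) (v : Fin n) : treeDepth T s v < s := by
  by_contra hcon
  push Not at hcon
  obtain ⟨h1, h2⟩ := of_lt_treeDepth (T := T) (s := s) (v := v) (l := s - 1) (by omega)
  have h3 : ∃ x ∈ subtree T v, lev v + s ≤ lev x := by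
    by_contra hno
    push Not at hno
    refine h2 (Set.Subset.antisymm (fun x hx => (hT.mem_treeBall_iff.1 hx).1) fun x hx => ?_)
    have := hno x hx
    exact hT.mem_treeBall_iff.2 ⟨hx, by omega⟩
  obtain ⟨x, hx, hxl⟩ := h3
  have h4 : s ≤ (treeBall T v (s - 1)).ncard := by
    refine le_ncard_of_levels (f := lev) (b := lev v) fun i hi => ?_
    have hx' := hT.mem_treeLevel_of_mem_subtree hx
    rw [show lev x - lev v = i + (lev x - lev v - i) by omega, mem_treeLevel_add] at hx'
    obtain ⟨u, hu, -⟩ := hx'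
    exact ⟨u, ⟨i, by omega, hu⟩, hT.lev_of_mem_treeLevel hu⟩
  omega

theorem _root_.SSG.self_mem_piece (s : ℕ) (v : Fin n) : v ∈ piece T s v :=
  .inl ⟨0, Nat.zero_le _, rfl⟩

theorem _root_.SSG.piece_subset_subtree (s : ℕ) (v : Fin n) : piece T s v ⊆ subtree T v := by
  rintro x (⟨j, -, hx⟩ | ⟨u, hu, -, hx⟩)
  · exact ⟨j, hx⟩
  · exact subtree_subset ⟨_, hu⟩ hx

theorem _root_.SSG.IsSubCenter.mem_subtree {s : ℕ} {w c : Fin n} (hc : IsSubCenter T s w c) :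
    c ∈ subtree T w := by
  induction hc with
  | root => exact self_mem_subtree w
  | child _ hu _ ih => exact subtree_subset ih ⟨_, hu⟩

theorem _root_.SSG.exists_mem_piece {s : ℕ} {w x : Fin n} (hx : x ∈ subtree T w) :
    ∃ c, IsSubCenter T s w c ∧ x ∈ piece T s c := by
  have key : ∀ m v, IsSubCenter T s w v → ∀ j < m, x ∈ treeLevel T v j →
      ∃ c, IsSubCenter T s w c ∧ x ∈ piece T s c := by
    intro m
    induction m with
    | zero => intro v _ j hj; omega
    | succ m ih =>
      intro v hv j hj hxv
      by_cases hjl : j ≤ treeDepth T s v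
      · exact ⟨v, hv, .inl ⟨j, hjl, hxv⟩⟩
      · rw [show j = treeDepth T s v + 1 + (j - treeDepth T s v - 1) by omega,
          mem_treeLevel_add] at hxv
        obtain ⟨u, hu, hxu⟩ := hxv
        by_cases hsu : s ≤ (subtree T u).ncard
        · exact ih u (hv.child hu hsu) _ (by omega) hxu
        · exact ⟨v, hv, .inr ⟨u, hu, not_le.1 hsu, _, hxu⟩⟩
  obtain ⟨j, hj⟩ := hx
  exact key (j + 1) w .root j (Nat.lt_succ_self j) hj

/-- Below a sub-center `c`, any other sub-center lies in the subtree of a child of `c` in the recursion. -/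
theorem exists_child (hT : IsForest T lev) {s : ℕ} {w : Fin n} (m : ℕ) : ∀ c c', lev c' ≤ m → IsSubCenter T s w c →
    IsSubCenter T s w c' → c' ∈ subtree T c → c' ≠ c →
    ∃ u ∈ treeLevel T c (treeDepth T s c + 1), s ≤ (subtree T u).ncard ∧ c' ∈ subtree T u := by
  induction m with
  | zero =>
    intro c c' hm _ _ hcc' hne
    exact absurd (hT.eq_of_mem_subtree_of_lev_le hcc' (by omega)) hne
  | succ m ih =>
    intro c c' hm hc hc' hcc' hne
    cases hc' with
    | root =>
      exact absurd (hT.eq_of_mem_subtree_of_lev_le hcc'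
        (hT.lev_le_of_mem_subtree hc.mem_subtree)) hne
    | @child v _ hv hu hs =>
      have hlu := hT.lev_of_mem_treeLevel hu
      by_cases hvc : lev c ≤ lev v
      · have h1 : v ∈ subtree T c := hT.subtree_comparable ⟨_, hu⟩ hcc' hvc
        by_cases hvc' : v = c
        · subst hvc'
          exact ⟨c', hu, hs, self_mem_subtree c'⟩
        · obtain ⟨u, hu', hsu, hvu⟩ := ih c v (by omega) hc hv h1 hvc'
          exact ⟨u, hu', hsu, subtree_subset hvu ⟨_, hu⟩⟩
      · have h1 : c ∈ subtree T v := hT.subtree_comparable hcc' ⟨_, hu⟩ (by omega)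
        have h2 : lev c < lev c' := by
          by_contra hlt
          exact hne (hT.eq_of_mem_subtree_of_lev_le hcc' (by omega))
        obtain ⟨u, hu', -, hcu⟩ := ih v c (by omega) hv hc h1 (by rintro rfl; omega)
        have h3 := hT.lev_of_mem_treeLevel hu'
        have h4 := hT.lev_le_of_mem_subtree hcu
        omega

/-- The parts of a tree are disjoint. -/
theorem piece_unique (hT : IsForest T lev) {s : ℕ} {w c c' x : Fin n} (hc : IsSubCenter T s w c)
    (hc' : IsSubCenter T s w c') (hx : x ∈ piece T s c) (hx' : x ∈ piece T s c') : c = c' := by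
  wlog hle : lev c ≤ lev c' generalizing c c'
  · exact (this hc' hc hx' hx (by omega)).symm
  by_contra hne
  have h1 := hT.subtree_comparable (piece_subset_subtree s c' hx') (piece_subset_subtree s c hx) hle
  obtain ⟨u, hu, hsu, hcu⟩ := hT.exists_child _ c c' le_rfl hc hc' h1 (Ne.symm hne)
  have hxu : x ∈ subtree T u := subtree_subset hcu (piece_subset_subtree s c' hx')
  have hlu := hT.lev_of_mem_treeLevel hu
  have hlx := hT.lev_le_of_mem_subtree hxu
  rcases hx with hx | ⟨u', hu', hsu', hxu'⟩
  · have := (hT.mem_treeBall_iff.1 hx).2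
    omega
  · have hlu' := hT.lev_of_mem_treeLevel hu'
    have h2 := hT.subtree_comparable hxu hxu' (by omega)
    have h3 := hT.eq_of_mem_subtree_of_lev_le h2 (by omega)
    subst h3
    omega

theorem parent_mem_piece (hT : IsForest T lev) {s : ℕ} {c p x : Fin n} (hx : x ∈ piece T s c) (hxc : x ≠ c)
    (hpx : T p x) : p ∈ piece T s c := by
  rcases hx with ⟨j, hj, hx⟩ | ⟨u, hu, hsu, j, hx⟩
  · cases j with
    | zero => exact absurd hx hxc
    | succ j =>
      obtain ⟨p', hp', hpx'⟩ := hx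
      obtain rfl := hT.uniq hpx hpx'
      exact .inl ⟨j, by omega, hp'⟩
  · cases j with
    | zero =>
      obtain rfl : x = u := hx
      obtain ⟨p', hp', hpx'⟩ := hu
      obtain rfl := hT.uniq hpx hpx'
      exact .inl ⟨_, le_rfl, hp'⟩
    | succ j =>
      obtain ⟨p', hp', hpx'⟩ := hx
      obtain rfl := hT.uniq hpx hpx'
      exact .inr ⟨u, hu, hsu, j, hp'⟩

theorem _root_.SSG.le_ncard_subtree_of_isSubCenter {s : ℕ} {w c : Fin n}
    (hc : IsSubCenter T s w c) (hcw : c ≠ w) : s ≤ (subtree T c).ncard := by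
  cases hc with
  | root => exact absurd rfl hcw
  | child _ _ hs => exact hs

theorem le_ncard_piece (hT : IsForest T lev) {s : ℕ} {w c : Fin n} (hc : IsSubCenter T s w c) (hcw : c ≠ w) :
    s ≤ (piece T s c).ncard := by
  rcases hT.treeDepth_spec s c with h | h
  · exact h.trans (Set.ncard_le_ncard Set.subset_union_left (Set.toFinite _))
  · refine (le_ncard_subtree_of_isSubCenter hc hcw).trans ?_
    rw [← h]
    exact Set.ncard_le_ncard Set.subset_union_left (Set.toFinite _)

/-- The levels of a subtree with fewer than `s` vertices number fewer than `s`. -/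
theorem lt_of_ncard_subtree_lt (hT : IsForest T lev) {s : ℕ} {u x : Fin n} (hsu : (subtree T u).ncard < s)
    (hx : x ∈ subtree T u) : lev x < lev u + s := by
  by_contra hcon
  have : s ≤ (subtree T u).ncard := by
    refine le_ncard_of_levels (f := lev) (b := lev u) fun i hi => ?_
    have hx' := hT.mem_treeLevel_of_mem_subtree hx
    rw [show lev x - lev u = i + (lev x - lev u - i) by omega, mem_treeLevel_add] at hx'
    obtain ⟨y, hy, -⟩ := hx'
    exact ⟨y, ⟨i, hy⟩, hT.lev_of_mem_treeLevel hy⟩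
  omega

theorem lev_le_of_mem_piece (hT : IsForest T lev) {s : ℕ} (hs : 1 ≤ s) {c x : Fin n} (hx : x ∈ piece T s c) :
    lev x ≤ lev c + 2 * s := by
  have hd := hT.treeDepth_lt hs c
  rcases hx with hx | ⟨u, hu, hsu, hxu⟩
  · have := (hT.mem_treeBall_iff.1 hx).2
    omega
  · have h1 := hT.lev_of_mem_treeLevel hu
    have h2 := hT.lt_of_ncard_subtree_lt hsu hxu
    omega

end IsForest

/-! ### Cells and their breadth-first search trees -/

section Cells

variable {n : ℕ} {G : SimpleGraph (Fin n)} {W : Set (Fin n)} {k s : ℕ}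

theorem exists_on_geodesic (hG : G.Connected) {v x : Fin n} {i : ℕ} (hi : i ≤ G.dist v x) :
    ∃ y, G.dist v y = i ∧ G.dist y x = G.dist v x - i := by
  obtain ⟨p, hp⟩ := hG.exists_walk_length_eq_dist v x
  have h1 : G.dist v (p.getVert i) ≤ i := by
    refine (SimpleGraph.dist_le (p.take i)).trans ?_
    simp [SimpleGraph.Walk.take_length]
  have h2 : G.dist (p.getVert i) x ≤ p.length - i := by
    refine (SimpleGraph.dist_le (p.drop i)).trans ?_
    simp [SimpleGraph.Walk.drop_length]
  have h3 := hG.dist_triangle (u := v) (v := p.getVert i) (w := x)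
  exact ⟨p.getVert i, by omega, by omega⟩

theorem exists_adj_dist_add_one (hG : G.Connected) {v x : Fin n} (h : x ≠ v) :
    ∃ y, G.Adj y x ∧ G.dist v y + 1 = G.dist v x := by
  have h0 : 0 < G.dist v x := hG.pos_dist_of_ne h.symm
  obtain ⟨y, h1, h2⟩ := exists_on_geodesic hG (v := v) (x := x) (i := G.dist v x - 1) (by omega)
  exact ⟨y, SimpleGraph.dist_eq_one_iff_adj.1 (by omega), by omega⟩

theorem dist_le_dist_add_one (hG : G.Connected) {v x y : Fin n} (h : G.Adj x y) :
    G.dist v y ≤ G.dist v x + 1 := by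
  have h1 := hG.dist_triangle (u := v) (v := x) (w := y)
  have h2 := SimpleGraph.dist_eq_one_iff_adj.2 h
  omega

theorem bfsDepth_spec (G : SimpleGraph (Fin n)) (k : ℕ) (v : Fin n) :
    k ≤ (bfsBall G k v).ncard ∨ bfsBall G k v = Set.univ := by
  have hne : {l | k ≤ (ball G v l).ncard ∨ ball G v l = Set.univ}.Nonempty := by
    refine ⟨Finset.univ.sup (G.dist v), .inr ?_⟩
    ext x
    simpa [ball] using Finset.le_sup (f := G.dist v) (Finset.mem_univ x)
  exact Nat.sInf_mem hne

theorem of_lt_bfsDepth {v : Fin n} {l : ℕ} (hl : l < bfsDepth G k v) :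
    (ball G v l).ncard < k ∧ ball G v l ≠ Set.univ := by
  have := Nat.notMem_of_lt_sInf hl
  simp only [Set.mem_ofPred_eq, not_or, not_le] at this
  exact this

theorem bfsDepth_le {v : Fin n} {l : ℕ} (h : k ≤ (ball G v l).ncard ∨ ball G v l = Set.univ) :
    bfsDepth G k v ≤ l := Nat.sInf_le h

theorem bfsDepth_lt (hG : G.Connected) (hk : 1 ≤ k) (v : Fin n) : bfsDepth G k v < k := by
  by_contra hcon
  obtain ⟨h1, h2⟩ := of_lt_bfsDepth (G := G) (k := k) (v := v) (l := k - 1) (by omega)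
  obtain ⟨x, hx⟩ := (Set.ne_univ_iff_exists_notMem _).1 h2
  have hx : k - 1 < G.dist v x := not_le.1 hx
  have h3 : k ≤ (ball G v (k - 1)).ncard := by
    refine le_ncard_of_levels (f := G.dist v) (b := 0) fun i hi => ?_
    obtain ⟨y, hy, -⟩ := exists_on_geodesic hG (v := v) (x := x) (i := i) (by omega)
    exact ⟨y, show G.dist v y ≤ k - 1 by omega, by omega⟩
  omega

theorem exists_isCenter (G : SimpleGraph (Fin n)) (hW : W.Nonempty) (v : Fin n) :
    ∃ w, IsCenter G W v w := by
  obtain ⟨w, hw, hmin⟩ := Set.exists_min_image W (fun w => toLex (G.dist w v, w)) (Set.toFinite _) hW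
  refine ⟨w, hw, fun w' hw' => ?_⟩
  have := hmin w' hw'
  rw [Prod.Lex.le_iff] at this
  simpa using this

theorem IsCenter.unique {v w w' : Fin n} (h : IsCenter G W v w) (h' : IsCenter G W v w') :
    w = w' := by
  have h1 := h.2 w' h'.1
  have h2 := h'.2 w h.1
  rcases h1 with h1 | ⟨h1, h3⟩ <;> rcases h2 with h2 | ⟨h2, h4⟩
  · omega
  · omega
  · omega
  · exact le_antisymm h3 h4

theorem notMem_remote_iff {v : Fin n} :
    v ∉ remote G W k ↔ ∃ w ∈ W, G.dist v w ≤ bfsDepth G k v := by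
  simp only [remote, Set.mem_ofPred_eq, ← ne_eq, ← Set.nonempty_iff_ne_empty]
  exact ⟨fun ⟨w, h1, h2⟩ => ⟨w, h2, h1⟩, fun ⟨w, h1, h2⟩ => ⟨w, h2, h1⟩⟩

theorem dist_le_bfsDepth_of_mem_cell {v w : Fin n} (h : v ∈ cell G W k w) :
    G.dist w v ≤ bfsDepth G k v := by
  obtain ⟨w', hw', hd⟩ := notMem_remote_iff.1 h.2
  rw [G.dist_comm] at hd
  rcases h.1.2 w' hw' with h1 | h1 <;> omega

theorem exists_mem_cell {v : Fin n} (h : v ∉ remote G W k) : ∃ w ∈ W, v ∈ cell G W k w := by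
  obtain ⟨w', hw', -⟩ := notMem_remote_iff.1 h
  obtain ⟨w, hw⟩ := exists_isCenter G ⟨w', hw'⟩ v
  exact ⟨w, hw.1, hw, h⟩

theorem bfsDepth_le_add (hG : G.Connected) (u v : Fin n) :
    bfsDepth G k v ≤ bfsDepth G k u + G.dist u v := by
  have hsub : bfsBall G k u ⊆ ball G v (bfsDepth G k u + G.dist u v) := by
    intro x hx
    have hx : G.dist u x ≤ bfsDepth G k u := hx
    have h1 := hG.dist_triangle (u := v) (v := u) (w := x)
    rw [G.dist_comm (u := v) (v := u)] at h1
    exact show G.dist v x ≤ _ by omega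
  refine bfsDepth_le ?_
  rcases bfsDepth_spec G k u with h | h
  · exact .inl (h.trans (Set.ncard_le_ncard hsub (Set.toFinite _)))
  · exact .inr (Set.univ_subset_iff.1 (h ▸ hsub))

/-- A cell contains every geodesic from one of its vertices to its center. -/
theorem mem_cell_of_on_geodesic (hG : G.Connected) {v w z : Fin n} (hv : v ∈ cell G W k w)
    (hz : G.dist w z + G.dist z v = G.dist w v) : z ∈ cell G W k w := by
  refine ⟨⟨hv.1.1, fun w' hw' => ?_⟩, notMem_remote_iff.2 ⟨w, hv.1.1, ?_⟩⟩
  · have h1 := hG.dist_triangle (u := w') (v := z) (w := v)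
    rcases hv.1.2 w' hw' with h2 | ⟨h2, h3⟩
    · left; omega
    · by_cases h4 : G.dist w z < G.dist w' z
      · exact .inl h4
      · exact .inr ⟨by omega, h3⟩
  · have h1 := dist_le_bfsDepth_of_mem_cell hv
    have h2 := bfsDepth_le_add (k := k) hG z v
    rw [G.dist_comm (u := z) (v := w)]
    omega

theorem self_mem_cell (hG : G.Connected) {w : Fin n} (hw : w ∈ W) : w ∈ cell G W k w := by
  refine ⟨⟨hw, fun w' _ => ?_⟩, notMem_remote_iff.2 ⟨w, hw, by simp⟩⟩
  by_cases h : w' = w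
  · subst h; exact .inr ⟨rfl, le_rfl⟩
  · left
    rw [SimpleGraph.dist_self]
    exact hG.pos_dist_of_ne h

/-- Distances from `r` in `G[S]`, when every vertex of `S` other than `r` has a neighbour in `S` on
the previous level of a function `lev` that changes by at most one along edges. -/
theorem dist_induce_eq {S : Set (Fin n)} {r : Fin n} {lev : Fin n → ℕ}
    (hpred : ∀ x ∈ S, x ≠ r → ∃ p ∈ S, G.Adj p x ∧ lev p + 1 = lev x)
    (hstep : ∀ a b, G.Adj a b → lev b ≤ lev a + 1) (hr : ∀ x ∈ S, lev r ≤ lev x)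
    {x : Fin n} (hx : x ∈ S) :
    (G.induce S).spanningCoe.Reachable r x ∧
      lev r + (G.induce S).spanningCoe.dist r x = lev x := by
  set H := (G.induce S).spanningCoe with hH
  have hAdj : ∀ a b, H.Adj a b ↔ G.Adj a b ∧ a ∈ S ∧ b ∈ S := by
    intro a b
    simp [hH, SimpleGraph.map_adj]
  have hup : ∀ m, ∀ x ∈ S, lev x ≤ m → ∃ p : H.Walk r x, lev r + p.length = lev x := by
    intro m
    induction m with
    | zero =>
      intro x hx hm
      by_cases hxr : x = r
      · subst hxr; exact ⟨.nil, rfl⟩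
      · obtain ⟨p, -, -, h⟩ := hpred x hx hxr; omega
    | succ m ih =>
      intro x hx hm
      by_cases hxr : x = r
      · subst hxr; exact ⟨.nil, rfl⟩
      · obtain ⟨p, hp, hpx, h⟩ := hpred x hx hxr
        obtain ⟨q, hq⟩ := ih p hp (by omega)
        refine ⟨q.concat ((hAdj p x).2 ⟨hpx, hp, hx⟩), ?_⟩
        rw [SimpleGraph.Walk.length_concat]; omega
  have hlow : ∀ {a b : Fin n} (p : H.Walk a b), lev b ≤ lev a + p.length := by
    intro a b p
    induction p with
    | nil => simp
    | cons h p ih =>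
      have := hstep _ _ ((hAdj _ _).1 h).1
      rw [SimpleGraph.Walk.length_cons]; omega
  obtain ⟨p, hp⟩ := hup _ x hx le_rfl
  have hreach : H.Reachable r x := ⟨p⟩
  obtain ⟨q, hq⟩ := hreach.exists_walk_length_eq_dist
  have h1 := hlow q
  have h2 := SimpleGraph.dist_le p
  exact ⟨hreach, by omega⟩

theorem dist_induce_cell (hG : G.Connected) {w x : Fin n} (hx : x ∈ cell G W k w) :
    (G.induce (cell G W k w)).spanningCoe.dist w x = G.dist w x := by
  have := (dist_induce_eq (G := G) (S := cell G W k w) (r := w) (lev := G.dist w) ?_ ?_ ?_ hx).2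
  · simpa using this
  · intro x hx hxw
    obtain ⟨y, hy, hd⟩ := exists_adj_dist_add_one hG hxw
    have := SimpleGraph.dist_eq_one_iff_adj.2 hy
    exact ⟨y, mem_cell_of_on_geodesic hG hx (by omega), hy, hd⟩
  · intro a b hab
    exact dist_le_dist_add_one hG hab
  · simp

/-- In the BFS tree of a cell, distances may be taken in the whole graph. -/
theorem isBFSParent_cell_iff (hG : G.Connected) {w p x : Fin n} :
    IsBFSParent G (cell G W k w) w p x ↔
      x ∈ cell G W k w ∧ IsLeast {y | G.Adj y x ∧ G.dist w y + 1 = G.dist w x} p := by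
  refine and_congr_right fun hx => ?_
  have : bfsPred G (cell G W k w) w x = {y | G.Adj y x ∧ G.dist w y + 1 = G.dist w x} := by
    ext y
    simp only [bfsPred, Set.mem_ofPred_eq]
    constructor
    · rintro ⟨hy, hyx, hd⟩
      rw [dist_induce_cell hG hy, dist_induce_cell hG hx] at hd
      exact ⟨hyx, hd⟩
    · rintro ⟨hyx, hd⟩
      have := SimpleGraph.dist_eq_one_iff_adj.2 hyx
      have hy : y ∈ cell G W k w := mem_cell_of_on_geodesic hG hx (by omega)
      refine ⟨hy, hyx, ?_⟩
      rw [dist_induce_cell hG hy, dist_induce_cell hG hx, hd]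
  rw [this]

/-- The parent relation of the BFS tree of the cell of `w`. -/
abbrev cellTree (G : SimpleGraph (Fin n)) (W : Set (Fin n)) (k : ℕ) (w : Fin n) :
    Fin n → Fin n → Prop := IsBFSParent G (cell G W k w) w

theorem cellTree_isForest (hG : G.Connected) (w : Fin n) :
    IsForest (cellTree G W k w) (G.dist w) where
  lev_eq h := ((isBFSParent_cell_iff hG).1 h).2.1.2.symm
  uniq h h' := ((isBFSParent_cell_iff hG).1 h).2.unique ((isBFSParent_cell_iff hG).1 h').2

theorem cellTree_mem (hG : G.Connected) {w p x : Fin n} (h : cellTree G W k w p x) :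
    p ∈ cell G W k w ∧ x ∈ cell G W k w ∧ G.Adj p x := by
  obtain ⟨h1, ⟨h2, h3⟩, -⟩ := (isBFSParent_cell_iff hG).1 h
  have := SimpleGraph.dist_eq_one_iff_adj.2 h2
  exact ⟨mem_cell_of_on_geodesic hG h1 (by omega), h1, h2⟩

theorem exists_cellTree (hG : G.Connected) {w x : Fin n} (hx : x ∈ cell G W k w) (hxw : x ≠ w) :
    ∃ p, cellTree G W k w p x := by
  obtain ⟨p, hp, hmin⟩ := Set.exists_min_image {y | G.Adj y x ∧ G.dist w y + 1 = G.dist w x} id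
    (Set.toFinite _) (exists_adj_dist_add_one hG hxw)
  exact ⟨p, (isBFSParent_cell_iff hG).2 ⟨hx, hp, fun y hy => hmin y hy⟩⟩

theorem subtree_subset_cell (hG : G.Connected) {w v : Fin n} (hv : v ∈ cell G W k w) :
    subtree (cellTree G W k w) v ⊆ cell G W k w := by
  rintro x ⟨j, hx⟩
  cases j with
  | zero => exact (show x = v from hx) ▸ hv
  | succ j =>
    obtain ⟨p, -, hpx⟩ := hx
    exact (cellTree_mem hG hpx).2.1

theorem subtree_root (hG : G.Connected) {w : Fin n} (hw : w ∈ W) :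
    subtree (cellTree G W k w) w = cell G W k w := by
  refine Set.Subset.antisymm (subtree_subset_cell hG (self_mem_cell hG hw)) ?_
  have key : ∀ m, ∀ x ∈ cell G W k w, G.dist w x ≤ m → x ∈ subtree (cellTree G W k w) w := by
    intro m
    induction m with
    | zero =>
      intro x _ hm
      obtain rfl : w = x := hG.dist_eq_zero_iff.1 (Nat.le_zero.1 hm)
      exact self_mem_subtree w
    | succ m ih =>
      intro x hx hm
      by_cases hxw : x = w
      · rw [hxw]; exact self_mem_subtree w
      · obtain ⟨p, hp⟩ := exists_cellTree hG hx hxw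
        have h1 := (cellTree_isForest hG w).lev_eq hp
        obtain ⟨j, hj⟩ := ih p (cellTree_mem hG hp).1 (by omega)
        exact ⟨j + 1, p, hj, hp⟩
  exact fun x hx => key _ x hx le_rfl

theorem piece_subset_cell (hG : G.Connected) {w c : Fin n} (hw : w ∈ W)
    (hc : IsSubCenter (cellTree G W k w) s w c) :
    piece (cellTree G W k w) s c ⊆ cell G W k w := by
  refine (piece_subset_subtree s c).trans ((subtree_subset hc.mem_subtree).trans ?_)
  rw [subtree_root hG hw]

/-- The BFS tree of a part is the part of the BFS tree of its cell. -/
theorem isBFSParent_piece_iff (hG : G.Connected) {w c p x : Fin n} (hw : w ∈ W)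
    (hc : IsSubCenter (cellTree G W k w) s w c) :
    IsBFSParent G (piece (cellTree G W k w) s c) c p x ↔
      x ∈ piece (cellTree G W k w) s c ∧ x ≠ c ∧ cellTree G W k w p x := by
  set X := piece (cellTree G W k w) s c with hX
  have hF := cellTree_isForest (W := W) (k := k) hG w
  have hXcell : X ⊆ cell G W k w := piece_subset_cell hG hw hc
  have hparent : ∀ x ∈ X, x ≠ c → ∃ p ∈ X, cellTree G W k w p x := by
    intro x hx hxc
    have hxw : x ≠ w := by
      rintro rfl
      have h1 := hF.lev_le_of_mem_subtree (piece_subset_subtree s c hx)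
      rw [SimpleGraph.dist_self] at h1
      exact hxc (hG.dist_eq_zero_iff.1 (Nat.le_zero.1 h1))
    obtain ⟨p, hp⟩ := exists_cellTree hG (hXcell hx) hxw
    exact ⟨p, hF.parent_mem_piece hx hxc hp, hp⟩
  -- Distances to `c` inside the part are differences of distances to `w`.
  have hdist : ∀ x ∈ X, G.dist w c + (G.induce X).spanningCoe.dist c x = G.dist w x := by
    intro x hx
    refine (dist_induce_eq (G := G) (S := X) (r := c) (lev := G.dist w) ?_ ?_ ?_ hx).2
    · intro x hx hxc
      obtain ⟨p, hp, hpx⟩ := hparent x hx hxc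
      exact ⟨p, hp, (cellTree_mem hG hpx).2.2, (hF.lev_eq hpx).symm⟩
    · intro a b hab
      exact dist_le_dist_add_one hG hab
    · intro x hx
      exact hF.lev_le_of_mem_subtree (piece_subset_subtree s c hx)
  refine and_congr_right fun hx => ?_
  constructor
  · rintro ⟨⟨hp, hpx, hd⟩, hmin⟩
    have hxc : x ≠ c := by
      rintro rfl
      rw [SimpleGraph.dist_self] at hd
      omega
    refine ⟨hxc, ?_⟩
    obtain ⟨p', hp', hpx'⟩ := hparent x hx hxc
    have h1 := hdist p hp
    have h2 := hdist x hx
    have h3 := hdist p' hp'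
    have h4 := hF.lev_eq hpx'
    have h5 : p ≤ p' := hmin ⟨hp', (cellTree_mem hG hpx').2.2, by omega⟩
    have h6 : p' ≤ p := ((isBFSParent_cell_iff hG).1 hpx').2.2 ⟨hpx, by omega⟩
    rwa [le_antisymm h5 h6]
  · rintro ⟨hxc, hpx⟩
    have hp := hF.parent_mem_piece hx hxc hpx
    have h1 := hdist p hp
    have h2 := hdist x hx
    have h4 := hF.lev_eq hpx
    refine ⟨⟨hp, (cellTree_mem hG hpx).2.2, by omega⟩, ?_⟩
    rintro y ⟨hy, hyx, hd⟩
    have h3 := hdist y hy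
    exact ((isBFSParent_cell_iff hG).1 hpx).2.2 ⟨hyx, by omega⟩

end Cells

/-! ### The partition and the graph built from it -/

section Graph

variable {n : ℕ} {G : SimpleGraph (Fin n)} {W : Set (Fin n)} {k s : ℕ}

theorem IsRootedPart.subset_compl_remote (hG : G.Connected) {c : Fin n} {X : Set (Fin n)}
    (h : IsRootedPart G W k s c X) {v : Fin n} (hv : v ∈ X) : v ∉ remote G W k := by
  obtain ⟨w, hw, hc, rfl⟩ := h
  exact (piece_subset_cell hG hw hc hv).2

theorem IsRootedPart.unique (hG : G.Connected) {c c' v : Fin n} {X X' : Set (Fin n)}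
    (h : IsRootedPart G W k s c X) (h' : IsRootedPart G W k s c' X') (hv : v ∈ X) (hv' : v ∈ X') :
    c = c' ∧ X = X' := by
  obtain ⟨w, hw, hc, rfl⟩ := h
  obtain ⟨w', hw', hc', rfl⟩ := h'
  obtain rfl := (piece_subset_cell hG hw hc hv).1.unique (piece_subset_cell hG hw' hc' hv').1
  obtain rfl := (cellTree_isForest hG w).piece_unique hc hc' hv hv'
  exact ⟨rfl, rfl⟩

theorem exists_isRootedPart (hG : G.Connected) (s : ℕ) {v : Fin n} (hv : v ∉ remote G W k) :
    ∃ c X, IsRootedPart G W k s c X ∧ v ∈ X := by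
  obtain ⟨w, hw, hvw⟩ := exists_mem_cell hv
  rw [← subtree_root hG hw] at hvw
  obtain ⟨c, hc, hvc⟩ := exists_mem_piece (s := s) hvw
  exact ⟨c, _, ⟨w, hw, hc, rfl⟩, hvc⟩

theorem IsRootedPart.self_mem {c : Fin n} {X : Set (Fin n)} (h : IsRootedPart G W k s c X) :
    c ∈ X := by
  obtain ⟨w, hw, hc, rfl⟩ := h
  exact self_mem_piece s c

theorem exists_part (hG : G.Connected) (W : Set (Fin n)) (k s : ℕ) (v : Fin n) :
    ∃ X ∈ parts G W k s, v ∈ X := by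
  by_cases hv : v ∈ remote G W k
  · exact ⟨{v}, .inl ⟨v, hv, rfl⟩, rfl⟩
  · obtain ⟨c, X, hX, hvX⟩ := exists_isRootedPart hG s hv
    exact ⟨X, .inr ⟨c, hX⟩, hvX⟩

theorem part_unique (hG : G.Connected) {v : Fin n} {X Y : Set (Fin n)} (hX : X ∈ parts G W k s)
    (hY : Y ∈ parts G W k s) (hvX : v ∈ X) (hvY : v ∈ Y) : X = Y := by
  rcases hX with ⟨u, hu, rfl⟩ | ⟨c, hX⟩ <;> rcases hY with ⟨u', hu', rfl⟩ | ⟨c', hY⟩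
  · rw [← show v = u from hvX, ← show v = u' from hvY]
  · exact absurd ((show v = u from hvX) ▸ hu) (hY.subset_compl_remote hG hvY)
  · exact absurd ((show v = u' from hvY) ▸ hu') (hX.subset_compl_remote hG hvX)
  · exact (hX.unique hG hY hvX hvY).2

/-- Every vertex of a part is joined to its sub-center by a path of the sparse spanning graph inside the
part, of length at most `2 * s`. -/
theorem IsRootedPart.exists_walk (hG : G.Connected) (hs : 1 ≤ s) {c x : Fin n} {X : Set (Fin n)}
    (h : IsRootedPart G W k s c X) (hx : x ∈ X) :
    ∃ p : (sparseSpanningGraph G W k s).Walk c x, p.length ≤ 2 * s ∧ ∀ y ∈ p.support, y ∈ X := by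
  have h' := h
  obtain ⟨w, hw, hc, rfl⟩ := h
  have hF := cellTree_isForest (W := W) (k := k) hG w
  have key : ∀ m, ∀ x ∈ piece (cellTree G W k w) s c, G.dist w x ≤ G.dist w c + m →
      ∃ p : (sparseSpanningGraph G W k s).Walk c x, p.length ≤ m ∧
        ∀ y ∈ p.support, y ∈ piece (cellTree G W k w) s c := by
    intro m
    induction m with
    | zero =>
      intro x hx hm
      obtain rfl := hF.eq_of_mem_subtree_of_lev_le (piece_subset_subtree s c hx) (by omega)
      exact ⟨.nil, by simp, by simpa using hx⟩
    | succ m ih =>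
      intro x hx hm
      by_cases hxc : x = c
      · subst hxc
        exact ⟨.nil, by simp, by simpa using hx⟩
      · have hxw : x ≠ w := by
          rintro rfl
          have h1 := hF.lev_le_of_mem_subtree (piece_subset_subtree s c hx)
          rw [SimpleGraph.dist_self] at h1
          exact hxc (hG.dist_eq_zero_iff.1 (Nat.le_zero.1 h1))
        obtain ⟨p, hp⟩ := exists_cellTree hG (piece_subset_cell hG hw hc hx) hxw
        have h1 := hF.lev_eq hp
        obtain ⟨q, hq, hqX⟩ := ih p (hF.parent_mem_piece hx hxc hp) (by omega)
        have hadj : (sparseSpanningGraph G W k s).Adj p x :=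
          .inl ⟨c, _, h', .inl ((isBFSParent_piece_iff hG hw hc).2 ⟨hx, hxc, hp⟩)⟩
        refine ⟨q.concat hadj, ?_, ?_⟩
        · rw [SimpleGraph.Walk.length_concat]; omega
        · intro y hy
          rw [SimpleGraph.Walk.support_concat] at hy
          simp only [List.mem_append, List.mem_singleton] at hy
          rcases hy with hy | rfl
          exacts [hqX y hy, hx]
  exact key (2 * s) x hx (hF.lev_le_of_mem_piece hs hx)

theorem sparseSpanningGraph_le : sparseSpanningGraph G W k s ≤ G := by
  rintro x y (⟨c, X, -, h | h⟩ | ⟨X, -, Y, -, -, h⟩)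
  · exact h.2.1.2.1
  · exact h.2.1.2.1.symm
  · exact h.2.2.1

theorem conn_part (hG : G.Connected) (hs : 1 ≤ s) {X : Set (Fin n)} (hX : X ∈ parts G W k s) :
    Conn G X := by
  rcases hX with ⟨u, -, rfl⟩ | ⟨c, hX⟩
  · exact .singleton u
  · refine conn_of_preconnected ⟨c, hX.self_mem⟩ c (fun x hx => ?_) hX.self_mem
    obtain ⟨p, -, hp⟩ := hX.exists_walk hG hs hx
    have key : ∀ {a b} (p : (sparseSpanningGraph G W k s).Walk a b), (∀ y ∈ p.support, y ∈ X) →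
        Relation.ReflTransGen (fun a b => G.Adj a b ∧ b ∈ X) a b := by
      intro a b p
      induction p with
      | nil => exact fun _ => .refl
      | cons hab p ih =>
        intro hp
        exact .head ⟨sparseSpanningGraph_le hab, hp _ (by simp)⟩
          (ih fun y hy => hp y (by simp [hy]))
    exact key p hp

theorem exists_isMinEdge {X Y : Set (Fin n)} {u v : Fin n} (hu : u ∈ X) (hv : v ∈ Y)
    (huv : G.Adj u v) : ∃ x y, IsMinEdge G X Y x y := by
  obtain ⟨⟨x, y⟩, h, hmin⟩ := Set.exists_min_image {p : Fin n × Fin n | p.1 ∈ X ∧ p.2 ∈ Y ∧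
    G.Adj p.1 p.2} (fun p => edgeRank p.1 p.2) (Set.toFinite _) ⟨(u, v), hu, hv, huv⟩
  exact ⟨x, y, h.1, h.2.1, h.2.2, fun x' hx' y' hy' h' => hmin (x', y') ⟨hx', hy', h'⟩⟩

/-- From a vertex, every vertex of its part is reached in at most `4 * s` steps. -/
theorem exists_walk_of_mem_part (hG : G.Connected) (hs : 1 ≤ s) {X : Set (Fin n)}
    (hX : X ∈ parts G W k s) {x y : Fin n} (hx : x ∈ X) (hy : y ∈ X) :
    ∃ p : (sparseSpanningGraph G W k s).Walk x y, p.length ≤ 4 * s := by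
  rcases hX with ⟨u, -, rfl⟩ | ⟨c, hX⟩
  · obtain rfl : x = u := hx
    obtain rfl : y = x := hy
    exact ⟨.nil, by simp⟩
  · obtain ⟨p, hp, -⟩ := hX.exists_walk hG hs hx
    obtain ⟨q, hq, -⟩ := hX.exists_walk hG hs hy
    refine ⟨p.reverse.append q, ?_⟩
    rw [SimpleGraph.Walk.length_append, SimpleGraph.Walk.length_reverse]
    omega

/-- Two adjacent vertices are in one part, or their parts are joined by an edge; in both cases the walk
through the trees of the parts is short. -/
theorem exists_walk_of_adj (hG : G.Connected) (W : Set (Fin n)) (k : ℕ) (hs : 1 ≤ s)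
    {u v : Fin n} (huv : G.Adj u v) :
    ∃ p : (sparseSpanningGraph G W k s).Walk u v, p.length ≤ 8 * s + 1 := by
  obtain ⟨X, hX, hu⟩ := exists_part hG W k s u
  obtain ⟨Y, hY, hv⟩ := exists_part hG W k s v
  by_cases hXY : X = Y
  · subst hXY
    obtain ⟨p, hp⟩ := exists_walk_of_mem_part hG hs hX hu hv
    exact ⟨p, by omega⟩
  · obtain ⟨x, y, hxy⟩ := exists_isMinEdge hu hv huv
    obtain ⟨p, hp⟩ := exists_walk_of_mem_part hG hs hX hu hxy.1
    obtain ⟨q, hq⟩ := exists_walk_of_mem_part hG hs hY hxy.2.1 hv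
    have hadj : (sparseSpanningGraph G W k s).Adj x y := .inr ⟨X, hX, Y, hY, hXY, hxy⟩
    refine ⟨p.append (.cons hadj q), ?_⟩
    rw [SimpleGraph.Walk.length_append, SimpleGraph.Walk.length_cons]
    omega

theorem exists_walk_of_walk (hG : G.Connected) (W : Set (Fin n)) (k : ℕ) (hs : 1 ≤ s)
    {u v : Fin n} (p : G.Walk u v) :
    ∃ q : (sparseSpanningGraph G W k s).Walk u v, q.length ≤ (8 * s + 1) * p.length := by
  induction p with
  | nil => exact ⟨.nil, by simp⟩
  | cons h p ih =>
    obtain ⟨q, hq⟩ := ih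
    obtain ⟨r, hr⟩ := exists_walk_of_adj hG W k hs h
    refine ⟨r.append q, ?_⟩
    rw [SimpleGraph.Walk.length_append, SimpleGraph.Walk.length_cons, mul_add]
    omega

theorem sparseSpanningGraph_connected (hG : G.Connected) (W : Set (Fin n)) (k : ℕ) (hs : 1 ≤ s) :
    (sparseSpanningGraph G W k s).Connected := by
  have := hG.nonempty
  refine ⟨fun u v => ?_⟩
  obtain ⟨p, -⟩ := hG.exists_walk_length_eq_dist u v
  exact ⟨(exists_walk_of_walk hG W k hs p).choose⟩

theorem dist_sparseSpanningGraph_le (hG : G.Connected) (W : Set (Fin n)) (k : ℕ) (hs : 1 ≤ s)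
    (u v : Fin n) : (sparseSpanningGraph G W k s).dist u v ≤ (8 * s + 1) * G.dist u v := by
  obtain ⟨p, hp⟩ := hG.exists_walk_length_eq_dist u v
  obtain ⟨q, hq⟩ := exists_walk_of_walk hG W k hs p
  exact (SimpleGraph.dist_le q).trans (hp ▸ hq)

/-! ### The number of edges -/

open Classical in
/-- The parts other than single remote vertices number at most `|W| + n / s`, since only the parts at the roots
of the cells may have fewer than `s` vertices. -/
theorem ncard_parts_mul_le (hG : G.Connected) :
    (parts G W k s).ncard * s ≤ (remote G W k).ncard * s + W.ncard * s + n := by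
  set R : Set (Set (Fin n)) := (fun v => {v}) '' remote G W k with hR
  set C : Set (Set (Fin n)) := (fun w => piece (cellTree G W k w) s w) '' W with hC
  set B : Set (Set (Fin n)) := {X ∈ parts G W k s | s ≤ X.ncard} with hB
  have hsub : parts G W k s ⊆ R ∪ C ∪ B := by
    rintro X (⟨v, hv, rfl⟩ | ⟨c, hX⟩)
    · exact .inl (.inl ⟨v, hv, rfl⟩)
    · have hXp : X ∈ parts G W k s := .inr ⟨c, hX⟩
      obtain ⟨w, hw, hc, rfl⟩ := hX
      by_cases hcw : c = w
      · subst hcw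
        exact .inl (.inr ⟨c, hw, rfl⟩)
      · exact .inr ⟨hXp, (cellTree_isForest hG w).le_ncard_piece hc hcw⟩
  have h1 : (parts G W k s).ncard ≤ (remote G W k).ncard + W.ncard + B.ncard := by
    refine (Set.ncard_le_ncard hsub (Set.toFinite _)).trans ((Set.ncard_union_le _ _).trans ?_)
    refine Nat.add_le_add_right ((Set.ncard_union_le _ _).trans ?_) _
    exact Nat.add_le_add (Set.ncard_image_le (Set.toFinite _)) (Set.ncard_image_le (Set.toFinite _))
  have h2 : B.ncard * s ≤ n := by
    have hBf : B.Finite := Set.toFinite _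
    have hdisj : ∀ X ∈ hBf.toFinset, ∀ Y ∈ hBf.toFinset, X ≠ Y →
        Disjoint X.toFinset Y.toFinset := by
      intro X hX Y hY hXY
      rw [Set.disjoint_toFinset, Set.disjoint_left]
      intro v hvX hvY
      exact hXY (part_unique hG ((hBf.mem_toFinset).1 hX).1 ((hBf.mem_toFinset).1 hY).1 hvX hvY)
    have h3 := Finset.card_biUnion hdisj
    have h4 : (hBf.toFinset.biUnion fun X => X.toFinset).card ≤ n := by
      simpa using Finset.card_le_univ (hBf.toFinset.biUnion fun X => X.toFinset)
    have h5 : ∑ X ∈ hBf.toFinset, s ≤ ∑ X ∈ hBf.toFinset, X.toFinset.card := by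
      refine Finset.sum_le_sum fun X hX => ?_
      have := ((hBf.mem_toFinset).1 hX).2
      rwa [Set.ncard_eq_toFinset_card'] at this
    rw [Finset.sum_const, smul_eq_mul, ← Set.ncard_eq_toFinset_card B hBf] at h5
    omega
  nlinarith

/-- The graph obtained by contracting every part to a point. -/
def quotientGraph (G : SimpleGraph (Fin n)) (W : Set (Fin n)) (k s : ℕ) :
    SimpleGraph (parts G W k s) where
  Adj X Y := X ≠ Y ∧ ∃ x ∈ X.1, ∃ y ∈ Y.1, G.Adj x y
  symm := ⟨fun _ _ ⟨h, x, hx, y, hy, hxy⟩ => ⟨h.symm, y, hy, x, hx, hxy.symm⟩⟩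
  loopless := ⟨fun _ h => h.1 rfl⟩

/-- Contracting the parts, which are connected, turns a clique minor of the quotient into one of `G`. -/
theorem hasClique_of_quotientGraph (hG : G.Connected) (hs : 1 ≤ s) {h : ℕ}
    (hQ : HasClique h (quotientGraph G W k s) Set.univ) : HasClique h G Set.univ := by
  refine hQ.lift (fun X => X.1) (fun X _ => ⟨Set.subset_univ _, conn_part hG hs X.2⟩) ?_ ?_
  · intro X _ Y _ hXY
    rw [Set.disjoint_left]
    exact fun v hv hv' => hXY (Subtype.ext (part_unique hG X.2 Y.2 hv hv'))
  · exact fun X _ Y _ hXY => hXY.2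

theorem edgeRank_eq_imp {x y x' y' : Fin n} (h : edgeRank x y = edgeRank x' y') :
    s(x, y) = s(x', y') := by
  simp only [edgeRank, EmbeddingLike.apply_eq_iff_eq, Prod.mk.injEq] at h
  rw [Sym2.eq_iff]
  rcases le_total x y with h1 | h1 <;> rcases le_total x' y' with h2 | h2 <;>
    simp only [h1, h2, min_eq_left, min_eq_right, max_eq_left, max_eq_right] at h <;> tauto

theorem IsMinEdge.unique {X Y : Set (Fin n)} {x y x' y' : Fin n} (h : IsMinEdge G X Y x y)
    (h' : IsMinEdge G X Y x' y') : s(x, y) = s(x', y') :=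
  edgeRank_eq_imp (le_antisymm (h.2.2.2 x' h'.1 y' h'.2.1 h'.2.2.1)
    (h'.2.2.2 x h.1 y h.2.1 h.2.2.1))

open Classical in
/-- Besides at most one tree edge for each vertex, there is one edge for each edge of the quotient. -/
theorem two_mul_ncard_edgeSet_le (hG : G.Connected) :
    2 * (sparseSpanningGraph G W k s).edgeSet.ncard ≤
      2 * n + adjPairs (quotientGraph G W k s) := by
  have hne := hG.nonempty
  have hne' : Nonempty (Sym2 (parts G W k s)) := by
    obtain ⟨v⟩ := hne
    obtain ⟨X, hX, -⟩ := exists_part hG W k s v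
    exact ⟨s(⟨X, hX⟩, ⟨X, hX⟩)⟩
  -- the tree edges, as images of their lower endpoints
  set T : Set (Sym2 (Fin n)) := {e | ∃ c X p x, IsRootedPart G W k s c X ∧ IsBFSParent G X c p x ∧
    e = s(p, x)} with hT
  have hTn : T.ncard ≤ n := by
    have hsel : ∀ e ∈ T, ∃ x, ∃ c X p, IsRootedPart G W k s c X ∧ IsBFSParent G X c p x ∧
        e = s(p, x) := by
      rintro e ⟨c, X, p, x, h⟩
      exact ⟨x, c, X, p, h⟩
    choose! f hf using hsel
    have : T.ncard ≤ (Set.univ : Set (Fin n)).ncard := by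
      refine Set.ncard_le_ncard_of_injOn f (fun _ _ => Set.mem_univ _) ?_ (Set.toFinite _)
      intro e he e' he' hee
      obtain ⟨c, X, p, hX, hp, h⟩ := hf e he
      obtain ⟨c', X', p', hX', hp', h'⟩ := hf e' he'
      rw [hee] at hp h
      obtain ⟨rfl, rfl⟩ := hX.unique hG hX' hp.1 hp'.1
      exact h.trans ((congrArg (fun z => s(z, f e')) (hp.2.unique hp'.2)).trans h'.symm)
    simpa using this
  -- the edges between parts, as images of pairs of adjacent parts
  set M : Set (Sym2 (Fin n)) := {e | ∃ X ∈ parts G W k s, ∃ Y ∈ parts G W k s, ∃ x y, X ≠ Y ∧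
    IsMinEdge G X Y x y ∧ e = s(x, y)} with hM
  have hMn : M.ncard ≤ (quotientGraph G W k s).edgeSet.ncard := by
    have hsel : ∀ e ∈ M, ∃ q ∈ (quotientGraph G W k s).edgeSet, ∃ X Y : parts G W k s, ∃ x y,
        IsMinEdge G X.1 Y.1 x y ∧ e = s(x, y) ∧ q = s(X, Y) := by
      rintro e ⟨X, hX, Y, hY, x, y, hXY, hmin, rfl⟩
      refine ⟨s(⟨X, hX⟩, ⟨Y, hY⟩), ?_, _, _, x, y, hmin, rfl, rfl⟩
      exact ⟨fun h => hXY (congrArg Subtype.val h), x, hmin.1, y, hmin.2.1, hmin.2.2.1⟩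
    choose! f hfm hf using hsel
    refine Set.ncard_le_ncard_of_injOn f hfm ?_ (Set.toFinite _)
    intro e he e' he' hee
    obtain ⟨X, Y, x, y, hmin, rfl, h⟩ := hf e he
    obtain ⟨X', Y', x', y', hmin', rfl, h'⟩ := hf e' he'
    rw [hee, h', Sym2.eq_iff] at h
    rcases h with ⟨rfl, rfl⟩ | ⟨rfl, rfl⟩
    · exact hmin.unique hmin'
    · have hswap : IsMinEdge G X'.1 Y'.1 y x := by
        refine ⟨hmin.2.1, hmin.1, hmin.2.2.1.symm, fun a ha b hb hab => ?_⟩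
        have := hmin.2.2.2 b hb a ha hab.symm
        simpa [edgeRank, min_comm, max_comm] using this
      rw [Sym2.eq_swap]
      exact hswap.unique hmin'
  have hQ : 2 * (quotientGraph G W k s).edgeSet.ncard = adjPairs (quotientGraph G W k s) := by
    rw [← Set.coe_toFinset (quotientGraph G W k s).edgeSet, Set.ncard_coe_finset,
      ← SimpleGraph.edgeFinset, ← SimpleGraph.sum_degrees_eq_twice_card_edges,
      adjPairs_eq_sum _ (U := Finset.univ) (fun _ _ _ => Finset.mem_univ _)]
    refine Finset.sum_congr rfl fun X _ => ?_
    rw [← SimpleGraph.card_neighborFinset_eq_degree]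
    congr 1
    ext Y
    simp
  have hsub : (sparseSpanningGraph G W k s).edgeSet ⊆ T ∪ M := by
    intro e
    induction e with
    | _ x y =>
      rintro (⟨c, X, hX, h | h⟩ | ⟨X, hX, Y, hY, hXY, h⟩)
      · exact .inl ⟨c, X, x, y, hX, h, rfl⟩
      · exact .inl ⟨c, X, y, x, hX, h, Sym2.eq_swap⟩
      · exact .inr ⟨X, hX, Y, hY, x, y, hXY, h, rfl⟩
  have h1 := (Set.ncard_le_ncard hsub (Set.toFinite _)).trans (Set.ncard_union_le _ _)
  omega

/-- In a graph without a complete minor on `h` vertices, the sparse spanning graph has at most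
`n + density h * |parts|` edges. -/
theorem ncard_edgeSet_le (hG : G.Connected) (hs : 1 ≤ s) {h : ℕ} (hh : 1 ≤ h)
    (hminor : ¬ HasClique h G Set.univ) :
    (sparseSpanningGraph G W k s).edgeSet.ncard ≤ n + density h * (parts G W k s).ncard := by
  classical
  have h1 := two_mul_ncard_edgeSet_le (W := W) (k := k) (s := s) hG
  obtain ⟨v⟩ := hG.nonempty
  obtain ⟨X, hX, -⟩ := exists_part hG W k s v
  have : Nonempty (parts G W k s) := ⟨⟨X, hX⟩⟩
  have h2 : adjPairs (quotientGraph G W k s) < 2 * density h * Fintype.card (parts G W k s) := by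
    by_contra hcon
    exact hminor (hasClique_of_quotientGraph hG hs
      (hasClique_of_density_mul_card_le hh _ (not_lt.1 hcon)))
  rw [← Nat.card_eq_fintype_card, Nat.card_coe_set_eq] at h2
  rw [mul_assoc] at h2
  omega

end Graph

/-! ### Programs with bounded loops -/

/-- Programs all of whose loops are counted: `loop i N p` runs `p` with register `i` ranging over
the numbers below the content of register `N`. -/
inductive FProg
  | skip
  | assign (i : ℕ) (e : Expr)
  | store (a e : Expr)
  | probe (i : ℕ) (a b : Expr)
  | seq (p q : FProg)
  | ite (e : Expr) (p q : FProg)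
  | loop (i N : ℕ) (p : FProg)

/-- `σ` with register `i` set to `x`. -/
def State.setReg (σ : State) (i x : ℕ) : State := { σ with reg := Function.update σ.reg i x }

/-- `σ` with memory cell `a` set to `x`. -/
def State.setMem (σ : State) (a x : ℕ) : State := { σ with mem := Function.update σ.mem a x }

@[simp] theorem State.setReg_reg (σ : State) (i x j : ℕ) :
    (σ.setReg i x).reg j = if j = i then x else σ.reg j := by
  simp [State.setReg, Function.update_apply]

@[simp] theorem State.setReg_mem (σ : State) (i x : ℕ) : (σ.setReg i x).mem = σ.mem := rfl

@[simp] theorem State.setMem_reg (σ : State) (a x : ℕ) : (σ.setMem a x).reg = σ.reg := rfl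

@[simp] theorem State.setMem_mem (σ : State) (a x b : ℕ) :
    (σ.setMem a x).mem b = if b = a then x else σ.mem b := by
  simp [State.setMem, Function.update_apply]

namespace FProg

/-- The sequential composition of a list of programs. -/
def block : List FProg → FProg
  | [] => skip
  | p :: ps => seq p (block ps)

/-- The word-RAM program for a program with counted loops. -/
def compile : FProg → Prog
  | skip => .while (.lit 0) (.assign 0 (.lit 0))
  | assign i e => .assign i e
  | store a e => .store a e
  | probe i a b => .probe i a b
  | seq p q => .seq p.compile q.compile
  | ite e p q => .ite e p.compile q.compile
  | loop i N p => .seq (.assign i (.lit 0)) (.while (.op .lt (.reg i) (.reg N))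
      (.seq p.compile (.assign i (.op .add (.reg i) (.lit 1)))))

/-- The final state of a program with counted loops. -/
def denote (w : ℕ) (O : ℕ → ℕ → ℕ) : FProg → State → State
  | skip, σ => σ
  | assign i e, σ => σ.setReg i (e.eval w σ)
  | store a e, σ => σ.setMem (a.eval w σ) (e.eval w σ)
  | probe i a b, σ => σ.setReg i (O (a.eval w σ) (b.eval w σ))
  | seq p q, σ => q.denote w O (p.denote w O σ)
  | ite e p q, σ => if e.eval w σ ≠ 0 then p.denote w O σ else q.denote w O σ
  | loop i N p, σ => Nat.rec (σ.setReg i 0) (fun j τ => (p.denote w O τ).setReg i (j + 1)) (σ.reg N)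

/-- The registers to which a program may write. -/
def writes : FProg → List ℕ
  | skip => []
  | assign i _ => [i]
  | store _ _ => []
  | probe i _ _ => [i]
  | seq p q => p.writes ++ q.writes
  | ite _ p q => p.writes ++ q.writes
  | loop i _ p => i :: p.writes

/-- The loop bounds are held in registers below `K`, all registers written to are at least `K`, and
no loop body writes to its loop counter. -/
def wf (K : ℕ) : FProg → Bool
  | skip => true
  | assign i _ => K ≤ i
  | store _ _ => true
  | probe i _ _ => K ≤ i
  | seq p q => p.wf K && q.wf K
  | ite _ p q => p.wf K && q.wf K
  | loop i N p => K ≤ i && N < K && !(p.writes.contains i) && p.wf K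

/-- An upper bound for the running time, if the loop bounds have the values `c`. -/
def time (c : ℕ → ℕ) : FProg → ℕ
  | skip => 2
  | assign _ e => e.cost + 1
  | store a e => a.cost + e.cost + 1
  | probe _ a b => a.cost + b.cost + 1
  | seq p q => p.time c + q.time c
  | ite e p q => e.cost + 1 + (p.time c + q.time c)
  | loop _ N p => 6 + c N * (p.time c + 8)

/-- An upper bound for the number of probes, if the loop bounds have the values `c`. -/
def probes (c : ℕ → ℕ) : FProg → ℕ
  | skip => 0
  | assign _ _ => 0
  | store _ _ => 0
  | probe _ _ _ => 1
  | seq p q => p.probes c + q.probes c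
  | ite _ p q => p.probes c + q.probes c
  | loop _ N p => c N * p.probes c

variable {w : ℕ} {O : ℕ → ℕ → ℕ}

theorem denote_reg_of_notMem {p : FProg} {i : ℕ} (hi : i ∉ p.writes) (σ : State) :
    (p.denote w O σ).reg i = σ.reg i := by
  induction p generalizing σ with
  | skip => rfl
  | assign j e => simp_all [writes, denote]
  | store a e => rfl
  | probe j a b => simp_all [writes, denote]
  | seq p q ihp ihq =>
    simp only [writes, List.mem_append, not_or] at hi
    simp only [denote]
    rw [ihq hi.2, ihp hi.1]
  | ite e p q ihp ihq =>
    simp only [writes, List.mem_append, not_or] at hi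
    simp only [denote]
    split_ifs
    exacts [ihp hi.1 σ, ihq hi.2 σ]
  | loop j N p ih =>
    simp only [writes, List.mem_cons, not_or] at hi
    simp only [denote]
    induction σ.reg N with
    | zero => simp [hi.1]
    | succ m ihm => simp only [State.setReg_reg, hi.1, if_false]; rw [ih hi.2, ihm]

theorem le_of_mem_writes {K : ℕ} {p : FProg} (hp : p.wf K = true) {i : ℕ} (hi : i ∈ p.writes) :
    K ≤ i := by
  induction p with
  | skip => simp [writes] at hi
  | assign j e => simp_all [writes, wf]
  | store a e => simp [writes] at hi
  | probe j a b => simp_all [writes, wf]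
  | seq p q ihp ihq =>
    simp only [writes, List.mem_append, wf, Bool.and_eq_true] at hi hp
    exact hi.elim (ihp hp.1) (ihq hp.2)
  | ite e p q ihp ihq =>
    simp only [writes, List.mem_append, wf, Bool.and_eq_true] at hi hp
    exact hi.elim (ihp hp.1) (ihq hp.2)
  | loop j N p ih =>
    simp only [writes, List.mem_cons, wf, Bool.and_eq_true, decide_eq_true_eq] at hi hp
    rcases hi with rfl | hi
    exacts [hp.1.1.1, ih hp.2 hi]

theorem denote_reg_of_wf {K : ℕ} {p : FProg} (hp : p.wf K = true) {i : ℕ} (hi : i < K)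
    (σ : State) : (p.denote w O σ).reg i = σ.reg i :=
  denote_reg_of_notMem (fun h => absurd (le_of_mem_writes hp h) (by omega)) σ

/-- The compiled program computes `denote`, within the bounds `time` and `probes`. -/
theorem exec_compile {K : ℕ} {c : ℕ → ℕ} {p : FProg} (hp : p.wf K = true) (σ : State)
    (hc : ∀ i < K, σ.reg i = c i) (hcw : ∀ i < K, c i < 2 ^ w) :
    ∃ t m, Exec w O p.compile σ (p.denote w O σ) t m ∧ t ≤ p.time c ∧ m ≤ p.probes c := by
  induction p generalizing σ with
  | skip => exact ⟨_, _, .while_false (by simp [Expr.eval]), by simp [Expr.cost, time], by simp⟩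
  | assign i e => exact ⟨_, _, .assign i e σ, le_rfl, le_rfl⟩
  | store a e => exact ⟨_, _, .store a e σ, le_rfl, le_rfl⟩
  | probe i a b => exact ⟨_, _, .probe i a b σ, le_rfl, le_rfl⟩
  | seq p q ihp ihq =>
    simp only [wf, Bool.and_eq_true] at hp
    obtain ⟨t, m, h1, ht, hm⟩ := ihp hp.1 σ hc
    obtain ⟨t', m', h2, ht', hm'⟩ := ihq hp.2 (p.denote w O σ)
      (fun i hi => (denote_reg_of_wf hp.1 hi σ).trans (hc i hi))
    exact ⟨_, _, .seq h1 h2, by simp only [time]; omega, by simp only [probes]; omega⟩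
  | ite e p q ihp ihq =>
    simp only [wf, Bool.and_eq_true] at hp
    simp only [denote, time, probes, compile]
    by_cases he : e.eval w σ = 0
    · obtain ⟨t, m, h1, ht, hm⟩ := ihq hp.2 σ hc
      rw [if_neg (not_not.2 he)]
      exact ⟨_, _, .ite_false he h1, by omega, by omega⟩
    · obtain ⟨t, m, h1, ht, hm⟩ := ihp hp.1 σ hc
      rw [if_pos he]
      exact ⟨_, _, .ite_true he h1, by omega, by omega⟩
  | loop i N p ih =>
    simp only [wf, Bool.and_eq_true, decide_eq_true_eq, Bool.not_eq_true', List.contains_eq_mem,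
      decide_eq_false_iff_not] at hp
    obtain ⟨⟨⟨hKi, hNK⟩, hip⟩, hp⟩ := hp
    set f : ℕ → State := fun j =>
      Nat.rec (σ.setReg i 0) (fun j τ => (p.denote w O τ).setReg i (j + 1)) j with hf
    have hf0 : f 0 = σ.setReg i 0 := rfl
    have hfs : ∀ j, f (j + 1) = (p.denote w O (f j)).setReg i (j + 1) := fun j => rfl
    have hfi : ∀ j, (f j).reg i = j := by
      intro j
      cases j with
      | zero => simp [hf0]
      | succ j => simp [hfs]
    have hfc : ∀ j, ∀ r < K, (f j).reg r = c r := by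
      intro j r hr
      have hri : r ≠ i := by omega
      induction j with
      | zero => simp [hf0, hri, hc r hr]
      | succ j ihj => simp only [hfs, State.setReg_reg, hri, if_false]; rw [denote_reg_of_wf hp hr, ihj]
    have hcN := hcw N hNK
    have key : ∀ r j, j + r = c N → ∃ t m, Exec w O (.while (.op .lt (.reg i) (.reg N))
        (.seq p.compile (.assign i (.op .add (.reg i) (.lit 1))))) (f j) (f (c N)) t m ∧
        t ≤ 4 + r * (p.time c + 8) ∧ m ≤ r * p.probes c := by
      intro r
      induction r with
      | zero =>
        intro j hj
        obtain rfl : j = c N := by omega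
        refine ⟨_, _, .while_false ?_, by simp [Expr.cost], by simp⟩
        simp [Expr.eval, Op.eval, hfi, hfc _ N hNK]
      | succ r ihr =>
        intro j hj
        obtain ⟨t, m, h1, ht, hm⟩ := ih hp (f j) (hfc j)
        obtain ⟨t', m', h2, ht', hm'⟩ := ihr (j + 1) (by omega)
        have hlit : 1 % 2 ^ w = 1 := Nat.mod_eq_of_lt (by omega)
        have h3 : Exec w O (.assign i (.op .add (.reg i) (.lit 1))) (p.denote w O (f j)) (f (j + 1))
            4 0 := by
          have := Exec.assign (w := w) (O := O) i (.op .add (.reg i) (.lit 1)) (p.denote w O (f j))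
          have hi : (p.denote w O (f j)).reg i = j := (denote_reg_of_notMem hip _).trans (hfi j)
          simpa [Expr.eval, Op.eval, hi, hlit, Nat.mod_eq_of_lt (show j + 1 < 2 ^ w by omega),
            Expr.cost, hfs, State.setReg] using this
        refine ⟨_, _, .while_true ?_ (.seq h1 h3) h2, ?_, ?_⟩
        · simp [Expr.eval, Op.eval, hfi, hfc _ N hNK]; omega
        · simp only [Expr.cost]; rw [Nat.add_mul]; omega
        · rw [Nat.add_mul]; omega
    obtain ⟨t, m, h1, ht, hm⟩ := key (c N) 0 (by omega)
    have h0 : f 0 = { σ with reg := Function.update σ.reg i ((Expr.lit 0).eval w σ) } := by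
      simp [hf0, State.setReg, Expr.eval]
    have h2 : denote w O (loop i N p) σ = f (c N) := by rw [← hc N hNK]; rfl
    rw [h0] at h1
    rw [h2]
    exact ⟨_, _, .seq (.assign i (.lit 0) σ) h1, by simp only [Expr.cost, time]; omega,
      by simp only [probes]; omega⟩

theorem denote_block_nil (σ : State) : (block []).denote w O σ = σ := rfl

theorem denote_block_cons (p : FProg) (ps : List FProg) (σ : State) :
    (block (p :: ps)).denote w O σ = (block ps).denote w O (p.denote w O σ) := rfl

theorem denote_ite_pos {e : Expr} {p q : FProg} {σ : State} (h : e.eval w σ ≠ 0) :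
    (ite e p q).denote w O σ = p.denote w O σ := if_pos h

theorem denote_ite_neg {e : Expr} {p q : FProg} {σ : State} (h : e.eval w σ = 0) :
    (ite e p q).denote w O σ = q.denote w O σ := if_neg (not_not.2 h)

/-- The invariant rule for counted loops; the invariant must not depend on the loop counter. -/
theorem loop_inv {i N : ℕ} {p : FProg} {σ : State} (I : ℕ → State → Prop) {m : ℕ}
    (hN : σ.reg N = m) (hset : ∀ j τ x, I j τ → I j (τ.setReg i x)) (h0 : I 0 σ)
    (hstep : ∀ j < m, ∀ τ, I j τ → τ.reg i = j → I (j + 1) (p.denote w O τ)) :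
    I m ((loop i N p).denote w O σ) := by
  have key : ∀ j ≤ m, I j (Nat.rec (σ.setReg i 0)
      (fun j τ => (p.denote w O τ).setReg i (j + 1)) j : State) ∧
      (Nat.rec (σ.setReg i 0) (fun j τ => (p.denote w O τ).setReg i (j + 1)) j : State).reg i
        = j := by
    intro j
    induction j with
    | zero => exact fun _ => ⟨hset 0 σ 0 h0, by simp⟩
    | succ j ih =>
      intro hj
      obtain ⟨h1, h2⟩ := ih (by omega)
      exact ⟨hset _ _ _ (hstep j (by omega) _ h1 h2), by simp⟩
  have := (key m le_rfl).1
  simp only [denote, hN]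
  exact this

end FProg

theorem eval_lit {w : ℕ} {σ : State} {c : ℕ} (h : c < 2 ^ w) : (Expr.lit c).eval w σ = c :=
  Nat.mod_eq_of_lt h

theorem eval_reg {w : ℕ} {σ : State} {i : ℕ} : (Expr.reg i).eval w σ = σ.reg i := rfl

theorem eval_mem {w : ℕ} {σ : State} {a : Expr} : (Expr.mem a).eval w σ = σ.mem (a.eval w σ) := rfl

theorem eval_add {w : ℕ} {σ : State} {a b : Expr} (h : a.eval w σ + b.eval w σ < 2 ^ w) :
    (Expr.op .add a b).eval w σ = a.eval w σ + b.eval w σ := Nat.mod_eq_of_lt h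

theorem eval_mul {w : ℕ} {σ : State} {a b : Expr} (h : a.eval w σ * b.eval w σ < 2 ^ w) :
    (Expr.op .mul a b).eval w σ = a.eval w σ * b.eval w σ := Nat.mod_eq_of_lt h

theorem eval_mod {w : ℕ} {σ : State} {a b : Expr} :
    (Expr.op .mod a b).eval w σ = a.eval w σ % b.eval w σ := rfl

theorem eval_lt {w : ℕ} {σ : State} {a b : Expr} :
    (Expr.op .lt a b).eval w σ = if a.eval w σ < b.eval w σ then 1 else 0 := rfl

theorem eval_eq {w : ℕ} {σ : State} {a b : Expr} :
    (Expr.op .eq a b).eval w σ = if a.eval w σ = b.eval w σ then 1 else 0 := rfl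


/-! ### Breadth-first exploration -/

section Oracle

variable {n : ℕ} {G : SimpleGraph (Fin n)}

theorem IncidenceLists.oracle_eq (L : IncidenceLists G) (x : Fin n) (j : ℕ) :
    L.oracle (x + 1) (j + 1) = match (L.nbrs x)[j]? with
      | some u => (u : ℕ) + 1
      | none => 0 := by
  have h : 1 ≤ (x : ℕ) + 1 ∧ (x : ℕ) + 1 ≤ n ∧ 1 ≤ j + 1 := ⟨by omega, x.2, by omega⟩
  rcases hL : (L.nbrs x)[j]? with _ | u <;> simp [oracle, h, hL]

theorem IncidenceLists.oracle_cases (L : IncidenceLists G) (x : Fin n) (j : ℕ) :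
    L.oracle (x + 1) (j + 1) = 0 ∨ ∃ y : Fin n, G.Adj x y ∧ L.oracle (x + 1) (j + 1) = y + 1 := by
  rw [L.oracle_eq]
  cases h : (L.nbrs x)[j]? with
  | none => exact .inl rfl
  | some y => exact .inr ⟨y, (L.mem_iff x y).1 (List.mem_of_getElem? h), rfl⟩

theorem IncidenceLists.exists_oracle_eq (L : IncidenceLists G) {d : ℕ}
    (hd : ∀ v, (G.neighborSet v).ncard ≤ d) {x y : Fin n} (h : G.Adj x y) :
    ∃ j < d, L.oracle (x + 1) (j + 1) = y + 1 := by
  classical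
  obtain ⟨j, hj, hy⟩ := List.getElem_of_mem ((L.mem_iff x y).2 h)
  have hlen : (L.nbrs x).length ≤ d := by
    refine le_trans ?_ (hd x)
    rw [← List.toFinset_card_of_nodup (L.nodup x), ← Set.ncard_coe_finset]
    refine Set.ncard_le_ncard (fun z hz => ?_) (Set.toFinite _)
    exact (L.mem_iff x z).1 (by simpa using hz)
  refine ⟨j, by omega, ?_⟩
  rw [L.oracle_eq, List.getElem?_eq_getElem hj, hy]

end Oracle

/-- The data of a breadth-first exploration from `src` of the set `S` along the relation `R`: the rank of
a vertex is its distance from `src`. -/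
structure Layering {n : ℕ} (G : SimpleGraph (Fin n)) (S : Set (Fin n)) (R : Fin n → Fin n → Prop)
    (rk : Fin n → ℕ) (src : Fin n) : Prop where
  src_mem : src ∈ S
  rk_src : rk src = 0
  eq_src : ∀ x ∈ S, rk x = 0 → x = src
  step : ∀ x ∈ S, ∀ y, R x y → y ∈ S ∧ rk y ≤ rk x + 1
  pred : ∀ y ∈ S, ∀ r, rk y = r + 1 → ∃ x ∈ S, rk x = r ∧ R x y
  adj : ∀ x y, R x y → G.Adj x y
  rk_le : ∀ x ∈ S, rk x ≤ n

/-- The state of a breadth-first exploration: `L` lists the vertices discovered, in their order, those at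
positions below `i` have been expanded, and of the one at position `i` the successors in `D`
have been dealt with. -/
structure Explored {n : ℕ} (S : Set (Fin n)) (R : Fin n → Fin n → Prop)
    (rk : Fin n → ℕ) (src : Fin n) (L : List (Fin n)) (i : ℕ) (D : Fin n → Prop) (m : ℕ) : Prop where
  nodup : L.Nodup
  head : L[0]? = some src
  mem : ∀ x ∈ L, x ∈ S
  sorted : L.Pairwise fun a b => rk a ≤ rk b
  closed : ∀ j < i, ∀ x, L[j]? = some x → ∀ y, R x y → y ∈ L
  done : ∀ x, L[i]? = some x → ∀ y, R x y → D y → y ∈ L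
  full : ∀ j ≤ i, ∀ x, L[j]? = some x → ∀ y ∈ S, rk y ≤ rk x → y ∈ L
  near : ∀ x, L[i]? = some x → ∀ y ∈ L, rk y ≤ rk x + 1
  length_le : L.length ≤ m

section Explored

variable {n : ℕ} {G : SimpleGraph (Fin n)} {S : Set (Fin n)} {R : Fin n → Fin n → Prop}
  {rk : Fin n → ℕ} {src : Fin n} {L : List (Fin n)} {i m : ℕ} {D : Fin n → Prop}

theorem Explored.start (hS : Layering G S R rk src) :
    Explored S R rk src [src] 0 (fun _ => False) 1 where
  nodup := List.nodup_singleton _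
  head := rfl
  mem := by simpa using hS.src_mem
  sorted := List.pairwise_singleton _ _
  closed := by intro j hj; omega
  done := by intro _ _ _ _ h; exact h.elim
  full := by
    intro j hj x hx y hy hyx
    obtain rfl : j = 0 := by omega
    obtain rfl : src = x := by simpa using hx
    rw [hS.rk_src] at hyx
    simp [hS.eq_src y hy (by omega)]
  near := by
    intro x hx y hy
    obtain rfl : src = x := by simpa using hx
    obtain rfl : y = src := by simpa using hy
    omega
  length_le := le_rfl

theorem Explored.congr {D' : Fin n → Prop} {m' : ℕ} (h : Explored S R rk src L i D m)
    (hD : ∀ x, L[i]? = some x → ∀ y, R x y → D' y → D y ∨ y ∈ L) (hm : m ≤ m') :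
    Explored S R rk src L i D' m' :=
  { h with
    done := fun x hx y hxy hy => (hD x hx y hxy hy).elim (h.done x hx y hxy) id
    length_le := h.length_le.trans hm }

theorem Explored.sorted' (h : Explored S R rk src L i D m) {a b : ℕ} {x y : Fin n} (hab : a ≤ b)
    (hx : L[a]? = some x) (hy : L[b]? = some y) : rk x ≤ rk y := by
  rcases hab.eq_or_lt with rfl | hab
  · rw [hx] at hy
    cases hy
    exact le_rfl
  · obtain ⟨ha, rfl⟩ := List.getElem?_eq_some_iff.1 hx
    obtain ⟨hb, rfl⟩ := List.getElem?_eq_some_iff.1 hy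
    exact List.pairwise_iff_getElem.1 h.sorted a b ha hb hab

/-- A successor not seen before has the next rank, so appending it keeps the list sorted by rank. -/
theorem Explored.append (hS : Layering G S R rk src) (h : Explored S R rk src L i D m) {x y : Fin n}
    (hx : L[i]? = some x) (hxy : R x y) (hy : y ∉ L) :
    rk y = rk x + 1 ∧ Explored S R rk src (L ++ [y]) i (fun z => D z ∨ z = y) (m + 1) := by
  have hxS := h.mem x (List.mem_of_getElem? hx)
  obtain ⟨hyS, hyr⟩ := hS.step x hxS y hxy
  have hrk : rk y = rk x + 1 := by
    by_contra hne
    exact hy (h.full i le_rfl x hx y hyS (by omega))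
  have hi : i < L.length := (List.getElem?_eq_some_iff.1 hx).1
  have hget : ∀ j ≤ i, (L ++ [y])[j]? = L[j]? := fun j hj => List.getElem?_append_left (by omega)
  refine ⟨hrk, ?_, ?_, ?_, ?_, ?_, ?_, ?_, ?_, ?_⟩
  · rw [List.nodup_append]
    refine ⟨h.nodup, List.nodup_singleton _, ?_⟩
    rintro a ha b hb rfl
    rw [List.mem_singleton] at hb
    exact hy (hb ▸ ha)
  · rw [hget 0 (by omega)]; exact h.head
  · intro z hz
    rcases List.mem_append.1 hz with hz | hz
    · exact h.mem z hz
    · rw [List.mem_singleton.1 hz]; exact hyS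
  · rw [List.pairwise_append]
    refine ⟨h.sorted, List.pairwise_singleton _ _, fun a ha b hb => ?_⟩
    rw [List.mem_singleton.1 hb, hrk]
    exact h.near x hx a ha
  · intro j hj z hz u hu
    rw [hget j hj.le] at hz
    exact List.mem_append_left _ (h.closed j hj z hz u hu)
  · intro z hz u hu hDu
    rw [hget i le_rfl] at hz
    rcases hDu with hDu | rfl
    · exact List.mem_append_left _ (h.done z hz u hu hDu)
    · simp
  · intro j hj z hz u hu hur
    rw [hget j hj] at hz
    exact List.mem_append_left _ (h.full j hj z hz u hu hur)
  · intro z hz u hu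
    rw [hget i le_rfl, hx] at hz
    cases hz
    rcases List.mem_append.1 hu with hu | hu
    · exact h.near x hx u hu
    · rw [List.mem_singleton.1 hu, hrk]
  · simpa using h.length_le

/-- When all successors of the vertex at position `i` have been dealt with, the exploration moves on. -/
theorem Explored.next (hS : Layering G S R rk src) (h : Explored S R rk src L i D m)
    (hD : ∀ x, L[i]? = some x → ∀ y, R x y → D y) :
    Explored S R rk src L (i + 1) (fun _ => False) m where
  nodup := h.nodup
  head := h.head
  mem := h.mem
  sorted := h.sorted
  closed := by
    intro j hj x hx y hxy
    rcases Nat.lt_succ_iff_lt_or_eq.1 hj with hj | rfl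
    · exact h.closed j hj x hx y hxy
    · exact h.done x hx y hxy (hD x hx y hxy)
  done := by intro _ _ _ _ h; exact h.elim
  full := by
    intro j hj x' hx' y hy hyx
    by_cases hji : j ≤ i
    · exact h.full j hji x' hx' y hy hyx
    obtain rfl : j = i + 1 := by omega
    have hi : i < L.length := by have := (List.getElem?_eq_some_iff.1 hx').1; omega
    have hx : L[i]? = some L[i] := List.getElem?_eq_getElem hi
    by_cases hyr : rk y ≤ rk L[i]
    · exact h.full i le_rfl _ hx y hy hyr
    have h1 := h.near _ hx x' (List.mem_of_getElem? hx')
    obtain ⟨z, hzS, hzr, hzy⟩ := hS.pred y hy (rk L[i]) (by omega)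
    obtain ⟨a, ha⟩ := List.mem_iff_getElem?.1 (h.full i le_rfl _ hx z hzS hzr.le)
    rcases lt_trichotomy a i with hai | rfl | hai
    · exact h.closed a hai z ha y hzy
    · exact h.done z ha y hzy (hD z ha y hzy)
    · have := h.sorted' (show i + 1 ≤ a by omega) hx' ha
      omega
  near := by
    intro x' hx' y hy
    have hi : i < L.length := by have := (List.getElem?_eq_some_iff.1 hx').1; omega
    have hx : L[i]? = some L[i] := List.getElem?_eq_getElem hi
    have h1 := h.near _ hx y hy
    have h2 := h.sorted' (Nat.le_succ i) hx hx'
    omega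
  length_le := h.length_le

/-- If all discovered vertices have been expanded then everything has been discovered. -/
theorem Explored.mem_iff_of_length_le (hS : Layering G S R rk src) (h : Explored S R rk src L i D m)
    (hL : L.length ≤ i) (x : Fin n) : x ∈ L ↔ x ∈ S := by
  refine ⟨h.mem x, ?_⟩
  have key : ∀ r x, x ∈ S → rk x = r → x ∈ L := by
    intro r
    induction r with
    | zero =>
      intro x hx hr
      rw [hS.eq_src x hx hr]
      exact List.mem_of_getElem? h.head
    | succ r ih =>
      intro x hx hr
      obtain ⟨z, hz, hzr, hzx⟩ := hS.pred x hx r hr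
      obtain ⟨a, ha⟩ := List.mem_iff_getElem?.1 (ih z hz hzr)
      have := (List.getElem?_eq_some_iff.1 ha).1
      exact h.closed a (by omega) z ha x hzx
  exact fun hx => key _ x hx rfl

theorem Explored.length_le_card (h : Explored S R rk src L i D m) : L.length ≤ n := by
  classical
  rw [← List.toFinset_card_of_nodup h.nodup]
  exact (Finset.card_le_univ _).trans (by simp)

/-- When `N` positions have been expanded and more than `N'` vertices discovered, `N' < N`, then
the vertices of rank at most that of the one at position `N'` are known, and those of smaller
rank are at most `N'` in number. -/
theorem Explored.ncard_lt (h : Explored S R rk src L i D m) {j : ℕ} {x : Fin n}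
    (hx : L[j]? = some x) (hj : j ≤ i) {T : Set (Fin n)} (hT : ∀ y ∈ T, y ∈ S ∧ rk y < rk x) :
    T.ncard ≤ j := by
  classical
  have hsub : T ⊆ ((L.take j).toFinset : Set (Fin n)) := by
    intro y hy
    obtain ⟨hyS, hyr⟩ := hT y hy
    obtain ⟨a, ha⟩ := List.mem_iff_getElem?.1 (h.full j hj x hx y hyS hyr.le)
    have haj : a < j := by
      by_contra hcon
      have := h.sorted' (not_lt.1 hcon) hx ha
      omega
    simp only [List.coe_toFinset, Set.mem_ofPred_eq]
    exact List.mem_of_getElem? ((List.getElem?_take_of_lt haj).trans ha)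
  refine (Set.ncard_le_ncard hsub (Set.toFinite _)).trans ?_
  rw [Set.ncard_coe_finset]
  exact (List.toFinset_card_le _).trans (by simp)

/-- The first vertices discovered have rank at most that of the one at position `j`. -/
theorem Explored.lt_ncard (h : Explored S R rk src L i D m) {j : ℕ} {x : Fin n}
    (hx : L[j]? = some x) {T : Set (Fin n)} (hT : ∀ y ∈ S, rk y ≤ rk x → y ∈ T) :
    j < T.ncard := by
  classical
  have hj := (List.getElem?_eq_some_iff.1 hx).1
  have hsub : ((L.take (j + 1)).toFinset : Set (Fin n)) ⊆ T := by
    intro y hy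
    simp only [List.coe_toFinset, Set.mem_ofPred_eq] at hy
    obtain ⟨a, ha⟩ := List.mem_iff_getElem?.1 hy
    have haj : a < j + 1 := by
      have := (List.getElem?_eq_some_iff.1 ha).1
      simp at this; omega
    rw [List.getElem?_take_of_lt haj] at ha
    exact hT y (h.mem y (List.mem_of_getElem? ha)) (h.sorted' (by omega) ha hx)
  have h1 := Set.ncard_le_ncard hsub (Set.toFinite _)
  rw [Set.ncard_coe_finset, List.toFinset_card_of_nodup (h.nodup.sublist (List.take_sublist _ _)),
    List.length_take] at h1
  omega

end Explored

/-- The memory holds the list `L` of vertices from address `b` on, and at address `c + v` the rank of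
the vertex with identifier `v`, increased by one, if it is in `L`, and `0` otherwise. -/
structure Holds {n : ℕ} (mem : ℕ → ℕ) (b c : ℕ) (L : List (Fin n)) (rk : Fin n → ℕ) : Prop where
  list : ∀ (i : ℕ) (x : Fin n), L[i]? = some x → mem (b + i) = x + 1
  rank : ∀ v : Fin n, mem (c + (v + 1)) = if v ∈ L then rk v + 1 else 0

namespace FProg

/-- Breadth-first exploration from the vertex in register `o`, expanding at most as many vertices as
register `N` says. The addresses of the list of vertices and of the table of ranks are in the registers `bl`
and `bc`. The program `test` decides whether the vertex in register `o + 5` is a successor of the one in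
register `o + 3`, and leaves the answer in register `o + 6`. -/
def explore (o bl bc N : ℕ) (test : FProg) : FProg := block [
  store (.reg bl) (.reg o),
  store (.op .add (.reg bc) (.reg o)) (.lit 1),
  assign (o + 1) (.lit 1),
  loop (o + 2) N (ite (.op .lt (.reg (o + 2)) (.reg (o + 1)))
    (block [
      assign (o + 3) (.mem (.op .add (.reg bl) (.reg (o + 2)))),
      loop (o + 4) 3 (block [
        probe (o + 5) (.reg (o + 3)) (.op .add (.reg (o + 4)) (.lit 1)),
        test,
        ite (.reg (o + 6))
          (ite (.mem (.op .add (.reg bc) (.reg (o + 5)))) skip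
            (block [
              store (.op .add (.reg bl) (.reg (o + 1))) (.reg (o + 5)),
              store (.op .add (.reg bc) (.reg (o + 5)))
                (.op .add (.mem (.op .add (.reg bc) (.reg (o + 3)))) (.lit 1)),
              assign (o + 1) (.op .add (.reg (o + 1)) (.lit 1))]))
          skip])])
    skip)]

end FProg

section Spec

variable {n : ℕ} {G : SimpleGraph (Fin n)} {S : Set (Fin n)} {R : Fin n → Fin n → Prop}
  {rk : Fin n → ℕ} {src : Fin n}

/-- Appending a vertex to the list, in memory. -/
theorem Holds.append {mem : ℕ → ℕ} {b c : ℕ} {L : List (Fin n)} (h : Holds mem b c L rk)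
    (hL : L.length < n) (hbc : b + n + 2 ≤ c) {y : Fin n} {mem' : ℕ → ℕ}
    (hb : mem' (b + L.length) = y + 1) (hc : mem' (c + (y + 1)) = rk y + 1)
    (hne : ∀ a, a ≠ b + L.length → a ≠ c + (y + 1) → mem' a = mem a) :
    Holds mem' b c (L ++ [y]) rk where
  list := by
    intro i x hx
    rcases lt_or_ge i L.length with hi | hi
    · rw [List.getElem?_append_left hi] at hx
      rw [hne _ (by omega) (by omega)]
      exact h.list i x hx
    · rw [List.getElem?_append_right hi] at hx
      have hi' := (List.getElem?_eq_some_iff.1 hx).1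
      simp only [List.length_singleton] at hi'
      obtain rfl : i = L.length := by omega
      obtain rfl : y = x := by simpa using hx
      exact hb
  rank := by
    intro v
    by_cases hv : v = y
    · subst hv
      simp [hc]
    · have hv' : (v : ℕ) ≠ y := fun h => hv (Fin.ext h)
      rw [hne _ (by omega) (by omega), h.rank v]
      simp [hv]

open FProg

/-- Correctness of breadth-first exploration. `I` is any property of states that the exploration and
the test preserve. -/
theorem explore_spec (I : State → Prop) (hS : Layering G S R rk src) (IL : IncidenceLists G)
    {w d o bl bc N b c Nv : ℕ} {test : FProg}
    (hdeg : ∀ v, (G.neighborSet v).ncard ≤ d)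
    (hbc : b + n + 2 ≤ c) (hcw : c + n + 2 < 2 ^ w) (hdw : d < 2 ^ w)
    (hIreg : ∀ τ i x, o < i → I τ → I (τ.setReg i x))
    (hImem : ∀ τ a x, (b ≤ a ∧ a < b + n + 2 ∨ c ≤ a ∧ a < c + n + 2) → I τ → I (τ.setMem a x))
    (hIc : ∀ τ, I τ → τ.reg bl = b ∧ τ.reg bc = c ∧ τ.reg 3 = d ∧ τ.reg N = Nv)
    (htest : ∀ τ (x : Fin n) y₀, I τ → x ∈ S → τ.reg (o + 3) = x + 1 → τ.reg (o + 5) = y₀ →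
      (y₀ = 0 ∨ ∃ y : Fin n, G.Adj x y ∧ y₀ = y + 1) →
      I (test.denote w IL.oracle τ) ∧
      ((test.denote w IL.oracle τ).reg (o + 6) ≠ 0 ↔ ∃ y : Fin n, y₀ = y + 1 ∧ R x y) ∧
      (∀ i < 6, (test.denote w IL.oracle τ).reg (o + i) = τ.reg (o + i)) ∧
      ∀ a, (b ≤ a ∧ a < b + n + 2 ∨ c ≤ a ∧ a < c + n + 2) →
        (test.denote w IL.oracle τ).mem a = τ.mem a)
    {σ : State} (hσ : I σ) (hsrc : σ.reg o = src + 1)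
    (hzero : ∀ v : Fin n, σ.mem (c + (v + 1)) = 0) :
    I ((explore o bl bc N test).denote w IL.oracle σ) ∧
    ∃ L : List (Fin n), Explored S R rk src L Nv (fun _ => False) (1 + Nv * d) ∧
      Holds ((explore o bl bc N test).denote w IL.oracle σ).mem b c L rk ∧
      ((explore o bl bc N test).denote w IL.oracle σ).reg (o + 1) = L.length := by
  have h1w : 1 < 2 ^ w := by omega
  have hlit1 : ∀ τ : State, (Expr.lit 1).eval w τ = 1 := fun τ => eval_lit h1w
  simp only [explore, denote_block_cons, denote_block_nil]
  -- the initialization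
  have hsrcn := src.2
  set σ₁ := (store (.reg bl) (.reg o)).denote w IL.oracle σ with hσ₁
  have e₁ : σ₁ = σ.setMem b (src + 1) := by
    rw [hσ₁]; simp only [denote, eval_reg, (hIc σ hσ).1, hsrc]
  have hI₁ : I σ₁ := e₁ ▸ hImem σ _ _ (.inl ⟨le_rfl, by omega⟩) hσ
  set σ₂ := (store (.op .add (.reg bc) (.reg o)) (.lit 1)).denote w IL.oracle σ₁ with hσ₂
  have e₂ : σ₂ = σ₁.setMem (c + (src + 1)) 1 := by
    have h1 : σ₁.reg bc = c := (hIc σ₁ hI₁).2.1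
    have h2 : σ₁.reg o = src + 1 := by rw [e₁, State.setMem_reg, hsrc]
    have h3 : (Expr.op .add (.reg bc) (.reg o)).eval w σ₁ = c + (src + 1) := by
      rw [eval_add] <;> simp only [eval_reg, h1, h2]
      omega
    rw [hσ₂]; simp only [denote, h3, hlit1]
  have hI₂ : I σ₂ := e₂ ▸ hImem σ₁ _ _ (.inr ⟨by omega, by omega⟩) hI₁
  set σ₃ := (assign (o + 1) (.lit 1)).denote w IL.oracle σ₂ with hσ₃
  have e₃ : σ₃ = σ₂.setReg (o + 1) 1 := by rw [hσ₃]; simp only [denote, hlit1]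
  have hI₃ : I σ₃ := e₃ ▸ hIreg σ₂ _ _ (by omega) hI₂
  refine loop_inv (fun j τ => I τ ∧ ∃ L : List (Fin n),
    Explored S R rk src L j (fun _ => False) (1 + j * d) ∧ Holds τ.mem b c L rk ∧
      τ.reg (o + 1) = L.length) (hIc σ₃ hI₃).2.2.2 ?_ ?_ ?_
  · rintro j τ x ⟨hI, L, h1, h2, h3⟩
    exact ⟨hIreg _ _ _ (by omega) hI, L, h1, h2, by simpa using h3⟩
  · refine ⟨hI₃, [src], by simpa using Explored.start hS, ⟨?_, ?_⟩, by simp [e₃]⟩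
    · intro i x hx
      have hi := (List.getElem?_eq_some_iff.1 hx).1
      simp only [List.length_singleton] at hi
      obtain rfl : i = 0 := by omega
      obtain rfl : src = x := by simpa using hx
      simp only [e₃, e₂, e₁, State.setReg_mem, State.setMem_mem]
      rw [if_neg (by omega)]; simp
    · intro v
      simp only [e₃, e₂, e₁, State.setReg_mem, State.setMem_mem, List.mem_singleton]
      by_cases hv : v = src
      · subst hv; simp [hS.rk_src]
      · have hv' : (v : ℕ) ≠ src := fun h => hv (Fin.ext h)
        rw [if_neg (by omega), if_neg (by omega), if_neg hv, hzero]
  -- the expansion of the vertex at position `j`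
  · rintro j - τ ⟨hI, L, hE, hH, hlen⟩ hj
    have hLn := hE.length_le_card
    by_cases hjL : j < L.length
    swap
    · rw [denote_ite_neg (by simp [eval_lt, eval_reg, hj, hlen, hjL])]
      refine ⟨hI, L, (hE.next hS fun x hx => ?_).congr (fun _ _ _ _ h => h.elim) (by
        rw [Nat.add_mul]; omega), hH, hlen⟩
      exact absurd (List.getElem?_eq_some_iff.1 hx).1 hjL
    rw [denote_ite_pos (by simp [eval_lt, eval_reg, hj, hlen, hjL])]
    simp only [denote_block_cons, denote_block_nil]
    set x := L[j] with hx
    have hxj : L[j]? = some x := List.getElem?_eq_getElem hjL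
    have hxS : x ∈ S := hE.mem x (List.mem_of_getElem? hxj)
    set τ₁ := (assign (o + 3) (.mem (.op .add (.reg bl) (.reg (o + 2))))).denote w IL.oracle τ
      with hτ₁
    have e₁ : τ₁ = τ.setReg (o + 3) (x + 1) := by
      have h3 : (Expr.op .add (.reg bl) (.reg (o + 2))).eval w τ = b + j := by
        rw [eval_add] <;> simp only [eval_reg, (hIc τ hI).1, hj]
        omega
      rw [hτ₁]; simp only [denote, eval_mem, h3, hH.list j x hxj]
    have hI₁ : I τ₁ := e₁ ▸ hIreg τ _ _ (by omega) hI
    have key := loop_inv (w := w) (O := IL.oracle) (i := o + 4) (N := 3) (σ := τ₁) (m := d)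
      (p := block [
        probe (o + 5) (.reg (o + 3)) (.op .add (.reg (o + 4)) (.lit 1)),
        test,
        ite (.reg (o + 6))
          (ite (.mem (.op .add (.reg bc) (.reg (o + 5)))) skip
            (block [
              store (.op .add (.reg bl) (.reg (o + 1))) (.reg (o + 5)),
              store (.op .add (.reg bc) (.reg (o + 5)))
                (.op .add (.mem (.op .add (.reg bc) (.reg (o + 3)))) (.lit 1)),
              assign (o + 1) (.op .add (.reg (o + 1)) (.lit 1))]))
          skip])
      (fun i τ => I τ ∧ τ.reg (o + 3) = x + 1 ∧ ∃ L : List (Fin n), L[j]? = some x ∧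
        Explored S R rk src L j (fun y => ∃ l < i, IL.oracle (x + 1) (l + 1) = y + 1)
          (1 + j * d + i) ∧ Holds τ.mem b c L rk ∧ τ.reg (o + 1) = L.length)
      (hIc τ₁ hI₁).2.2.1 ?_ ?_ ?_
    · obtain ⟨hI', -, L', hxj', hE', hH', hlen'⟩ := key
      refine ⟨hI', L', (hE'.next hS fun z hz y hzy => ?_).congr (fun _ _ _ _ h => h.elim) (by
        rw [Nat.add_mul]; omega), hH', hlen'⟩
      rw [hxj'] at hz
      cases hz
      exact IL.exists_oracle_eq hdeg (hS.adj x y hzy)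
    · rintro i τ z ⟨hI, h1, L, h2, h3, h4, h5⟩
      exact ⟨hIreg _ _ _ (by omega) hI, by simpa using h1, L, h2, h3, h4, by simpa using h5⟩
    · refine ⟨hI₁, by simp [e₁], L, hxj, hE.congr ?_ (by omega), by simpa [e₁] using hH,
        by simp [e₁, hlen]⟩
      rintro z - y - ⟨l, hl, -⟩
      omega
    -- the test of one neighbour
    · clear hτ₁ e₁ hI₁ hlen hH hE hj hI hxj
      clear_value x τ₁
      clear hx hjL hLn
      clear L
      rintro i hi τ ⟨hI, hx3, L, hxj, hE, hH, hlen⟩ hti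
      have hLn := hE.length_le_card
      simp only [denote_block_cons, denote_block_nil]
      set y₀ := IL.oracle (x + 1) (i + 1) with hy₀
      set ν := (probe (o + 5) (.reg (o + 3)) (.op .add (.reg (o + 4)) (.lit 1))).denote w
        IL.oracle τ with hν
      have eν : ν = τ.setReg (o + 5) y₀ := by
        have h3 : (Expr.op .add (.reg (o + 4)) (.lit 1)).eval w τ = i + 1 := by
          rw [eval_add] <;> simp only [eval_reg, hlit1, hti]
          omega
        rw [hν]; simp only [denote, h3, eval_reg, hx3, hy₀]
      have hIν : I ν := eν ▸ hIreg τ _ _ (by omega) hI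
      have hcases := IL.oracle_cases x i
      rw [← hy₀] at hcases
      obtain ⟨hI', hf, hreg, hmem⟩ := htest ν x y₀ hIν hxS (by simpa [eν] using hx3)
        (by simp [eν]) hcases
      set ν' := test.denote w IL.oracle ν with hν'
      have hr1 : ν'.reg (o + 1) = L.length := by
        rw [hreg 1 (by omega), eν]; simpa using hlen
      have hr3 : ν'.reg (o + 3) = x + 1 := by
        rw [hreg 3 (by omega), eν]; simpa using hx3
      have hr5 : ν'.reg (o + 5) = y₀ := by
        rw [hreg 5 (by omega), eν]; simp
      have hH' : Holds ν'.mem b c L rk := by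
        constructor
        · intro a z hz
          have ha := (List.getElem?_eq_some_iff.1 hz).1
          rw [hmem _ (.inl ⟨by omega, by omega⟩), eν]
          exact hH.list a z hz
        · intro v
          rw [hmem _ (.inr ⟨by omega, by omega⟩), eν]
          exact hH.rank v
      have hDle : ∀ {y : Fin n}, (∃ l < i + 1, IL.oracle (x + 1) (l + 1) = y + 1) →
          (∃ l < i, IL.oracle (x + 1) (l + 1) = y + 1) ∨ y₀ = y + 1 := by
        rintro y ⟨l, hl, hly⟩
        rcases Nat.lt_succ_iff_lt_or_eq.1 hl with hl | rfl
        exacts [.inl ⟨l, hl, hly⟩, .inr hly]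
      by_cases hflag : ν'.reg (o + 6) = 0
      · rw [denote_ite_neg (by simpa [eval_reg] using hflag)]
        refine ⟨hI', hr3, L, hxj, hE.congr ?_ (by omega), hH', hr1⟩
        intro z hz y hzy hD
        rw [hxj] at hz
        cases hz
        rcases hDle hD with hD | hD
        · exact .inl hD
        · exact absurd hflag (hf.2 ⟨y, hD, hzy⟩)
      rw [denote_ite_pos (by simpa [eval_reg] using hflag)]
      obtain ⟨y, hy, hxy⟩ := hf.1 hflag
      have hyn := y.2
      have hxn := x.2
      have hadr : (Expr.op .add (.reg bc) (.reg (o + 5))).eval w ν' = c + (y + 1) := by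
        rw [eval_add] <;> simp only [eval_reg, (hIc ν' hI').2.1, hr5, hy]
        omega
      by_cases hyL : y ∈ L
      · rw [denote_ite_pos (by rw [eval_mem, hadr, hH'.rank, if_pos hyL]; omega)]
        refine ⟨hI', hr3, L, hxj, hE.congr ?_ (by omega), hH', hr1⟩
        intro z hz y' hzy hD
        rcases hDle hD with hD | hD
        · exact .inl hD
        · obtain rfl : y' = y := Fin.ext (by omega)
          exact .inr hyL
      rw [denote_ite_neg (by rw [eval_mem, hadr, hH'.rank, if_neg hyL])]
      simp only [denote_block_cons, denote_block_nil]
      obtain ⟨hrk, hE'⟩ := hE.append hS hxj hxy hyL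
      have hLn' : L.length < n := by
        have := hE'.length_le_card
        simp at this
        omega
      set ν₁ := (store (.op .add (.reg bl) (.reg (o + 1))) (.reg (o + 5))).denote w IL.oracle ν'
        with hν₁
      have e₁ : ν₁ = ν'.setMem (b + L.length) (y + 1) := by
        have h3 : (Expr.op .add (.reg bl) (.reg (o + 1))).eval w ν' = b + L.length := by
          rw [eval_add] <;> simp only [eval_reg, (hIc ν' hI').1, hr1]
          omega
        rw [hν₁]; simp only [denote, h3, eval_reg, hr5, hy]
      have hI₁ : I ν₁ := e₁ ▸ hImem ν' _ _ (.inl ⟨by omega, by omega⟩) hI'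
      set ν₂ := (store (.op .add (.reg bc) (.reg (o + 5)))
        (.op .add (.mem (.op .add (.reg bc) (.reg (o + 3)))) (.lit 1))).denote w IL.oracle ν₁
        with hν₂
      have e₂ : ν₂ = ν₁.setMem (c + (y + 1)) (rk y + 1) := by
        have h1 : (Expr.op .add (.reg bc) (.reg (o + 5))).eval w ν₁ = c + (y + 1) := by
          rw [eval_add] <;> simp only [eval_reg, (hIc ν₁ hI₁).2.1]
          · rw [e₁, State.setMem_reg, hr5, hy]
          · rw [e₁, State.setMem_reg, hr5, hy]; omega
        have h2 : (Expr.op .add (.reg bc) (.reg (o + 3))).eval w ν₁ = c + (x + 1) := by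
          rw [eval_add] <;> simp only [eval_reg, (hIc ν₁ hI₁).2.1]
          · rw [e₁, State.setMem_reg, hr3]
          · rw [e₁, State.setMem_reg, hr3]; omega
        have h3 : ν₁.mem (c + (x + 1)) = rk y := by
          rw [e₁, State.setMem_mem, if_neg (by omega), hH'.rank,
            if_pos (List.mem_of_getElem? hxj), hrk]
        have h5 := hS.rk_le y (hS.step x hxS y hxy).1
        have h4 : (Expr.op .add (.mem (.op .add (.reg bc) (.reg (o + 3)))) (.lit 1)).eval w ν₁ =
            rk y + 1 := by
          rw [eval_add] <;> simp only [eval_mem, h2, h3, hlit1]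
          omega
        rw [hν₂]; simp only [denote, h1, h4]
      have hI₂ : I ν₂ := e₂ ▸ hImem ν₁ _ _ (.inr ⟨by omega, by omega⟩) hI₁
      set ν₃ := (assign (o + 1) (.op .add (.reg (o + 1)) (.lit 1))).denote w IL.oracle ν₂ with hν₃
      have e₃ : ν₃ = ν₂.setReg (o + 1) (L.length + 1) := by
        have h1 : ν₂.reg (o + 1) = L.length := by rw [e₂, e₁]; simpa using hr1
        have h2 : (Expr.op .add (.reg (o + 1)) (.lit 1)).eval w ν₂ = L.length + 1 := by
          rw [eval_add] <;> simp only [eval_reg, h1, hlit1]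
          omega
        rw [hν₃]; simp only [denote, h2]
      refine ⟨e₃ ▸ hIreg ν₂ _ _ (by omega) hI₂, ?_, L ++ [y], ?_, hE'.congr ?_ (by omega), ?_, ?_⟩
      · rw [e₃, e₂, e₁]; simpa using hr3
      · rw [List.getElem?_append_left (List.getElem?_eq_some_iff.1 hxj).1, hxj]
      · intro z _ y' _ hD
        rcases hDle hD with hD | hD
        · exact .inl (.inl hD)
        · exact .inl (.inr (Fin.ext (by omega)))
      · refine hH'.append hLn' hbc ?_ ?_ ?_ <;> rw [e₃, e₂, e₁]
        · simp only [State.setReg_mem, State.setMem_mem]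
          rw [if_neg (by omega), if_true]
        · simp
        · intro a h1 h2
          simp [h1, h2]
      · rw [e₃]; simp

end Spec

theorem eval_sub {w : ℕ} {σ : State} {a b : Expr} (h : b.eval w σ ≤ a.eval w σ)
    (ha : a.eval w σ < 2 ^ w) :
    (Expr.op .sub a b).eval w σ = a.eval w σ - b.eval w σ := by
  have : (Expr.op .sub a b).eval w σ = (a.eval w σ + 2 ^ w - b.eval w σ) % 2 ^ w := rfl
  rw [this, show a.eval w σ + 2 ^ w - b.eval w σ = (a.eval w σ - b.eval w σ) + 2 ^ w by omega,
    Nat.add_mod_right, Nat.mod_eq_of_lt (by omega)]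

namespace FProg

/-- Resetting the table of ranks after an exploration. -/
def wipe (o bl bc N : ℕ) : FProg :=
  loop (o + 7) N (ite (.op .lt (.reg (o + 7)) (.reg (o + 1)))
    (store (.op .add (.reg bc) (.mem (.op .add (.reg bl) (.reg (o + 7))))) (.lit 0)) skip)

/-- After `wipe` the table of ranks is empty. `I` is any property of states that it preserves. -/
theorem wipe_spec {n w : ℕ} {O : ℕ → ℕ → ℕ} (I : State → Prop) {o bl bc N b c Nv : ℕ}
    {L : List (Fin n)} {rk : Fin n → ℕ} (hLn : L.length ≤ n) (hLN : L.length ≤ Nv)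
    (hbc : b + n + 2 ≤ c) (hcw : c + n + 2 < 2 ^ w)
    (hIreg : ∀ τ x, I τ → I (τ.setReg (o + 7) x))
    (hImem : ∀ τ a x, (c ≤ a ∧ a < c + n + 2) → I τ → I (τ.setMem a x))
    (hIc : ∀ τ, I τ → τ.reg bl = b ∧ τ.reg bc = c ∧ τ.reg N = Nv ∧ τ.reg (o + 1) = L.length)
    {σ : State} (hσ : I σ) (hH : Holds σ.mem b c L rk) :
    I ((wipe o bl bc N).denote w O σ) ∧
      ∀ v : Fin n, ((wipe o bl bc N).denote w O σ).mem (c + (v + 1)) = 0 := by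
  have key := loop_inv (w := w) (O := O) (i := o + 7) (N := N) (σ := σ) (m := Nv)
    (p := ite (.op .lt (.reg (o + 7)) (.reg (o + 1)))
      (store (.op .add (.reg bc) (.mem (.op .add (.reg bl) (.reg (o + 7))))) (.lit 0)) skip)
    (fun j τ => I τ ∧ (∀ (i : ℕ) (x : Fin n), L[i]? = some x → τ.mem (b + i) = x + 1) ∧
      (∀ v : Fin n, v ∉ L → τ.mem (c + (v + 1)) = 0) ∧
      ∀ i < j, ∀ x : Fin n, L[i]? = some x → τ.mem (c + (x + 1)) = 0)
    (hIc σ hσ).2.2.1 ?_ ?_ ?_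
  · obtain ⟨h1, -, h2, h3⟩ := key
    refine ⟨h1, fun v => ?_⟩
    by_cases hv : v ∈ L
    · obtain ⟨i, hi⟩ := List.mem_iff_getElem?.1 hv
      have := (List.getElem?_eq_some_iff.1 hi).1
      exact h3 i (by omega) v hi
    · exact h2 v hv
  · rintro j τ x ⟨h1, h2⟩
    exact ⟨hIreg _ _ h1, h2⟩
  · refine ⟨hσ, hH.list, fun v hv => ?_, by intro i hi; omega⟩
    rw [hH.rank, if_neg hv]
  · rintro j - τ ⟨hI, h1, h2, h3⟩ hj
    obtain ⟨c1, c2, c3, c4⟩ := hIc τ hI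
    by_cases hjL : j < L.length
    · rw [denote_ite_pos (by simp [eval_lt, eval_reg, hj, c4, hjL])]
      have hx : L[j]? = some L[j] := List.getElem?_eq_getElem hjL
      have hxn := L[j].2
      have e1 : (Expr.op .add (.reg bl) (.reg (o + 7))).eval w τ = b + j := by
        rw [eval_add] <;> simp only [eval_reg, c1, hj]
        omega
      have e2 : (Expr.op .add (.reg bc) (.mem (.op .add (.reg bl) (.reg (o + 7))))).eval w τ =
          c + (L[j] + 1) := by
        rw [eval_add] <;> simp only [eval_mem, e1, eval_reg, c2, h1 j _ hx]
        omega
      have e3 : (Expr.lit 0).eval w τ = 0 := Nat.zero_mod _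
      simp only [denote, e2, e3]
      refine ⟨hImem _ _ _ ⟨by omega, by omega⟩ hI, ?_, ?_, ?_⟩
      · intro i x hi
        have := (List.getElem?_eq_some_iff.1 hi).1
        rw [State.setMem_mem, if_neg (by omega), h1 i x hi]
      · intro v hv
        rw [State.setMem_mem, h2 v hv, ite_self]
      · intro i hi x hix
        rw [State.setMem_mem]
        rcases Nat.lt_succ_iff_lt_or_eq.1 hi with hi | rfl
        · rw [h3 i hi x hix, ite_self]
        · rw [hx] at hix
          cases hix
          rw [if_pos rfl]
    · rw [denote_ite_neg (by simp [eval_lt, eval_reg, hj, c4, hjL])]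
      refine ⟨hI, h1, h2, fun i hi x hix => h3 i ?_ x hix⟩
      have := (List.getElem?_eq_some_iff.1 hix).1
      omega

end FProg

/-- The data of a run: the graph with its incidence lists, the parameters, the seed and the word size,
which has to be large enough for all numbers that occur. -/
structure Setup where
  n : ℕ
  d : ℕ
  k : ℕ
  s : ℕ
  w : ℕ
  q : ℕ
  θ : ℕ
  G : SimpleGraph (Fin n)
  L : IncidenceLists G
  ρ : Fin (2 * k * d) → Fin q
  conn : G.Connected
  deg : ∀ v, (G.neighborSet v).ncard ≤ d
  two_le_k : 2 ≤ k
  two_le_s : 2 ≤ s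
  one_le_d : 1 ≤ d
  lt_q : n < q
  bound : q * q + q + 2 * k * d + 8 * (n + 2) + θ + ((s * d + 1) * d + 1) + s + k * d + 10 < 2 ^ w

namespace Setup

variable (P : Setup)

/-- The set of centers. -/
abbrev W : Set (Fin P.n) := centers P.n P.θ P.ρ

/-- The address of the `i`-th array, behind the seed. -/
def base (i : ℕ) : ℕ := 2 * P.k * P.d + i * (P.n + 2)

/-- The registers below `20` other than the first two hold the parameters and the addresses of the arrays,
and the memory holds the seed. -/
structure Ctx (τ : State) : Prop where
  r2 : τ.reg 2 = P.n
  r3 : τ.reg 3 = P.d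
  r4 : τ.reg 4 = P.k
  r5 : τ.reg 5 = P.s
  r6 : τ.reg 6 = 2 * P.k * P.d
  r7 : τ.reg 7 = P.q
  r8 : τ.reg 8 = P.θ
  r9 : τ.reg 9 = P.base 0
  r10 : τ.reg 10 = P.base 1
  r11 : τ.reg 11 = P.base 2
  r12 : τ.reg 12 = P.base 3
  r13 : τ.reg 13 = P.base 4
  r14 : τ.reg 14 = P.base 5
  r15 : τ.reg 15 = P.base 6
  r16 : τ.reg 16 = P.k * P.d + 1
  r17 : τ.reg 17 = P.s * P.d + 1
  r18 : τ.reg 18 = (P.s * P.d + 1) * P.d + 1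
  seed : ∀ j (h : j < 2 * P.k * P.d), τ.mem j = P.ρ ⟨j, h⟩

/-- `σ` and `τ` agree on the registers below `r` and on the memory except the arrays `i` to `j - 1`. -/
def Agree (r i j : ℕ) (σ τ : State) : Prop :=
  (∀ x < r, τ.reg x = σ.reg x) ∧ ∀ a, a < P.base i ∨ P.base j ≤ a → τ.mem a = σ.mem a

variable {P}

theorem Agree.refl {r i j : ℕ} (σ : State) : P.Agree r i j σ σ := ⟨fun _ _ => rfl, fun _ _ => rfl⟩

theorem base_mono {i j : ℕ} (h : i ≤ j) : P.base i ≤ P.base j :=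
  Nat.add_le_add_left (Nat.mul_le_mul_right _ h) _

theorem base_succ (i : ℕ) : P.base (i + 1) = P.base i + (P.n + 2) := by
  unfold base; ring

theorem base_lt {i : ℕ} (h : i ≤ 7) : P.base i + P.n + 2 < 2 ^ P.w := by
  have h1 := P.bound
  have h2 : i * (P.n + 2) ≤ 7 * (P.n + 2) := Nat.mul_le_mul_right _ h
  unfold base
  omega

theorem Agree.trans {r i j : ℕ} {σ τ υ : State} (h : P.Agree r i j σ τ) (h' : P.Agree r i j τ υ) :
    P.Agree r i j σ υ :=
  ⟨fun x hx => (h'.1 x hx).trans (h.1 x hx), fun a ha => (h'.2 a ha).trans (h.2 a ha)⟩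

theorem Agree.mono {r i j r' i' j' : ℕ} {σ τ : State} (h : P.Agree r i j σ τ) (hr : r' ≤ r)
    (hi : i' ≤ i) (hj : j ≤ j') : P.Agree r' i' j' σ τ :=
  ⟨fun x hx => h.1 x (by omega), fun a ha => h.2 a (ha.imp
    (fun ha => ha.trans_le (base_mono hi)) (fun ha => (base_mono hj).trans ha))⟩

theorem Agree.setReg {r i j : ℕ} {σ τ : State} (h : P.Agree r i j σ τ) {m : ℕ} (hm : r ≤ m)
    (x : ℕ) : P.Agree r i j σ (τ.setReg m x) :=
  ⟨fun y hy => by rw [State.setReg_reg, if_neg (by omega), h.1 y hy], h.2⟩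

theorem Agree.setMem {r i j : ℕ} {σ τ : State} (h : P.Agree r i j σ τ) {a : ℕ}
    (ha : P.base i ≤ a ∧ a < P.base j) (x : ℕ) : P.Agree r i j σ (τ.setMem a x) :=
  ⟨h.1, fun b hb => by rw [State.setMem_mem, if_neg (by omega), h.2 b hb]⟩

theorem seed_lt_base (i : ℕ) : 2 * P.k * P.d ≤ P.base i := Nat.le_add_right _ _

theorem Ctx.of_agree {r i j : ℕ} {σ τ : State} (hσ : P.Ctx σ) (h : P.Agree r i j σ τ)
    (hr : 20 ≤ r) : P.Ctx τ := by
  constructor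
  case seed =>
    intro a ha
    rw [h.2 a (.inl (ha.trans_le (seed_lt_base i)))]
    exact hσ.seed a ha
  all_goals rw [h.1 _ (by omega)]
  exacts [hσ.r2, hσ.r3, hσ.r4, hσ.r5, hσ.r6, hσ.r7, hσ.r8, hσ.r9, hσ.r10, hσ.r11, hσ.r12, hσ.r13,
    hσ.r14, hσ.r15, hσ.r16, hσ.r17, hσ.r18]

/-- The table of ranks in the array `i` is empty. -/
def Zero (P : Setup) (i : ℕ) (τ : State) : Prop := ∀ v : Fin P.n, τ.mem (P.base i + (v + 1)) = 0

theorem Zero.of_agree {r i j m : ℕ} {σ τ : State} (hσ : P.Zero m σ) (h : P.Agree r i j σ τ)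
    (hm : m < i ∨ j ≤ m) : P.Zero m τ := by
  intro v
  rw [h.2, hσ v]
  have hv := v.2
  rcases hm with hm | hm
  · have := base_mono (P := P) (show m + 1 ≤ i by omega)
    rw [base_succ] at this
    left; omega
  · have := base_mono (P := P) hm
    right; omega

end Setup

/-! ### Hash values -/

namespace FProg

/-- The hash value of the number in register `90`, in register `91`. -/
def hash : FProg := block [
  assign 91 (.lit 0),
  assign 92 (.lit 1),
  loop 93 6 (block [
    assign 91 (.op .mod (.op .add (.reg 91) (.op .mul (.mem (.reg 93)) (.reg 92))) (.reg 7)),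
    assign 92 (.op .mod (.op .mul (.reg 92) (.reg 90)) (.reg 7))])]

end FProg

namespace Setup

variable {P : Setup}
open FProg

/-- The program keeps the current power of `x` and the partial sum, both reduced modulo `q`, so that the products
fit into a word. -/
theorem hash_spec {O : ℕ → ℕ → ℕ} {σ : State} (hσ : P.Ctx σ) {x : ℕ} (hx : σ.reg 90 = x)
    (hxn : x ≤ P.n) :
    (hash.denote P.w O σ).reg 91 = hashValue P.ρ x ∧ (hash.denote P.w O σ).mem = σ.mem := by
  have hq := P.lt_q
  have hB := P.bound
  have hq1 : 1 ≤ P.q := by omega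
  simp only [FProg.hash, denote_block_cons, denote_block_nil]
  set f : ℕ → ℕ := fun i => if h : i < 2 * P.k * P.d then (P.ρ ⟨i, h⟩ : ℕ) else 0 with hf
  have hsum : ∑ j : Fin (2 * P.k * P.d), (P.ρ j : ℕ) * x ^ (j : ℕ) =
      ∑ i ∈ Finset.range (2 * P.k * P.d), f i * x ^ i := by
    rw [Finset.sum_range]
    refine Finset.sum_congr rfl fun j _ => ?_
    simp [hf]
  unfold hashValue
  rw [hsum]
  have hn1 : 1 ≤ P.n := by
    obtain ⟨v⟩ := P.conn.nonempty
    have := v.2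
    omega
  -- The invariant: partial sum and power modulo `q`.
  have key := loop_inv (w := P.w) (O := O) (i := 93) (N := 6)
    (σ := (assign 92 (.lit 1)).denote P.w O ((assign 91 (.lit 0)).denote P.w O σ))
    (m := 2 * P.k * P.d) (p := block [
      assign 91 (.op .mod (.op .add (.reg 91) (.op .mul (.mem (.reg 93)) (.reg 92))) (.reg 7)),
      assign 92 (.op .mod (.op .mul (.reg 92) (.reg 90)) (.reg 7))])
    (fun j τ => τ.mem = σ.mem ∧ τ.reg 7 = P.q ∧ τ.reg 90 = x ∧
      τ.reg 91 = (∑ i ∈ Finset.range j, f i * x ^ i) % P.q ∧ τ.reg 92 = x ^ j % P.q)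
    (by simp [denote, hσ.r6]) ?_ ?_ ?_
  · exact ⟨key.2.2.2.1, key.1⟩
  · rintro j τ y ⟨h1, h2, h3, h4, h5⟩
    exact ⟨h1, by simpa using h2, by simpa using h3, by simpa using h4, by simpa using h5⟩
  · refine ⟨rfl, by simp [denote, hσ.r7], by simp [denote, hx], by simp [denote, Expr.eval], ?_⟩
    simp only [denote, State.setReg_reg, if_true, pow_zero]
    rw [eval_lit (by omega), Nat.mod_eq_of_lt (by omega)]
  · rintro j hj τ ⟨h1, h2, h3, h4, h5⟩ hji
    have hmem : τ.mem j = f j := by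
      rw [h1, hσ.seed j hj]; simp [hf, hj]
    have hfj : f j < P.q := by
      simp only [hf, hj, dif_pos]; exact (P.ρ _).2
    have ha : (∑ i ∈ Finset.range j, f i * x ^ i) % P.q < P.q := Nat.mod_lt _ hq1
    have hp : x ^ j % P.q < P.q := Nat.mod_lt _ hq1
    have hm1 : f j * (x ^ j % P.q) ≤ P.q * P.q := Nat.mul_le_mul hfj.le hp.le
    have hm2 : x ^ j % P.q * x ≤ P.q * P.q := Nat.mul_le_mul hp.le (by omega)
    have e1 : (Expr.op .mul (.mem (.reg 93)) (.reg 92)).eval P.w τ = f j * (x ^ j % P.q) := by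
      rw [eval_mul] <;> simp only [eval_mem, eval_reg, hji, hmem, h5]
      omega
    have e2 : (Expr.op .mod (.op .add (.reg 91) (.op .mul (.mem (.reg 93)) (.reg 92)))
        (.reg 7)).eval P.w τ = (∑ i ∈ Finset.range (j + 1), f i * x ^ i) % P.q := by
      rw [eval_mod, eval_add] <;> simp only [e1, eval_reg, h4, h2]
      · rw [Finset.sum_range_succ]
        conv_rhs => rw [Nat.add_mod, Nat.mul_mod]
        conv_lhs => rw [Nat.add_mod, Nat.mul_mod]
        simp
      · omega
    have e3 : ∀ y, (Expr.op .mod (.op .mul (.reg 92) (.reg 90)) (.reg 7)).eval P.w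
        (τ.setReg 91 y) = x ^ (j + 1) % P.q := by
      intro y
      rw [eval_mod, eval_mul] <;> simp only [eval_reg, State.setReg_reg, Nat.reduceEqDiff, if_false,
        h5, h3, h2]
      · rw [pow_succ, Nat.mod_mul_mod]
      · omega
    simp only [denote_block_cons, denote_block_nil]
    simp only [denote, e2, e3]
    exact ⟨h1, by simpa using h2, by simpa using h3, by simp, by simp⟩

theorem mem_centers_iff {n t q θ : ℕ} {ρ : Fin t → Fin q} {v : Fin n} :
    v ∈ centers n θ ρ ↔ hashValue ρ (v + 1) < θ := Iff.rfl

end Setup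

/-! ### Exploring the graph -/

namespace FProg

/-- Exploration of the graph from the vertex in register `80`. -/
def bfs : FProg := explore 80 9 10 4 (assign 86 (.reg 85))

/-- The table of ranks is reset after an exploration of the graph. -/
def bfsWipe : FProg := wipe 80 9 10 16

end FProg

theorem dist_le_card {n : ℕ} {G : SimpleGraph (Fin n)} (hG : G.Connected) (v x : Fin n) :
    G.dist v x < n := by
  have : G.dist v x + 1 ≤ (Set.univ : Set (Fin n)).ncard := by
    refine le_ncard_of_levels (f := G.dist v) (b := 0) fun i hi => ?_
    obtain ⟨y, hy, -⟩ := exists_on_geodesic hG (v := v) (x := x) (i := i) (by omega)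
    exact ⟨y, Set.mem_univ _, by omega⟩
  simpa using this

/-- The exploration of the whole graph from `v`, by distance. -/
theorem layering_graph {n : ℕ} {G : SimpleGraph (Fin n)} (hG : G.Connected) (v : Fin n) :
    Layering G Set.univ G.Adj (G.dist v) v where
  src_mem := Set.mem_univ v
  rk_src := SimpleGraph.dist_self
  eq_src x _ hx := (hG.dist_eq_zero_iff.1 hx).symm
  step x _ y hxy := ⟨Set.mem_univ y, dist_le_dist_add_one hG hxy⟩
  pred y _ r hr := by
    obtain ⟨x, hx, hd⟩ := exists_adj_dist_add_one hG (v := v) (x := y) (by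
      rintro rfl; simp at hr)
    exact ⟨x, Set.mem_univ x, by omega, hx⟩
  adj _ _ h := h
  rk_le x _ := (dist_le_card hG v x).le

/-- The first `k` vertices in breadth-first order determine `B_k(v)`. -/
theorem Explored.bfsBall_eq {n : ℕ} {G : SimpleGraph (Fin n)} (hG : G.Connected) {v : Fin n}
    {L : List (Fin n)} {k m : ℕ} {D : Fin n → Prop} (hk : 1 ≤ k)
    (h : Explored Set.univ G.Adj (G.dist v) v L k D m) :
    (L.length < k ∧ bfsBall G k v = Set.univ ∧ (∀ x, x ∈ L)) ∨
      ∃ x, L[k - 1]? = some x ∧ bfsBall G k v = {y | y ∈ L ∧ G.dist v y ≤ G.dist v x} := by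
  rcases lt_or_ge L.length k with hL | hL
  · left
    have hall := h.mem_iff_of_length_le (layering_graph hG v) hL.le
    refine ⟨hL, ?_, fun x => (hall x).2 trivial⟩
    rcases bfsDepth_spec G k v with h1 | h1
    · have h2 : (bfsBall G k v).ncard ≤ L.toFinset.card := by
        rw [← Set.ncard_coe_finset]
        exact Set.ncard_le_ncard (fun x _ => by simpa using (hall x).2 trivial) (Set.toFinite _)
      have h3 := List.toFinset_card_le L
      omega
    · exact h1
  · right
    have hx : L[k - 1]? = some L[k - 1] := List.getElem?_eq_getElem (by omega)
    refine ⟨_, hx, ?_⟩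
    have hd : bfsDepth G k v = G.dist v L[k - 1] := by
      refine le_antisymm (bfsDepth_le (.inl ?_)) ?_
      · have := h.lt_ncard hx (T := ball G v (G.dist v L[k - 1])) (fun y _ hy => hy)
        omega
      · by_contra hlt
        have hsub : bfsBall G k v ⊆ {y | G.dist v y < G.dist v L[k - 1]} := by
          intro y hy
          have hy : G.dist v y ≤ bfsDepth G k v := hy
          exact show G.dist v y < _ by omega
        rcases bfsDepth_spec G k v with h1 | h1
        · have h2 := Set.ncard_le_ncard hsub (Set.toFinite _)
          have h3 := h.ncard_lt hx (by omega) (T := {y | G.dist v y < G.dist v L[k - 1]})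
            (fun y hy => ⟨trivial, hy⟩)
          omega
        · rw [h1] at hsub
          exact absurd (hsub (Set.mem_univ L[k - 1])) (lt_irrefl (G.dist v L[k - 1]))
    ext y
    simp only [Set.mem_ofPred_eq, bfsBall, hd, ball]
    exact ⟨fun hy => ⟨h.full _ (by omega) _ hx y trivial hy, hy⟩, fun hy => hy.2⟩

namespace Setup

variable {P : Setup}
open FProg

/-- Expanding `k` vertices suffices to discover at least `k` vertices or all. -/
theorem bfs_spec {σ : State} (hσ : P.Ctx σ) (hz : P.Zero 1 σ) {y : Fin P.n}
    (hy : σ.reg 80 = y + 1) :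
    P.Agree 81 0 2 σ (bfs.denote P.w P.L.oracle σ) ∧ ∃ L : List (Fin P.n),
      Explored Set.univ P.G.Adj (P.G.dist y) y L P.k (fun _ => False) (1 + P.k * P.d) ∧
      Holds (bfs.denote P.w P.L.oracle σ).mem (P.base 0) (P.base 1) L (P.G.dist y) ∧
      (bfs.denote P.w P.L.oracle σ).reg 81 = L.length := by
  have h01 : P.base 1 = P.base 0 + (P.n + 2) := base_succ 0
  have h12 : P.base 2 = P.base 1 + (P.n + 2) := base_succ 1
  have hw := base_lt (P := P) (i := 1) (by omega)
  have hB := P.bound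
  refine explore_spec (o := 80) (bl := 9) (bc := 10) (N := 4) (c := P.base 1)
    (fun τ => P.Agree 81 0 2 σ τ) (layering_graph P.conn y) P.L P.deg (by omega) (by omega) ?_
    ?_ ?_ ?_ ?_ (Agree.refl σ) hy hz
  · have : P.d ≤ P.k * P.d := Nat.le_mul_of_pos_left _ (by have := P.two_le_k; omega)
    omega
  · intro τ i x hi hI
    exact hI.setReg (by omega) x
  · intro τ a x ha hI
    exact hI.setMem (by omega) x
  · intro τ hI
    have := hσ.of_agree hI (by omega)
    exact ⟨this.r9, this.r10, this.r3, this.r4⟩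
  · intro τ x y₀ hI _ h3 h5 hy₀
    simp only [denote, eval_reg, h5]
    refine ⟨hI.setReg (by omega) _, ?_, ?_, fun _ _ => rfl⟩
    · simp only [State.setReg_reg, if_true]
      rcases hy₀ with rfl | ⟨y, hxy, rfl⟩
      · simp
      · exact ⟨fun _ => ⟨y, rfl, hxy⟩, fun _ => by omega⟩
    · intro i hi
      rw [State.setReg_reg, if_neg (by omega)]

theorem bfsWipe_spec {O : ℕ → ℕ → ℕ} {σ : State} (hσ : P.Ctx σ) {L : List (Fin P.n)}
    {rk : Fin P.n → ℕ} (hLn : L.length ≤ P.n) (hL : L.length ≤ 1 + P.k * P.d)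
    (hH : Holds σ.mem (P.base 0) (P.base 1) L rk) (hlen : σ.reg 81 = L.length) :
    P.Agree 87 0 2 σ (bfsWipe.denote P.w O σ) ∧ P.Zero 1 (bfsWipe.denote P.w O σ) := by
  have h01 : P.base 1 = P.base 0 + (P.n + 2) := base_succ 0
  have h12 : P.base 2 = P.base 1 + (P.n + 2) := base_succ 1
  have hw := base_lt (P := P) (i := 1) (by omega)
  refine wipe_spec (o := 80) (bl := 9) (bc := 10) (N := 16) (c := P.base 1) (Nv := P.k * P.d + 1)
    (fun τ => P.Agree 87 0 2 σ τ) hLn (by omega) (by omega) (by omega) ?_ ?_ ?_ (Agree.refl σ) hH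
  · intro τ x hI
    exact hI.setReg (by omega) x
  · intro τ a x ha hI
    exact hI.setMem (by omega) x
  · intro τ hI
    have := hσ.of_agree hI (by omega)
    exact ⟨this.r9, this.r10, this.r16, (hI.1 81 (by omega)).trans hlen⟩

end Setup

/-! ### Tests -/

namespace Expr

/-- Conjunction of tests. -/
def and (a b : Expr) : Expr := .op .mul a b

/-- Disjunction of tests. -/
def or (a b : Expr) : Expr := .op .lt (.lit 0) (.op .add a b)

/-- The expression `e` has the value `1` if `p` holds, and `0` otherwise. -/
def Tests (w : ℕ) (σ : State) (e : Expr) (p : Prop) : Prop :=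
  (p → e.eval w σ = 1) ∧ (¬ p → e.eval w σ = 0)

variable {w : ℕ} {σ : State} {a b : Expr} {p q : Prop}

theorem tests_lt {x y : ℕ} (ha : a.eval w σ = x) (hb : b.eval w σ = y) :
    Tests w σ (.op .lt a b) (x < y) :=
  ⟨fun h => by rw [eval_lt, ha, hb, if_pos h], fun h => by rw [eval_lt, ha, hb, if_neg h]⟩

theorem tests_eq {x y : ℕ} (ha : a.eval w σ = x) (hb : b.eval w σ = y) :
    Tests w σ (.op .eq a b) (x = y) :=
  ⟨fun h => by rw [eval_eq, ha, hb, if_pos h], fun h => by rw [eval_eq, ha, hb, if_neg h]⟩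

theorem Tests.and (hw : 2 < 2 ^ w) (ha : Tests w σ a p) (hb : Tests w σ b q) :
    Tests w σ (a.and b) (p ∧ q) := by
  unfold Expr.and
  constructor
  · rintro ⟨h1, h2⟩
    rw [eval_mul] <;> rw [ha.1 h1, hb.1 h2]
    omega
  · intro h
    by_cases h1 : p
    · have h2 : b.eval w σ = 0 := hb.2 fun h2 => h ⟨h1, h2⟩
      rw [eval_mul] <;> rw [h2]
      · rfl
      · omega
    · rw [eval_mul] <;> rw [ha.2 h1, Nat.zero_mul]
      omega

theorem Tests.or (hw : 2 < 2 ^ w) (ha : Tests w σ a p) (hb : Tests w σ b q) :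
    Tests w σ (a.or b) (p ∨ q) := by
  unfold Expr.or
  have e : (Expr.op .add a b).eval w σ = a.eval w σ + b.eval w σ := by
    apply eval_add
    by_cases h1 : p <;> by_cases h2 : q <;> simp only [ha.1, ha.2, hb.1, hb.2, h1, h2, not_false_eq_true] <;> omega
  have e0 : (Expr.lit 0).eval w σ = 0 := Nat.zero_mod _
  constructor
  · intro h
    rw [eval_lt, if_pos]
    rw [e, e0]
    rcases h with h | h
    · rw [ha.1 h]; omega
    · rw [hb.1 h]; omega
  · intro h
    push Not at h
    rw [eval_lt, if_neg]
    rw [e, e0, ha.2 h.1, hb.2 h.2]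
    omega

theorem Tests.ne_zero (h : Tests w σ a p) : a.eval w σ ≠ 0 ↔ p := by
  by_cases hp : p
  · simp [h.1 hp, hp]
  · simp [h.2 hp, hp]

end Expr

theorem FProg.denote_ite_of_tests {w : ℕ} {O : ℕ → ℕ → ℕ} {e : Expr} {p q : FProg} {σ : State}
    {c : Prop} (h : e.Tests w σ c) :
    (c ∧ (ite e p q).denote w O σ = p.denote w O σ) ∨
      (¬ c ∧ (ite e p q).denote w O σ = q.denote w O σ) := by
  by_cases hc : c
  · exact .inl ⟨hc, denote_ite_pos (h.ne_zero.2 hc)⟩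
  · exact .inr ⟨hc, denote_ite_neg (h.2 hc)⟩

theorem eval_address {w : ℕ} {σ : State} {i j b x : ℕ} (hi : σ.reg i = b) (hj : σ.reg j = x)
    (h : b + x < 2 ^ w) : (Expr.op .add (.reg i) (.reg j)).eval w σ = b + x := by
  rw [eval_add] <;> simp only [eval_reg, hi, hj]
  exact h

theorem eval_succ {w : ℕ} {σ : State} {i x : ℕ} (hi : σ.reg i = x) (h : x + 1 < 2 ^ w) :
    (Expr.op .add (.reg i) (.lit 1)).eval w σ = x + 1 := by
  have h1 : (Expr.lit 1).eval w σ = 1 := eval_lit (by omega)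
  rw [eval_add] <;> simp only [eval_reg, hi, h1]
  exact h

theorem eval_zero {w : ℕ} {σ : State} : (Expr.lit 0).eval w σ = 0 := Nat.zero_mod _

/-! ### The center and the parent of a vertex -/

namespace FProg

open SSG.Expr in
/-- The search for the center of the vertex in register `60`: its identifier is left in register `61`
and its distance plus one in register `62`, or `0` in both if the vertex is remote. -/
def center : FProg := block [
  assign 61 (.lit 0),
  assign 62 (.lit 0),
  assign 80 (.reg 60),
  bfs,
  ite (.op .lt (.reg 81) (.reg 4)) (assign 64 (.op .add (.reg 2) (.lit 2)))
    (assign 64 (.mem (.op .add (.reg 10)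
      (.mem (.op .add (.reg 9) (.op .sub (.reg 4) (.lit 1))))))),
  loop 65 16 (ite (.op .lt (.reg 65) (.reg 81)) (block [
    assign 90 (.mem (.op .add (.reg 9) (.reg 65))),
    assign 66 (.mem (.op .add (.reg 10) (.reg 90))),
    hash,
    ite (Expr.and (Expr.and (.op .lt (.reg 91) (.reg 8)) (.op .lt (.reg 66) (.op .add (.reg 64) (.lit 1))))
        (Expr.or (.op .eq (.reg 61) (.lit 0)) (Expr.or (.op .lt (.reg 66) (.reg 62))
          (Expr.and (.op .eq (.reg 66) (.reg 62)) (.op .lt (.reg 90) (.reg 61))))))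
      (block [assign 61 (.reg 90), assign 62 (.reg 66)]) skip]) skip),
  bfsWipe]

/-- The rank, in the exploration from the vertex in register `69`, of the vertex in register `61`,
plus one, or `0` if the latter is not found. -/
def rankOf : FProg := block [
  assign 80 (.reg 69),
  bfs,
  assign 70 (.mem (.op .add (.reg 10) (.reg 61))),
  bfsWipe]

/-- The center and the parent of the vertex in register `60`: as `center`, with the identifier of the parent
in register `63`, or `0` if there is none. -/
def parent : FProg := block [
  center,
  assign 63 (.lit 0),
  ite (.op .lt (.lit 1) (.reg 62)) (loop 68 3 (block [
    probe 69 (.reg 60) (.op .add (.reg 68) (.lit 1)),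
    ite (.reg 69) (block [
      rankOf,
      ite (Expr.and (.op .eq (.op .add (.reg 70) (.lit 1)) (.reg 62))
          (Expr.or (.op .eq (.reg 63) (.lit 0)) (.op .lt (.reg 69) (.reg 63))))
        (assign 63 (.reg 69)) skip]) skip])) skip]

end FProg

namespace Setup

variable {P : Setup}
open FProg SSG.Expr

theorem Agree.mem_eq {r i : ℕ} {σ τ : State} (h : P.Agree r i i σ τ) : τ.mem = σ.mem :=
  funext fun a => h.2 a (lt_or_ge _ _)

theorem ten_lt (P : Setup) : P.n + 10 < 2 ^ P.w := by have := P.bound; omega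

theorem hash_agree {O : ℕ → ℕ → ℕ} {σ : State} (hσ : P.Ctx σ) {x : ℕ} (hx : σ.reg 90 = x)
    (hxn : x ≤ P.n) : P.Agree 91 0 0 σ (hash.denote P.w O σ) :=
  ⟨fun r hr => denote_reg_of_notMem (by simp [FProg.hash, block, writes]; omega) σ,
    fun _ _ => by rw [(hash_spec hσ hx hxn).2]⟩

/-- The first vertex in the order of distance from `y` and of identifiers that satisfies `C` is coded
by `c` and `l`; both are `0` if there is none. -/
def Best (P : Setup) (y : Fin P.n) (C : Fin P.n → Prop) (c l : ℕ) : Prop :=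
  (c = 0 ∧ l = 0 ∧ ∀ x, ¬ C x) ∨ ∃ w : Fin P.n, C w ∧ c = w + 1 ∧ l = P.G.dist y w + 1 ∧
    ∀ x, C x → P.G.dist y w < P.G.dist y x ∨ (P.G.dist y w = P.G.dist y x ∧ w ≤ x)

theorem Best.congr {y : Fin P.n} {C C' : Fin P.n → Prop} {c l : ℕ} (h : P.Best y C c l)
    (hC : ∀ x, C x ↔ C' x) : P.Best y C' c l := by
  obtain rfl : C = C' := funext fun x => propext (hC x)
  exact h

theorem Best.insert_pos {y z : Fin P.n} {C : Fin P.n → Prop} {c l : ℕ} (h : P.Best y C c l)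
    (hz : c = 0 ∨ P.G.dist y z + 1 < l ∨ (P.G.dist y z + 1 = l ∧ z + 1 < c)) :
    P.Best y (fun x => C x ∨ x = z) (z + 1) (P.G.dist y z + 1) := by
  refine .inr ⟨z, .inr rfl, rfl, rfl, fun x hx => ?_⟩
  rcases hx with hx | rfl
  swap
  · exact .inr ⟨rfl, le_rfl⟩
  rcases h with ⟨-, -, h⟩ | ⟨w, h1, h2, h3, h4⟩
  · exact absurd hx (h x)
  · rcases h4 x hx with h4 | ⟨h4, h5⟩
    · left; omega
    · rw [Fin.le_def] at h5 ⊢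
      omega

theorem Best.insert_neg {y z : Fin P.n} {C : Fin P.n → Prop} {c l : ℕ} (h : P.Best y C c l)
    (hz : ¬ (c = 0 ∨ P.G.dist y z + 1 < l ∨ (P.G.dist y z + 1 = l ∧ z + 1 < c))) :
    P.Best y (fun x => C x ∨ x = z) c l := by
  push Not at hz
  rcases h with ⟨h, -⟩ | ⟨w, h1, h2, h3, h4⟩
  · exact absurd h hz.1
  · refine .inr ⟨w, .inl h1, h2, h3, fun x hx => ?_⟩
    rcases hx with hx | rfl
    · exact h4 x hx
    · rw [Fin.le_def]
      have := hz.2.2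
      omega

/-- The outcome of the search for the center of `y`. -/
def IsCenterCode (P : Setup) (y : Fin P.n) (c l : ℕ) : Prop :=
  (y ∈ remote P.G P.W P.k ∧ c = 0 ∧ l = 0) ∨
    ∃ w ∈ P.W, y ∈ cell P.G P.W P.k w ∧ c = w + 1 ∧ l = P.G.dist w y + 1

theorem Best.isCenterCode {y : Fin P.n} {c l : ℕ}
    (h : P.Best y (fun x => x ∈ bfsBall P.G P.k y ∧ x ∈ P.W) c l) : P.IsCenterCode y c l := by
  rcases h with ⟨h1, h2, h3⟩ | ⟨w, ⟨h1, h1'⟩, h2, h3, h4⟩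
  · exact .inl ⟨Set.eq_empty_of_forall_notMem fun x hx => h3 x hx, h1, h2⟩
  · refine .inr ⟨w, h1', ⟨⟨h1', fun w' hw' => ?_⟩, ?_⟩, h2, by rw [h3, P.G.dist_comm]⟩
    · rw [P.G.dist_comm (u := w), P.G.dist_comm (u := w')]
      by_cases hb : w' ∈ bfsBall P.G P.k y
      · exact h4 w' ⟨hb, hw'⟩
      · have h5 : P.G.dist y w ≤ bfsDepth P.G P.k y := h1
        have h6 : ¬ P.G.dist y w' ≤ bfsDepth P.G P.k y := hb
        left; omega
    · intro hr
      exact Set.notMem_empty w (hr ▸ ⟨h1, h1'⟩)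

/-- The exploration lists `B_k(y)` and possibly some vertices further away, which are excluded by comparing with
the rank of the `k`-th vertex. -/
theorem center_spec {σ : State} (hσ : P.Ctx σ) (hz : P.Zero 1 σ) {y : Fin P.n}
    (hy : σ.reg 60 = y + 1) :
    P.Agree 61 0 2 σ (center.denote P.w P.L.oracle σ) ∧
      P.Zero 1 (center.denote P.w P.L.oracle σ) ∧
      P.IsCenterCode y ((center.denote P.w P.L.oracle σ).reg 61)
        ((center.denote P.w P.L.oracle σ).reg 62) := by
  have hw := P.ten_lt
  have hk := P.two_le_k
  have hyn := y.2
  have hb0 := base_lt (P := P) (i := 0) (by omega)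
  have hb1 := base_lt (P := P) (i := 1) (by omega)
  have hbd := P.bound
  simp only [center, denote_block_cons, denote_block_nil]
  set σ₁ := (assign 80 (.reg 60)).denote P.w P.L.oracle ((assign 62 (.lit 0)).denote P.w P.L.oracle
    ((assign 61 (.lit 0)).denote P.w P.L.oracle σ)) with e₁
  simp only [denote, eval_zero, eval_reg, State.setReg_reg, Nat.reduceEqDiff, if_false, hy] at e₁
  have a₁ : P.Agree 61 0 2 σ σ₁ := by
    rw [e₁]
    exact (((Agree.refl σ).setReg (by omega) _).setReg (by omega) _).setReg (by omega) _
  have c₁ := hσ.of_agree a₁ (by omega)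
  obtain ⟨a₂, L, hE, hH, hlen⟩ := bfs_spec c₁ (by rw [e₁]; exact hz) (y := y) (by rw [e₁]; simp)
  set σ₂ := bfs.denote P.w P.L.oracle σ₁
  have c₂ := c₁.of_agree a₂ (by omega)
  have hLn := hE.length_le_card
  have h61 : σ₂.reg 61 = 0 := by rw [a₂.1 61 (by omega), e₁]; simp
  have h62 : σ₂.reg 62 = 0 := by rw [a₂.1 62 (by omega), e₁]; simp
  -- the limit
  obtain ⟨σ₃, lim, hσ₃, e₃, hlim, hsub, hlw⟩ : ∃ σ₃ lim, (ite (.op .lt (.reg 81) (.reg 4))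
      (assign 64 (.op .add (.reg 2) (.lit 2))) (assign 64 (.mem (.op .add (.reg 10)
      (.mem (.op .add (.reg 9) (.op .sub (.reg 4) (.lit 1)))))))).denote P.w P.L.oracle σ₂ = σ₃ ∧
      σ₃ = σ₂.setReg 64 lim ∧ (∀ x ∈ L, P.G.dist y x < lim ↔ x ∈ bfsBall P.G P.k y) ∧
      (∀ x ∈ bfsBall P.G P.k y, x ∈ L) ∧ lim + 1 < 2 ^ P.w := by
    rcases hE.bfsBall_eq P.conn (by omega) with ⟨h1, h2, h3⟩ | ⟨x, hx, h2⟩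
    · refine ⟨_, P.n + 2, rfl, ?_, fun x _ => ?_, fun x _ => h3 x, by omega⟩
      · rw [denote_ite_pos (by simp [eval_lt, eval_reg, hlen, c₂.r4, h1])]
        have e : (Expr.lit 2).eval P.w σ₂ = 2 := eval_lit (by omega)
        simp only [denote]
        rw [eval_add] <;> simp only [e, eval_reg, c₂.r2]
        omega
      · have := dist_le_card P.conn y x
        rw [h2]
        exact ⟨fun _ => trivial, fun _ => by omega⟩
    · have hk' := (List.getElem?_eq_some_iff.1 hx).1
      have hxL := List.mem_of_getElem? hx
      have hxn := x.2
      have := dist_le_card P.conn y x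
      refine ⟨_, P.G.dist y x + 1, rfl, ?_, fun z hz => ?_, fun z hz => ?_, by omega⟩
      · rw [denote_ite_neg (by simp only [eval_lt, eval_reg, hlen, c₂.r4]; rw [if_neg (by omega)])]
        have e : (Expr.lit 1).eval P.w σ₂ = 1 := eval_lit (by omega)
        have e1 : (Expr.op .sub (.reg 4) (.lit 1)).eval P.w σ₂ = P.k - 1 := by
          rw [eval_sub] <;> simp only [e, eval_reg, c₂.r4] <;> omega
        have e2 : (Expr.op .add (.reg 9) (.op .sub (.reg 4) (.lit 1))).eval P.w σ₂ =
            P.base 0 + (P.k - 1) := by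
          rw [eval_add] <;> simp only [e1, eval_reg, c₂.r9]
          omega
        have e3 : (Expr.op .add (.reg 10) (.mem (.op .add (.reg 9)
            (.op .sub (.reg 4) (.lit 1))))).eval P.w σ₂ = P.base 1 + (x + 1) := by
          rw [eval_add] <;> simp only [eval_mem, e2, eval_reg, c₂.r10, hH.list _ x hx]
          omega
        simp only [denote, eval_mem, e3, hH.rank, if_pos hxL]
      · rw [h2]
        simp only [Set.mem_ofPred_eq, hz, true_and]
        omega
      · rw [h2] at hz
        exact hz.1
  rw [hσ₃]
  have a₃ : P.Agree 64 0 0 σ₂ σ₃ := by rw [e₃]; exact (Agree.refl _).setReg (by omega) _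
  -- the scan
  set σ₄ := (loop 65 16 _).denote P.w P.L.oracle σ₃ with hσ₄
  have key : P.Agree 61 0 0 σ₃ σ₄ ∧ σ₄.reg 64 = lim ∧ σ₄.reg 81 = L.length ∧
      P.Best y (fun x => (∃ i < P.k * P.d + 1, L[i]? = some x) ∧ x ∈ bfsBall P.G P.k y ∧ x ∈ P.W)
        (σ₄.reg 61) (σ₄.reg 62) := by
    refine loop_inv (fun j τ => P.Agree 61 0 0 σ₃ τ ∧ τ.reg 64 = lim ∧ τ.reg 81 = L.length ∧
      P.Best y (fun x => (∃ i < j, L[i]? = some x) ∧ x ∈ bfsBall P.G P.k y ∧ x ∈ P.W)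
        (τ.reg 61) (τ.reg 62)) ?_ ?_ ?_ ?_
    · rw [e₃, State.setReg_reg, if_neg (by omega), c₂.r16]
    · rintro j τ x ⟨h1, h2, h3, h4⟩
      exact ⟨h1.setReg (by omega) x, by simpa using h2, by simpa using h3, by simpa using h4⟩
    · refine ⟨Agree.refl _, by rw [e₃]; simp, by rw [e₃]; simpa using hlen, .inl ⟨?_, ?_, ?_⟩⟩
      · rw [e₃]; simpa using h61
      · rw [e₃]; simpa using h62
      · rintro x ⟨⟨i, hi, -⟩, -⟩
        omega
    · rintro j - τ ⟨h1, h2, h3, h4⟩ hj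
      have hτ : P.Ctx τ := (c₂.of_agree a₃ (by omega)).of_agree h1 (by omega)
      have hmem : τ.mem = σ₂.mem := by rw [h1.mem_eq, a₃.mem_eq]
      by_cases hjL : j < L.length
      swap
      · rw [denote_ite_neg (by simp only [eval_lt, eval_reg, hj, h3]; rw [if_neg hjL])]
        refine ⟨h1, h2, h3, h4.congr fun x => and_congr_left fun _ => ?_⟩
        refine ⟨fun ⟨i, hi, hx⟩ => ⟨i, by omega, hx⟩, fun ⟨i, hi, hx⟩ => ⟨i, ?_, hx⟩⟩
        have := (List.getElem?_eq_some_iff.1 hx).1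
        omega
      rw [denote_ite_pos (by simp only [eval_lt, eval_reg, hj, h3]; rw [if_pos hjL]; omega)]
      simp only [denote_block_cons, denote_block_nil]
      obtain ⟨x, hx⟩ : ∃ x, L[j]? = some x := ⟨_, List.getElem?_eq_getElem hjL⟩
      have hxL := List.mem_of_getElem? hx
      have hxn := x.2
      have hdn := dist_le_card P.conn y x
      set τ₁ := (assign 90 (.mem (.op .add (.reg 9) (.reg 65)))).denote P.w P.L.oracle τ with f₁
      simp only [denote, eval_mem, eval_address (w := P.w) hτ.r9 hj (by omega), hmem, hH.list j x hx] at f₁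
      set τ₂ := (assign 66 (.mem (.op .add (.reg 10) (.reg 90)))).denote P.w P.L.oracle τ₁ with f₂
      have g1 : τ₁.reg 10 = P.base 1 := by rw [f₁]; simpa using hτ.r10
      have g2 : τ₁.reg 90 = x + 1 := by rw [f₁]; simp
      have g3 : τ₁.mem = σ₂.mem := by rw [f₁]; simpa using hmem
      simp only [denote, eval_mem, eval_address (w := P.w) g1 g2 (by omega), g3, hH.rank, if_pos hxL] at f₂
      have b₂ : P.Agree 66 0 0 τ τ₂ := by
        rw [f₂, f₁]; exact ((Agree.refl _).setReg (by omega) _).setReg (by omega) _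
      have hτ₂ := hτ.of_agree b₂ (by omega)
      have g4 : τ₂.reg 90 = x + 1 := by rw [f₂]; simpa using g2
      have b₃ := hash_agree (O := P.L.oracle) hτ₂ g4 (by omega)
      have hhash := (hash_spec (O := P.L.oracle) hτ₂ g4 (by omega)).1
      set τ₃ := hash.denote P.w P.L.oracle τ₂
      have r66 : τ₃.reg 66 = P.G.dist y x + 1 := by rw [b₃.1 66 (by omega), f₂]; simp
      have r90 : τ₃.reg 90 = x + 1 := by rw [b₃.1 90 (by omega), g4]
      have r61 : τ₃.reg 61 = τ.reg 61 := by rw [b₃.1 61 (by omega), b₂.1 61 (by omega)]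
      have r62 : τ₃.reg 62 = τ.reg 62 := by rw [b₃.1 62 (by omega), b₂.1 62 (by omega)]
      have r64 : τ₃.reg 64 = lim := by rw [b₃.1 64 (by omega), b₂.1 64 (by omega), h2]
      have r81 : τ₃.reg 81 = L.length := by
        rw [b₃.1 81 (by omega), f₂, f₁]; simpa using h3
      have r8 : τ₃.reg 8 = P.θ := by rw [b₃.1 8 (by omega), hτ₂.r8]
      have b : P.Agree 61 0 0 σ₃ τ₃ :=
        (h1.trans (b₂.mono (by omega) le_rfl le_rfl)).trans (b₃.mono (by omega) le_rfl le_rfl)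
      have hC : ∀ z, ((∃ i < j + 1, L[i]? = some z) ∧ z ∈ bfsBall P.G P.k y ∧ z ∈ P.W) ↔
          ((∃ i < j, L[i]? = some z) ∧ z ∈ bfsBall P.G P.k y ∧ z ∈ P.W) ∨
            (z = x ∧ x ∈ bfsBall P.G P.k y ∧ x ∈ P.W) := by
        intro z
        constructor
        · rintro ⟨⟨i, hi, hz⟩, hzz⟩
          rcases Nat.lt_succ_iff_lt_or_eq.1 hi with hi | rfl
          · exact .inl ⟨⟨i, hi, hz⟩, hzz⟩
          · rw [hx] at hz
            cases hz
            exact .inr ⟨rfl, hzz⟩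
        · rintro (⟨⟨i, hi, hz⟩, hzz⟩ | ⟨rfl, hzz⟩)
          · exact ⟨⟨i, by omega, hz⟩, hzz⟩
          · exact ⟨⟨j, by omega, hx⟩, hzz⟩
      have hT := ((tests_lt (w := P.w) (σ := τ₃) (a := .reg 91) (b := .reg 8) hhash r8).and
        (by omega) (tests_lt (a := .reg 66) (b := .op .add (.reg 64) (.lit 1)) r66
          (eval_succ r64 hlw))).and (by omega)
        (.or (by omega) (tests_eq (a := .reg 61) (b := .lit 0) r61 eval_zero)
          (.or (by omega) (tests_lt (a := .reg 66) (b := .reg 62) r66 r62)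
            (.and (by omega) (tests_eq (a := .reg 66) (b := .reg 62) r66 r62)
              (tests_lt (a := .reg 90) (b := .reg 61) r90 r61))))
      rw [← mem_centers_iff (n := P.n), Nat.add_lt_add_iff_right, hlim x hxL] at hT
      rcases denote_ite_of_tests (O := P.L.oracle) (p := block [assign 61 (.reg 90),
        assign 62 (.reg 66)]) (q := skip) hT with ⟨⟨⟨hc1, hc2⟩, hc⟩, e⟩ | ⟨hc, e⟩
      · rw [e]
        simp only [denote_block_cons, denote_block_nil, denote, eval_reg, State.setReg_reg,
          Nat.reduceEqDiff, if_false, if_true, r90, r66]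
        refine ⟨(b.setReg (by omega) _).setReg (by omega) _, r64, r81,
          (h4.insert_pos hc).congr fun z => ?_⟩
        rw [hC]
        exact or_congr_right ⟨fun h => ⟨h, hc2, hc1⟩, fun h => h.1⟩
      · rw [e]
        refine ⟨b, r64, r81, ?_⟩
        simp only [denote, r61, r62]
        by_cases hxW : x ∈ bfsBall P.G P.k y ∧ x ∈ P.W
        · refine (h4.insert_neg fun hc' => hc ⟨⟨hxW.2, hxW.1⟩, hc'⟩).congr fun z => ?_
          rw [hC]
          exact or_congr_right ⟨fun h => ⟨h, hxW⟩, fun h => h.1⟩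
        · refine h4.congr fun z => ?_
          rw [hC]
          exact ⟨.inl, fun h => h.elim id fun h => absurd h.2 hxW⟩
  clear_value σ₄
  clear hσ₄
  obtain ⟨a₄, -, r81, hbest⟩ := key
  have c₄ : P.Ctx σ₄ := (c₂.of_agree a₃ (by omega)).of_agree a₄ (by omega)
  have hlen4 := hE.length_le
  obtain ⟨a₅, hz₅⟩ := bfsWipe_spec (O := P.L.oracle) c₄ hLn (by omega)
    (by rw [a₄.mem_eq, a₃.mem_eq]; exact hH) r81
  have h02 : P.base 0 ≤ P.base 2 := base_mono (by omega)
  refine ⟨?_, hz₅, ?_⟩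
  · exact (((a₁.trans (a₂.mono (by omega) le_rfl le_rfl)).trans
      (a₃.mono (by omega) le_rfl (by omega))).trans (a₄.mono (by omega) le_rfl (by omega))).trans
        (a₅.mono (by omega) le_rfl le_rfl)
  · rw [a₅.1 61 (by omega), a₅.1 62 (by omega)]
    refine (hbest.congr fun x => ?_).isCenterCode
    refine ⟨fun h => h.2, fun h => ⟨?_, h⟩⟩
    obtain ⟨i, hi⟩ := List.mem_iff_getElem?.1 (hsub x h.1)
    have := (List.getElem?_eq_some_iff.1 hi).1
    exact ⟨i, by omega, hi⟩

end Setup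
namespace Setup

variable {P : Setup}
open FProg SSG.Expr

/-- Correctness of `rankOf`: the distance is found if `w` is near enough to `z`, and if the outcome is not `0`
it is the distance in any case. -/
theorem rankOf_spec {σ : State} (hσ : P.Ctx σ) (hz : P.Zero 1 σ) {z w : Fin P.n}
    (hz' : σ.reg 69 = z + 1) (hw' : σ.reg 61 = w + 1) :
    P.Agree 70 0 2 σ (rankOf.denote P.w P.L.oracle σ) ∧
      P.Zero 1 (rankOf.denote P.w P.L.oracle σ) ∧
      (w ∈ bfsBall P.G P.k z →
        (rankOf.denote P.w P.L.oracle σ).reg 70 = P.G.dist z w + 1) ∧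
      ((rankOf.denote P.w P.L.oracle σ).reg 70 = 0 ∨
        (rankOf.denote P.w P.L.oracle σ).reg 70 = P.G.dist z w + 1) := by
  have hk := P.two_le_k
  have hwn := w.2
  have hb1 := base_lt (P := P) (i := 1) (by omega)
  simp only [rankOf, denote_block_cons, denote_block_nil]
  set σ₁ := (assign 80 (.reg 69)).denote P.w P.L.oracle σ with e₁
  simp only [denote, eval_reg, hz'] at e₁
  have a₁ : P.Agree 70 0 2 σ σ₁ := by
    rw [e₁]; exact (Agree.refl σ).setReg (by omega) _
  have c₁ := hσ.of_agree a₁ (by omega)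
  obtain ⟨a₂, L, hE, hH, hlen⟩ := bfs_spec c₁ (by rw [e₁]; exact hz) (y := z) (by rw [e₁]; simp)
  set σ₂ := bfs.denote P.w P.L.oracle σ₁
  have c₂ := c₁.of_agree a₂ (by omega)
  have r61 : σ₂.reg 61 = w + 1 := by rw [a₂.1 61 (by omega), a₁.1 61 (by omega), hw']
  set σ₃ := (assign 70 _).denote P.w P.L.oracle σ₂ with e₃
  simp only [denote, eval_mem, eval_address (w := P.w) c₂.r10 r61 (by omega), hH.rank] at e₃
  have a₃ : P.Agree 70 0 2 σ₂ σ₃ := by rw [e₃]; exact (Agree.refl _).setReg (by omega) _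
  have c₃ := c₂.of_agree a₃ (by omega)
  obtain ⟨a₄, hz₄⟩ := bfsWipe_spec (O := P.L.oracle) c₃ hE.length_le_card hE.length_le
    (by rw [e₃]; exact hH) (by rw [e₃]; simpa using hlen)
  have r70 : (bfsWipe.denote P.w P.L.oracle σ₃).reg 70 =
      if w ∈ L then P.G.dist z w + 1 else 0 := by
    rw [a₄.1 70 (by omega), e₃]; simp
  refine ⟨((a₁.trans (a₂.mono (by omega) le_rfl le_rfl)).trans a₃).trans
    (a₄.mono (by omega) le_rfl le_rfl), hz₄, fun hw => ?_, ?_⟩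
  · rw [r70, if_pos]
    rcases hE.bfsBall_eq P.conn (by omega) with ⟨-, -, h3⟩ | ⟨x, -, h2⟩
    · exact h3 w
    · rw [h2] at hw
      exact hw.1
  · rw [r70]
    split_ifs
    exacts [.inr rfl, .inl rfl]

/-- The outcome of the search for the center and the parent of `y`. -/
def IsParentCode (P : Setup) (y : Fin P.n) (c l p : ℕ) : Prop :=
  (y ∈ remote P.G P.W P.k ∧ c = 0 ∧ l = 0 ∧ p = 0) ∨
    ∃ w ∈ P.W, y ∈ cell P.G P.W P.k w ∧ c = w + 1 ∧ l = P.G.dist w y + 1 ∧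
      ((p = 0 ∧ y = w) ∨ ∃ z : Fin P.n, p = z + 1 ∧ cellTree P.G P.W P.k w z y)

/-- Correctness of `parent`. A neighbour of `y` that is closer to the center `w` of `y` is in the same cell, so
that comparing the distances to `w` suffices to find the parent. -/
theorem parent_spec {σ : State} (hσ : P.Ctx σ) (hz : P.Zero 1 σ) {y : Fin P.n}
    (hy : σ.reg 60 = y + 1) :
    P.Agree 61 0 2 σ (parent.denote P.w P.L.oracle σ) ∧
      P.Zero 1 (parent.denote P.w P.L.oracle σ) ∧
      P.IsParentCode y ((parent.denote P.w P.L.oracle σ).reg 61)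
        ((parent.denote P.w P.L.oracle σ).reg 62) ((parent.denote P.w P.L.oracle σ).reg 63) := by
  have hw := P.ten_lt
  have hyn := y.2
  have hbd := P.bound
  have hdw : P.d < 2 ^ P.w := by
    have : P.d ≤ P.k * P.d := Nat.le_mul_of_pos_left _ (by have := P.two_le_k; omega)
    omega
  have h1 : (Expr.lit 1).eval P.w = fun _ => 1 := funext fun τ => eval_lit (by omega)
  simp only [parent, denote_block_cons, denote_block_nil]
  obtain ⟨a₁, z₁, hc⟩ := center_spec hσ hz hy
  set σ₁ := center.denote P.w P.L.oracle σ
  set σ₂ := (assign 63 (.lit 0)).denote P.w P.L.oracle σ₁ with e₂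
  simp only [denote, eval_zero] at e₂
  have a₂ : P.Agree 63 0 0 σ₁ σ₂ := by rw [e₂]; exact (Agree.refl _).setReg (by omega) _
  have h02 : P.base 0 ≤ P.base 2 := base_mono (by omega)
  have a₁₂ : P.Agree 61 0 2 σ σ₂ := a₁.trans (a₂.mono (by omega) le_rfl (by omega))
  have c₂ := hσ.of_agree a₁₂ (by omega)
  have z₂ : P.Zero 1 σ₂ := by rw [e₂]; exact z₁
  rw [← a₂.1 61 (by omega), ← a₂.1 62 (by omega)] at hc
  have r63 : σ₂.reg 63 = 0 := by rw [e₂]; simp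
  have hT := tests_lt (w := P.w) (σ := σ₂) (a := .lit 1) (b := .reg 62)
    (y := σ₂.reg 62) (congrFun h1 _) rfl
  rcases hc with ⟨hr, h61, h62⟩ | ⟨w, hwW, hcell, h61, h62⟩
  · rw [h62] at hT
    rw [denote_ite_neg (hT.2 (by omega))]
    exact ⟨a₁₂, z₂, .inl ⟨hr, h61, h62, r63⟩⟩
  by_cases hyw : y = w
  · subst hyw
    rw [h62, SimpleGraph.dist_self] at hT
    rw [denote_ite_neg (hT.2 (by omega))]
    exact ⟨a₁₂, z₂, .inr ⟨y, hwW, hcell, h61, h62, .inl ⟨r63, rfl⟩⟩⟩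
  have hpos : P.G.dist w y ≠ 0 := fun h => hyw (P.conn.dist_eq_zero_iff.1 h).symm
  rw [h62] at hT
  rw [denote_ite_pos (hT.ne_zero.2 (by omega))]
  have hdn := dist_le_card P.conn w y
  set A : Fin P.n → Prop := fun z => P.G.Adj z y ∧ P.G.dist w z + 1 = P.G.dist w y with hA
  -- The scan of the neighbours of `y`; register `63` holds the smallest candidate so far.
  have key := loop_inv (w := P.w) (O := P.L.oracle) (i := 68) (N := 3) (σ := σ₂) (m := P.d)
    (p := block [
    probe 69 (.reg 60) (.op .add (.reg 68) (.lit 1)),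
    ite (.reg 69) (block [
      rankOf,
      ite (Expr.and (.op .eq (.op .add (.reg 70) (.lit 1)) (.reg 62))
          (Expr.or (.op .eq (.reg 63) (.lit 0)) (.op .lt (.reg 69) (.reg 63))))
        (assign 63 (.reg 69)) skip]) skip])
    (fun j τ => P.Agree 63 0 2 σ₂ τ ∧ P.Zero 1 τ ∧
      ((τ.reg 63 = 0 ∧ ∀ z, A z → ¬ ∃ i < j, P.L.oracle (y + 1) (i + 1) = z + 1) ∨
        ∃ p : Fin P.n, τ.reg 63 = p + 1 ∧ A p ∧
          ∀ z, A z → (∃ i < j, P.L.oracle (y + 1) (i + 1) = z + 1) → p ≤ z)) c₂.r3 ?_ ?_ ?_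
  · obtain ⟨a₃, z₃, hp⟩ := key
    refine ⟨a₁₂.trans (a₃.mono (by omega) le_rfl le_rfl), z₃, .inr ⟨w, hwW, hcell, ?_, ?_, .inr ?_⟩⟩
    · rw [a₃.1 61 (by omega), h61]
    · rw [a₃.1 62 (by omega), h62]
    · rcases hp with ⟨-, hp⟩ | ⟨p, hp, hpA, hle⟩
      · obtain ⟨z, hz1, hz2⟩ := exists_adj_dist_add_one P.conn hyw
        exact absurd (P.L.exists_oracle_eq P.deg hz1.symm) (hp z ⟨hz1, hz2⟩)
      · refine ⟨p, hp, (isBFSParent_cell_iff P.conn).2 ⟨hcell, hpA, fun z hzA => ?_⟩⟩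
        exact hle z hzA (P.L.exists_oracle_eq P.deg hzA.1.symm)
  · rintro j τ x ⟨g1, g2, g3⟩
    exact ⟨g1.setReg (by omega) x, g2, by simpa using g3⟩
  · refine ⟨Agree.refl _, z₂, .inl ⟨r63, ?_⟩⟩
    rintro z - ⟨i, hi, -⟩
    omega
  · rintro j hj τ ⟨g1, g2, g3⟩ hjr
    have hτ := c₂.of_agree g1 (by omega)
    simp only [denote_block_cons, denote_block_nil]
    have r60 : τ.reg 60 = y + 1 := by rw [g1.1 60 (by omega), a₁₂.1 60 (by omega), hy]
    set τ₁ := (probe 69 (.reg 60) (.op .add (.reg 68) (.lit 1))).denote P.w P.L.oracle τ with f₁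
    simp only [denote, eval_succ (w := P.w) hjr (by omega), eval_reg, r60] at f₁
    have b₁ : P.Agree 69 0 0 τ τ₁ := by rw [f₁]; exact (Agree.refl _).setReg (by omega) _
    have b₁' : P.Agree 63 0 2 σ₂ τ₁ := g1.trans (b₁.mono (by omega) le_rfl (by omega))
    have zz₁ : P.Zero 1 τ₁ := by rw [f₁]; exact g2
    have r69 : τ₁.reg 69 = P.L.oracle (y + 1) (j + 1) := by rw [f₁]; simp
    rw [← b₁.1 63 (by omega)] at g3
    have hτ₁ := hτ.of_agree b₁ (by omega)
    have hlast : ∀ z, A z → (∃ i < j + 1, P.L.oracle (y + 1) (i + 1) = z + 1) →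
        (∃ i < j, P.L.oracle (y + 1) (i + 1) = z + 1) ∨ τ₁.reg 69 = z + 1 := by
      rintro z - ⟨i, hi, h⟩
      rcases Nat.lt_succ_iff_lt_or_eq.1 hi with hi | rfl
      · exact .inl ⟨i, hi, h⟩
      · exact .inr (r69.trans h)
    rcases P.L.oracle_cases y j with h0 | ⟨z, hz1, hz2⟩
    · rw [denote_ite_neg (by rw [eval_reg, r69, h0])]
      refine ⟨b₁', zz₁, g3.imp (fun h => ⟨h.1, fun z hz hi => ?_⟩)
        (fun ⟨p, h1, h2, h3⟩ => ⟨p, h1, h2, fun z hz hi => ?_⟩)⟩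
      all_goals rcases hlast z hz hi with hi | hi
      · exact h.2 z hz hi
      · omega
      · exact h3 z hz hi
      · omega
    rw [denote_ite_pos (by rw [eval_reg, r69, hz2]; omega)]
    rw [hz2] at r69
    have r61 : τ₁.reg 61 = w + 1 := by rw [b₁'.1 61 (by omega), h61]
    simp only [denote_block_cons, denote_block_nil]
    obtain ⟨b₂, zz₂, hr1, hr2⟩ := rankOf_spec hτ₁ zz₁ r69 r61
    set τ₂ := rankOf.denote P.w P.L.oracle τ₁
    have b₂' := b₁'.trans (b₂.mono (r' := 63) (by omega) le_rfl le_rfl)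
    have r62 : τ₂.reg 62 = P.G.dist w y + 1 := by rw [b₂'.1 62 (by omega), h62]
    have r69' : τ₂.reg 69 = z + 1 := by rw [b₂.1 69 (by omega), r69]
    rw [← b₂.1 63 (by omega)] at g3
    have hdz := dist_le_card P.conn z w
    -- If `z` is closer to `w` than `y`, it is in the cell of `w`, so its ball contains `w`.
    have hAz : τ₂.reg 70 + 1 = P.G.dist w y + 1 ↔ A z := by
      constructor
      · intro h
        refine ⟨hz1.symm, ?_⟩
        have := P.G.dist_comm (u := z) (v := w)
        rcases hr2 with h2 | h2 <;> omega
      · rintro ⟨-, h⟩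
        have hzc : z ∈ cell P.G P.W P.k w := by
          refine mem_cell_of_on_geodesic P.conn hcell ?_
          rw [SimpleGraph.dist_eq_one_iff_adj.2 hz1.symm, h]
        have hb : w ∈ bfsBall P.G P.k z := by
          have := dist_le_bfsDepth_of_mem_cell hzc
          rw [P.G.dist_comm] at this
          exact this
        rw [hr1 hb, P.G.dist_comm, h]
    have hT := (tests_eq (w := P.w) (σ := τ₂) (a := .op .add (.reg 70) (.lit 1)) (b := .reg 62)
      (eval_succ rfl (by rcases hr2 with h2 | h2 <;> omega)) r62).and (by omega)
        (.or (by omega) (tests_eq (a := .reg 63) (b := .lit 0) (x := τ₂.reg 63) rfl eval_zero)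
          (tests_lt (a := .reg 69) (b := .reg 63) (y := τ₂.reg 63) r69' rfl))
    rw [hAz] at hT
    rcases denote_ite_of_tests (O := P.L.oracle) (p := assign 63 (.reg 69)) (q := skip) hT with
      ⟨⟨hc1, hc2⟩, e⟩ | ⟨hc, e⟩
    · rw [e]
      simp only [denote, eval_reg, r69']
      refine ⟨b₂'.setReg (by omega) _, zz₂, .inr ⟨z, by simp, hc1, fun z' hz' hi => ?_⟩⟩
      rcases hlast z' hz' hi with hi | hi
      · rcases g3 with ⟨-, h⟩ | ⟨p, h1, h2, h3⟩
        · exact absurd hi (h z' hz')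
        · have := h3 z' hz' hi
          omega
      · omega
    · rw [e]
      simp only [denote]
      refine ⟨b₂', zz₂, ?_⟩
      rcases g3 with ⟨h1, h2⟩ | ⟨p, h1, h2, h3⟩
      · left
        refine ⟨h1, fun z' hz' hi => ?_⟩
        rcases hlast z' hz' hi with hi | hi
        · exact h2 z' hz' hi
        · obtain rfl : z' = z := Fin.ext (by omega)
          exact hc ⟨hz', .inl h1⟩
      · refine .inr ⟨p, h1, h2, fun z' hz' hi => ?_⟩
        rcases hlast z' hz' hi with hi | hi
        · exact h3 z' hz' hi
        · obtain rfl : z' = z := Fin.ext (by omega)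
          by_contra hlt
          exact hc ⟨hz', .inr (by omega)⟩

end Setup

/-! ### Exploring a subtree -/

/-- The exploration of a subtree, by level. -/
theorem IsForest.layering {n : ℕ} {G : SimpleGraph (Fin n)} {T : Fin n → Fin n → Prop}
    {lev : Fin n → ℕ} (hT : IsForest T lev) (hadj : ∀ x y, T x y → G.Adj x y)
    (hlev : ∀ x, lev x ≤ n) (v : Fin n) :
    Layering G (subtree T v) T (fun x => lev x - lev v) v where
  src_mem := self_mem_subtree v
  rk_src := Nat.sub_self _
  eq_src x hx h0 := hT.eq_of_mem_subtree_of_lev_le hx (by omega)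
  step x hx y hxy := by
    have h1 := hT.lev_le_of_mem_subtree hx
    have h2 := hT.lev_eq hxy
    obtain ⟨j, hj⟩ := hx
    exact ⟨⟨j + 1, x, hj, hxy⟩, by omega⟩
  pred y hy r hr := by
    have h1 := hT.lev_le_of_mem_subtree hy
    have h2 := hT.mem_treeLevel_of_mem_subtree hy
    rw [hr] at h2
    obtain ⟨x, hx, hxy⟩ := h2
    exact ⟨x, ⟨r, hx⟩, by have := hT.lev_of_mem_treeLevel hx; omega, hxy⟩
  adj := hadj
  rk_le x _ := (Nat.sub_le _ _).trans (hlev x)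

section Tree

variable {n : ℕ} {G : SimpleGraph (Fin n)} {T : Fin n → Fin n → Prop} {lev : Fin n → ℕ}

/-- The first `s` vertices in breadth-first order determine the depth at which the subtree is cut. -/
theorem IsForest.treeDepth_eq (hT : IsForest T lev) (hadj : ∀ x y, T x y → G.Adj x y)
    (hlev : ∀ x, lev x ≤ n) {v : Fin n} {L : List (Fin n)} {s N m : ℕ} {D : Fin n → Prop}
    (hs : 1 ≤ s) (hN : s ≤ N)
    (h : Explored (subtree T v) T (fun x => lev x - lev v) v L N D m) :
    (L.length < s ∧ (subtree T v).ncard < s ∧ ∀ x, x ∈ L ↔ x ∈ subtree T v) ∨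
      ∃ x, L[s - 1]? = some x ∧ x ∈ L ∧ s ≤ (subtree T v).ncard ∧
        treeDepth T s v = lev x - lev v := by
  rcases lt_or_ge L.length s with hL | hL
  · left
    have hall := h.mem_iff_of_length_le (hT.layering hadj hlev v) (by omega)
    refine ⟨hL, ?_, hall⟩
    have h2 : (subtree T v).ncard ≤ L.toFinset.card := by
      rw [← Set.ncard_coe_finset]
      exact Set.ncard_le_ncard (fun x hx => by simpa using (hall x).2 hx) (Set.toFinite _)
    have h3 := List.toFinset_card_le L
    omega
  · right
    have hx : L[s - 1]? = some L[s - 1] := List.getElem?_eq_getElem (by omega)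
    have hxL := List.mem_of_getElem? hx
    have hxS := h.mem _ hxL
    have hxv := hT.lev_le_of_mem_subtree hxS
    refine ⟨_, hx, hxL, ?_, ?_⟩
    · have := h.lt_ncard hx (T := subtree T v) fun y hy _ => hy
      omega
    · refine le_antisymm (Nat.sInf_le (.inl ?_)) ?_
      · have := h.lt_ncard hx (T := treeBall T v (lev L[s - 1] - lev v)) fun y hy hle => by
          rw [hT.mem_treeBall_iff]
          exact ⟨hy, by have := hT.lev_le_of_mem_subtree hy; omega⟩
        omega
      · by_contra hlt
        rcases hT.treeDepth_spec s v with h1 | h1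
        · have h3 := h.ncard_lt hx (by omega) (T := treeBall T v (treeDepth T s v)) fun y hy => by
            rw [hT.mem_treeBall_iff] at hy
            exact ⟨hy.1, by omega⟩
          omega
        · rw [← h1, hT.mem_treeBall_iff] at hxS
          omega

theorem IsForest.piece_eq_subtree (hT : IsForest T lev) {s : ℕ} {v : Fin n}
    (h : (subtree T v).ncard < s) : piece T s v = subtree T v := by
  refine Set.Subset.antisymm (piece_subset_subtree s v) ?_
  rcases hT.treeDepth_spec s v with h1 | h1
  · have := Set.ncard_le_ncard (s := treeBall T v (treeDepth T s v)) (t := subtree T v)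
      (fun x hx => (hT.mem_treeBall_iff.1 hx).1) (Set.toFinite _)
    omega
  · rw [← h1]
    exact Set.subset_union_left

theorem IsForest.ncard_treeBall_le (hT : IsForest T lev) (hadj : ∀ x y, T x y → G.Adj x y)
    {d s : ℕ} (hdeg : ∀ v, (G.neighborSet v).ncard ≤ d) (v : Fin n) :
    (treeBall T v (treeDepth T s v)).ncard ≤ 1 + s * d := by
  classical
  rcases Nat.eq_zero_or_pos (treeDepth T s v) with h0 | h0
  · have : treeBall T v (treeDepth T s v) ⊆ {v} := by
      intro x hx
      rw [hT.mem_treeBall_iff, h0] at hx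
      exact hT.eq_of_mem_subtree_of_lev_le hx.1 (by omega)
    have := Set.ncard_le_ncard this (Set.toFinite _)
    rw [Set.ncard_singleton] at this
    omega
  · obtain ⟨l, hl⟩ := Nat.exists_eq_succ_of_ne_zero h0.ne'
    have h1 := (of_lt_treeDepth (T := T) (s := s) (v := v) (l := l) (by omega)).1
    have hsub : treeBall T v (treeDepth T s v) ⊆
        ((insert v ((treeBall T v l).toFinset.biUnion fun p => (G.neighborSet p).toFinset) :
          Finset (Fin n)) : Set (Fin n)) := by
      rw [hl]
      rintro x ⟨j, hj, hx⟩
      rcases j with - | j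
      · obtain rfl : x = v := hx
        simp
      · obtain ⟨p, hp, hpx⟩ := hx
        simp only [Finset.coe_insert, Finset.coe_biUnion, Set.mem_insert_iff, Set.mem_iUnion]
        right
        exact ⟨p, by simpa using ⟨j, by omega, hp⟩, by simpa using hadj p x hpx⟩
    have h2 := Set.ncard_le_ncard hsub (Finset.finite_toSet _)
    rw [Set.ncard_coe_finset] at h2
    have h3 := Finset.card_insert_le v
      ((treeBall T v l).toFinset.biUnion fun p => (G.neighborSet p).toFinset)
    have h4 := Finset.card_biUnion_le_card_mul (treeBall T v l).toFinset
      (fun p => (G.neighborSet p).toFinset) d fun p _ => by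
        rw [← Set.ncard_eq_toFinset_card']; exact hdeg p
    rw [← Set.ncard_eq_toFinset_card'] at h4
    have h5 : (treeBall T v l).ncard * d ≤ s * d := Nat.mul_le_mul_right d h1.le
    omega

end Tree

namespace FProg

/-- The test for the exploration of a subtree: whether the vertex in register `o + 3` is the parent of the
one in register `o + 5`. -/
def isParent (o : ℕ) : FProg :=
  ite (.reg (o + 5)) (block [
    assign 60 (.reg (o + 5)),
    parent,
    assign (o + 6) (.op .eq (.reg 63) (.reg (o + 3)))]) (assign (o + 6) (.lit 0))

/-- Exploration of the subtree at the vertex in register `o`. -/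
def treeExplore (o bl bc N : ℕ) : FProg := explore o bl bc N (isParent o)

/-- The depth, plus one, at which the subtree at the vertex in register `50` is cut, or `0` if it has fewer
than `s` vertices, in register `58`. -/
def cutDepth : FProg := block [
  treeExplore 50 11 12 5,
  ite (.op .lt (.reg 51) (.reg 5)) (assign 58 (.lit 0))
    (assign 58 (.mem (.op .add (.reg 12) (.mem (.op .add (.reg 11) (.op .sub (.reg 5) (.lit 1))))))),
  wipe 50 11 12 17]

end FProg

namespace Setup

variable {P : Setup}
open FProg SSG.Expr

/-- The BFS tree of the cell of `w`. -/
abbrev T (P : Setup) (w : Fin P.n) : Fin P.n → Fin P.n → Prop := cellTree P.G P.W P.k w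

/-- The number of levels from `v` to `x` in the BFS tree of the cell of `w`. -/
noncomputable abbrev rk (P : Setup) (w v x : Fin P.n) : ℕ := P.G.dist w x - P.G.dist w v

theorem forest (P : Setup) (w : Fin P.n) : IsForest (P.T w) (P.G.dist w) :=
  cellTree_isForest P.conn w

theorem adj_of_tree {w x y : Fin P.n} (h : P.T w x y) : P.G.Adj x y :=
  (cellTree_mem P.conn h).2.2

theorem cell_unique {w w' x : Fin P.n} (h : x ∈ cell P.G P.W P.k w)
    (h' : x ∈ cell P.G P.W P.k w') : w = w' := h.1.unique h'.1

theorem not_tree_root {w x : Fin P.n} : ¬ P.T w x w := fun h => by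
  have := (P.forest w).lev_eq h
  simp at this

/-- The cell of the vertex tested need not be compared with that of `x`: a parent is in the same cell. -/
theorem isParent_spec {o : ℕ} (ho : o + 7 < 60) {σ : State} (hσ : P.Ctx σ) (ho' : 20 ≤ o)
    (hz : P.Zero 1 σ)
    {w x : Fin P.n} (hx : x ∈ cell P.G P.W P.k w) {y₀ : ℕ} (h3 : σ.reg (o + 3) = x + 1)
    (h5 : σ.reg (o + 5) = y₀) (hy₀ : y₀ = 0 ∨ ∃ y : Fin P.n, P.G.Adj x y ∧ y₀ = y + 1) :
    P.Agree (o + 6) 0 2 σ ((isParent o).denote P.w P.L.oracle σ) ∧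
      P.Zero 1 ((isParent o).denote P.w P.L.oracle σ) ∧
      (((isParent o).denote P.w P.L.oracle σ).reg (o + 6) ≠ 0 ↔
        ∃ y : Fin P.n, y₀ = y + 1 ∧ P.T w x y) := by
  rcases hy₀ with rfl | ⟨y, -, rfl⟩
  · rw [isParent, denote_ite_neg (by rw [eval_reg, h5])]
    simp only [denote, eval_zero]
    exact ⟨(Agree.refl σ).setReg (by omega) _, hz, by simp⟩
  rw [isParent, denote_ite_pos (by rw [eval_reg, h5]; omega)]
  simp only [denote_block_cons, denote_block_nil]
  set σ₁ := (assign 60 (.reg (o + 5))).denote P.w P.L.oracle σ with e₁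
  simp only [denote, eval_reg, h5] at e₁
  have a₁ : P.Agree 60 0 2 σ σ₁ := by rw [e₁]; exact (Agree.refl σ).setReg (by omega) _
  obtain ⟨a₂, z₂, hc⟩ := parent_spec (hσ.of_agree a₁ (by omega)) (by rw [e₁]; exact hz) (y := y)
    (by rw [e₁]; simp)
  set σ₂ := parent.denote P.w P.L.oracle σ₁
  have r3 : σ₂.reg (o + 3) = x + 1 := by
    rw [a₂.1 _ (by omega), a₁.1 _ (by omega), h3]
  have hT := tests_eq (w := P.w) (σ := σ₂) (a := .reg 63) (b := .reg (o + 3))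
    (x := σ₂.reg 63) rfl r3
  refine ⟨((a₁.mono (by omega) le_rfl le_rfl).trans
    (a₂.mono (by omega) le_rfl le_rfl)).setReg (by omega) _, z₂, ?_⟩
  simp only [denote, State.setReg_reg, if_true]
  rw [hT.ne_zero]
  rcases hc with ⟨hr, -, -, h63⟩ | ⟨w', -, hyc, -, -, ⟨h63, rfl⟩ | ⟨z, h63, hzy⟩⟩
  · refine ⟨fun h => by omega, ?_⟩
    rintro ⟨y', hy', hxy⟩
    obtain rfl : y = y' := Fin.ext (by omega)
    exact absurd hr (cellTree_mem P.conn hxy).2.1.2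
  · refine ⟨fun h => by omega, ?_⟩
    rintro ⟨y', hy', hxy⟩
    obtain rfl : y = y' := Fin.ext (by omega)
    obtain rfl := cell_unique hyc (cellTree_mem P.conn hxy).2.1
    exact absurd hxy not_tree_root
  · constructor
    · intro h
      obtain rfl : z = x := Fin.ext (by omega)
      obtain rfl := cell_unique hx (cellTree_mem P.conn hzy).1
      exact ⟨y, rfl, hzy⟩
    · rintro ⟨y', hy', hxy⟩
      obtain rfl : y = y' := Fin.ext (by omega)
      obtain rfl := cell_unique hyc (cellTree_mem P.conn hxy).2.1
      rw [h63, (P.forest w').uniq hzy hxy]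

/-- The exploration of a subtree, with its list in the array `i` and its table in the array `i + 1`. -/
theorem treeExplore_spec {o bl bc N i Nv : ℕ} (ho : o + 7 < 60) (ho' : 20 ≤ o) (hi : 2 ≤ i)
    (hi6 : i ≤ 6)
    {σ : State} (hσ : P.Ctx σ) (hz : P.Zero 1 σ) (hzi : P.Zero (i + 1) σ)
    (hc : ∀ τ, P.Ctx τ → τ.reg bl = P.base i ∧ τ.reg bc = P.base (i + 1) ∧ τ.reg N = Nv)
    {w v : Fin P.n} (hv : v ∈ cell P.G P.W P.k w) (hov : σ.reg o = v + 1) :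
    (P.Agree (o + 1) 0 (i + 2) σ ((treeExplore o bl bc N).denote P.w P.L.oracle σ) ∧
      (∀ a, P.base 2 ≤ a → a < P.base i →
        ((treeExplore o bl bc N).denote P.w P.L.oracle σ).mem a = σ.mem a) ∧
      P.Zero 1 ((treeExplore o bl bc N).denote P.w P.L.oracle σ)) ∧
      ∃ L : List (Fin P.n), Explored (subtree (P.T w) v) (P.T w) (P.rk w v) v L Nv
        (fun _ => False) (1 + Nv * P.d) ∧
      Holds ((treeExplore o bl bc N).denote P.w P.L.oracle σ).mem (P.base i) (P.base (i + 1)) L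
        (P.rk w v) ∧
      ((treeExplore o bl bc N).denote P.w P.L.oracle σ).reg (o + 1) = L.length := by
  have h0i : P.base 2 ≤ P.base i := base_mono hi
  have h02 : P.base 0 ≤ P.base 2 := base_mono (by omega)
  have h12 : P.base 2 = P.base 1 + (P.n + 2) := base_succ (P := P) 1
  have hi1 := base_succ (P := P) i
  have hi2 := base_succ (P := P) (i + 1)
  have hw := base_lt (P := P) (i := i + 1) (by omega)
  have hB := P.bound
  have hdk : P.d ≤ P.k * P.d := Nat.le_mul_of_pos_left _ (by have := P.two_le_k; omega)
  have hlay := (P.forest w).layering (fun x y h => adj_of_tree h)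
    (fun x => (dist_le_card P.conn w x).le) v
  refine explore_spec (o := o) (bl := bl) (bc := bc) (N := N) (b := P.base i)
    (c := P.base (i + 1)) (test := isParent o)
    (fun τ => P.Agree (o + 1) 0 (i + 2) σ τ ∧ (∀ a, P.base 2 ≤ a → a < P.base i →
      τ.mem a = σ.mem a) ∧ P.Zero 1 τ) hlay P.L P.deg (by omega) (by omega) (by omega)
    ?_ ?_ ?_ ?_ ⟨Agree.refl σ, fun _ _ _ => rfl, hz⟩ hov hzi
  · rintro τ i x hi ⟨h1, h2, h3⟩
    exact ⟨h1.setReg (by omega) x, h2, h3⟩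
  · rintro τ a x ha ⟨h1, h2, h3⟩
    refine ⟨h1.setMem (by rw [show i + 2 = i + 1 + 1 from rfl]; omega) x, fun a' h4 h5 => ?_, fun v' => ?_⟩
    · rw [State.setMem_mem, if_neg (by omega), h2 a' h4 h5]
    · have := v'.2
      rw [State.setMem_mem, if_neg (by omega), h3 v']
  · rintro τ ⟨h1, -⟩
    have hτ := hσ.of_agree h1 (by omega)
    exact ⟨(hc τ hτ).1, (hc τ hτ).2.1, hτ.r3, (hc τ hτ).2.2⟩
  · rintro τ x y₀ ⟨h1, h2, h3⟩ hx hr3 hr5 hy₀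
    obtain ⟨g1, g2, g3⟩ := isParent_spec ho (hσ.of_agree h1 (by omega)) ho' h3
      (subtree_subset_cell P.conn hv hx) hr3 hr5 hy₀
    refine ⟨⟨h1.trans (g1.mono (by omega) le_rfl (by omega)), fun a h4 h5 => ?_, g2⟩, g3,
      fun j hj => g1.1 _ (by omega), fun a ha => g1.2 a (.inr (by omega))⟩
    rw [g1.2 a (.inr h4), h2 a h4 h5]

theorem treeWipe_spec {O : ℕ → ℕ → ℕ} {o bl bc N i Nv : ℕ} (ho' : 20 ≤ o) (hi6 : i ≤ 6)
    {σ : State} (hσ : P.Ctx σ)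
    (hc : ∀ τ, P.Ctx τ → τ.reg bl = P.base i ∧ τ.reg bc = P.base (i + 1) ∧ τ.reg N = Nv)
    {L : List (Fin P.n)} {rk : Fin P.n → ℕ} (hLn : L.length ≤ P.n) (hL : L.length ≤ Nv)
    (hH : Holds σ.mem (P.base i) (P.base (i + 1)) L rk) (hlen : σ.reg (o + 1) = L.length) :
    P.Agree (o + 7) (i + 1) (i + 2) σ ((wipe o bl bc N).denote P.w O σ) ∧
      P.Zero (i + 1) ((wipe o bl bc N).denote P.w O σ) := by
  have hi1 := base_succ (P := P) i
  have hi2 : P.base (i + 2) = P.base (i + 1) + (P.n + 2) := base_succ (P := P) (i + 1)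
  have hw := base_lt (P := P) (i := i + 1) (by omega)
  refine wipe_spec (o := o) (bl := bl) (bc := bc) (N := N) (c := P.base (i + 1)) (Nv := Nv)
    (fun τ => P.Agree (o + 7) (i + 1) (i + 2) σ τ) hLn hL (by omega) (by omega) ?_ ?_ ?_
    (Agree.refl σ) hH
  · intro τ x hI
    exact hI.setReg (by omega) x
  · intro τ a x ha hI
    exact hI.setMem (by omega) x
  · intro τ hI
    have := hc τ (hσ.of_agree hI (by omega))
    exact ⟨this.1, this.2.1, this.2.2, (hI.1 _ (by omega)).trans hlen⟩

theorem eval_cut {τ : State} (hτ : P.Ctx τ) {bl bc i : ℕ} (hi6 : i ≤ 6) (hbl : τ.reg bl = P.base i)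
    (hbc : τ.reg bc = P.base (i + 1)) {L : List (Fin P.n)} {rk : Fin P.n → ℕ}
    (hLn : L.length ≤ P.n)
    (hH : Holds τ.mem (P.base i) (P.base (i + 1)) L rk) {x : Fin P.n}
    (hx : L[P.s - 1]? = some x) :
    (Expr.mem (.op .add (.reg bc) (.mem (.op .add (.reg bl)
      (.op .sub (.reg 5) (.lit 1)))))).eval P.w τ = rk x + 1 := by
  have hs := P.two_le_s
  have hB := P.bound
  have hsL := (List.getElem?_eq_some_iff.1 hx).1
  have hxn := x.2
  have hw := base_lt (P := P) (i := i) (by omega)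
  have hw := base_lt (P := P) (i := i + 1) (by omega)
  have e : (Expr.lit 1).eval P.w τ = 1 := eval_lit (by omega)
  have e1 : (Expr.op .sub (.reg 5) (.lit 1)).eval P.w τ = P.s - 1 := by
    rw [eval_sub] <;> simp only [e, eval_reg, hτ.r5] <;> omega
  have e2 : (Expr.op .add (.reg bl) (.op .sub (.reg 5) (.lit 1))).eval P.w τ =
      P.base i + (P.s - 1) := by
    rw [eval_add] <;> simp only [e1, eval_reg, hbl]
    omega
  have e3 : (Expr.op .add (.reg bc) (.mem (.op .add (.reg bl)
      (.op .sub (.reg 5) (.lit 1))))).eval P.w τ = P.base (i + 1) + (x + 1) := by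
    rw [eval_add] <;> simp only [eval_mem, e2, eval_reg, hbc, hH.list _ x hx]
    omega
  rw [eval_mem, e3, hH.rank, if_pos (List.mem_of_getElem? hx)]

/-- Correctness of `cutDepth`: the `s`-th vertex in the order of exploration is on the level where the subtree
is cut. -/
theorem cutDepth_spec {σ : State} (hσ : P.Ctx σ) (hz : P.Zero 1 σ) (hz3 : P.Zero 3 σ)
    {w v : Fin P.n} (hv : v ∈ cell P.G P.W P.k w) (hov : σ.reg 50 = v + 1) :
    P.Agree 51 0 4 σ (cutDepth.denote P.w P.L.oracle σ) ∧
      P.Zero 1 (cutDepth.denote P.w P.L.oracle σ) ∧ P.Zero 3 (cutDepth.denote P.w P.L.oracle σ) ∧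
      (cutDepth.denote P.w P.L.oracle σ).reg 58 =
        if P.s ≤ (subtree (P.T w) v).ncard then treeDepth (P.T w) P.s v + 1 else 0 := by
  have hs := P.two_le_s
  simp only [cutDepth, denote_block_cons, denote_block_nil]
  obtain ⟨⟨a₁, -, z₁⟩, L, hE, hH, hlen⟩ := treeExplore_spec (o := 50) (bl := 11) (bc := 12) (N := 5)
    (i := 2) (Nv := P.s) (by omega) (by omega) (by omega) (by omega) hσ hz hz3
    (fun τ h => ⟨h.r11, h.r12, h.r5⟩) hv hov
  set σ₁ := (treeExplore 50 11 12 5).denote P.w P.L.oracle σ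
  have c₁ := hσ.of_agree a₁ (by omega)
  obtain ⟨σ₂, hσ₂, e₂⟩ : ∃ σ₂, (ite (.op .lt (.reg 51) (.reg 5)) (assign 58 (.lit 0))
      (assign 58 (.mem (.op .add (.reg 12) (.mem (.op .add (.reg 11)
        (.op .sub (.reg 5) (.lit 1)))))))).denote P.w P.L.oracle σ₁ = σ₂ ∧
      σ₂ = σ₁.setReg 58
        (if P.s ≤ (subtree (P.T w) v).ncard then treeDepth (P.T w) P.s v + 1 else 0) := by
    refine ⟨_, rfl, ?_⟩
    have hT := tests_lt (w := P.w) (σ := σ₁) (a := .reg 51) (b := .reg 5) hlen c₁.r5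
    rcases (P.forest w).treeDepth_eq (fun x y h => adj_of_tree h)
      (fun x => (dist_le_card P.conn w x).le) (by omega) le_rfl hE with ⟨h1, h2, -⟩ | ⟨x, h1, -, h2, h3⟩
    · rw [denote_ite_pos (hT.ne_zero.2 h1), if_neg (by omega)]
      simp only [denote, eval_zero]
    · have := (List.getElem?_eq_some_iff.1 h1).1
      rw [denote_ite_neg (hT.2 (by omega)), if_pos h2, h3]
      simp only [denote, eval_cut (i := 2) c₁ (by omega) c₁.r11 c₁.r12 hE.length_le_card hH h1]
  rw [hσ₂]
  have a₂ : P.Agree 58 0 0 σ₁ σ₂ := by rw [e₂]; exact (Agree.refl _).setReg (by omega) _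
  have c₂ := c₁.of_agree a₂ (by omega)
  have hlen' := hE.length_le
  obtain ⟨a₃, z₃⟩ := treeWipe_spec (O := P.L.oracle) (o := 50) (bl := 11) (bc := 12) (N := 17)
    (i := 2) (Nv := P.s * P.d + 1) (by omega) (by omega) c₂ (fun τ h => ⟨h.r11, h.r12, h.r17⟩)
    hE.length_le_card (by omega) (by rw [a₂.mem_eq]; exact hH) (by rw [a₂.1 _ (by omega), hlen])
  have r58 : ((wipe 50 11 12 17).denote P.w P.L.oracle σ₂).reg 58 = σ₂.reg 58 :=
    denote_reg_of_notMem (by simp [wipe, writes]) σ₂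
  refine ⟨(a₁.trans (a₂.mono (by omega) le_rfl (by omega))).trans
    (a₃.mono (by omega) (by omega) le_rfl), ?_, z₃, ?_⟩
  · exact (z₁.of_agree a₂ (.inr (by omega))).of_agree a₃ (.inl (by omega))
  · rw [r58, e₂]; simp

end Setup

/-! ### The sub-center of a vertex -/

namespace FProg

/-- Replaces the vertex in register `39` by its ancestor whose distance from the center plus one is
in register `38`. -/
def climb : FProg := loop 40 4 (block [
  assign 60 (.reg 39),
  parent,
  ite (.op .lt (.reg 38) (.reg 62)) (assign 39 (.reg 63)) skip])

/-- The last part of a step of the descent, if the vertex in register `32` is below the cut of the current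
subtree: finds its ancestor just below the cut, and continues from there if the subtree is large. -/
def descendBelow : FProg := block [
  assign 39 (.reg 32),
  climb,
  assign 50 (.reg 39),
  cutDepth,
  ite (.reg 58) (block [assign 33 (.reg 39), assign 36 (.reg 38)]) skip]

/-- A step of the descent from a sub-center, in register `33`, towards the vertex in register `32`. -/
def descend : FProg := block [
  assign 50 (.reg 33),
  cutDepth,
  assign 38 (.op .add (.reg 36) (.reg 58)),
  ite (Expr.and (.op .lt (.lit 0) (.reg 58)) (.op .lt (.reg 38) (.op .add (.reg 35) (.lit 1))))
    descendBelow skip]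

/-- The sub-center of the part of the vertex in register `32`, in register `33`, and the parent of
the vertex itself in the BFS tree of its cell, in register `34`; both are `0` for a remote vertex. The part is found by descending
from the center, at most `k` times. -/
def findSub : FProg := block [
  assign 60 (.reg 32),
  parent,
  assign 33 (.reg 61),
  assign 34 (.reg 63),
  assign 35 (.reg 62),
  assign 36 (.lit 1),
  ite (.reg 33) (loop 37 4 descend) skip]

end FProg

namespace Setup

variable {P : Setup}
open FProg SSG.Expr

theorem subtree_of_subtree {w c x u : Fin P.n} (hc : u ∈ subtree (P.T w) c)
    (hx : u ∈ subtree (P.T w) x) (h : P.G.dist w c ≤ P.G.dist w x) : x ∈ subtree (P.T w) c :=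
  (P.forest w).subtree_comparable hx hc h

theorem climb_spec {σ : State} (hσ : P.Ctx σ) (hz : P.Zero 1 σ) {w c u : Fin P.n}
    (hc : c ∈ cell P.G P.W P.k w) (hcu : u ∈ subtree (P.T w) c) {m : ℕ}
    (h39 : σ.reg 39 = u + 1) (h38 : σ.reg 38 = m + 1) (hcm : P.G.dist w c < m)
    (hmu : m ≤ P.G.dist w u) :
    P.Agree 39 0 2 σ (climb.denote P.w P.L.oracle σ) ∧
      P.Zero 1 (climb.denote P.w P.L.oracle σ) ∧
      ∃ x : Fin P.n, (climb.denote P.w P.L.oracle σ).reg 39 = x + 1 ∧ u ∈ subtree (P.T w) x ∧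
        P.G.dist w x = m ∧ x ∈ subtree (P.T w) c := by
  have hk := P.two_le_k
  -- Each step goes up one level until level `m` is reached; there are fewer than `k` levels.
  have key := loop_inv (w := P.w) (O := P.L.oracle) (i := 40) (N := 4) (σ := σ) (m := P.k)
    (p := block [assign 60 (.reg 39), parent,
      ite (.op .lt (.reg 38) (.reg 62)) (assign 39 (.reg 63)) skip])
    (fun j τ => P.Agree 39 0 2 σ τ ∧ P.Zero 1 τ ∧ ∃ x : Fin P.n, τ.reg 39 = x + 1 ∧
      u ∈ subtree (P.T w) x ∧ m ≤ P.G.dist w x ∧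
      (P.G.dist w x + j ≤ P.G.dist w u ∨ P.G.dist w x = m)) hσ.r4 ?_ ?_ ?_
  · obtain ⟨h1, h2, x, h3, h4, h5, h6⟩ := key
    have hu := subtree_subset_cell P.conn hc hcu
    have := dist_le_bfsDepth_of_mem_cell hu
    have := bfsDepth_lt P.conn (k := P.k) (by omega) u
    exact ⟨h1, h2, x, h3, h4, by omega, subtree_of_subtree hcu h4 (by omega)⟩
  · rintro j τ y ⟨h1, h2, x, h3, h4⟩
    exact ⟨h1.setReg (by omega) y, h2, x, by simpa using h3, h4⟩
  · exact ⟨Agree.refl σ, hz, u, h39, self_mem_subtree u, hmu, .inl le_rfl⟩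
  · rintro j hj τ ⟨h1, h2, x, h3, h4, h5, h6⟩ -
    simp only [denote_block_cons, denote_block_nil]
    set τ₁ := (assign 60 (.reg 39)).denote P.w P.L.oracle τ with f₁
    simp only [denote, eval_reg, h3] at f₁
    have b₁ : P.Agree 60 0 2 τ τ₁ := by rw [f₁]; exact (Agree.refl τ).setReg (by omega) _
    obtain ⟨b₂, z₂, hcode⟩ := parent_spec ((hσ.of_agree h1 (by omega)).of_agree b₁ (by omega))
      (by rw [f₁]; exact h2) (y := x) (by rw [f₁]; simp)
    set τ₂ := parent.denote P.w P.L.oracle τ₁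
    have b : P.Agree 60 0 2 τ τ₂ := b₁.trans (b₂.mono (by omega) le_rfl le_rfl)
    have h1' : P.Agree 39 0 2 σ τ₂ := h1.trans (b.mono (by omega) le_rfl le_rfl)
    have r38 : τ₂.reg 38 = m + 1 := by rw [h1'.1 38 (by omega), h38]
    have r39 : τ₂.reg 39 = x + 1 := by rw [b.1 39 (by omega), h3]
    have hxc := subtree_of_subtree hcu h4 (by omega)
    have hxcell := subtree_subset_cell P.conn hc hxc
    have hT := tests_lt (w := P.w) (σ := τ₂) (a := .reg 38) (b := .reg 62) (y := τ₂.reg 62) r38 rfl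
    rcases hcode with ⟨hr, -⟩ | ⟨w', -, hw', -, h62, hp⟩
    · exact absurd hr hxcell.2
    obtain rfl := cell_unique hxcell hw'
    rw [h62] at hT
    rcases denote_ite_of_tests (O := P.L.oracle) (p := assign 39 (.reg 63)) (q := skip) hT with
      ⟨hlt, e⟩ | ⟨hlt, e⟩
    · rw [e]
      rcases hp with ⟨-, rfl⟩ | ⟨z, hz63, hzx⟩
      · rw [SimpleGraph.dist_self] at hlt
        omega
      · have hlev := (P.forest w).lev_eq hzx
        simp only [denote, eval_reg, hz63]
        refine ⟨h1'.setReg (by omega) _, z₂, z, by simp, ?_, by omega, ?_⟩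
        · exact subtree_subset ⟨1, z, rfl, hzx⟩ h4
        · omega
    · rw [e]
      exact ⟨h1', z₂, x, r39, h4, h5, by omega⟩

/-- The outcome of the search for the part of `u`. -/
def IsSubCode (P : Setup) (u : Fin P.n) (c p : ℕ) : Prop :=
  (u ∈ remote P.G P.W P.k ∧ c = 0 ∧ p = 0) ∨
    ∃ w ∈ P.W, ∃ v : Fin P.n, c = v + 1 ∧ IsSubCenter (P.T w) P.s w v ∧ u ∈ piece (P.T w) P.s v ∧
      ((p = 0 ∧ u = w) ∨ ∃ z : Fin P.n, p = z + 1 ∧ P.T w z u)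

/-- The invariant of the descent from the center `w` towards `u`. -/
def Descent (P : Setup) (σ τ : State) (w u : Fin P.n) (j : ℕ) : Prop :=
  P.Agree 33 0 4 σ τ ∧ P.Zero 1 τ ∧ P.Zero 3 τ ∧ τ.reg 34 = σ.reg 34 ∧
    τ.reg 35 = P.G.dist w u + 1 ∧ ∃ c : Fin P.n, τ.reg 33 = c + 1 ∧ τ.reg 36 = P.G.dist w c + 1 ∧
      IsSubCenter (P.T w) P.s w c ∧ u ∈ subtree (P.T w) c ∧
      (j ≤ P.G.dist w c ∨ u ∈ piece (P.T w) P.s c)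

theorem descendBelow_spec {τ₃ : State} (hσ₃ : P.Ctx τ₃) {w c u : Fin P.n} {j : ℕ}
    (hwW : w ∈ P.W) (h2 : P.Zero 1 τ₃) (h3 : P.Zero 3 τ₃)
    (h5 : τ₃.reg 35 = P.G.dist w u + 1) (h6 : τ₃.reg 33 = c + 1)
    (h7 : τ₃.reg 36 = P.G.dist w c + 1) (h8 : IsSubCenter (P.T w) P.s w c)
    (h9 : u ∈ subtree (P.T w) c) (h10 : j ≤ P.G.dist w c ∨ u ∈ piece (P.T w) P.s c)
    (r32 : τ₃.reg 32 = u + 1) (q38 : τ₃.reg 38 = P.G.dist w c + treeDepth (P.T w) P.s c + 2)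
    (hle : P.G.dist w c + treeDepth (P.T w) P.s c + 1 ≤ P.G.dist w u) :
    P.Descent τ₃ (descendBelow.denote P.w P.L.oracle τ₃) w u (j + 1) := by
  have hF := P.forest w
  have hroot : subtree (P.T w) w = cell P.G P.W P.k w := subtree_root P.conn hwW
  have hccell : c ∈ cell P.G P.W P.k w := hroot ▸ h8.mem_subtree
  generalize hD : treeDepth (P.T w) P.s c = D at *
  simp only [descendBelow, denote_block_cons, denote_block_nil]
  set τ₄ := (assign 39 (.reg 32)).denote P.w P.L.oracle τ₃ with f₄
  simp only [denote, eval_reg, r32] at f₄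
  have b₄ : P.Agree 39 0 4 τ₃ τ₄ := by rw [f₄]; exact (Agree.refl _).setReg (by omega) _
  obtain ⟨b₅, hz₅, a, ha39, hau, hadist, hac⟩ := climb_spec (m := P.G.dist w c + D + 1)
    (hσ₃.of_agree b₄ (by omega)) (by rw [f₄]; exact h2) hccell h9 (by rw [f₄]; simp)
    (by rw [f₄]; simpa using q38) (by omega) (by omega)
  set τ₅ := climb.denote P.w P.L.oracle τ₄
  have b₄₅ : P.Agree 39 0 4 τ₃ τ₅ := b₄.trans (b₅.mono le_rfl le_rfl (by omega))
  have z₅ : P.Zero 3 τ₅ := by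
    refine Zero.of_agree (σ := τ₄) ?_ b₅ (.inr (by omega))
    rw [f₄]; exact h3
  have halev : a ∈ treeLevel (P.T w) c (D + 1) := by
    have := hF.mem_treeLevel_of_mem_subtree hac
    rwa [show P.G.dist w a - P.G.dist w c = D + 1 by omega] at this
  set τ₆ := (assign 50 (.reg 39)).denote P.w P.L.oracle τ₅ with f₆
  simp only [denote, eval_reg, ha39] at f₆
  have b₆ : P.Agree 50 0 4 τ₅ τ₆ := by rw [f₆]; exact (Agree.refl _).setReg (by omega) _
  obtain ⟨b₇, z₇, zz₇, p58⟩ := cutDepth_spec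
    ((hσ₃.of_agree b₄₅ (by omega)).of_agree b₆ (by omega))
    (by rw [f₆]; exact hz₅) (by rw [f₆]; exact z₅) (subtree_subset_cell P.conn hccell hac)
    (by rw [f₆]; simp)
  set τ₇ := cutDepth.denote P.w P.L.oracle τ₆
  have b₅₇ : P.Agree 50 0 4 τ₅ τ₇ := b₆.trans (b₇.mono (by omega) le_rfl le_rfl)
  have b₃₇ : P.Agree 39 0 4 τ₃ τ₇ := b₄₅.trans (b₅₇.mono (by omega) le_rfl le_rfl)
  have h1'' : P.Agree 33 0 4 τ₃ τ₇ := b₃₇.mono (by omega) le_rfl le_rfl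
  have p39 : τ₇.reg 39 = a + 1 := by rw [b₅₇.1 39 (by omega), ha39]
  have p38 : τ₇.reg 38 = P.G.dist w a + 1 := by rw [b₃₇.1 38 (by omega), q38]; omega
  have plow : ∀ r, r < 38 → τ₇.reg r = τ₃.reg r := fun r hr => b₃₇.1 r (by omega)
  by_cases hsa : P.s ≤ (subtree (P.T w) a).ncard
  · rw [if_pos hsa] at p58
    rw [denote_ite_pos (by rw [eval_reg, p58]; omega)]
    simp only [denote_block_cons, denote_block_nil, denote, eval_reg, State.setReg_reg,
      Nat.reduceEqDiff, if_false, p39, p38]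
    refine ⟨(h1''.setReg (by omega) _).setReg (by omega) _, z₇, zz₇, ?_, ?_, a, ?_, ?_,
      .child h8 (hD ▸ halev) hsa, hau, .inl ?_⟩
    · simpa using plow 34 (by omega)
    · simpa using (plow 35 (by omega)).trans h5
    · simp
    · simp
    · rcases h10 with h10 | h10
      · omega
      -- a vertex of the part of `c` below the cut lies in a small subtree
      · exfalso
        simp only [piece, hD] at h10
        rcases h10 with h10 | ⟨a', ha', hsmall, hua'⟩
        · rw [hF.mem_treeBall_iff] at h10
          omega
        · obtain rfl : a = a' := by
            refine hF.ancestor_unique (hF.mem_treeLevel_of_mem_subtree hau) ?_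
            have h11 := hF.mem_treeLevel_of_mem_subtree hua'
            rwa [hF.lev_of_mem_treeLevel ha', ← hF.lev_of_mem_treeLevel halev] at h11
          omega
  · rw [if_neg hsa] at p58
    rw [denote_ite_neg (by rw [eval_reg, p58])]
    exact ⟨h1'', z₇, zz₇, plow 34 (by omega), (plow 35 (by omega)).trans h5, c,
      (plow 33 (by omega)).trans h6, (plow 36 (by omega)).trans h7, h8, h9,
      .inr (.inr ⟨a, hD ▸ halev, by omega, hau⟩)⟩

/-- Each step of the descent passes to a sub-center on a lower level, or has already reached the part of `u`. -/
theorem descend_spec {σ τ : State} (hσ : P.Ctx σ) {w u : Fin P.n} {j : ℕ}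
    (hu : σ.reg 32 = u + 1) (hwW : w ∈ P.W) (h : P.Descent σ τ w u j) :
    P.Descent σ (descend.denote P.w P.L.oracle τ) w u (j + 1) := by
  have hw := P.ten_lt
  have hF := P.forest w
  have hroot : subtree (P.T w) w = cell P.G P.W P.k w := subtree_root P.conn hwW
  have hdu := dist_le_card P.conn w u
  obtain ⟨h1, h2, h3, h4, h5, c, h6, h7, h8, h9, h10⟩ := h
  unfold descend
  have hccell : c ∈ cell P.G P.W P.k w := hroot ▸ h8.mem_subtree
  have hcu := hF.lev_le_of_mem_subtree h9
  simp only [denote_block_cons, denote_block_nil]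
  set τ₁ := (assign 50 (.reg 33)).denote P.w P.L.oracle τ with f₁
  simp only [denote, eval_reg, h6] at f₁
  have b₁ : P.Agree 50 0 4 τ τ₁ := by rw [f₁]; exact (Agree.refl τ).setReg (by omega) _
  obtain ⟨b₂, zz₂, zzz₂, r58⟩ := cutDepth_spec
    ((hσ.of_agree h1 (by omega)).of_agree b₁ (by omega))
    (by rw [f₁]; exact h2) (by rw [f₁]; exact h3) hccell (by rw [f₁]; simp)
  set τ₂ := cutDepth.denote P.w P.L.oracle τ₁
  have b : P.Agree 50 0 4 τ τ₂ := b₁.trans (b₂.mono (by omega) le_rfl le_rfl)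
  have r36 : τ₂.reg 36 = P.G.dist w c + 1 := by rw [b.1 36 (by omega), h7]
  have htd := hF.treeDepth_lt (s := P.s) (by have := P.two_le_s; omega) c
  have hcn := dist_le_card P.conn w c
  have hB := P.bound
  set D := τ₂.reg 58 with hD
  have hDs : D ≤ P.s := by rw [r58]; split_ifs <;> omega
  set τ₃ := (assign 38 (.op .add (.reg 36) (.reg 58))).denote P.w P.L.oracle τ₂ with f₃
  simp only [denote, eval_address (w := P.w) r36 hD.symm (by omega)] at f₃
  have b₃ : P.Agree 38 0 4 τ₂ τ₃ := by rw [f₃]; exact (Agree.refl _).setReg (by omega) _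
  have h1' : P.Agree 33 0 4 σ τ₃ := (h1.trans (b.mono (by omega) le_rfl le_rfl)).trans
    (b₃.mono (by omega) le_rfl le_rfl)
  have q58 : τ₃.reg 58 = D := by rw [f₃]; simp [hD]
  have q38 : τ₃.reg 38 = P.G.dist w c + 1 + D := by rw [f₃]; simp
  have qlow : ∀ r, r < 38 → τ₃.reg r = τ.reg r := fun r hr => by
    rw [b₃.1 r hr, b.1 r (by omega)]
  have hzz₁ : P.Zero 1 τ₃ := by rw [f₃]; exact zz₂
  have hzz₃ : P.Zero 3 τ₃ := by rw [f₃]; exact zzz₂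
  have hT := (tests_lt (w := P.w) (σ := τ₃) (a := .lit 0) (b := .reg 58) eval_zero q58).and
    (by omega) (tests_lt (a := .reg 38) (b := .op .add (.reg 35) (.lit 1)) q38
      (eval_succ ((qlow 35 (by omega)).trans h5) (by omega)))
  rcases denote_ite_of_tests (O := P.L.oracle) (p := descendBelow) (q := skip) hT with
    ⟨⟨ht1, ht2⟩, e⟩ | ⟨ht, e⟩
  swap
  -- `u` is above the cut
  · rw [e]
    refine ⟨h1', hzz₁, hzz₃, by rw [← h4]; exact qlow 34 (by omega),
      (qlow 35 (by omega)).trans h5, c, (qlow 33 (by omega)).trans h6,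
      (qlow 36 (by omega)).trans h7, h8, h9, .inr ?_⟩
    by_cases hs : P.s ≤ (subtree (P.T w) c).ncard
    · rw [if_pos hs] at r58
      left
      rw [hF.mem_treeBall_iff]
      exact ⟨h9, by omega⟩
    · rw [hF.piece_eq_subtree (by omega)]
      exact h9
  rw [e]
  have hs : P.s ≤ (subtree (P.T w) c).ncard := by
    by_contra hs
    rw [if_neg hs] at r58
    omega
  rw [if_pos hs] at r58
  obtain ⟨g1, g2, g3, g4, g5⟩ := descendBelow_spec (hσ.of_agree h1' (by omega)) hwW hzz₁ hzz₃
    ((qlow 35 (by omega)).trans h5) ((qlow 33 (by omega)).trans h6) ((qlow 36 (by omega)).trans h7)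
    h8 h9 h10 (by rw [h1'.1 32 (by omega), hu]) (q38.trans (by omega)) (by omega)
  exact ⟨h1'.trans g1, g2, g3, g4.trans ((qlow 34 (by omega)).trans h4), g5⟩

/-- Correctness of `findSub`: as distances to the center are less than `k`, the descent ends within `k` steps. -/
theorem findSub_spec {σ : State} (hσ : P.Ctx σ) (hz : P.Zero 1 σ) (hz3 : P.Zero 3 σ) {u : Fin P.n}
    (hu : σ.reg 32 = u + 1) :
    P.Agree 33 0 4 σ (findSub.denote P.w P.L.oracle σ) ∧
      P.Zero 1 (findSub.denote P.w P.L.oracle σ) ∧ P.Zero 3 (findSub.denote P.w P.L.oracle σ) ∧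
      P.IsSubCode u ((findSub.denote P.w P.L.oracle σ).reg 33)
        ((findSub.denote P.w P.L.oracle σ).reg 34) := by
  have hk := P.two_le_k
  have hw := P.ten_lt
  have hlit1 : (Expr.lit 1).eval P.w = fun _ => 1 := funext fun τ => eval_lit (by omega)
  simp only [findSub, denote_block_cons, denote_block_nil]
  set σ₁ := (assign 60 (.reg 32)).denote P.w P.L.oracle σ with e₁
  simp only [denote, eval_reg, hu] at e₁
  have a₁ : P.Agree 60 0 2 σ σ₁ := by rw [e₁]; exact (Agree.refl σ).setReg (by omega) _
  obtain ⟨a₂, z₂, hcode⟩ := parent_spec (hσ.of_agree a₁ (by omega))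
    (by rw [e₁]; exact hz) (y := u) (by rw [e₁]; simp)
  set σ₂ := parent.denote P.w P.L.oracle σ₁
  have a₁₂ : P.Agree 60 0 2 σ σ₂ := a₁.trans (a₂.mono (by omega) le_rfl le_rfl)
  set σ₃ := (assign 36 (.lit 1)).denote P.w P.L.oracle ((assign 35 (.reg 62)).denote P.w P.L.oracle
    ((assign 34 (.reg 63)).denote P.w P.L.oracle ((assign 33 (.reg 61)).denote P.w P.L.oracle σ₂)))
    with e₃
  simp only [denote, eval_reg, State.setReg_reg, Nat.reduceEqDiff, if_false, congrFun hlit1] at e₃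
  have a₃ : P.Agree 33 0 2 σ₂ σ₃ := by
    rw [e₃]
    exact ((((Agree.refl σ₂).setReg (by omega) _).setReg (by omega) _).setReg (by omega) _).setReg
      (by omega) _
  have a : P.Agree 33 0 4 σ σ₃ :=
    ((a₁₂.mono (by omega) le_rfl le_rfl).trans a₃).mono le_rfl le_rfl (by omega)
  have z₃ : P.Zero 1 σ₃ := by rw [e₃]; exact z₂
  have zz₃ : P.Zero 3 σ₃ := (hz3.of_agree a₁₂ (.inr (by omega))).of_agree a₃ (.inr (by omega))
  have r33 : σ₃.reg 33 = σ₂.reg 61 := by rw [e₃]; simp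
  have r34 : σ₃.reg 34 = σ₂.reg 63 := by rw [e₃]; simp
  have r35 : σ₃.reg 35 = σ₂.reg 62 := by rw [e₃]; simp
  have r36 : σ₃.reg 36 = 1 := by rw [e₃]; simp
  rw [← r33, ← r34, ← r35] at hcode
  rcases hcode with ⟨hr, h33, -, h34⟩ | ⟨w, hwW, hcell, h33, h35, hp⟩
  · rw [denote_ite_neg (by rw [eval_reg, h33])]
    exact ⟨a, z₃, zz₃, .inl ⟨hr, h33, h34⟩⟩
  rw [denote_ite_pos (by rw [eval_reg, h33]; omega)]
  have c₃ := hσ.of_agree a (by omega)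
  have hF := P.forest w
  have hroot : subtree (P.T w) w = cell P.G P.W P.k w := subtree_root P.conn hwW
  have hdu := dist_le_card P.conn w u
  have hdk : P.G.dist w u < P.k :=
    (dist_le_bfsDepth_of_mem_cell hcell).trans_lt (bfsDepth_lt P.conn (k := P.k) (by omega) u)
  have r32 : σ₃.reg 32 = u + 1 := by rw [a.1 32 (by omega), hu]
  have key := loop_inv (w := P.w) (O := P.L.oracle) (i := 37) (N := 4) (σ := σ₃) (m := P.k)
    (p := descend) (fun j τ => P.Descent σ₃ τ w u j) c₃.r4 ?_ ?_ ?_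
  · obtain ⟨h1, h2, h3, h4, -, c, h5, -, h6, h7, h8⟩ := key
    refine ⟨a.trans h1, h2, h3, .inr ⟨w, hwW, c, h5, h6, h8.resolve_left ?_, ?_⟩⟩
    · have := hF.lev_le_of_mem_subtree h7
      omega
    · rw [h4]
      exact hp
  · rintro j τ y ⟨h1, h2, h3, h4, h5, c, h6, h7, h8⟩
    exact ⟨h1.setReg (by omega) y, h2, h3, by simpa using h4, by simpa using h5, c,
      by simpa using h6, by simpa using h7, h8⟩
  · exact ⟨Agree.refl _, z₃, zz₃, rfl, h35, w, h33, by rw [r36, SimpleGraph.dist_self], .root,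
      hroot ▸ hcell, .inl (Nat.zero_le _)⟩
  · exact fun j _ τ h _ => descend_spec c₃ r32 hwW h

end Setup

/-! ### Enumerating a part -/

section Cover

variable {n : ℕ} {G : SimpleGraph (Fin n)} {T : Fin n → Fin n → Prop} {lev : Fin n → ℕ}

open Classical in
/-- The vertices that the vertex `e` with rank `r` contributes to a part cut at depth `lim - 1`. -/
noncomputable def cover (T : Fin n → Fin n → Prop) (s lim r : ℕ) (e : Fin n) : Set (Fin n) :=
  if r < lim then {e} else if r = lim ∧ (subtree T e).ncard < s then subtree T e else ∅

/-- The vertices contributed by the first `j` entries of the list `L`. -/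
def covered (T : Fin n → Fin n → Prop) (s lim : ℕ) (rk : Fin n → ℕ) (L : List (Fin n)) (j : ℕ) :
    Set (Fin n) :=
  {y | ∃ i < j, ∃ e, L[i]? = some e ∧ y ∈ cover T s lim (rk e) e}

theorem covered_succ {s lim : ℕ} {rk : Fin n → ℕ} {L : List (Fin n)} {j : ℕ} {e : Fin n}
    (he : L[j]? = some e) :
    covered T s lim rk L (j + 1) = covered T s lim rk L j ∪ cover T s lim (rk e) e := by
  ext y
  constructor
  · rintro ⟨i, hi, e', he', hy⟩
    rcases Nat.lt_succ_iff_lt_or_eq.1 hi with hi | rfl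
    · exact .inl ⟨i, hi, e', he', hy⟩
    · rw [he] at he'
      cases he'
      exact .inr hy
  · rintro (⟨i, hi, h⟩ | hy)
    · exact ⟨i, by omega, h⟩
    · exact ⟨j, by omega, e, he, hy⟩

theorem covered_of_length_le {s lim : ℕ} {rk : Fin n → ℕ} {L : List (Fin n)} {i j : ℕ}
    (hi : L.length ≤ i) (hj : L.length ≤ j) : covered T s lim rk L i = covered T s lim rk L j := by
  ext y
  constructor <;>
  · rintro ⟨a, -, e, he, hy⟩
    have := (List.getElem?_eq_some_iff.1 he).1
    exact ⟨a, by omega, e, he, hy⟩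

theorem IsForest.covered_eq_piece (hT : IsForest T lev) (hadj : ∀ x y, T x y → G.Adj x y)
    (hlev : ∀ x, lev x < n) {d s lim m : ℕ} (hdeg : ∀ v, (G.neighborSet v).ncard ≤ d) (hs : 1 ≤ s)
    (hd : 1 ≤ d) {v : Fin n} {L : List (Fin n)} {D : Fin n → Prop}
    (h : Explored (subtree T v) T (fun x => lev x - lev v) v L (s * d + 1) D m)
    (hlim : if L.length < s then n + 1 < lim else lim = treeDepth T s v + 1) :
    covered T s lim (fun x => lev x - lev v) L L.length = piece T s v := by
  have hsd : s ≤ s * d := Nat.le_mul_of_pos_right _ hd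
  rcases hT.treeDepth_eq hadj (fun x => (hlev x).le) hs (by omega) h with
    ⟨h1, h2, h3⟩ | ⟨x, hx, hxL, h2, h3⟩
  · rw [if_pos h1] at hlim
    rw [hT.piece_eq_subtree h2]
    ext y
    rw [← h3 y]
    constructor
    · rintro ⟨i, -, e, he, hy⟩
      rw [cover, if_pos (show lev e - lev v < lim by have := hlev e; omega)] at hy
      obtain rfl : y = e := hy
      exact List.mem_of_getElem? he
    · intro hy
      obtain ⟨i, hi⟩ := List.mem_iff_getElem?.1 hy
      refine ⟨i, (List.getElem?_eq_some_iff.1 hi).1, y, hi, ?_⟩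
      rw [cover, if_pos (show lev y - lev v < lim by have := hlev y; omega)]
      rfl
  · have hsL := (List.getElem?_eq_some_iff.1 hx).1
    rw [if_neg (by omega)] at hlim
    ext y
    constructor
    · rintro ⟨i, -, e, he, hy⟩
      have heS := h.mem e (List.mem_of_getElem? he)
      have hel := hT.lev_le_of_mem_subtree heS
      simp only [cover] at hy
      split_ifs at hy with c1 c2
      · obtain rfl : y = e := hy
        exact .inl (hT.mem_treeBall_iff.2 ⟨heS, by omega⟩)
      · refine .inr ⟨e, ?_, c2.2, hy⟩
        have := hT.mem_treeLevel_of_mem_subtree heS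
        rwa [c2.1, hlim] at this
      · exact hy.elim
    · have key : ∀ e ∈ L, y ∈ cover T s lim (lev e - lev v) e →
          y ∈ covered T s lim (fun x => lev x - lev v) L L.length := by
        intro e he hy
        obtain ⟨i, hi⟩ := List.mem_iff_getElem?.1 he
        exact ⟨i, (List.getElem?_eq_some_iff.1 hi).1, e, hi, hy⟩
      have hfull : ∀ z ∈ treeBall T v (treeDepth T s v), z ∈ L := by
        intro z hz
        rw [hT.mem_treeBall_iff] at hz
        exact h.full (s - 1) (by omega) x hx z hz.1 (by omega)
      rintro (hy | ⟨u, hu, hsm, hyu⟩)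
      · refine key y (hfull y hy) ?_
        rw [hT.mem_treeBall_iff] at hy
        rw [cover, if_pos (by omega)]
        rfl
      · obtain ⟨z, hz, hzu⟩ := hu
        have hzB : z ∈ treeBall T v (treeDepth T s v) := ⟨_, le_rfl, hz⟩
        have hzl := hT.lev_of_mem_treeLevel hz
        have hul := hT.lev_eq hzu
        obtain ⟨i, hi⟩ := List.mem_iff_getElem?.1 (hfull z hzB)
        have h4 := h.lt_ncard hi (T := treeBall T v (treeDepth T s v)) fun a ha hle => by
          rw [hT.mem_treeBall_iff]
          exact ⟨ha, by omega⟩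
        have h5 := hT.ncard_treeBall_le hadj hdeg (s := s) v
        refine key u (h.closed i (by omega) z hi u hzu) ?_
        rw [cover, if_neg (by omega), if_pos ⟨by omega, hsm⟩]
        exact hyu

end Cover

namespace FProg

/-- Runs `act` on all vertices of the subtree at the vertex in register `27`, if it has fewer than `s`
vertices. In a run of `act`, register `27` holds the vertex. -/
def forSmall (act : FProg) : FProg := block [
  assign 50 (.reg 27),
  treeExplore 50 11 12 5,
  ite (.op .lt (.reg 51) (.reg 5))
    (loop 31 5 (ite (.op .lt (.reg 31) (.reg 51))
      (block [assign 27 (.mem (.op .add (.reg 11) (.reg 31))), act]) skip)) skip,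
  wipe 50 11 12 17]

/-- What is done with an entry of the list of the vertices explored from a sub-center. -/
def forEntry (act : FProg) : FProg := block [
  assign 27 (.mem (.op .add (.reg 13) (.reg 29))),
  assign 30 (.mem (.op .add (.reg 14) (.reg 27))),
  ite (.op .lt (.reg 30) (.op .add (.reg 28) (.lit 1))) act
    (ite (.op .eq (.reg 30) (.op .add (.reg 28) (.lit 1))) (forSmall act) skip)]

/-- Runs `act` on all vertices of the part of the vertex in register `25`, whose sub-center is in
register `26`. -/
def forPart (act : FProg) : FProg :=
  ite (.reg 26) (block [
    assign 42 (.reg 26),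
    treeExplore 42 13 14 17,
    ite (.op .lt (.reg 43) (.reg 5)) (assign 28 (.op .add (.reg 2) (.lit 2)))
      (assign 28 (.mem (.op .add (.reg 14) (.mem (.op .add (.reg 13)
        (.op .sub (.reg 5) (.lit 1))))))),
    loop 29 18 (ite (.op .lt (.reg 29) (.reg 43)) (forEntry act) skip),
    wipe 42 13 14 18])
  (block [assign 27 (.reg 25), act])

end FProg

namespace Setup

variable {P : Setup}
open FProg SSG.Expr

/-- What is left unchanged by the programs that are run on the vertices of a part. -/
def Keep (P : Setup) (σ τ : State) : Prop :=
  (∀ a < P.base 6, τ.mem a = σ.mem a) ∧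
    ∀ r, (r < 20 ∨ 28 ≤ r ∧ r < 60) → r ≠ 31 → τ.reg r = σ.reg r

theorem Keep.refl (σ : State) : P.Keep σ σ := ⟨fun _ _ => rfl, fun _ _ _ => rfl⟩

theorem Keep.trans {σ τ υ : State} (h : P.Keep σ τ) (h' : P.Keep τ υ) : P.Keep σ υ :=
  ⟨fun a ha => (h'.1 a ha).trans (h.1 a ha), fun r hr hr' => (h'.2 r hr hr').trans (h.2 r hr hr')⟩

theorem Keep.setReg {σ τ : State} (h : P.Keep σ τ) {i : ℕ} (hi : i = 27 ∨ i = 31) (x : ℕ) :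
    P.Keep σ (τ.setReg i x) :=
  ⟨h.1, fun r hr hr' => by rw [State.setReg_reg, if_neg (by omega), h.2 r hr hr']⟩

theorem Ctx.of_keep {σ τ : State} (hσ : P.Ctx σ) (h : P.Keep σ τ) : P.Ctx τ := by
  constructor
  case seed =>
    intro a ha
    rw [h.1 a (ha.trans_le (seed_lt_base 6))]
    exact hσ.seed a ha
  all_goals rw [h.2 _ (by omega) (by omega)]
  exacts [hσ.r2, hσ.r3, hσ.r4, hσ.r5, hσ.r6, hσ.r7, hσ.r8, hσ.r9, hσ.r10, hσ.r11, hσ.r12, hσ.r13,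
    hσ.r14, hσ.r15, hσ.r16, hσ.r17, hσ.r18]

theorem Zero.of_keep {i : ℕ} {σ τ : State} (hσ : P.Zero i σ) (h : P.Keep σ τ) (hi : i < 6) :
    P.Zero i τ := by
  intro v
  have hv := v.2
  have h1 := base_succ (P := P) i
  have h2 := base_mono (P := P) (show i + 1 ≤ 6 by omega)
  rw [h.1 _ (by omega), hσ v]

/-- `act` maintains the property `J` of the set of vertices on which it has been run. -/
structure Acts (P : Setup) (act : FProg) (J : Set (Fin P.n) → State → Prop) : Prop where
  agree : ∀ X σ τ, P.Agree 25 0 6 σ τ → J X σ → J X τ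
  run : ∀ X σ (x : Fin P.n), P.Ctx σ → J X σ → σ.reg 27 = x + 1 →
    J (X ∪ {x}) (act.denote P.w P.L.oracle σ) ∧ P.Keep σ (act.denote P.w P.L.oracle σ)

variable {act : FProg} {J : Set (Fin P.n) → State → Prop}

open Classical in
theorem forSmall_spec (hJ : P.Acts act J) {σ : State} (hσ : P.Ctx σ) (hz : P.Zero 1 σ)
    (hz3 : P.Zero 3 σ) {w e : Fin P.n} (he : e ∈ cell P.G P.W P.k w) (h27 : σ.reg 27 = e + 1)
    {X : Set (Fin P.n)} (hX : J X σ) :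
    J (X ∪ if (subtree (P.T w) e).ncard < P.s then subtree (P.T w) e else ∅)
      ((forSmall act).denote P.w P.L.oracle σ) ∧
    P.Ctx ((forSmall act).denote P.w P.L.oracle σ) ∧
    P.Zero 1 ((forSmall act).denote P.w P.L.oracle σ) ∧
    P.Zero 3 ((forSmall act).denote P.w P.L.oracle σ) ∧
    (∀ r, 28 ≤ r → r < 50 → r ≠ 31 → ((forSmall act).denote P.w P.L.oracle σ).reg r = σ.reg r) ∧
    ∀ a, P.base 4 ≤ a → a < P.base 6 →
      ((forSmall act).denote P.w P.L.oracle σ).mem a = σ.mem a := by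
  have h24 : P.base 2 ≤ P.base 4 := base_mono (by omega)
  have h34 : P.base 4 = P.base 3 + (P.n + 2) := base_succ 3
  have h23 : P.base 3 = P.base 2 + (P.n + 2) := base_succ 2
  have h46 : P.base 4 ≤ P.base 6 := base_mono (by omega)
  have hw := base_lt (P := P) (i := 2) (by omega)
  simp only [forSmall, denote_block_cons, denote_block_nil]
  obtain ⟨σ₁, e₁⟩ : ∃ σ₁, σ₁ = (assign 50 (.reg 27)).denote P.w P.L.oracle σ := ⟨_, rfl⟩
  rw [← e₁]
  simp only [denote, eval_reg, h27] at e₁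
  have a₁ : P.Agree 50 0 4 σ σ₁ := by rw [e₁]; exact (Agree.refl σ).setReg (by omega) _
  obtain ⟨⟨a₂, -, z₂⟩, L, hE, hH, hlen⟩ := treeExplore_spec (o := 50) (bl := 11) (bc := 12) (N := 5)
    (i := 2) (Nv := P.s) (by omega) (by omega) (by omega) (by omega) (hσ.of_agree a₁ (by omega))
    (by rw [e₁]; exact hz) (by rw [e₁]; exact hz3)
    (fun τ h => ⟨h.r11, h.r12, h.r5⟩) he (by rw [e₁]; simp)
  generalize (treeExplore 50 11 12 5).denote P.w P.L.oracle σ₁ = σ₂ at *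
  have a₂' : P.Agree 50 0 4 σ σ₂ := a₁.trans (a₂.mono (by omega) le_rfl (by omega))
  have c₂ := hσ.of_agree a₂' (by omega)
  have hX₂ : J X σ₂ := hJ.agree X σ σ₂ (a₂'.mono (by omega) le_rfl (by omega)) hX
  have hLn := hE.length_le_card
  have hlen' := hE.length_le
  have hT := tests_lt (w := P.w) (σ := σ₂) (a := .reg 51) (b := .reg 5) hlen c₂.r5
  obtain ⟨σ₃, hσ₃, hJ₃, k₃⟩ : ∃ σ₃, (ite (.op .lt (.reg 51) (.reg 5))
      (loop 31 5 (ite (.op .lt (.reg 31) (.reg 51))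
      (block [assign 27 (.mem (.op .add (.reg 11) (.reg 31))), act]) skip)) skip).denote
      P.w P.L.oracle σ₂ = σ₃ ∧
      J (X ∪ if (subtree (P.T w) e).ncard < P.s then subtree (P.T w) e else ∅) σ₃ ∧
      P.Keep σ₂ σ₃ := by
    refine ⟨_, rfl, ?_⟩
    rcases (P.forest w).treeDepth_eq (fun x y h => adj_of_tree h)
      (fun x => (dist_le_card P.conn w x).le) (by have := P.two_le_s; omega) le_rfl hE with
      ⟨h1, h2, h3⟩ | ⟨x, h1, -, h2, h3⟩
    swap
    · have := (List.getElem?_eq_some_iff.1 h1).1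
      rw [denote_ite_neg (hT.2 (by have := P.two_le_s; omega)), if_neg (by omega), Set.union_empty]
      exact ⟨hX₂, Keep.refl _⟩
    rw [denote_ite_pos (hT.ne_zero.2 h1), if_pos h2]
    have key := loop_inv (w := P.w) (O := P.L.oracle) (i := 31) (N := 5) (σ := σ₂) (m := P.s)
      (p := ite (.op .lt (.reg 31) (.reg 51))
        (block [assign 27 (.mem (.op .add (.reg 11) (.reg 31))), act]) skip)
      (fun j τ => J (X ∪ {y | ∃ i < j, L[i]? = some y}) τ ∧ P.Keep σ₂ τ) c₂.r5 ?_ ?_ ?_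
    · refine ⟨?_, key.2⟩
      convert key.1 using 2
      ext y
      rw [← h3 y]
      constructor
      · intro hy
        obtain ⟨i, hi⟩ := List.mem_iff_getElem?.1 hy
        have := (List.getElem?_eq_some_iff.1 hi).1
        exact ⟨i, by omega, hi⟩
      · rintro ⟨i, -, hi⟩
        exact List.mem_of_getElem? hi
    · rintro j τ y ⟨g1, g2⟩
      exact ⟨hJ.agree _ _ _ ((Agree.refl τ).setReg (by omega) y) g1, g2.setReg (.inr rfl) y⟩
    · refine ⟨?_, Keep.refl _⟩
      convert hX₂ using 1
      ext y
      simp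
    · rintro j - τ ⟨g1, g2⟩ hj
      have cτ := c₂.of_keep g2
      have r51 : τ.reg 51 = L.length := by rw [g2.2 51 (by omega) (by omega), hlen]
      have hT' := tests_lt (w := P.w) (σ := τ) (a := .reg 31) (b := .reg 51) hj r51
      by_cases hjL : j < L.length
      swap
      · rw [denote_ite_neg (hT'.2 hjL)]
        refine ⟨?_, g2⟩
        change J _ τ
        convert g1 using 2
        ext y
        constructor
        · rintro ⟨i, hi, hy⟩
          have := (List.getElem?_eq_some_iff.1 hy).1
          exact ⟨i, by omega, hy⟩
        · rintro ⟨i, hi, hy⟩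
          exact ⟨i, by omega, hy⟩
      rw [denote_ite_pos (hT'.ne_zero.2 hjL)]
      obtain ⟨y, hy⟩ : ∃ y, L[j]? = some y := ⟨_, List.getElem?_eq_getElem hjL⟩
      simp only [denote_block_cons, denote_block_nil]
      obtain ⟨τ₁, f₁⟩ : ∃ τ₁, τ₁ = (assign 27 (.mem (.op .add (.reg 11) (.reg 31)))).denote
        P.w P.L.oracle τ := ⟨_, rfl⟩
      rw [← f₁]
      have hmem : τ.mem (P.base 2 + j) = y + 1 := by
        rw [g2.1 _ (by omega), hH.list j y hy]
      simp only [denote, eval_mem, eval_address (w := P.w) cτ.r11 hj (by omega), hmem] at f₁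
      have k₁ : P.Keep τ τ₁ := by rw [f₁]; exact (Keep.refl τ).setReg (.inl rfl) _
      obtain ⟨q1, q2⟩ := hJ.run _ τ₁ y (cτ.of_keep k₁)
        (hJ.agree _ τ τ₁ (by rw [f₁]; exact (Agree.refl τ).setReg (by omega) _) g1)
        (by rw [f₁]; simp)
      refine ⟨?_, (g2.trans k₁).trans q2⟩
      convert q1 using 1
      rw [Set.union_assoc]
      congr 1
      ext z
      constructor
      · rintro ⟨i, hi, hz⟩
        rcases Nat.lt_succ_iff_lt_or_eq.1 hi with hi | rfl
        · exact .inl ⟨i, hi, hz⟩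
        · rw [hy] at hz
          cases hz
          exact .inr rfl
      · rintro (⟨i, hi, hz⟩ | hz)
        · exact ⟨i, by omega, hz⟩
        · obtain rfl : z = y := hz
          exact ⟨j, by omega, hy⟩
  rw [hσ₃]
  have c₃ := c₂.of_keep k₃
  have hH₃ : Holds σ₃.mem (P.base 2) (P.base 3) L (P.rk w e) := by
    constructor
    · intro i x hx
      have := (List.getElem?_eq_some_iff.1 hx).1
      rw [k₃.1 _ (by omega), hH.list i x hx]
    · intro v
      have := v.2
      rw [k₃.1 _ (by omega), hH.rank v]
  have hsd : P.s ≤ P.s * P.d := Nat.le_mul_of_pos_right _ P.one_le_d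
  obtain ⟨a₄, z₄⟩ := treeWipe_spec (O := P.L.oracle) (o := 50) (bl := 11) (bc := 12) (N := 17)
    (i := 2) (Nv := P.s * P.d + 1) (by omega) (by omega) c₃ (fun τ h => ⟨h.r11, h.r12, h.r17⟩)
    hLn (by omega) hH₃ (by rw [k₃.2 51 (by omega) (by omega), hlen])
  have z₃ := z₂.of_keep k₃ (by omega)
  refine ⟨hJ.agree _ _ _ (a₄.mono (by omega) (by omega) (by omega)) hJ₃,
    c₃.of_agree a₄ (by omega), z₃.of_agree a₄ (.inl (by omega)), z₄, fun r h1 h2 h3 => ?_,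
    fun a h1 h2 => ?_⟩
  · rw [a₄.1 r (by omega), k₃.2 r (by omega) h3, a₂'.1 r (by omega)]
  · rw [a₄.2 a (.inr h1), k₃.1 a h2, a₂'.2 a (.inr h1)]

theorem forEntry_spec (hJ : P.Acts act J) {σ : State} (hσ : P.Ctx σ) (hz : P.Zero 1 σ)
    (hz3 : P.Zero 3 σ) {w e v : Fin P.n} (he : e ∈ cell P.G P.W P.k w) {L : List (Fin P.n)}
    {j lim : ℕ} (hLn : L.length ≤ P.n)
    (h29 : σ.reg 29 = j) (h28 : σ.reg 28 = lim) (hlim : lim + 1 < 2 ^ P.w)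
    (hH : Holds σ.mem (P.base 4) (P.base 5) L (P.rk w v)) (hj : L[j]? = some e)
    {X : Set (Fin P.n)} (hX : J X σ) :
    J (X ∪ cover (P.T w) P.s lim (P.rk w v e) e) ((forEntry act).denote P.w P.L.oracle σ) ∧
    P.Ctx ((forEntry act).denote P.w P.L.oracle σ) ∧
    P.Zero 1 ((forEntry act).denote P.w P.L.oracle σ) ∧
    P.Zero 3 ((forEntry act).denote P.w P.L.oracle σ) ∧
    ((forEntry act).denote P.w P.L.oracle σ).reg 28 = lim ∧
    ((forEntry act).denote P.w P.L.oracle σ).reg 43 = σ.reg 43 ∧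
    ∀ a, P.base 4 ≤ a → a < P.base 6 →
      ((forEntry act).denote P.w P.L.oracle σ).mem a = σ.mem a := by
  classical
  have hjL := (List.getElem?_eq_some_iff.1 hj).1
  have hen := e.2
  have hw4 := base_lt (P := P) (i := 4) (by omega)
  have hw5 := base_lt (P := P) (i := 5) (by omega)
  simp only [forEntry, denote_block_cons, denote_block_nil]
  obtain ⟨σ₁, e₁⟩ : ∃ σ₁, σ₁ = (assign 27 (.mem (.op .add (.reg 13) (.reg 29)))).denote
    P.w P.L.oracle σ := ⟨_, rfl⟩
  rw [← e₁]
  simp only [denote, eval_mem, eval_address (w := P.w) hσ.r13 h29 (by omega), hH.list j e hj] at e₁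
  have r14 : σ₁.reg 14 = P.base 5 := by rw [e₁]; simpa using hσ.r14
  have r27 : σ₁.reg 27 = e + 1 := by rw [e₁]; simp
  obtain ⟨σ₂, e₂⟩ : ∃ σ₂, σ₂ = (assign 30 (.mem (.op .add (.reg 14) (.reg 27)))).denote
    P.w P.L.oracle σ₁ := ⟨_, rfl⟩
  rw [← e₂]
  have hm : σ₁.mem = σ.mem := by rw [e₁]; rfl
  simp only [denote, eval_mem, eval_address (w := P.w) r14 r27 (by omega), hm, hH.rank,
    if_pos (List.mem_of_getElem? hj)] at e₂
  have a₂ : P.Agree 27 0 0 σ σ₂ := by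
    rw [e₂, e₁]; exact ((Agree.refl σ).setReg (by omega) _).setReg (by omega) _
  have c₂ := hσ.of_agree a₂ (by omega)
  have z₂ : P.Zero 1 σ₂ := hz.of_agree a₂ (.inr (by omega))
  have zz₂ : P.Zero 3 σ₂ := hz3.of_agree a₂ (.inr (by omega))
  have hX₂ : J X σ₂ := hJ.agree X σ σ₂ (a₂.mono (by omega) le_rfl (by omega)) hX
  have s27 : σ₂.reg 27 = e + 1 := by rw [e₂]; simpa using r27
  have s28 : σ₂.reg 28 = lim := by rw [e₂, e₁]; simpa using h28
  have s30 : σ₂.reg 30 = P.rk w v e + 1 := by rw [e₂]; simp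
  have s43 : σ₂.reg 43 = σ.reg 43 := by rw [e₂, e₁]; simp
  have hlt := tests_lt (w := P.w) (σ := σ₂) (a := .reg 30) (b := .op .add (.reg 28) (.lit 1)) s30
    (eval_succ s28 hlim)
  have heq := tests_eq (w := P.w) (σ := σ₂) (a := .reg 30) (b := .op .add (.reg 28) (.lit 1)) s30
    (eval_succ s28 hlim)
  rw [Nat.add_lt_add_iff_right] at hlt
  rw [Nat.add_right_cancel_iff] at heq
  unfold cover
  by_cases h1 : P.rk w v e < lim
  · rw [denote_ite_pos (hlt.ne_zero.2 h1), if_pos h1]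
    obtain ⟨g1, g2⟩ := hJ.run X σ₂ e c₂ hX₂ s27
    refine ⟨g1, c₂.of_keep g2, z₂.of_keep g2 (by omega), zz₂.of_keep g2 (by omega),
      (g2.2 28 (by omega) (by omega)).trans s28, (g2.2 43 (by omega) (by omega)).trans s43,
      fun a h1 h2 => ?_⟩
    rw [g2.1 a h2, a₂.mem_eq]
  rw [denote_ite_neg (hlt.2 h1), if_neg h1]
  by_cases h2 : P.rk w v e = lim
  · rw [denote_ite_pos (heq.ne_zero.2 h2)]
    obtain ⟨g1, g2, g3, g4, g5, g6⟩ := forSmall_spec hJ c₂ z₂ zz₂ he s27 hX₂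
    refine ⟨?_, g2, g3, g4, (g5 28 (by omega) (by omega) (by omega)).trans s28,
      (g5 43 (by omega) (by omega) (by omega)).trans s43, fun a h1 h2 => ?_⟩
    · simpa only [h2, true_and] using g1
    · rw [g6 a h1 h2, a₂.mem_eq]
  · rw [denote_ite_neg (heq.2 h2), if_neg (fun h => h2 h.1), Set.union_empty]
    refine ⟨hX₂, c₂, z₂, zz₂, s28, s43, fun a _ _ => ?_⟩
    simp only [denote]
    rw [a₂.mem_eq]

/-- The properties of a state between the main steps of a query. -/
structure Ready (P : Setup) (σ : State) : Prop where
  ctx : P.Ctx σ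
  zero1 : P.Zero 1 σ
  zero3 : P.Zero 3 σ
  zero5 : P.Zero 5 σ

/-- The list of the vertices explored from a sub-center contains all vertices on the level just below the cut, so
its entries contribute the whole part. -/
theorem forPart_spec_of_subCenter (hJ : P.Acts act J) {σ : State} (hσ : P.Ready σ)
    {w c : Fin P.n} (hwW : w ∈ P.W) (hc : IsSubCenter (P.T w) P.s w c)
    (h26 : σ.reg 26 = c + 1) (hX : J ∅ σ) :
    J (piece (P.T w) P.s c) ((forPart act).denote P.w P.L.oracle σ) ∧
      P.Ready ((forPart act).denote P.w P.L.oracle σ) := by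
  have hs := P.two_le_s
  have hw10 := P.ten_lt
  have hF := P.forest w
  have hccell : c ∈ cell P.G P.W P.k w := subtree_root P.conn hwW ▸ hc.mem_subtree
  have hsd : P.s ≤ P.s * P.d := Nat.le_mul_of_pos_right _ P.one_le_d
  have h45 : P.base 5 = P.base 4 + (P.n + 2) := base_succ 4
  have h56 : P.base 6 = P.base 5 + (P.n + 2) := base_succ 5
  rw [forPart, denote_ite_pos (by rw [eval_reg, h26]; omega)]
  simp only [denote_block_cons, denote_block_nil]
  obtain ⟨σ₁, e₁⟩ : ∃ σ₁, σ₁ = (assign 42 (.reg 26)).denote P.w P.L.oracle σ := ⟨_, rfl⟩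
  rw [← e₁]
  simp only [denote, eval_reg, h26] at e₁
  have a₁ : P.Agree 42 0 0 σ σ₁ := by rw [e₁]; exact (Agree.refl σ).setReg (by omega) _
  have c₁ := hσ.ctx.of_agree a₁ (by omega)
  obtain ⟨⟨a₂, m₂, z₂⟩, L, hE, hH, hlen⟩ := treeExplore_spec (o := 42) (bl := 13) (bc := 14)
    (N := 17) (i := 4) (Nv := P.s * P.d + 1) (by omega) (by omega) (by omega) (by omega) c₁
    (by rw [e₁]; exact hσ.zero1) (by rw [e₁]; exact hσ.zero5)
    (fun τ h => ⟨h.r13, h.r14, h.r17⟩) hccell (by rw [e₁]; simp)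
  generalize (treeExplore 42 13 14 17).denote P.w P.L.oracle σ₁ = σ₂ at *
  have a₂' : P.Agree 42 0 6 σ σ₂ :=
    (a₁.mono le_rfl le_rfl (by omega)).trans (a₂.mono (by omega) le_rfl le_rfl)
  have c₂ := hσ.ctx.of_agree a₂' (by omega)
  have zz₂ : P.Zero 3 σ₂ := by
    intro v
    have hv := v.2
    have h23 : P.base 2 ≤ P.base 3 := base_mono (by omega)
    have h34 : P.base 4 = P.base 3 + (P.n + 2) := base_succ 3
    rw [m₂ _ (by omega) (by omega), a₁.mem_eq, hσ.zero3 v]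
  have hX₂ : J ∅ σ₂ := hJ.agree ∅ σ σ₂ (a₂'.mono (by omega) le_rfl le_rfl) hX
  have hLn := hE.length_le_card
  have hlen' := hE.length_le
  have hB := P.bound
  obtain ⟨σ₃, lim, hσ₃, e₃, hlim, hlw⟩ : ∃ σ₃ lim, (ite (.op .lt (.reg 43) (.reg 5))
      (assign 28 (.op .add (.reg 2) (.lit 2)))
      (assign 28 (.mem (.op .add (.reg 14) (.mem (.op .add (.reg 13)
        (.op .sub (.reg 5) (.lit 1)))))))).denote P.w P.L.oracle σ₂ = σ₃ ∧
      σ₃ = σ₂.setReg 28 lim ∧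
      (if L.length < P.s then P.n + 1 < lim else lim = treeDepth (P.T w) P.s c + 1) ∧
      lim + 1 < 2 ^ P.w := by
    have hT := tests_lt (w := P.w) (σ := σ₂) (a := .reg 43) (b := .reg 5) hlen c₂.r5
    rcases hF.treeDepth_eq (s := P.s) (fun x y h => adj_of_tree h)
      (fun x => (dist_le_card P.conn w x).le) (by omega) (by omega) hE with
      ⟨h1, h2, -⟩ | ⟨x, h1, -, h2, h3⟩
    · refine ⟨_, P.n + 2, rfl, ?_, by rw [if_pos h1]; omega, by omega⟩
      have e : (Expr.lit 2).eval P.w σ₂ = 2 := eval_lit (by omega)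
      rw [denote_ite_pos (hT.ne_zero.2 h1)]
      simp only [denote]
      rw [eval_add] <;> simp only [e, eval_reg, c₂.r2]
      omega
    · have := (List.getElem?_eq_some_iff.1 h1).1
      have htd := hF.treeDepth_lt (s := P.s) (by omega) c
      refine ⟨_, treeDepth (P.T w) P.s c + 1, rfl, ?_, by rw [if_neg (by omega)], by omega⟩
      rw [denote_ite_neg (hT.2 (by omega)), h3]
      simp only [denote, eval_cut (i := 4) c₂ (by omega) c₂.r13 c₂.r14 hLn hH h1]
  rw [hσ₃]
  have a₃ : P.Agree 28 0 0 σ₂ σ₃ := by rw [e₃]; exact (Agree.refl _).setReg (by omega) _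
  have c₃ := c₂.of_agree a₃ (by omega)
  have key := loop_inv (w := P.w) (O := P.L.oracle) (i := 29) (N := 18) (σ := σ₃)
    (m := (P.s * P.d + 1) * P.d + 1) (p := ite (.op .lt (.reg 29) (.reg 43)) (forEntry act) skip)
    (fun j τ => J (covered (P.T w) P.s lim (P.rk w c) L j) τ ∧ P.Ctx τ ∧ P.Zero 1 τ ∧ P.Zero 3 τ ∧
      τ.reg 28 = lim ∧ τ.reg 43 = L.length ∧
      ∀ a, P.base 4 ≤ a → a < P.base 6 → τ.mem a = σ₃.mem a) c₃.r18 ?_ ?_ ?_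
  · obtain ⟨g1, g2, g3, g4, -, g6, g7⟩ := key
    generalize (loop 29 18 (ite (.op .lt (.reg 29) (.reg 43)) (forEntry act) skip)).denote P.w
      P.L.oracle σ₃ = σ₄ at *
    have hH₄ : Holds σ₄.mem (P.base 4) (P.base 5) L (P.rk w c) := by
      rw [e₃] at g7
      constructor
      · intro i x hx
        have := (List.getElem?_eq_some_iff.1 hx).1
        rw [g7 _ (by omega) (by omega)]
        exact hH.list i x hx
      · intro v
        have := v.2
        rw [g7 _ (by omega) (by omega)]
        exact hH.rank v
    obtain ⟨a₅, z₅⟩ := treeWipe_spec (O := P.L.oracle) (o := 42) (bl := 13) (bc := 14) (N := 18)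
      (i := 4) (Nv := (P.s * P.d + 1) * P.d + 1) (by omega) (by omega) g2
      (fun τ h => ⟨h.r13, h.r14, h.r18⟩) hLn (by omega) hH₄ g6
    refine ⟨?_, g2.of_agree a₅ (by omega), g3.of_agree a₅ (.inl (by omega)),
      g4.of_agree a₅ (.inl (by omega)), z₅⟩
    rw [covered_of_length_le (j := L.length) (by omega) le_rfl,
      hF.covered_eq_piece (fun x y h => adj_of_tree h) (dist_le_card P.conn w) P.deg (by omega)
        P.one_le_d hE hlim] at g1
    exact hJ.agree _ _ _ (a₅.mono (by omega) (by omega) (by omega)) g1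
  · rintro j τ y ⟨g1, g2, g3, g4, g5, g6, g7⟩
    have a := (Agree.refl (P := P) (r := 29) (i := 0) (j := 0) τ).setReg (m := 29) le_rfl y
    exact ⟨hJ.agree _ _ _ (a.mono (by omega) le_rfl (by omega)) g1, g2.of_agree a (by omega), g3, g4,
      by simpa using g5, by simpa using g6, g7⟩
  · refine ⟨?_, c₃, by rw [e₃]; exact z₂, by rw [e₃]; exact zz₂, by rw [e₃]; simp,
      by rw [e₃]; simpa using hlen, fun _ _ _ => rfl⟩
    convert hJ.agree _ _ _ (a₃.mono (by omega) le_rfl (by omega)) hX₂ using 1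
    ext y
    simp [covered]
  · rintro j - τ ⟨g1, g2, g3, g4, g5, g6, g7⟩ hj
    have hT := tests_lt (w := P.w) (σ := τ) (a := .reg 29) (b := .reg 43) hj g6
    by_cases hjL : j < L.length
    · rw [denote_ite_pos (hT.ne_zero.2 hjL)]
      obtain ⟨e, he⟩ : ∃ e, L[j]? = some e := ⟨_, List.getElem?_eq_getElem hjL⟩
      have hHτ : Holds τ.mem (P.base 4) (P.base 5) L (P.rk w c) := by
        rw [e₃] at g7
        constructor
        · intro i x hx
          have := (List.getElem?_eq_some_iff.1 hx).1
          rw [g7 _ (by omega) (by omega)]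
          exact hH.list i x hx
        · intro v
          have := v.2
          rw [g7 _ (by omega) (by omega)]
          exact hH.rank v
      obtain ⟨f1, f2, f3, f4, f5, f6, f7⟩ := forEntry_spec hJ g2 g3 g4
        (subtree_subset_cell P.conn hccell (hE.mem e (List.mem_of_getElem? he))) hLn hj g5 hlw hHτ he
        g1
      rw [covered_succ he]
      exact ⟨f1, f2, f3, f4, f5, f6.trans g6, fun a h1 h2 => (f7 a h1 h2).trans (g7 a h1 h2)⟩
    · rw [denote_ite_neg (hT.2 hjL)]
      rw [covered_of_length_le (j := j) (by omega) (by omega)]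
      exact ⟨g1, g2, g3, g4, g5, g6, g7⟩

/-- `X` is the part of `x` in the partition, and `c` codes its sub-center. -/
def IsPartCode (P : Setup) (x : Fin P.n) (X : Set (Fin P.n)) (c : ℕ) : Prop :=
  (x ∈ remote P.G P.W P.k ∧ c = 0 ∧ X = {x}) ∨
    ∃ w ∈ P.W, ∃ v : Fin P.n, c = v + 1 ∧ IsSubCenter (P.T w) P.s w v ∧ x ∈ X ∧
      X = piece (P.T w) P.s v

/-- Correctness of `forPart`, for parts of both kinds. -/
theorem forPart_spec (hJ : P.Acts act J) {σ : State} (hσ : P.Ready σ) {x : Fin P.n}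
    {X : Set (Fin P.n)} (hx : P.IsPartCode x X (σ.reg 26)) (h25 : σ.reg 25 = x + 1) (hX : J ∅ σ) :
    J X ((forPart act).denote P.w P.L.oracle σ) ∧
      P.Ready ((forPart act).denote P.w P.L.oracle σ) := by
  rcases hx with ⟨-, h26, rfl⟩ | ⟨w, hwW, v, h26, hv, -, rfl⟩
  · rw [forPart, denote_ite_neg (by rw [eval_reg, h26])]
    simp only [denote_block_cons, denote_block_nil]
    obtain ⟨σ₁, e₁⟩ : ∃ σ₁, σ₁ = (assign 27 (.reg 25)).denote P.w P.L.oracle σ := ⟨_, rfl⟩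
    rw [← e₁]
    simp only [denote, eval_reg, h25] at e₁
    have a₁ : P.Agree 25 0 0 σ σ₁ := by rw [e₁]; exact (Agree.refl σ).setReg (by omega) _
    have c₁ := hσ.ctx.of_agree a₁ (by omega)
    obtain ⟨g1, g2⟩ := hJ.run ∅ σ₁ x c₁ (hJ.agree _ _ _ (a₁.mono le_rfl le_rfl (by omega)) hX)
      (by rw [e₁]; simp)
    rw [Set.empty_union] at g1
    have z : ∀ i < 6, P.Zero i σ → P.Zero i (act.denote P.w P.L.oracle σ₁) := fun i hi h =>
      (h.of_agree a₁ (.inr (by omega))).of_keep g2 hi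
    exact ⟨g1, c₁.of_keep g2, z 1 (by omega) hσ.zero1, z 3 (by omega) hσ.zero3,
      z 5 (by omega) hσ.zero5⟩
  · exact forPart_spec_of_subCenter hJ hσ hwW hv h26 hX

end Setup

/-! ### Answering a query -/

namespace FProg

/-- Marks the vertex in register `27`. -/
def mark : FProg := store (.op .add (.reg 15) (.reg 27)) (.lit 1)

/-- Puts the smaller and the larger one of the contents of registers `a` and `b` into the registers `i` and
`i + 1`. -/
def orient (a b i : ℕ) : FProg := block [
  assign i (.reg a),
  assign (i + 1) (.reg b),
  ite (.op .lt (.reg b) (.reg a)) (block [assign i (.reg b), assign (i + 1) (.reg a)]) skip]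

/-- Sets register `24` to `1` if the vertex in register `27` has an edge to a marked vertex whose rank
is smaller than the rank of the query. -/
def check : FProg :=
  loop 71 3 (block [
    probe 72 (.reg 27) (.op .add (.reg 71) (.lit 1)),
    ite (.reg 72) (ite (.mem (.op .add (.reg 15) (.reg 72))) (block [
      orient 27 72 73,
      orient 0 1 75,
      ite (Expr.or (.op .lt (.reg 73) (.reg 75))
          (Expr.and (.op .eq (.reg 73) (.reg 75)) (.op .lt (.reg 74) (.reg 76))))
        (assign 24 (.lit 1)) skip]) skip) skip])

/-- The answer to the query in registers `0` and `1`, in register `24`. -/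
def answer : FProg := block [
  assign 32 (.reg 0),
  findSub,
  assign 20 (.reg 33),
  assign 21 (.reg 34),
  assign 32 (.reg 1),
  findSub,
  assign 22 (.reg 33),
  assign 23 (.reg 34),
  ite (Expr.and (.op .lt (.lit 0) (.reg 20)) (.op .eq (.reg 20) (.reg 22)))
    (assign 24 (Expr.or (.op .eq (.reg 21) (.reg 1)) (.op .eq (.reg 23) (.reg 0))))
    (block [
      assign 24 (.lit 0),
      assign 25 (.reg 1),
      assign 26 (.reg 22),
      forPart mark,
      assign 25 (.reg 0),
      assign 26 (.reg 20),
      forPart check,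
      assign 24 (.op .eq (.reg 24) (.lit 0))])]

end FProg

namespace Setup

variable {P : Setup}
open FProg SSG.Expr

theorem IsPartCode.mem {x : Fin P.n} {X : Set (Fin P.n)} {c : ℕ} (h : P.IsPartCode x X c) :
    x ∈ X := by
  rcases h with ⟨-, -, rfl⟩ | ⟨w, -, v, -, -, hx, -⟩
  exacts [rfl, hx]

theorem IsPartCode.mem_parts {x : Fin P.n} {X : Set (Fin P.n)} {c : ℕ} (h : P.IsPartCode x X c) :
    X ∈ parts P.G P.W P.k P.s := by
  rcases h with ⟨hx, -, rfl⟩ | ⟨w, hw, v, -, hv, -, rfl⟩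
  exacts [.inl ⟨x, hx, rfl⟩, .inr ⟨v, w, hw, hv, rfl⟩]

theorem IsSubCode.exists_isPartCode {x : Fin P.n} {c p : ℕ} (h : P.IsSubCode x c p) :
    ∃ X, P.IsPartCode x X c := by
  rcases h with ⟨hx, hc, -⟩ | ⟨w, hw, v, hc, hv, hx, -⟩
  exacts [⟨_, .inl ⟨hx, hc, rfl⟩⟩, ⟨_, .inr ⟨w, hw, v, hc, hv, hx, rfl⟩⟩]

/-- An edge within a part is kept if one of its ends is the parent of the other. -/
theorem adj_iff_of_same_part {u v : Fin P.n} {c pu pv : ℕ} (hu : P.IsSubCode u c pu)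
    (hv : P.IsSubCode v c pv) (hc : c ≠ 0) :
    (sparseSpanningGraph P.G P.W P.k P.s).Adj u v ↔ pu = v + 1 ∨ pv = u + 1 := by
  rcases hu with ⟨-, h, -⟩ | ⟨w, hw, a, rfl, ha, hua, hpu⟩
  · exact absurd h hc
  rcases hv with ⟨-, h, -⟩ | ⟨w', hw', a', haa, ha', hva, hpv⟩
  · exact absurd h hc
  obtain rfl : a = a' := Fin.ext (by omega)
  have hacell : ∀ w ∈ P.W, IsSubCenter (P.T w) P.s w a → a ∈ cell P.G P.W P.k w := fun w hw h =>
    subtree_root P.conn hw ▸ h.mem_subtree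
  obtain rfl := cell_unique (hacell w hw ha) (hacell w' hw' ha')
  have hX : IsRootedPart P.G P.W P.k P.s a (piece (P.T w) P.s a) := ⟨w, hw, ha, rfl⟩
  have hpar : ∀ {x y : Fin P.n} {p : ℕ}, ((p = 0 ∧ x = w) ∨ ∃ z : Fin P.n, p = z + 1 ∧ P.T w z x) →
      (p = y + 1 ↔ P.T w y x) := by
    rintro x y p (⟨rfl, rfl⟩ | ⟨z, rfl, hz⟩)
    · exact ⟨fun h => by omega, fun h => absurd h not_tree_root⟩
    · constructor
      · intro h
        obtain rfl : z = y := Fin.ext (by omega)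
        exact hz
      · intro h
        rw [(P.forest w).uniq hz h]
  have hbfs : ∀ {x y : Fin P.n}, x ∈ piece (P.T w) P.s a → y ∈ piece (P.T w) P.s a →
      (IsBFSParent P.G (piece (P.T w) P.s a) a x y ↔ P.T w x y) := by
    intro x y hx hy
    rw [isBFSParent_piece_iff P.conn hw ha]
    refine ⟨fun h => h.2.2, fun h => ⟨hy, ?_, h⟩⟩
    rintro rfl
    have h1 := (P.forest w).lev_eq h
    have h2 := (P.forest w).lev_le_of_mem_subtree (piece_subset_subtree _ _ hx)
    omega
  rw [hpar hpu, hpar hpv, ← hbfs hva hua, ← hbfs hua hva]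
  constructor
  · rintro (⟨b, Y, hY, h⟩ | ⟨Y, hY, Z, hZ, hne, h1, h2, -⟩)
    · have huY : u ∈ Y := by
        rcases h with h | h
        exacts [h.2.1.1, h.1]
      obtain ⟨rfl, rfl⟩ := hX.unique P.conn hY hua huY
      exact h.symm
    · have hp : piece (P.T w) P.s a ∈ parts P.G P.W P.k P.s := .inr ⟨a, hX⟩
      exact absurd ((part_unique P.conn hY hp h1 hua).trans
        (part_unique P.conn hp hZ hva h2)) hne
  · exact fun h => .inl ⟨a, _, hX, h.symm⟩

/-- Vertices with different sub-centers lie in different parts. -/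
theorem part_ne {u v : Fin P.n} (huv : u ≠ v) {cu cv : ℕ} {X Y : Set (Fin P.n)}
    (hu : P.IsPartCode u X cu) (hv : P.IsPartCode v Y cv) (hc : ¬ (0 < cu ∧ cu = cv)) : X ≠ Y := by
  rintro rfl
  have huX := hu.mem
  have hvX := hv.mem
  rcases hu with ⟨-, -, rfl⟩ | ⟨w, hw, a, ha, hwa, -, hXa⟩
  · exact huv hvX.symm
  rcases hv with ⟨-, -, rfl⟩ | ⟨w', hw', a', ha', hwa', -, hXa'⟩
  · exact huv huX
  · have := (IsRootedPart.unique P.conn ⟨w, hw, hwa, hXa⟩ ⟨w', hw', hwa', hXa'⟩ huX huX).1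
    subst this
    omega

/-- An edge between two parts is kept if it has minimum rank. -/
theorem adj_iff_of_part_ne {u v : Fin P.n} (huv : P.G.Adj u v) {X Y : Set (Fin P.n)}
    (hX : X ∈ parts P.G P.W P.k P.s) (hY : Y ∈ parts P.G P.W P.k P.s) (hu : u ∈ X) (hv : v ∈ Y)
    (hne : X ≠ Y) :
    (sparseSpanningGraph P.G P.W P.k P.s).Adj u v ↔
      ¬ ∃ x ∈ X, ∃ y ∈ Y, P.G.Adj x y ∧ edgeRank x y < edgeRank u v := by
  constructor
  · rintro (⟨b, Z, hZ, h⟩ | ⟨X', hX', Y', hY', -, h1, h2, -, h4⟩)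
    · have huZ : u ∈ Z ∧ v ∈ Z := by
        rcases h with h | h
        exacts [⟨h.2.1.1, h.1⟩, ⟨h.1, h.2.1.1⟩]
      have hZ' : Z ∈ parts P.G P.W P.k P.s := .inr ⟨b, hZ⟩
      exact absurd ((part_unique P.conn hX hZ' hu huZ.1).trans
        (part_unique P.conn hZ' hY huZ.2 hv)) hne
    · obtain rfl := part_unique P.conn hX' hX h1 hu
      obtain rfl := part_unique P.conn hY' hY h2 hv
      rintro ⟨x, hx, y, hy, hxy, hlt⟩
      exact absurd (h4 x hx y hy hxy) (not_le.2 hlt)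
  · intro h
    refine .inr ⟨X, hX, Y, hY, hne, hu, hv, huv, fun x hx y hy hxy => ?_⟩
    by_contra hlt
    exact h ⟨x, hx, y, hy, hxy, not_le.1 hlt⟩

theorem Ready.of_agree {r i : ℕ} {σ τ : State} (hσ : P.Ready σ) (h : P.Agree r i i σ τ)
    (hr : 20 ≤ r) : P.Ready τ :=
  ⟨hσ.ctx.of_agree h hr, hσ.zero1.of_agree h (lt_or_ge 1 i), hσ.zero3.of_agree h (lt_or_ge 3 i),
    hσ.zero5.of_agree h (lt_or_ge 5 i)⟩

open Classical in
/-- The marked vertices are those in `X`. -/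
def Marked (P : Setup) (X : Set (Fin P.n)) (τ : State) : Prop :=
  ∀ y : Fin P.n, τ.mem (P.base 6 + (y + 1)) = if y ∈ X then 1 else 0

/-- Running `mark` on a set of vertices marks this set. -/
theorem acts_mark (σ₀ : State) :
    P.Acts mark fun X τ => P.Marked X τ ∧ ∀ r < 25, τ.reg r = σ₀.reg r where
  agree X σ τ h := by
    rintro ⟨h1, h2⟩
    refine ⟨fun y => ?_, fun r hr => (h.1 r hr).trans (h2 r hr)⟩
    rw [h.2 _ (.inr (by omega)), h1 y]
  run X σ x hσ := by
    classical
    rintro ⟨h1, h2⟩ h27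
    have hw := base_lt (P := P) (i := 6) (by omega)
    have hxn := x.2
    have e : (Expr.lit 1).eval P.w σ = 1 := eval_lit (by omega)
    simp only [mark, denote, eval_address (w := P.w) hσ.r15 h27 (by omega), e]
    refine ⟨⟨fun y => ?_, h2⟩, fun a ha => ?_, fun r _ _ => rfl⟩
    · rw [State.setMem_mem]
      by_cases hy : y = x
      · subst hy
        simp
      · rw [if_neg (fun h => hy (Fin.ext (by omega))), h1 y]
        have : y ∈ X ∪ {x} ↔ y ∈ X := by simp [hy]
        simp only [this]
    · rw [State.setMem_mem, if_neg (by omega)]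

theorem orient_spec {w : ℕ} {O : ℕ → ℕ → ℕ} {σ : State} {a b i x y : ℕ} (ha : σ.reg a = x)
    (hb : σ.reg b = y) (hai : a < i) (hbi : b < i) :
    ((orient a b i).denote w O σ).mem = σ.mem ∧
      ((orient a b i).denote w O σ).reg i = min x y ∧
      ((orient a b i).denote w O σ).reg (i + 1) = max x y ∧
      ∀ r, r ≠ i → r ≠ i + 1 → ((orient a b i).denote w O σ).reg r = σ.reg r := by
  simp only [orient, denote_block_cons, denote_block_nil]
  obtain ⟨τ, e⟩ : ∃ τ, τ = (assign (i + 1) (.reg b)).denote w O ((assign i (.reg a)).denote w O σ) :=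
    ⟨_, rfl⟩
  rw [← e]
  simp only [denote, eval_reg, State.setReg_reg, ha, hb, if_neg hbi.ne] at e
  have hT := tests_lt (w := w) (σ := τ) (a := .reg b) (b := .reg a) (x := y) (y := x)
    (by rw [eval_reg, e, State.setReg_reg, if_neg (by omega), State.setReg_reg, if_neg hbi.ne, hb])
    (by rw [eval_reg, e, State.setReg_reg, if_neg (by omega), State.setReg_reg, if_neg hai.ne, ha])
  rcases denote_ite_of_tests (O := O) (p := block [assign i (.reg b), assign (i + 1) (.reg a)])
    (q := skip) hT with ⟨hlt, h⟩ | ⟨hlt, h⟩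
  · rw [h]
    have hb' : b ≠ i + 1 := by omega
    have ha' : a ≠ i + 1 := by omega
    simp only [denote_block_cons, denote_block_nil, denote, eval_reg, e, State.setReg_reg,
      State.setReg_mem, if_neg hb', if_neg ha', if_neg hai.ne, if_neg hbi.ne, ha, hb]
    refine ⟨trivial, ?_, ?_, fun r h1 h2 => by simp [h1, h2]⟩
    · rw [min_eq_right hlt.le]; simp
    · rw [max_eq_left hlt.le]; simp
  · rw [h, e]
    simp only [denote, State.setReg_reg, State.setReg_mem]
    refine ⟨trivial, ?_, ?_, fun r h1 h2 => by simp [h1, h2]⟩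
    · rw [min_eq_left (not_lt.1 hlt)]; simp
    · rw [max_eq_right (not_lt.1 hlt)]; simp

theorem edgeRank_lt_iff {n : ℕ} {x y u v : Fin n} : edgeRank x y < edgeRank u v ↔
    min ((x : ℕ) + 1) (y + 1) < min ((u : ℕ) + 1) (v + 1) ∨
      min ((x : ℕ) + 1) (y + 1) = min ((u : ℕ) + 1) (v + 1) ∧
        max ((x : ℕ) + 1) (y + 1) < max ((u : ℕ) + 1) (v + 1) := by
  have h1 : ∀ a b : Fin n, ((min a b : Fin n) : ℕ) = min (a : ℕ) b := fun a b =>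
    Fin.val_strictMono.monotone.map_min
  have h2 : ∀ a b : Fin n, ((max a b : Fin n) : ℕ) = max (a : ℕ) b := fun a b =>
    Fin.val_strictMono.monotone.map_max
  simp only [edgeRank, Prod.Lex.toLex_lt_toLex, Fin.lt_def, Fin.ext_iff, h1, h2]
  omega

/-- `b` tells whether some edge from `X` to `Y` has smaller rank than `{u, v}`. -/
def Found (P : Setup) (u v : Fin P.n) (X Y : Set (Fin P.n)) (b : ℕ) : Prop :=
  (b = 0 ∨ b = 1) ∧
    (b = 1 ↔ ∃ x ∈ X, ∃ y ∈ Y, P.G.Adj x y ∧ edgeRank x y < edgeRank u v)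

/-- Running `check` on the vertices of `X` finds out whether the query is not the edge of minimum rank
between `X` and the marked set `Y`. -/
theorem acts_check {σ₀ : State} {u v : Fin P.n} (hu : σ₀.reg 0 = u + 1) (hv : σ₀.reg 1 = v + 1)
    (Y : Set (Fin P.n)) :
    P.Acts check fun X τ => P.Marked Y τ ∧ (∀ r < 24, τ.reg r = σ₀.reg r) ∧
      P.Found u v X Y (τ.reg 24) where
  agree X σ τ h := by
    rintro ⟨h1, h2, h3⟩
    refine ⟨fun y => ?_, fun r hr => (h.1 r (by omega)).trans (h2 r hr), ?_⟩
    · rw [h.2 _ (.inr (by omega)), h1 y]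
    · rw [h.1 24 (by omega)]
      exact h3
  run X σ x hσ := by
    classical
    rintro ⟨h1, h2, h3⟩ h27
    have hw := base_lt (P := P) (i := 6) (by omega)
    have hw10 := P.ten_lt
    have hdw : P.d < 2 ^ P.w := by
      have := P.bound
      have : P.d ≤ P.k * P.d := Nat.le_mul_of_pos_left _ (by have := P.two_le_k; omega)
      omega
    have key := loop_inv (w := P.w) (O := P.L.oracle) (i := 71) (N := 3) (σ := σ) (m := P.d)
      (p := block [
    probe 72 (.reg 27) (.op .add (.reg 71) (.lit 1)),
    ite (.reg 72) (ite (.mem (.op .add (.reg 15) (.reg 72))) (block [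
      orient 27 72 73,
      orient 0 1 75,
      ite (Expr.or (.op .lt (.reg 73) (.reg 75))
          (Expr.and (.op .eq (.reg 73) (.reg 75)) (.op .lt (.reg 74) (.reg 76))))
        (assign 24 (.lit 1)) skip]) skip) skip])
      (fun j τ => τ.mem = σ.mem ∧ (∀ r < 71, r ≠ 24 → τ.reg r = σ.reg r) ∧
        (τ.reg 24 = 0 ∨ τ.reg 24 = 1) ∧ (τ.reg 24 = 1 ↔
          (∃ x ∈ X, ∃ y ∈ Y, P.G.Adj x y ∧ edgeRank x y < edgeRank u v) ∨
          ∃ y ∈ Y, (∃ i < j, P.L.oracle (x + 1) (i + 1) = y + 1) ∧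
            edgeRank x y < edgeRank u v)) hσ.r3 ?_ ?_ ?_
    · obtain ⟨g1, g2, g3, g4⟩ := key
      refine ⟨⟨fun y => ?_, fun r hr => ?_, g3, g4.trans ?_⟩, fun a _ => ?_, fun r hr _ => ?_⟩
      · exact (congrFun g1 _).trans (h1 y)
      · exact (g2 r (by omega) (by omega)).trans (h2 r hr)
      · constructor
        · rintro (⟨a, ha, h⟩ | ⟨y, hy, ⟨i, -, hi⟩, hlt⟩)
          · exact ⟨a, .inl ha, h⟩
          · refine ⟨x, .inr rfl, y, hy, ?_, hlt⟩
            rcases P.L.oracle_cases x i with h0 | ⟨z, hz, hz'⟩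
            · omega
            · obtain rfl : y = z := Fin.ext (by omega)
              exact hz
        · rintro ⟨a, ha | ha, y, hy, hay, hlt⟩
          · exact .inl ⟨a, ha, y, hy, hay, hlt⟩
          · obtain rfl : a = x := ha
            exact .inr ⟨y, hy, P.L.exists_oracle_eq P.deg hay, hlt⟩
      · exact congrFun g1 a
      · exact g2 r (by omega) (by omega)
    · rintro j τ y ⟨g1, g2, g3, g4⟩
      refine ⟨g1, fun r hr h => ?_, by simpa using g3, by simpa using g4⟩
      rw [State.setReg_reg, if_neg (by omega), g2 r hr h]
    · refine ⟨rfl, fun _ _ _ => rfl, h3.1, h3.2.trans ⟨.inl, ?_⟩⟩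
      rintro (h | ⟨y, -, ⟨i, hi, -⟩, -⟩)
      · exact h
      · omega
    · rintro j hj τ ⟨g1, g2, g3, g4⟩ hjr
      simp only [denote_block_cons, denote_block_nil]
      obtain ⟨τ₁, f₁⟩ : ∃ τ₁, τ₁ = (probe 72 (.reg 27) (.op .add (.reg 71) (.lit 1))).denote
        P.w P.L.oracle τ := ⟨_, rfl⟩
      rw [← f₁]
      have r27 : τ.reg 27 = x + 1 := (g2 27 (by omega) (by omega)).trans h27
      simp only [denote, eval_succ (w := P.w) hjr (by omega), eval_reg, r27] at f₁
      have r72 : τ₁.reg 72 = P.L.oracle (x + 1) (j + 1) := by rw [f₁]; simp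
      have r24 : τ₁.reg 24 = τ.reg 24 := by rw [f₁]; simp
      have hm₁ : τ₁.mem = σ.mem := by rw [f₁]; exact g1
      have hr₁ : ∀ r < 71, r ≠ 24 → τ₁.reg r = σ.reg r := fun r hr h => by
        rw [f₁, State.setReg_reg, if_neg (by omega), g2 r hr h]
      -- the statement for `j` differs from that for `j + 1` by the neighbour just probed
      have hlast : (τ₁.reg 24 = 1 ∨ ∃ y ∈ Y, τ₁.reg 72 = y + 1 ∧ edgeRank x y < edgeRank u v) ↔
          ((∃ x ∈ X, ∃ y ∈ Y, P.G.Adj x y ∧ edgeRank x y < edgeRank u v) ∨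
          ∃ y ∈ Y, (∃ i < j + 1, P.L.oracle (x + 1) (i + 1) = y + 1) ∧
            edgeRank x y < edgeRank u v) := by
        rw [r24, g4, or_assoc]
        refine or_congr_right ?_
        constructor
        · rintro (⟨y, hy, ⟨i, hi, h⟩, hlt⟩ | ⟨y, hy, h, hlt⟩)
          · exact ⟨y, hy, ⟨i, by omega, h⟩, hlt⟩
          · exact ⟨y, hy, ⟨j, by omega, r72.symm.trans h⟩, hlt⟩
        · rintro ⟨y, hy, ⟨i, hi, h⟩, hlt⟩
          rcases Nat.lt_succ_iff_lt_or_eq.1 hi with hi | rfl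
          · exact .inl ⟨y, hy, ⟨i, hi, h⟩, hlt⟩
          · exact .inr ⟨y, hy, r72.trans h, hlt⟩
      rw [← r24] at g3
      rcases P.L.oracle_cases x j with h0 | ⟨z, -, hz⟩
      · rw [denote_ite_neg (by rw [eval_reg, r72, h0])]
        refine ⟨hm₁, hr₁, g3, ?_⟩
        rw [← hlast]
        refine ⟨.inl, ?_⟩
        rintro (h | ⟨y, -, h, -⟩)
        · exact h
        · omega
      rw [hz] at r72
      have hzn := z.2
      rw [denote_ite_pos (by rw [eval_reg, r72]; omega)]
      have r15 : τ₁.reg 15 = P.base 6 := (hr₁ 15 (by omega) (by omega)).trans hσ.r15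
      have hmem : (Expr.mem (.op .add (.reg 15) (.reg 72))).eval P.w τ₁ = if z ∈ Y then 1 else 0 := by
        rw [eval_mem, eval_address r15 r72 (by omega), hm₁, h1 z]
      by_cases hzY : z ∈ Y
      swap
      · rw [denote_ite_neg (by rw [hmem, if_neg hzY])]
        refine ⟨hm₁, hr₁, g3, ?_⟩
        rw [← hlast]
        refine ⟨.inl, ?_⟩
        rintro (h | ⟨y, hy, h, -⟩)
        · exact h
        · obtain rfl : z = y := Fin.ext (by omega)
          exact absurd hy hzY
      rw [denote_ite_pos (by rw [hmem, if_pos hzY]; omega)]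
      simp only [denote_block_cons, denote_block_nil]
      obtain ⟨m1, p1, p2, p3⟩ := orient_spec (w := P.w) (O := P.L.oracle) (i := 73)
        ((hr₁ 27 (by omega) (by omega)).trans h27) r72 (by omega) (by omega)
      generalize (orient 27 72 73).denote P.w P.L.oracle τ₁ = τ₂ at *
      have q0 : τ₂.reg 0 = u + 1 := by
        rw [p3 0 (by omega) (by omega), hr₁ 0 (by omega) (by omega), h2 0 (by omega), hu]
      have q1 : τ₂.reg 1 = v + 1 := by
        rw [p3 1 (by omega) (by omega), hr₁ 1 (by omega) (by omega), h2 1 (by omega), hv]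
      obtain ⟨m2, o1, o2, o3⟩ := orient_spec (w := P.w) (O := P.L.oracle) (i := 75) q0 q1
        (by omega) (by omega)
      generalize (orient 0 1 75).denote P.w P.L.oracle τ₂ = τ₃ at *
      have s73 : τ₃.reg 73 = min ((x : ℕ) + 1) (z + 1) := (o3 73 (by omega) (by omega)).trans p1
      have s74 : τ₃.reg 74 = max ((x : ℕ) + 1) (z + 1) := (o3 74 (by omega) (by omega)).trans p2
      have s24 : τ₃.reg 24 = τ₁.reg 24 := by
        rw [o3 24 (by omega) (by omega), p3 24 (by omega) (by omega)]
      have hm₃ : τ₃.mem = σ.mem := by rw [m2, m1, hm₁]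
      have hr₃ : ∀ r < 71, r ≠ 24 → τ₃.reg r = σ.reg r := fun r hr h => by
        rw [o3 r (by omega) (by omega), p3 r (by omega) (by omega), hr₁ r hr h]
      have hT := Tests.or (by omega) (tests_lt (w := P.w) (σ := τ₃) (a := .reg 73) (b := .reg 75)
        s73 o1) (.and (by omega) (tests_eq (a := .reg 73) (b := .reg 75) s73 o1)
          (tests_lt (a := .reg 74) (b := .reg 76) s74 o2))
      rw [← edgeRank_lt_iff] at hT
      rcases denote_ite_of_tests (O := P.L.oracle) (p := assign 24 (.lit 1)) (q := skip) hT with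
        ⟨hlt, e⟩ | ⟨hlt, e⟩
      · have e1 : (Expr.lit 1).eval P.w τ₃ = 1 := eval_lit (by omega)
        rw [e]
        simp only [denote, e1]
        refine ⟨hm₃, fun r hr h => ?_, .inr (by simp), ?_⟩
        · rw [State.setReg_reg, if_neg h, hr₃ r hr h]
        · rw [← hlast]
          exact ⟨fun _ => .inr ⟨z, hzY, r72, hlt⟩, fun _ => by simp⟩
      · rw [e]
        simp only [denote]
        rw [s24]
        refine ⟨hm₃, hr₃, g3, ?_⟩
        rw [← hlast]
        refine ⟨.inl, ?_⟩
        rintro (h | ⟨y, -, h, hlt'⟩)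
        · exact h
        · obtain rfl : z = y := Fin.ext (by omega)
          exact absurd hlt' hlt

/-- Correctness of `answer`. If both endpoints are in the same part, the edge is kept if and only if one
endpoint is the parent of the other; otherwise if and only if no edge between the two parts has smaller rank. -/
theorem answer_spec {σ : State} (hσ : P.Ready σ) (hzero : ∀ a, P.base 6 ≤ a → σ.mem a = 0)
    {u v : Fin P.n} (hu : σ.reg 0 = u + 1) (hv : σ.reg 1 = v + 1) (huv : P.G.Adj u v) :
    ((sparseSpanningGraph P.G P.W P.k P.s).Adj u v ∧
      (answer.denote P.w P.L.oracle σ).reg 24 = 1) ∨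
    (¬ (sparseSpanningGraph P.G P.W P.k P.s).Adj u v ∧
      (answer.denote P.w P.L.oracle σ).reg 24 = 0) := by
  have hw10 := P.ten_lt
  have h46 : P.base 4 ≤ P.base 6 := base_mono (by omega)
  simp only [answer, denote_block_cons, denote_block_nil]
  -- the sub-center of `u`
  obtain ⟨σ₁, e₁⟩ : ∃ σ₁, σ₁ = (assign 32 (.reg 0)).denote P.w P.L.oracle σ := ⟨_, rfl⟩
  rw [← e₁]
  simp only [denote, eval_reg, hu] at e₁
  have a₁ : P.Agree 32 4 4 σ σ₁ := by rw [e₁]; exact (Agree.refl σ).setReg (by omega) _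
  have s₁ := hσ.of_agree a₁ (by omega)
  obtain ⟨a₂, z₂, zz₂, hcu⟩ := findSub_spec s₁.ctx s₁.zero1 s₁.zero3 (u := u) (by rw [e₁]; simp)
  generalize findSub.denote P.w P.L.oracle σ₁ = σ₂ at *
  have a₂' : P.Agree 32 0 4 σ σ₂ :=
    (a₁.mono le_rfl (by omega) le_rfl).trans (a₂.mono (by omega) le_rfl le_rfl)
  have s₂ : P.Ready σ₂ := ⟨hσ.ctx.of_agree a₂' (by omega), z₂, zz₂,
    hσ.zero5.of_agree a₂' (.inr (by omega))⟩
  generalize hcu' : σ₂.reg 33 = cu at *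
  generalize hpu' : σ₂.reg 34 = pu at *
  obtain ⟨σ₃, e₃⟩ : ∃ σ₃, σ₃ = (assign 32 (.reg 1)).denote P.w P.L.oracle
    ((assign 21 (.reg 34)).denote P.w P.L.oracle ((assign 20 (.reg 33)).denote P.w P.L.oracle σ₂)) :=
    ⟨_, rfl⟩
  rw [← e₃]
  have r1 : σ₂.reg 1 = v + 1 := (a₂'.1 1 (by omega)).trans hv
  simp only [denote, eval_reg, State.setReg_reg, Nat.reduceEqDiff, if_false, hcu', hpu',
    OfNat.one_ne_ofNat, r1] at e₃
  have a₃ : P.Agree 20 4 4 σ₂ σ₃ := by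
    rw [e₃]
    exact (((Agree.refl σ₂).setReg (by omega) _).setReg (by omega) _).setReg (by omega) _
  have s₃ := s₂.of_agree a₃ (by omega)
  -- the sub-center of `v`
  obtain ⟨a₄, z₄, zz₄, hcv⟩ := findSub_spec s₃.ctx s₃.zero1 s₃.zero3 (u := v) (by rw [e₃]; simp)
  generalize findSub.denote P.w P.L.oracle σ₃ = σ₄ at *
  have s₄ : P.Ready σ₄ := ⟨s₃.ctx.of_agree a₄ (by omega), z₄, zz₄,
    s₃.zero5.of_agree a₄ (.inr (by omega))⟩
  have hm₄ : ∀ a, P.base 6 ≤ a → σ₄.mem a = 0 := fun a ha => by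
    rw [a₄.2 a (.inr (by omega)), a₃.mem_eq, a₂'.2 a (.inr (by omega)), hzero a ha]
  have low₄ : ∀ r < 20, σ₄.reg r = σ.reg r := fun r hr => by
    rw [a₄.1 r (by omega), a₃.1 r hr, a₂'.1 r (by omega)]
  have r20 : σ₄.reg 20 = cu := by rw [a₄.1 20 (by omega), e₃]; simp
  have r21 : σ₄.reg 21 = pu := by rw [a₄.1 21 (by omega), e₃]; simp
  generalize hcv' : σ₄.reg 33 = cv at *
  generalize hpv' : σ₄.reg 34 = pv at *
  obtain ⟨σ₅, e₅⟩ : ∃ σ₅, σ₅ = (assign 23 (.reg 34)).denote P.w P.L.oracle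
    ((assign 22 (.reg 33)).denote P.w P.L.oracle σ₄) := ⟨_, rfl⟩
  rw [← e₅]
  simp only [denote, eval_reg, State.setReg_reg, Nat.reduceEqDiff, if_false, hcv', hpv'] at e₅
  have a₅ : P.Agree 22 4 4 σ₄ σ₅ := by
    rw [e₅]
    exact ((Agree.refl σ₄).setReg (by omega) _).setReg (by omega) _
  have s₅ := s₄.of_agree a₅ (by omega)
  have q0 : σ₅.reg 0 = u + 1 := by rw [a₅.1 0 (by omega), low₄ 0 (by omega), hu]
  have q1 : σ₅.reg 1 = v + 1 := by rw [a₅.1 1 (by omega), low₄ 1 (by omega), hv]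
  have q20 : σ₅.reg 20 = cu := (a₅.1 20 (by omega)).trans r20
  have q21 : σ₅.reg 21 = pu := (a₅.1 21 (by omega)).trans r21
  have q22 : σ₅.reg 22 = cv := by rw [e₅]; simp
  have q23 : σ₅.reg 23 = pv := by rw [e₅]; simp
  have hm₅ : ∀ a, P.base 6 ≤ a → σ₅.mem a = 0 := fun a ha => by rw [a₅.mem_eq, hm₄ a ha]
  clear hm₄ low₄ r20 r21 e₅ e₃ a₅ s₄ z₄ zz₄ a₄ s₃ a₃ r1 a₂' s₂ a₂ z₂ zz₂ e₁ a₁ s₁ hσ hzero hu hv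
  have hT := (tests_lt (w := P.w) (σ := σ₅) (a := .lit 0) (b := .reg 20) eval_zero q20).and (by omega)
    (tests_eq (a := .reg 20) (b := .reg 22) q20 q22)
  by_cases hsame : 0 < cu ∧ cu = cv
  · rw [denote_ite_pos (hT.ne_zero.2 hsame)]
    obtain ⟨hpos, rfl⟩ := hsame
    have hT' := (tests_eq (w := P.w) (σ := σ₅) (a := .reg 21) (b := .reg 1) q21 q1).or (by omega)
      (tests_eq (a := .reg 23) (b := .reg 0) q23 q0)
    simp only [denote, State.setReg_reg, if_true]
    rw [adj_iff_of_same_part hcu hcv (by omega)]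
    by_cases h : pu = v + 1 ∨ pv = u + 1
    exacts [.inl ⟨h, hT'.1 h⟩, .inr ⟨h, hT'.2 h⟩]
  rw [denote_ite_neg (hT.2 hsame)]
  obtain ⟨X, hX⟩ := hcu.exists_isPartCode
  obtain ⟨Y, hY⟩ := hcv.exists_isPartCode
  rw [adj_iff_of_part_ne huv hX.mem_parts hY.mem_parts hX.mem hY.mem
    (part_ne huv.ne hX hY hsame)]
  simp only [denote_block_cons, denote_block_nil]
  -- marking the part of `v`
  obtain ⟨σ₆, e₆⟩ : ∃ σ₆, σ₆ = (assign 26 (.reg 22)).denote P.w P.L.oracle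
    ((assign 25 (.reg 1)).denote P.w P.L.oracle ((assign 24 (.lit 0)).denote P.w P.L.oracle σ₅)) :=
    ⟨_, rfl⟩
  rw [← e₆]
  simp only [denote, eval_reg, eval_zero, State.setReg_reg, Nat.reduceEqDiff, if_false, q22,
    OfNat.one_ne_ofNat, q1] at e₆
  have a₆ : P.Agree 24 0 0 σ₅ σ₆ := by
    rw [e₆]
    exact (((Agree.refl σ₅).setReg (by omega) _).setReg (by omega) _).setReg (by omega) _
  obtain ⟨⟨hM, hlow⟩, s₇⟩ := forPart_spec (acts_mark σ₆) (s₅.of_agree a₆ (by omega)) (x := v) (X := Y)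
    (by rw [e₆]; simpa using hY) (by rw [e₆]; simp)
    ⟨fun y => by rw [a₆.mem_eq, hm₅ _ (by omega)]; simp, fun _ _ => rfl⟩
  generalize (forPart mark).denote P.w P.L.oracle σ₆ = σ₇ at *
  have p0 : σ₇.reg 0 = u + 1 := by rw [hlow 0 (by omega), a₆.1 0 (by omega), q0]
  have p1 : σ₇.reg 1 = v + 1 := by rw [hlow 1 (by omega), a₆.1 1 (by omega), q1]
  have p20 : σ₇.reg 20 = cu := by rw [hlow 20 (by omega), a₆.1 20 (by omega), q20]
  have p24 : σ₇.reg 24 = 0 := by rw [hlow 24 (by omega), e₆]; simp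
  -- scanning the part of `u`
  obtain ⟨σ₈, e₈⟩ : ∃ σ₈, σ₈ = (assign 26 (.reg 20)).denote P.w P.L.oracle
    ((assign 25 (.reg 0)).denote P.w P.L.oracle σ₇) := ⟨_, rfl⟩
  rw [← e₈]
  simp only [denote, eval_reg, State.setReg_reg, Nat.reduceEqDiff, if_false, p20, p0] at e₈
  have a₈ : P.Agree 25 0 0 σ₇ σ₈ := by
    rw [e₈]
    exact ((Agree.refl σ₇).setReg (by omega) _).setReg (by omega) _
  obtain ⟨⟨-, -, hF⟩, -⟩ := forPart_spec
    (acts_check ((a₈.1 0 (by omega)).trans p0) ((a₈.1 1 (by omega)).trans p1) Y)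
    (s₇.of_agree a₈ (by omega)) (x := u) (X := X)
    (by rw [e₈]; simpa using hX) (by rw [e₈]; simp)
    ⟨fun y => by rw [a₈.mem_eq, hM y], fun _ _ => rfl, by
      rw [a₈.1 24 (by omega), p24]
      exact ⟨.inl rfl, by simp⟩⟩
  generalize (forPart check).denote P.w P.L.oracle σ₈ = σ₉ at *
  have hT' := tests_eq (w := P.w) (σ := σ₉) (a := .reg 24) (b := .lit 0) (x := σ₉.reg 24) rfl
    eval_zero
  simp only [denote, State.setReg_reg, if_true]
  obtain ⟨h01, hiff⟩ := hF
  rw [← hiff]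
  rcases h01 with h | h
  · exact .inl ⟨by omega, hT'.1 h⟩
  · exact .inr ⟨fun h' => h' h, hT'.2 (by omega)⟩

end Setup

/-! ### Running time and number of probes -/

/-- The contents of the registers that serve as loop bounds. -/
structure Limits (c : ℕ → ℕ) (k d s : ℕ) : Prop where
  one_le_k : 1 ≤ k
  one_le_d : 1 ≤ d
  one_le_s : 1 ≤ s
  c3 : c 3 = d
  c4 : c 4 = k
  c5 : c 5 = s
  c6 : c 6 = 2 * k * d
  c16 : c 16 = k * d + 1
  c17 : c 17 = s * d + 1
  c18 : c 18 = (s * d + 1) * d + 1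

namespace Limits

open FProg

variable {c : ℕ → ℕ} {k d s : ℕ}

theorem time_center_le (h : Limits c k d s) : center.time c ≤ 500 * (k * d * (k * d)) := by
  have hX : 1 ≤ k * d := Nat.mul_pos h.one_le_k h.one_le_d
  have hk : k ≤ k * d := Nat.le_mul_of_pos_right _ h.one_le_d
  have e : center.time c = 38 + bfs.time c + c 16 * (64 + (12 + c 6 * 25)) + c 16 * 22 := by
    simp only [center, FProg.hash, bfsWipe, wipe, block, time, Expr.cost, Expr.and, Expr.or]; ring
  have e' : bfs.time c = 18 + c 4 * 27 + c 4 * c 3 * 49 := by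
    simp only [bfs, explore, block, time, Expr.cost]; ring
  rw [e, e', h.c16, h.c6, h.c4, h.c3]
  nlinarith [Nat.mul_le_mul hX hX, Nat.mul_le_mul_left (k * d) hX]

theorem time_parent_le (h : Limits c k d s) : parent.time c ≤ 1000 * (k * d * (k * d)) := by
  have hX : 1 ≤ k * d := Nat.mul_pos h.one_le_k h.one_le_d
  have hk : k ≤ k * d := Nat.le_mul_of_pos_right _ h.one_le_d
  have hd : d ≤ k * d := Nat.le_mul_of_pos_left _ h.one_le_k
  have e : parent.time c = 16 + center.time c + c 3 * 56 +
      c 3 * (18 + c 4 * 27 + c 4 * c 3 * 49) + c 3 * (c 16 * 22) := by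
    simp only [parent, rankOf, bfs, bfsWipe, explore, wipe, block, time, Expr.cost, Expr.and,
      Expr.or]; ring
  have h1 := h.time_center_le
  rw [e, h.c16, h.c4, h.c3]
  nlinarith [Nat.mul_le_mul hX hX, Nat.mul_le_mul_left (k * d) hX,
    Nat.mul_le_mul_right (k * d) hd, Nat.mul_le_mul_left d hk]

theorem time_treeExplore_le (h : Limits c k d s) {o bl bc N N' : ℕ} (hN : c N = N') (hN' : 1 ≤ N') :
    (treeExplore o bl bc N).time c ≤ 1200 * (N' * d * (k * d * (k * d))) := by
  have hX : 1 ≤ k * d := Nat.mul_pos h.one_le_k h.one_le_d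
  have hY : 1 ≤ k * d * (k * d) := Nat.mul_pos hX hX
  have hd := h.one_le_d
  have e : (treeExplore o bl bc N).time c = 18 + c N * 27 + c N * c 3 * 59 +
      c N * c 3 * parent.time c := by
    simp only [treeExplore, isParent, explore, block, time, Expr.cost]; ring
  have h1 := h.time_parent_le
  rw [e, h.c3, hN]
  have h2 : N' ≤ N' * d := Nat.le_mul_of_pos_right _ hd
  have h3 : N' * d ≤ N' * d * (k * d * (k * d)) := Nat.le_mul_of_pos_right _ hY
  have h4 := Nat.mul_le_mul_left (N' * d) h1
  nlinarith

theorem time_cutDepth_le (h : Limits c k d s) : cutDepth.time c ≤ 1400 * (s * d * (k * d * (k * d))) := by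
  have hX : 1 ≤ k * d := Nat.mul_pos h.one_le_k h.one_le_d
  have hY : 1 ≤ k * d * (k * d) := Nat.mul_pos hX hX
  have hsd : 1 ≤ s * d := Nat.mul_pos h.one_le_s h.one_le_d
  have e : cutDepth.time c = 24 + (treeExplore 50 11 12 5).time c + c 17 * 22 := by
    simp only [cutDepth, wipe, block, time, Expr.cost]; ring
  have h1 := h.time_treeExplore_le (o := 50) (bl := 11) (bc := 12) h.c5 h.one_le_s
  have h3 : s * d ≤ s * d * (k * d * (k * d)) := Nat.le_mul_of_pos_right _ hY
  rw [e, h.c17]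
  omega

theorem time_findSub_le (h : Limits c k d s) :
    findSub.time c ≤ 5000 * (k * (s * d + k) * (k * d * (k * d))) := by
  have hX : 1 ≤ k * d := Nat.mul_pos h.one_le_k h.one_le_d
  have hY : 1 ≤ k * d * (k * d) := Nat.mul_pos hX hX
  have hsd : 1 ≤ s * d := Nat.mul_pos h.one_le_s h.one_le_d
  have hk := h.one_le_k
  have e : findSub.time c = 22 + parent.time c + c 4 * (50 + 2 * cutDepth.time c +
      c 4 * (20 + parent.time c)) := by
    simp only [findSub, descend, descendBelow, climb, block, time, Expr.cost, Expr.and]; ring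
  have h1 := h.time_parent_le
  have h2 := h.time_cutDepth_le
  rw [e, h.c4]
  generalize k * d * (k * d) = Y at *
  have h3 : k * (20 + parent.time c) ≤ 1020 * (k * Y) := by
    have := Nat.mul_le_mul_left k (show 20 + parent.time c ≤ 1020 * Y by omega)
    linarith
  have h4 : s * d ≤ s * d * Y := Nat.le_mul_of_pos_right _ hY
  have h5 := Nat.mul_le_mul_left k (show 50 + 2 * cutDepth.time c + k * (20 + parent.time c) ≤
    2900 * (s * d * Y) + 1020 * (k * Y) by omega)
  have h6 : Y ≤ k * (k * Y) := by
    have := Nat.mul_pos hk hk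
    calc Y ≤ k * k * Y := Nat.le_mul_of_pos_left _ this
      _ = k * (k * Y) := by ring
  nlinarith

theorem time_forPart_le (h : Limits c k d s) {act : FProg} (hact : act.time c ≤ 200 * d) :
    (forPart act).time c ≤ 12000 * (s * d * d * (s * d) * (k * d * (k * d))) := by
  have hX : 1 ≤ k * d := Nat.mul_pos h.one_le_k h.one_le_d
  have hY : 1 ≤ k * d * (k * d) := Nat.mul_pos hX hX
  have hd := h.one_le_d
  have hsd : 1 ≤ s * d := Nat.mul_pos h.one_le_s h.one_le_d
  have hs : s ≤ s * d := Nat.le_mul_of_pos_right _ hd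
  have hds : d ≤ s * d := Nat.le_mul_of_pos_left _ h.one_le_s
  have e : (forPart act).time c = 40 + (treeExplore 42 13 14 17).time c + c 18 * (40 + act.time c +
      (22 + (treeExplore 50 11 12 5).time c + c 5 * (21 + act.time c) + c 17 * 22) + 22) +
      act.time c := by
    simp only [forPart, forEntry, forSmall, wipe, block, time, Expr.cost]; ring
  have h1 := h.time_treeExplore_le (o := 50) (bl := 11) (bc := 12) h.c5 h.one_le_s
  have h2 := h.time_treeExplore_le (o := 42) (bl := 13) (bc := 14) h.c17 (by omega)
  rw [e, h.c18, h.c17, h.c5]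
  generalize k * d * (k * d) = Y at *
  have h4 : s * d ≤ s * d * Y := Nat.le_mul_of_pos_right _ hY
  have h5 : s * (21 + act.time c) ≤ 21 * (s * d) + 200 * (s * d) := by
    have := Nat.mul_le_mul_left s (show 21 + act.time c ≤ 221 * d by omega)
    linarith
  have h6 : 40 + act.time c + (22 + (treeExplore 50 11 12 5).time c + s * (21 + act.time c) +
      (s * d + 1) * 22) + 22 ≤ 2000 * (s * d * Y) := by omega
  have h7 : (s * d + 1) * d + 1 ≤ 3 * (s * d * d) := by
    have : d ≤ s * d * d := Nat.le_mul_of_pos_left _ hsd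
    have := Nat.mul_pos hsd hd
    linarith
  have h8 := Nat.mul_le_mul h7 h6
  have h9 : (s * d + 1) * d * Y ≤ 2 * (s * d * d * Y) := by
    have : d * Y ≤ s * d * (d * Y) := Nat.le_mul_of_pos_left _ hsd
    nlinarith
  have h10 : s * d * d * Y ≤ s * d * d * Y * (s * d) := Nat.le_mul_of_pos_right _ hsd
  have h11 : 1 ≤ s * d * d * Y := Nat.mul_pos (Nat.mul_pos hsd hd) hY
  have h12 : d ≤ s * d * d * Y := by
    calc d ≤ s * d * d := Nat.le_mul_of_pos_left _ hsd
      _ ≤ _ := Nat.le_mul_of_pos_right _ hY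
  have e1 : s * d * d * (s * d) * Y = s * d * d * Y * (s * d) := by ring
  have e2 : 3 * (s * d * d) * (2000 * (s * d * Y)) = 6000 * (s * d * d * Y * (s * d)) := by ring
  rw [e1]
  rw [e2] at h8
  omega

/-- The main costs are those of finding the sub-centers, and of enumerating a part, where small subtrees below
up to `s * d * d` vertices are explored; each test for being a parent takes `O((k * d) ^ 2)` steps. -/
theorem time_answer_le (h : Limits c k d s) : answer.time c ≤
    50000 * (k * (s * d + k) * (k * d * (k * d)) +
      s * d * d * (s * d) * (k * d * (k * d))) := by
  have hX : 1 ≤ k * d := Nat.mul_pos h.one_le_k h.one_le_d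
  have hY : 1 ≤ k * d * (k * d) := Nat.mul_pos hX hX
  have hsd : 1 ≤ s * d := Nat.mul_pos h.one_le_s h.one_le_d
  have h1 := h.time_findSub_le
  have h2 := h.time_forPart_le (act := mark) (by
    have := h.one_le_d
    simp only [mark, time, Expr.cost]
    omega)
  have h3 := h.time_forPart_le (act := check) (by
    have := h.one_le_d
    have e : check.time c = 6 + c 3 * 82 := by
      simp only [check, orient, block, time, Expr.cost, Expr.and, Expr.or]
    rw [e, h.c3]
    omega)
  have e : answer.time c = 48 + 2 * findSub.time c + (forPart mark).time c +
      (forPart check).time c := by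
    simp only [answer, block, time, Expr.cost, Expr.and, Expr.or]; ring
  have h4 : 1 ≤ s * d * d * (s * d) * (k * d * (k * d)) :=
    Nat.mul_pos (Nat.mul_pos (Nat.mul_pos hsd h.one_le_d) hsd) hY
  omega

theorem probes_center_le (h : Limits c k d s) : center.probes c ≤ k * d := by
  have e : center.probes c = c 4 * c 3 := by
    simp only [center, bfs, explore, FProg.hash, bfsWipe, wipe, block, probes]; ring
  rw [e, h.c4, h.c3]

theorem probes_parent_le (h : Limits c k d s) : parent.probes c ≤ 3 * (k * d * d) := by
  have e : parent.probes c = center.probes c + c 3 + c 3 * (c 4 * c 3) := by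
    simp only [parent, rankOf, bfs, bfsWipe, explore, wipe, block, probes]; ring
  have h1 := h.probes_center_le
  have h2 : k * d ≤ k * d * d := Nat.le_mul_of_pos_right _ h.one_le_d
  have h3 : d ≤ k * d := Nat.le_mul_of_pos_left _ h.one_le_k
  rw [e, h.c4, h.c3]
  linarith

theorem probes_treeExplore_le (h : Limits c k d s) {o bl bc N N' : ℕ} (hN : c N = N') :
    (treeExplore o bl bc N).probes c ≤ 4 * (N' * d * (k * d * d)) := by
  have hZ : 1 ≤ k * d * d := Nat.mul_pos (Nat.mul_pos h.one_le_k h.one_le_d) h.one_le_d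
  have e : (treeExplore o bl bc N).probes c = c N * c 3 * (1 + parent.probes c) := by
    simp only [treeExplore, isParent, explore, block, probes]; ring
  have h1 := h.probes_parent_le
  rw [e, h.c3, hN]
  have := Nat.mul_le_mul_left (N' * d) (show 1 + parent.probes c ≤ 4 * (k * d * d) by omega)
  linarith

theorem probes_cutDepth_le (h : Limits c k d s) :
    cutDepth.probes c ≤ 4 * (s * d * (k * d * d)) := by
  have e : cutDepth.probes c = (treeExplore 50 11 12 5).probes c := by
    simp only [cutDepth, wipe, block, probes]; ring
  rw [e]
  exact h.probes_treeExplore_le h.c5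

theorem probes_findSub_le (h : Limits c k d s) :
    findSub.probes c ≤ 11 * (k * (s * d + k) * (k * d * d)) := by
  have hk := h.one_le_k
  have e : findSub.probes c = parent.probes c + c 4 * (2 * cutDepth.probes c +
      c 4 * parent.probes c) := by
    simp only [findSub, descend, descendBelow, climb, block, probes]; ring
  have h1 := h.probes_parent_le
  have h2 := h.probes_cutDepth_le
  rw [e, h.c4]
  generalize k * d * d = Z at *
  have h3 := Nat.mul_le_mul_left k h1
  have h5 := Nat.mul_le_mul_left k (show 2 * cutDepth.probes c + k * parent.probes c ≤
    8 * (s * d * Z) + k * (3 * Z) by omega)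
  have h6 : Z ≤ k * k * Z := Nat.le_mul_of_pos_left _ (Nat.mul_pos hk hk)
  nlinarith

theorem probes_forPart_le (h : Limits c k d s) {act : FProg} (hact : act.probes c ≤ d) :
    (forPart act).probes c ≤ 30 * (s * d * d * (s * d) * (k * d * d)) := by
  have hd := h.one_le_d
  have hsd : 1 ≤ s * d := Nat.mul_pos h.one_le_s h.one_le_d
  have hZ : 1 ≤ k * d * d := Nat.mul_pos (Nat.mul_pos h.one_le_k hd) hd
  have e : (forPart act).probes c = (treeExplore 42 13 14 17).probes c + c 18 * (act.probes c +
      ((treeExplore 50 11 12 5).probes c + c 5 * act.probes c)) + act.probes c := by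
    simp only [forPart, forEntry, forSmall, wipe, block, probes]; ring
  have h1 := h.probes_treeExplore_le (o := 50) (bl := 11) (bc := 12) h.c5
  have h2 := h.probes_treeExplore_le (o := 42) (bl := 13) (bc := 14) h.c17
  rw [e, h.c18, h.c5]
  generalize k * d * d = Z at *
  have h4 : s * d ≤ s * d * Z := Nat.le_mul_of_pos_right _ hZ
  have h5 : s * act.probes c ≤ s * d := Nat.mul_le_mul_left s hact
  have hds : d ≤ s * d := Nat.le_mul_of_pos_left _ h.one_le_s
  have h6 : act.probes c + ((treeExplore 50 11 12 5).probes c + s * act.probes c) ≤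
      6 * (s * d * Z) := by omega
  have h7 : (s * d + 1) * d + 1 ≤ 3 * (s * d * d) := by
    have : d ≤ s * d * d := Nat.le_mul_of_pos_left _ hsd
    have := Nat.mul_pos hsd hd
    linarith
  have h8 := Nat.mul_le_mul h7 h6
  have h9 : (s * d + 1) * d * Z ≤ 2 * (s * d * d * Z) := by
    have : d * Z ≤ s * d * (d * Z) := Nat.le_mul_of_pos_left _ hsd
    nlinarith
  have h10 : s * d * d * Z ≤ s * d * d * Z * (s * d) := Nat.le_mul_of_pos_right _ hsd
  have h12 : d ≤ s * d * d * Z := by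
    calc d ≤ s * d * d := Nat.le_mul_of_pos_left _ hsd
      _ ≤ _ := Nat.le_mul_of_pos_right _ hZ
  have e1 : s * d * d * (s * d) * Z = s * d * d * Z * (s * d) := by ring
  have e2 : 3 * (s * d * d) * (6 * (s * d * Z)) = 18 * (s * d * d * Z * (s * d)) := by ring
  rw [e1]
  rw [e2] at h8
  omega

theorem probes_answer_le (h : Limits c k d s) : answer.probes c ≤
    60 * (k * (s * d + k) * (k * d * d) + s * d * d * (s * d) * (k * d * d)) := by
  have h1 := h.probes_findSub_le
  have h2 := h.probes_forPart_le (act := mark) (Nat.zero_le _)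
  have h3 := h.probes_forPart_le (act := check) (by
    have e : check.probes c = c 3 := by
      simp only [check, orient, block, probes]; ring
    rw [e, h.c3])
  have e : answer.probes c = 2 * findSub.probes c + (forPart mark).probes c +
      (forPart check).probes c := by
    simp only [answer, block, probes]; ring
  omega

end Limits

/-! ### The program -/

namespace FProg

/-- The computation of the addresses of the arrays and of the loop bounds. -/
def prelude : FProg := block [
  assign 9 (.reg 6),
  assign 10 (.op .add (.reg 9) (.op .add (.reg 2) (.lit 2))),
  assign 11 (.op .add (.reg 10) (.op .add (.reg 2) (.lit 2))),
  assign 12 (.op .add (.reg 11) (.op .add (.reg 2) (.lit 2))),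
  assign 13 (.op .add (.reg 12) (.op .add (.reg 2) (.lit 2))),
  assign 14 (.op .add (.reg 13) (.op .add (.reg 2) (.lit 2))),
  assign 15 (.op .add (.reg 14) (.op .add (.reg 2) (.lit 2))),
  assign 16 (.op .add (.op .mul (.reg 4) (.reg 3)) (.lit 1)),
  assign 17 (.op .add (.op .mul (.reg 5) (.reg 3)) (.lit 1)),
  assign 18 (.op .add (.op .mul (.reg 17) (.reg 3)) (.lit 1))]

theorem prelude_wf : prelude.wf 0 = true := rfl

set_option maxRecDepth 20000 in
theorem answer_wf : answer.wf 20 = true := by decide +kernel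

end FProg

/-- The word-RAM program that answers the queries. -/
def program : Prog :=
  .seq FProg.prelude.compile (.seq FProg.answer.compile (.assign 0 (.reg 24)))

namespace Setup

variable {P : Setup}
open FProg

/-- The initial configuration of a run. -/
structure Init (P : Setup) (u v : Fin P.n) (σ : State) : Prop where
  r0 : σ.reg 0 = u + 1
  r1 : σ.reg 1 = v + 1
  r2 : σ.reg 2 = P.n
  r3 : σ.reg 3 = P.d
  r4 : σ.reg 4 = P.k
  r5 : σ.reg 5 = P.s
  r6 : σ.reg 6 = 2 * P.k * P.d
  r7 : σ.reg 7 = P.q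
  r8 : σ.reg 8 = P.θ
  r19 : σ.reg 19 = 0
  seed : ∀ j (h : j < 2 * P.k * P.d), σ.mem j = P.ρ ⟨j, h⟩
  rest : ∀ j, 2 * P.k * P.d ≤ j → σ.mem j = 0

/-- The addresses and loop bounds are computed without overflow. -/
theorem prelude_spec {O : ℕ → ℕ → ℕ} {u v : Fin P.n} {σ : State} (h : P.Init u v σ) :
    P.Ctx (FProg.prelude.denote P.w O σ) ∧ (FProg.prelude.denote P.w O σ).mem = σ.mem ∧
      (∀ r, (r < 9 ∨ r = 19) → (FProg.prelude.denote P.w O σ).reg r = σ.reg r) := by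
  have hw := fun i hi => base_lt (P := P) (i := i) hi
  have hB := P.bound
  have hn := P.ten_lt
  have hk := P.two_le_k
  have hdk : P.d ≤ P.k * P.d := Nat.le_mul_of_pos_left _ (by omega)
  have l1 : ∀ τ, (Expr.lit 1).eval P.w τ = 1 := fun τ => eval_lit (by omega)
  have l2 : ∀ τ, (Expr.lit 2).eval P.w τ = 2 := fun τ => eval_lit (by omega)
  have b0 : P.base 0 = 2 * P.k * P.d := by simp [base]
  have bs : ∀ i, P.base (i + 1) = P.base i + (P.n + 2) := base_succ
  -- one step of the computation of the addresses
  have step : ∀ (τ : State) (a i : ℕ), i < 7 → τ.reg a = P.base i → τ.reg 2 = P.n →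
      (Expr.op .add (.reg a) (.op .add (.reg 2) (.lit 2))).eval P.w τ = P.base (i + 1) := by
    intro τ a i hi h1 h2
    have e : (Expr.op .add (.reg 2) (.lit 2)).eval P.w τ = P.n + 2 := by
      rw [eval_add] <;> simp only [eval_reg, l2, h2]
      omega
    have := hw i (by omega)
    rw [eval_add] <;> simp only [eval_reg, e, h1]
    · exact (bs i).symm
    · omega
  have prod : ∀ (τ : State) (a b x y : ℕ), τ.reg a = x → τ.reg b = y → x * y + 1 < 2 ^ P.w →
      (Expr.op .add (.op .mul (.reg a) (.reg b)) (.lit 1)).eval P.w τ = x * y + 1 := by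
    intro τ a b x y h1 h2 h3
    have e : (Expr.op .mul (.reg a) (.reg b)).eval P.w τ = x * y := by
      rw [eval_mul] <;> simp only [eval_reg, h1, h2]
      omega
    rw [eval_add] <;> simp only [e, l1]
    exact h3
  have hsd : P.s * P.d + 1 ≤ (P.s * P.d + 1) * P.d := Nat.le_mul_of_pos_right _ P.one_le_d
  obtain ⟨τ, hτ⟩ : ∃ τ, τ = FProg.prelude.denote P.w O σ := ⟨_, rfl⟩
  rw [← hτ]
  simp only [prelude, denote_block_cons, denote_block_nil, denote] at hτ
  rw [show (Expr.reg 6).eval P.w σ = P.base 0 from h.r6.trans b0.symm] at hτ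
  rw [step _ 9 0 (by omega) (by simp) (by simpa using h.r2)] at hτ
  rw [step _ 10 1 (by omega) (by simp) (by simpa using h.r2)] at hτ
  rw [step _ 11 2 (by omega) (by simp) (by simpa using h.r2)] at hτ
  rw [step _ 12 3 (by omega) (by simp) (by simpa using h.r2)] at hτ
  rw [step _ 13 4 (by omega) (by simp) (by simpa using h.r2)] at hτ
  rw [step _ 14 5 (by omega) (by simp) (by simpa using h.r2)] at hτ
  rw [prod _ _ _ P.k P.d (by simpa using h.r4) (by simpa using h.r3) (by omega)] at hτ
  rw [prod _ _ _ P.s P.d (by simpa using h.r5) (by simpa using h.r3) (by omega)] at hτ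
  rw [prod _ _ _ (P.s * P.d + 1) P.d (by simp) (by simpa using h.r3) (by omega)] at hτ
  have hlow : ∀ r, (r < 9 ∨ r = 19) → τ.reg r = σ.reg r := by
    intro r hr
    rw [hτ]
    simp only [State.setReg_reg]
    iterate 10 rw [if_neg (by omega)]
  have hm : τ.mem = σ.mem := by rw [hτ]; rfl
  refine ⟨?_, hm, hlow⟩
  constructor
  case seed => rw [hm]; exact h.seed
  case r2 => rw [hlow 2 (by omega), h.r2]
  case r3 => rw [hlow 3 (by omega), h.r3]
  case r4 => rw [hlow 4 (by omega), h.r4]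
  case r5 => rw [hlow 5 (by omega), h.r5]
  case r6 => rw [hlow 6 (by omega), h.r6]
  case r7 => rw [hlow 7 (by omega), h.r7]
  case r8 => rw [hlow 8 (by omega), h.r8]
  all_goals rw [hτ]; simp

/-- The program answers the queries correctly and within the bounds on its costs. -/
theorem exec_program {u v : Fin P.n} {σ : State} (h : P.Init u v σ) (huv : P.G.Adj u v) :
    ∃ σ' t m, Exec P.w P.L.oracle program σ σ' t m ∧
      t ≤ 50100 * (P.k * (P.s * P.d + P.k) * (P.k * P.d * (P.k * P.d)) +
        P.s * P.d * P.d * (P.s * P.d) * (P.k * P.d * (P.k * P.d))) ∧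
      m ≤ 60 * (P.k * (P.s * P.d + P.k) * (P.k * P.d * P.d) +
        P.s * P.d * P.d * (P.s * P.d) * (P.k * P.d * P.d)) ∧
      ((sparseSpanningGraph P.G P.W P.k P.s).Adj u v ∧ σ'.reg 0 = 1 ∨
        ¬ (sparseSpanningGraph P.G P.W P.k P.s).Adj u v ∧ σ'.reg 0 = 0) := by
  have hB := P.bound
  have hk := P.two_le_k
  have hs := P.two_le_s
  have hd := P.one_le_d
  obtain ⟨t₁, m₁, ex₁, ht₁, hm₁⟩ := exec_compile (w := P.w) (O := P.L.oracle) (c := fun _ => 0)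
    prelude_wf σ (fun i hi => absurd hi (Nat.not_lt_zero i)) (fun i hi => absurd hi (Nat.not_lt_zero i))
  obtain ⟨c, hm, hlow⟩ := prelude_spec (O := P.L.oracle) h
  generalize FProg.prelude.denote P.w P.L.oracle σ = σ₁ at *
  have hlim : Limits σ₁.reg P.k P.d P.s :=
    ⟨by omega, hd, by omega, c.r3, c.r4, c.r5, c.r6, c.r16, c.r17, c.r18⟩
  have hbase := fun i hi => base_lt (P := P) (i := i) hi
  have hun := u.2
  have hvn := v.2
  have hsmall : ∀ i < 20, σ₁.reg i < 2 ^ P.w := by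
    have hdk : P.d ≤ P.k * P.d := Nat.le_mul_of_pos_left _ (by omega)
    have hkd : P.k ≤ P.k * P.d := Nat.le_mul_of_pos_right _ hd
    have hsd : P.s * P.d + 1 ≤ (P.s * P.d + 1) * P.d := Nat.le_mul_of_pos_right _ hd
    intro i hi
    interval_cases i
    · rw [hlow 0 (by omega), h.r0]; omega
    · rw [hlow 1 (by omega), h.r1]; omega
    · rw [c.r2]; omega
    · rw [c.r3]; omega
    · rw [c.r4]; omega
    · rw [c.r5]; omega
    · rw [c.r6]; omega
    · rw [c.r7]; omega
    · rw [c.r8]; omega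
    · rw [c.r9]; have := hbase 0 (by omega); omega
    · rw [c.r10]; have := hbase 1 (by omega); omega
    · rw [c.r11]; have := hbase 2 (by omega); omega
    · rw [c.r12]; have := hbase 3 (by omega); omega
    · rw [c.r13]; have := hbase 4 (by omega); omega
    · rw [c.r14]; have := hbase 5 (by omega); omega
    · rw [c.r15]; have := hbase 6 (by omega); omega
    · rw [c.r16]; omega
    · rw [c.r17]; omega
    · rw [c.r18]; omega
    · rw [hlow 19 (by omega), h.r19]; omega
  obtain ⟨t₂, m₂, ex₂, ht₂, hm₂⟩ := exec_compile (w := P.w) (O := P.L.oracle) (c := σ₁.reg)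
    answer_wf σ₁ (fun _ _ => rfl) hsmall
  have hz : ∀ a, P.base 0 ≤ a → σ₁.mem a = 0 := fun a ha => by
    rw [hm]
    exact h.rest a (by have : P.base 0 = 2 * P.k * P.d := by simp [base]
                       omega)
  have hzero : ∀ i, P.Zero i σ₁ := fun i v' =>
    hz _ ((base_mono (Nat.zero_le i)).trans (Nat.le_add_right _ _))
  have hans := answer_spec (σ := σ₁) ⟨c, hzero 1, hzero 3, hzero 5⟩
    (fun a ha => hz a ((base_mono (Nat.zero_le 6)).trans ha))
    ((hlow 0 (by omega)).trans h.r0) ((hlow 1 (by omega)).trans h.r1) huv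
  refine ⟨_, _, _, .seq ex₁ (.seq ex₂ (.assign 0 (.reg 24) _)), ?_, ?_, ?_⟩
  · have h1 := hlim.time_answer_le
    have h2 : prelude.time (fun _ => 0) ≤ 96 := by
      simp [prelude, block, time, Expr.cost]
    have h3 : 1 ≤ P.s * P.d * P.d * (P.s * P.d) * (P.k * P.d * (P.k * P.d)) := by
      have hsd : 1 ≤ P.s * P.d := Nat.mul_pos (by omega) hd
      have hX : 1 ≤ P.k * P.d := Nat.mul_pos (by omega) hd
      exact Nat.mul_pos (Nat.mul_pos (Nat.mul_pos hsd hd) hsd) (Nat.mul_pos hX hX)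
    simp only [Expr.cost]
    omega
  · have h1 := hlim.probes_answer_le
    have h2 : prelude.probes (fun _ => 0) = 0 := by
      simp [prelude, block, probes]
    omega
  · simpa [eval_reg] using hans

end Setup

/-! ### Second moments over a finite sample space -/

section Freq

variable {Ω ι : Type*}

/-- The probability of an event for the uniform distribution on a finite type. -/
noncomputable def freq (S : Set Ω) : ℝ := S.ncard / Nat.card Ω

theorem freq_eq_sum [Fintype Ω] (S : Set Ω) :
    freq S = (∑ x, S.indicator (1 : Ω → ℝ) x) / Nat.card Ω := by
  classical
  unfold freq
  congr 1
  simp only [Set.indicator_apply, Pi.one_apply, Finset.sum_boole, Set.ncard_eq_toFinset_card' S,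
    Set.filter_mem_univ_eq_toFinset]

theorem freq_nonneg (S : Set Ω) : 0 ≤ freq S := by unfold freq; positivity

theorem freq_mono [Finite Ω] {S T : Set Ω} (h : S ⊆ T) : freq S ≤ freq T := by
  unfold freq
  gcongr
  exact Set.toFinite T

theorem freq_union_le (S T : Set Ω) : freq (S ∪ T) ≤ freq S + freq T := by
  unfold freq
  rw [← add_div]
  gcongr
  exact_mod_cast Set.ncard_union_le S T

theorem freq_compl [Finite Ω] [Nonempty Ω] (S : Set Ω) : freq Sᶜ = 1 - freq S := by
  have h := Set.ncard_add_ncard_compl S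
  have hc : (0 : ℝ) < Nat.card Ω := by exact_mod_cast Nat.card_pos
  unfold freq
  rw [eq_sub_iff_add_eq, ← add_div, div_eq_one_iff_eq hc.ne', ← h]
  push_cast
  ring

/-- Complements of independent events are independent. -/
theorem freq_compl_inter_compl [Finite Ω] [Nonempty Ω] {S T : Set Ω} (h : freq (S ∩ T) = freq S * freq T) :
    freq (Sᶜ ∩ Tᶜ) = freq Sᶜ * freq Tᶜ := by
  have h1 : (S ∪ T).ncard + (S ∩ T).ncard = S.ncard + T.ncard := Set.ncard_union_add_ncard_inter S T
  have h2 : freq (S ∪ T) + freq (S ∩ T) = freq S + freq T := by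
    unfold freq
    rw [← add_div, ← add_div]
    congr 1
    exact_mod_cast h1
  rw [← Set.compl_union, freq_compl, freq_compl, freq_compl]
  linarith

/-- **Chebyshev's inequality** for the number of those events of a family that occur, when every event
is uncorrelated to all but at most `M` events. -/
theorem freq_two_mul_le_ncard [Fintype Ω] [Nonempty Ω] [Fintype ι] (Y : ι → Set Ω) (R : ι → ι → Prop) (M : ℕ)
    (hY : ∀ i j, ¬ R i j → freq (Y i ∩ Y j) = freq (Y i) * freq (Y j))
    (hM : ∀ i, {j | R i j}.ncard ≤ M) {T : ℝ} (hT : 0 < T) (hm : ∑ i, freq (Y i) ≤ T) :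
    freq {x | 2 * T ≤ ({i | x ∈ Y i}.ncard : ℝ)} ≤ M * (∑ i, freq (Y i)) / T ^ 2 := by
  classical
  have hc : (0 : ℝ) < Nat.card Ω := by exact_mod_cast Nat.card_pos
  obtain ⟨m, hm'⟩ : ∃ m, m = ∑ i, freq (Y i) := ⟨_, rfl⟩
  let f : ι → Ω → ℝ := fun i => (Y i).indicator 1
  have hS : ∀ x, ({i | x ∈ Y i}.ncard : ℝ) = ∑ i, f i x := by
    intro x
    rw [Set.ncard_eq_toFinset_card', Finset.card_eq_sum_ones, Set.toFinset_ofPred, Finset.sum_filter]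
    push_cast
    rfl
  have hff : ∀ i j x, f i x * f j x = (Y i ∩ Y j).indicator 1 x := by
    intro i j x
    simp only [f, Set.indicator_apply, Set.mem_inter_iff, Pi.one_apply]
    split_ifs <;> simp_all
  -- the variance
  have hvar : (∑ x, ((∑ i, f i x) - m) ^ 2) / Nat.card Ω =
      ∑ i, ∑ j, (freq (Y i ∩ Y j) - freq (Y i) * freq (Y j)) := by
    have h1 : ∀ x, ((∑ i, f i x) - m) ^ 2 =
        (∑ i, ∑ j, (Y i ∩ Y j).indicator (1 : Ω → ℝ) x) - 2 * m * (∑ i, f i x) + m ^ 2 := by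
      intro x
      simp only [← hff, ← Finset.sum_mul_sum]
      ring
    have h2 : (∑ x, ∑ i, f i x) = m * Nat.card Ω := by
      rw [Finset.sum_comm, hm', Finset.sum_mul]
      refine Finset.sum_congr rfl fun i _ => ?_
      rw [freq_eq_sum, div_mul_cancel₀ _ hc.ne']
    have h3 : (∑ x, ∑ i, ∑ j, (Y i ∩ Y j).indicator (1 : Ω → ℝ) x) =
        (∑ i, ∑ j, freq (Y i ∩ Y j)) * Nat.card Ω := by
      rw [Finset.sum_comm, Finset.sum_mul]
      refine Finset.sum_congr rfl fun i _ => ?_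
      rw [Finset.sum_comm, Finset.sum_mul]
      refine Finset.sum_congr rfl fun j _ => ?_
      rw [freq_eq_sum, div_mul_cancel₀ _ hc.ne']
    have h4 : ∑ i, ∑ j, freq (Y i) * freq (Y j) = m ^ 2 := by
      rw [hm', sq, Finset.sum_mul_sum]
    rw [Finset.sum_congr rfl fun i _ => Finset.sum_sub_distrib _ _, Finset.sum_sub_distrib, h4]
    simp only [h1, Finset.sum_add_distrib, Finset.sum_sub_distrib, ← Finset.mul_sum, h2, h3,
      Finset.sum_const, Finset.card_univ, nsmul_eq_mul, Nat.card_eq_fintype_card]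
    rw [Nat.card_eq_fintype_card] at hc
    field_simp
    ring
  have hle : (∑ x, ((∑ i, f i x) - m) ^ 2) / Nat.card Ω ≤ M * m := by
    rw [hvar, hm', Finset.mul_sum]
    refine Finset.sum_le_sum fun i _ => ?_
    calc ∑ j, (freq (Y i ∩ Y j) - freq (Y i) * freq (Y j))
        ≤ ∑ j, if R i j then freq (Y i) else 0 := by
          refine Finset.sum_le_sum fun j _ => ?_
          split_ifs with h
          · have := freq_mono (Set.inter_subset_left (s := Y i) (t := Y j))
            have := mul_nonneg (freq_nonneg (Y i)) (freq_nonneg (Y j))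
            linarith
          · rw [hY i j h, sub_self]
      _ = ({j | R i j}.ncard : ℝ) * freq (Y i) := by
          rw [← Finset.sum_filter, Finset.sum_const, nsmul_eq_mul, Set.ncard_eq_toFinset_card',
            Set.toFinset_ofPred]
      _ ≤ M * freq (Y i) := by
          gcongr
          · exact freq_nonneg _
          · exact hM i
  rw [← hm', le_div_iff₀ (by positivity)]
  refine le_trans ?_ hle
  rw [freq_eq_sum, div_mul_eq_mul_div, Finset.sum_mul]
  gcongr with x
  rw [Set.indicator_apply]
  split_ifs with h
  · rw [Set.mem_ofPred_eq, hS] at h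
    rw [Pi.one_apply, one_mul]
    exact pow_le_pow_left₀ hT.le (by rw [← hm'] at hm; linarith) 2
  · rw [zero_mul]
    positivity

end Freq

/-! ### Independence of the centers -/

/-- Polynomials of degree less than `t` take arbitrary values at up to `t` points. -/
theorem exists_coefficients {F : Type*} [Field F] {α : Type*} [DecidableEq α] (A : Finset α) {x : α → F}
    (hx : Set.InjOn x A) {t : ℕ} (ht : A.card ≤ t) (y : α → F) :
    ∃ c : Fin t → F, ∀ v ∈ A, ∑ j, c j * x v ^ (j : ℕ) = y v := by
  refine ⟨fun j => (Lagrange.interpolate A x y).coeff j, fun v hv => ?_⟩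
  rw [Fin.sum_univ_eq_sum_range fun j => (Lagrange.interpolate A x y).coeff j * x v ^ j]
  have h0 : 0 < t := (Finset.card_pos.2 ⟨v, hv⟩).trans_le ht
  have h1 : (Lagrange.interpolate A x y).natDegree < t := by
    by_cases h : Lagrange.interpolate A x y = 0
    · rwa [h, Polynomial.natDegree_zero]
    · exact (Polynomial.natDegree_lt_iff_degree_lt h).2
        ((Lagrange.degree_interpolate_lt y hx).trans_le (by exact_mod_cast ht))
  rw [← Polynomial.eval_eq_sum_range' h1, Lagrange.eval_interpolate_at_node y hx hv]

/-- All fibres of a surjective homomorphism have the same size. -/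
theorem card_preimage_mul_card {V U : Type*} [AddCommGroup V] [AddCommGroup U] [Fintype V] [Fintype U]
    [DecidableEq U] (φ : V →+ U) (hφ : Function.Surjective φ) (B : Finset U) :
    (Finset.univ.filter fun v => φ v ∈ B).card * Fintype.card U = B.card * Fintype.card V := by
  classical
  have key : ∀ u, (Finset.univ.filter fun v => φ v = u).card =
      (Finset.univ.filter fun v => φ v = 0).card := by
    intro u
    obtain ⟨w, rfl⟩ := hφ u
    refine Finset.card_bij' (fun v _ => v - w) (fun v _ => v + w) ?_ ?_ ?_ ?_ <;> simp
    intro v hv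
    simp [hv]
  have hB : ∀ B : Finset U, (Finset.univ.filter fun v => φ v ∈ B).card =
      B.card * (Finset.univ.filter fun v => φ v = 0).card := by
    intro B
    rw [Finset.card_eq_sum_card_fiberwise (f := φ) (t := B) (by intro v hv; simpa using hv),
      Finset.sum_const_nat]
    intro u hu
    rw [← key u]
    congr 1
    ext v
    simp only [Finset.mem_filter, Finset.mem_univ, true_and, and_iff_right_iff_imp]
    rintro rfl
    exact hu
  have hU := hB Finset.univ
  simp only [Finset.mem_univ, Finset.filter_true, Finset.card_univ] at hU
  rw [hB, hU]
  ring

/-- The centers are independent within every set of at most `t` vertices: the probability that a set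
`A` of that size contains no center is `(1 - θ / q) ^ A.card`. -/
theorem freq_disjoint_centers {n θ t q : ℕ} (hq : q.Prime) (hn : n < q) (hθ : θ ≤ q) (A : Set (Fin n))
    (hA : A.ncard ≤ t) :
    freq {ρ : Fin t → Fin q | A ∩ centers n θ ρ = ∅} = (1 - (θ : ℝ) / q) ^ A.ncard := by
  classical
  have : Fact q.Prime := ⟨hq⟩
  have : NeZero q := ⟨hq.ne_zero⟩
  obtain ⟨A, rfl⟩ : ∃ A' : Finset (Fin n), A = ↑A' := ⟨A.toFinite.toFinset, by simp⟩
  rw [Set.ncard_coe_finset] at hA ⊢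
  -- evaluation of the polynomial given by the seed at the points of `A`
  let φ : (Fin t → ZMod q) →+ (A → ZMod q) :=
    { toFun := fun c v => ∑ j, c j * ((v : Fin n) + 1 : ℕ) ^ (j : ℕ)
      map_zero' := by ext; simp
      map_add' := fun c c' => by ext; simp [add_mul, Finset.sum_add_distrib] }
  have hφ : Function.Surjective φ := by
    intro y
    have hx : Set.InjOn (fun v : Fin n => (((v : ℕ) + 1 : ℕ) : ZMod q)) A := by
      intro v _ v' _ h
      have h' := (ZMod.natCast_eq_natCast_iff' _ _ _).1 h
      rw [Nat.mod_eq_of_lt (by omega), Nat.mod_eq_of_lt (by omega)] at h'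
      exact Fin.ext (by omega)
    obtain ⟨c, hc⟩ := exists_coefficients A hx hA fun v => if h : v ∈ A then y ⟨v, h⟩ else 0
    refine ⟨c, funext fun v => ?_⟩
    simpa [φ] using hc v v.2
  let e : (Fin t → Fin q) ≃ (Fin t → ZMod q) := (Equiv.refl _).arrowCongr (ZMod.finEquiv q).toEquiv
  have he : ∀ (ρ : Fin t → Fin q) j, e ρ j = ((ρ j : ℕ) : ZMod q) := by
    intro ρ j
    have : ∀ x : Fin q, ZMod.finEquiv q x = ((x : ℕ) : ZMod q) := by
      intro x
      rw [← ZMod.natCast_zmod_val (ZMod.finEquiv q x)]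
      obtain ⟨q, rfl⟩ : ∃ m, q = m + 1 := ⟨q - 1, by have := hq.pos; omega⟩
      rfl
    exact this _
  let B : Finset (A → ZMod q) := Fintype.piFinset fun _ => Finset.univ.filter fun z => θ ≤ z.val
  have hB : B.card = (q - θ) ^ A.card := by
    have h1 : (Finset.univ.filter fun z : ZMod q => θ ≤ z.val).card = q - θ := by
      rw [← Nat.card_Ico θ q]
      refine Finset.card_bij' (fun z _ => z.val) (fun m _ => (m : ZMod q)) ?_ ?_ ?_ ?_
      · intro z hz
        exact Finset.mem_Ico.2 ⟨(Finset.mem_filter.1 hz).2, ZMod.val_lt z⟩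
      · intro m hm
        rw [Finset.mem_Ico] at hm
        simpa [ZMod.val_cast_of_lt hm.2] using hm.1
      · intro z _
        exact ZMod.natCast_zmod_val z
      · intro m hm
        exact ZMod.val_cast_of_lt (Finset.mem_Ico.1 hm).2
    simp only [B, Fintype.card_piFinset, h1, Finset.prod_const, Finset.card_univ, Fintype.card_coe]
  have hset : {ρ : Fin t → Fin q | (A : Set (Fin n)) ∩ centers n θ ρ = ∅}.ncard =
      (Finset.univ.filter fun c => φ c ∈ B).card := by
    rw [← Set.ncard_image_of_injective _ e.injective, ← Set.ncard_coe_finset]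
    congr 1
    ext c
    obtain ⟨ρ, rfl⟩ := e.surjective c
    have hval : ∀ v : A, (φ (e ρ) v).val = hashValue ρ ((v : Fin n) + 1) := by
      intro v
      have : φ (e ρ) v = ((∑ j, (ρ j : ℕ) * ((v : Fin n) + 1 : ℕ) ^ (j : ℕ) : ℕ) : ZMod q) := by
        rw [Nat.cast_sum]
        change ∑ j, e ρ j * (((v : Fin n) + 1 : ℕ) : ZMod q) ^ (j : ℕ) = _
        refine Finset.sum_congr rfl fun j _ => ?_
        rw [he, Nat.cast_mul, Nat.cast_pow]
      rw [this, ZMod.val_natCast]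
      rfl
    simp only [e.injective.mem_set_image, Set.mem_ofPred_eq, Finset.coe_filter, Finset.mem_univ,
      true_and, B, Fintype.mem_piFinset, Finset.mem_filter, hval, Set.eq_empty_iff_forall_notMem,
      Set.mem_inter_iff, not_and, Finset.mem_coe, centers, not_lt, Subtype.forall]
  have hcard := card_preimage_mul_card φ hφ B
  rw [hB, ← hset] at hcard
  simp only [Fintype.card_fun, ZMod.card, Fintype.card_coe, Fintype.card_fin] at hcard
  have hq1 := hq.pos
  have hq0 : (0 : ℝ) < q := by exact_mod_cast hq1
  have hcast : ((q - θ : ℕ) : ℝ) = q - θ := by push_cast [hθ]; rfl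
  rw [freq, Nat.card_eq_fintype_card, Fintype.card_fun, Fintype.card_fin, Fintype.card_fin,
    ← div_self hq0.ne', ← sub_div, div_pow, ← hcast, div_eq_div_iff (by positivity) (by positivity)]
  exact_mod_cast hcard


/-! ### Overlapping balls -/

section Overlap

theorem ncard_exists_mem_le {α β : Type*} [Finite α] [Finite β] (A : Set α) (R : α → β → Prop) {b : ℕ}
    (h : ∀ x ∈ A, {y | R x y}.ncard ≤ b) : {y | ∃ x ∈ A, R x y}.ncard ≤ A.ncard * b := by
  have hfin := A.toFinite
  have e : {y | ∃ x ∈ A, R x y} = ⋃ x ∈ hfin.toFinset, {y | R x y} := by ext; simp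
  rw [e, Set.ncard_eq_toFinset_card A]
  refine (Finset.set_ncard_biUnion_le _ _).trans ?_
  rw [← smul_eq_mul]
  exact Finset.sum_le_card_nsmul _ _ _ fun x hx => h x (by simpa using hx)

variable {n d k : ℕ} {G : SimpleGraph (Fin n)}

theorem ncard_bfsBall_le (hG : G.Connected) (hd : ∀ v, (G.neighborSet v).ncard ≤ d) (hd1 : 1 ≤ d)
    (hk : 1 ≤ k) (v : Fin n) : (bfsBall G k v).ncard ≤ k * d := by
  rcases Nat.eq_zero_or_pos (bfsDepth G k v) with h0 | h0
  · have : bfsBall G k v ⊆ {v} := by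
      intro x hx
      have hx : G.dist v x ≤ bfsDepth G k v := hx
      exact (hG.dist_eq_zero_iff.1 (by omega)).symm
    refine (Set.ncard_le_ncard this).trans ?_
    rw [Set.ncard_singleton]
    exact Nat.mul_pos hk hd1
  · have h1 : bfsBall G k v ⊆ insert v {y | ∃ x ∈ ball G v (bfsDepth G k v - 1), G.Adj x y} := by
      intro x hx
      have hx : G.dist v x ≤ bfsDepth G k v := hx
      rcases eq_or_ne x v with rfl | hxv
      · exact Set.mem_insert _ _
      · obtain ⟨y, hy, hyd⟩ := exists_adj_dist_add_one hG hxv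
        exact .inr ⟨y, show G.dist v y ≤ _ by omega, hy⟩
    have h2 := (of_lt_bfsDepth (G := G) (k := k) (v := v) (l := bfsDepth G k v - 1) (by omega)).1
    have h3 := ncard_exists_mem_le (ball G v (bfsDepth G k v - 1)) G.Adj fun x _ => hd x
    have h4 := (Set.ncard_le_ncard h1).trans (Set.ncard_insert_le _ _)
    have h5 : ((ball G v (bfsDepth G k v - 1)).ncard + 1) * d ≤ k * d := Nat.mul_le_mul_right d h2
    rw [add_mul] at h5
    omega

/-- The vertices at distance exactly `r` from `y` whose balls of radius `r` are small. -/
def sparseSphere (G : SimpleGraph (Fin n)) (k : ℕ) (y : Fin n) (r : ℕ) : Set (Fin n) :=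
  {u | G.dist u y = r ∧ (ball G u r).ncard < k}

/-- On a geodesic from a vertex of the sphere of radius `r` to the center, the midpoint lies in the sphere of
radius `r / 2`, and by smallness of its ball it is the midpoint for fewer than `k` vertices. So halving
the radius costs a factor `k`. -/
theorem ncard_sparseSphere_le (hG : G.Connected) (hd : ∀ v, (G.neighborSet v).ncard ≤ d) (hd1 : 1 ≤ d)
    (y : Fin n) : ∀ m r, r ≤ 2 ^ m → (sparseSphere G k y r).ncard ≤ d * k ^ m
  | 0, r, hr => by
    rw [pow_zero, mul_one]
    rw [pow_zero] at hr
    rcases Nat.le_one_iff_eq_zero_or_eq_one.1 hr with rfl | rfl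
    · have : sparseSphere G k y 0 ⊆ {y} := fun u hu => hG.dist_eq_zero_iff.1 hu.1
      refine (Set.ncard_le_ncard this).trans ?_
      rwa [Set.ncard_singleton]
    · refine (Set.ncard_le_ncard ?_).trans (hd y)
      exact fun u hu => (SimpleGraph.dist_eq_one_iff_adj.1 hu.1).symm
  | m + 1, r, hr => by
    have ih := ncard_sparseSphere_le hG hd hd1 y m ((r + 1) / 2) (by rw [pow_succ] at hr; omega)
    have hsub : sparseSphere G k y r ⊆
        {u | ∃ z ∈ sparseSphere G k y ((r + 1) / 2), u ∈ ball G z ((r + 1) / 2)} := by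
      rintro u ⟨hu, hs⟩
      obtain ⟨z, hz, hzy⟩ := exists_on_geodesic hG (v := u) (x := y) (i := r / 2) (by omega)
      refine ⟨z, ⟨by omega, (Set.ncard_le_ncard ?_).trans_lt hs⟩, ?_⟩
      · intro x hx
        have hx : G.dist z x ≤ (r + 1) / 2 := hx
        have := hG.dist_triangle (u := u) (v := z) (w := x)
        exact show G.dist u x ≤ r by omega
      · exact show G.dist z u ≤ _ by rw [SimpleGraph.dist_comm]; omega
    refine (Set.ncard_le_ncard hsub).trans
      ((ncard_exists_mem_le _ _ (b := k) fun z hz => hz.2.le).trans ?_)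
    rw [pow_succ, ← mul_assoc]
    exact Nat.mul_le_mul_right k ih

/-- If `y` is in `B_k(u)`, some neighbour of `y` (or `y` itself) is at a distance from `u` at which the ball of
`u` is still small. -/
theorem ncard_mem_bfsBall_le (hG : G.Connected) (hd : ∀ v, (G.neighborSet v).ncard ≤ d) (hd1 : 1 ≤ d)
    (hk : 1 ≤ k) (y : Fin n) :
    {u | y ∈ bfsBall G k u}.ncard ≤ 2 * d ^ 2 * k ^ (Nat.clog 2 k + 1) := by
  have hsub : {u | y ∈ bfsBall G k u} ⊆ insert y {u | ∃ y' ∈ G.neighborSet y,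
      u ∈ {u | ∃ r ∈ (Set.univ : Set (Fin k)), u ∈ sparseSphere G k y' r}} := by
    intro u hu
    have hu : G.dist u y ≤ bfsDepth G k u := hu
    rcases eq_or_ne y u with rfl | hne
    · exact Set.mem_insert _ _
    · obtain ⟨y', h1, h2⟩ := exists_adj_dist_add_one hG hne
      have h3 := bfsDepth_lt hG hk u
      exact .inr ⟨y', h1.symm, ⟨G.dist u y', by omega⟩, trivial, rfl,
        (of_lt_bfsDepth (l := G.dist u y') (by omega)).1⟩
  have h1 : ∀ y', {u | ∃ r ∈ (Set.univ : Set (Fin k)), u ∈ sparseSphere G k y' r}.ncard ≤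
      k * (d * k ^ Nat.clog 2 k) := by
    intro y'
    refine (ncard_exists_mem_le _ _ (b := d * k ^ Nat.clog 2 k) fun r _ => ?_).trans ?_
    · exact ncard_sparseSphere_le hG hd hd1 y' _ _ (r.2.le.trans (Nat.le_pow_clog Nat.one_lt_two k))
    · rw [Set.ncard_univ, Nat.card_fin]
  have h2 := (Set.ncard_le_ncard hsub).trans (Set.ncard_insert_le _ _)
  have h3 := ncard_exists_mem_le (G.neighborSet y)
    (fun y' u => u ∈ {u | ∃ r ∈ (Set.univ : Set (Fin k)), u ∈ sparseSphere G k y' r})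
    fun y' _ => h1 y'
  have h4 : (G.neighborSet y).ncard * (k * (d * k ^ Nat.clog 2 k)) ≤
      d ^ 2 * k ^ (Nat.clog 2 k + 1) := by
    calc _ ≤ d * (k * (d * k ^ Nat.clog 2 k)) := Nat.mul_le_mul_right _ (hd y)
      _ = _ := by ring
  have h5 : 1 ≤ d ^ 2 * k ^ (Nat.clog 2 k + 1) :=
    Nat.mul_pos (pow_pos hd1 _) (pow_pos hk _)
  rw [mul_assoc]
  exact h2.trans (by omega)

/-- Each of the balls `B_k(v)` meets few others; the bound is quasi-polynomial in `k`. -/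
theorem ncard_overlap_le (hG : G.Connected) (hd : ∀ v, (G.neighborSet v).ncard ≤ d) (hd1 : 1 ≤ d)
    (hk : 1 ≤ k) (v : Fin n) :
    {u | ¬ Disjoint (bfsBall G k v) (bfsBall G k u)}.ncard ≤ 2 * d ^ 3 * k ^ (Nat.clog 2 k + 2) := by
  have hsub : {u | ¬ Disjoint (bfsBall G k v) (bfsBall G k u)} ⊆
      {u | ∃ y ∈ bfsBall G k v, y ∈ bfsBall G k u} := fun u hu => Set.not_disjoint_iff.1 hu
  refine (Set.ncard_le_ncard hsub).trans ((ncard_exists_mem_le _ _ fun y _ =>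
    ncard_mem_bfsBall_le hG hd hd1 hk y).trans ?_)
  calc _ ≤ k * d * (2 * d ^ 2 * k ^ (Nat.clog 2 k + 1)) :=
        Nat.mul_le_mul_right _ (ncard_bfsBall_le hG hd hd1 hk v)
    _ = _ := by ring

end Overlap

/-! ### The number of centers and the number of remote vertices -/

section Concentration

variable {n d k q θ : ℕ} {G : SimpleGraph (Fin n)} {γ : ℝ}

/-- The number of centers is concentrated, by pairwise independence. -/
theorem freq_many_centers_le {t : ℕ} (ht : 2 ≤ t) (hq : q.Prime) (hn : n < q) (hn1 : 1 ≤ n)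
    (hθ : θ ≤ q) (hγ : 0 < γ) (hle : (θ : ℝ) ≤ γ * q + 1) :
    freq {ρ : Fin t → Fin q | 2 * (γ * n + 1) ≤ ((centers n θ ρ).ncard : ℝ)} ≤ 1 / (γ * n) := by
  have : NeZero q := ⟨hq.ne_zero⟩
  have hq0 : (0 : ℝ) < q := by exact_mod_cast hq.pos
  have hn0 : (0 : ℝ) < n := by exact_mod_cast hn1
  have hY : ∀ v, {ρ : Fin t → Fin q | v ∈ centers n θ ρ} =
      {ρ : Fin t → Fin q | {v} ∩ centers n θ ρ = ∅}ᶜ := by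
    intro v
    ext ρ
    simp [Set.singleton_inter_eq_empty]
  have h1 : ∀ v, freq {ρ : Fin t → Fin q | {v} ∩ centers n θ ρ = ∅} = 1 - (θ : ℝ) / q := by
    intro v
    rw [freq_disjoint_centers hq hn hθ _ (by rw [Set.ncard_singleton]; omega), Set.ncard_singleton,
      pow_one]
  have h2 : ∀ v, freq {ρ : Fin t → Fin q | v ∈ centers n θ ρ} = (θ : ℝ) / q := by
    intro v
    rw [hY, freq_compl, h1, sub_sub_cancel]
  have hsum : ∑ v : Fin n, freq {ρ : Fin t → Fin q | v ∈ centers n θ ρ} ≤ γ * n + 1 := by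
    simp only [h2, Finset.sum_const, Finset.card_univ, Fintype.card_fin, nsmul_eq_mul]
    rw [← mul_div_assoc, div_le_iff₀ hq0]
    have hnq : (n : ℝ) ≤ q := by exact_mod_cast hn.le
    nlinarith
  have hT : 0 < γ * n + 1 := by positivity
  have key := freq_two_mul_le_ncard (fun v => {ρ : Fin t → Fin q | v ∈ centers n θ ρ}) Eq 1
    (fun u v huv => ?_) (fun v => ?_) hT hsum
  · refine key.trans ?_
    have : ((1 : ℕ) : ℝ) * (∑ v : Fin n, freq {ρ : Fin t → Fin q | v ∈ centers n θ ρ}) /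
        (γ * n + 1) ^ 2 ≤ (γ * n + 1) / (γ * n + 1) ^ 2 := by
      rw [Nat.cast_one, one_mul]
      gcongr
    refine this.trans ?_
    rw [sq, div_mul_cancel_left₀ hT.ne', ← one_div]
    gcongr
    linarith
  · simp only [hY]
    refine freq_compl_inter_compl ?_
    have h3 : {ρ : Fin t → Fin q | {u} ∩ centers n θ ρ = ∅} ∩ {ρ | {v} ∩ centers n θ ρ = ∅} =
        {ρ | {u, v} ∩ centers n θ ρ = ∅} := by
      ext ρ
      simp only [Set.mem_inter_iff, Set.mem_ofPred_eq, ← Set.singleton_union, Set.union_inter_distrib_right,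
        Set.union_empty_iff]
    rw [h3, h1, h1, freq_disjoint_centers hq hn hθ _ (by rw [Set.ncard_pair huv]; omega),
      Set.ncard_pair huv, sq]
  · have : {u | v = u} = {v} := by ext; simp [eq_comm]
    rw [this, Set.ncard_singleton]

/-- The number of remote vertices is concentrated, since the events that `u` and that `v` are remote are
uncorrelated if `B_k(u)` and `B_k(v)` are disjoint. -/
theorem freq_many_remote_le (hG : G.Connected) (hd : ∀ v, (G.neighborSet v).ncard ≤ d) (hd1 : 1 ≤ d)
    (hk : 1 ≤ k) (hq : q.Prime) (hn : n < q) (hθ : θ ≤ q) (hγ : 0 < γ) (hle : γ * q ≤ θ)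
    (hkγ : 2 * (d : ℝ) ^ 3 * k ^ (Nat.clog 2 k + 2) * Real.exp (-(γ * k)) ≤ γ) :
    freq {ρ : Fin (2 * k * d) → Fin q | 2 * (γ * n) ≤ ((remote G (centers n θ ρ) k).ncard : ℝ)} ≤
      1 / (γ * n) := by
  have : NeZero q := ⟨hq.ne_zero⟩
  have hq0 : (0 : ℝ) < q := by exact_mod_cast hq.pos
  obtain ⟨v₀⟩ := hG.nonempty
  have hn0 : (0 : ℝ) < n := by exact_mod_cast v₀.pos
  have hγn : 0 < γ * n := by positivity
  have hp : γ ≤ (θ : ℝ) / q := by rwa [le_div_iff₀ hq0]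
  have hp1 : (θ : ℝ) / q ≤ 1 := by
    rw [div_le_one hq0]
    exact_mod_cast hθ
  have hexp : ∀ m : ℕ, (1 - (θ : ℝ) / q) ^ m ≤ Real.exp (-(γ * m)) := by
    intro m
    calc (1 - (θ : ℝ) / q) ^ m ≤ Real.exp (-γ) ^ m := by
          refine pow_le_pow_left₀ (by linarith) ?_ m
          have := Real.add_one_le_exp (-γ)
          linarith
      _ = _ := by rw [← Real.exp_nat_mul]; ring_nf
  have hcard := fun v => ncard_bfsBall_le hG hd hd1 hk v
  have hkd : k * d ≤ 2 * k * d := by rw [mul_assoc]; omega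
  have h1 : ∀ v, freq {ρ : Fin (2 * k * d) → Fin q | bfsBall G k v ∩ centers n θ ρ = ∅} =
      (1 - (θ : ℝ) / q) ^ (bfsBall G k v).ncard := fun v =>
    freq_disjoint_centers hq hn hθ _ ((hcard v).trans hkd)
  rcases lt_or_ge n k with hnk | hnk
  · -- here all the balls consist of all the vertices
    have hB : ∀ v, bfsBall G k v = Set.univ := by
      intro v
      refine (bfsDepth_spec G k v).resolve_left fun h => ?_
      have := h.trans (Set.ncard_le_ncard (Set.subset_univ _))
      rw [Set.ncard_univ, Nat.card_fin] at this
      omega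
    refine (freq_mono (T := {ρ | bfsBall G k v₀ ∩ centers n θ ρ = ∅}) ?_).trans ?_
    · intro ρ hρ
      have hρ : 2 * (γ * n) ≤ ((remote G (centers n θ ρ) k).ncard : ℝ) := hρ
      have hpos : 0 < (remote G (centers n θ ρ) k).ncard := by
        have : (0 : ℝ) < (remote G (centers n θ ρ) k).ncard := by linarith
        exact_mod_cast this
      obtain ⟨v, hv⟩ := Set.nonempty_of_ncard_ne_zero hpos.ne'
      have hv : bfsBall G k v ∩ centers n θ ρ = ∅ := hv
      rw [hB] at hv
      rwa [Set.mem_ofPred_eq, hB]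
    · rw [h1, hB, Set.ncard_univ, Nat.card_fin]
      refine (hexp n).trans ?_
      rw [Real.exp_neg, one_div]
      gcongr
      have := Real.add_one_le_exp (γ * n)
      linarith
  · have hge : ∀ v, k ≤ (bfsBall G k v).ncard := by
      intro v
      rcases bfsDepth_spec G k v with h | h
      · exact h
      · rwa [h, Set.ncard_univ, Nat.card_fin]
    have h2 : ∀ v, freq {ρ : Fin (2 * k * d) → Fin q | bfsBall G k v ∩ centers n θ ρ = ∅} ≤
        Real.exp (-(γ * k)) := by
      intro v
      rw [h1]
      exact (pow_le_pow_of_le_one (by linarith) (by linarith [hγ]) (hge v)).trans (hexp k)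
    have hsum : ∑ v, freq {ρ : Fin (2 * k * d) → Fin q | bfsBall G k v ∩ centers n θ ρ = ∅} ≤
        n * Real.exp (-(γ * k)) := by
      refine (Finset.sum_le_card_nsmul _ _ _ fun v _ => h2 v).trans ?_
      rw [Finset.card_univ, Fintype.card_fin, nsmul_eq_mul]
    have hη : Real.exp (-(γ * k)) ≤ γ := by
      refine le_trans ?_ hkγ
      have h3 : (1 : ℝ) ≤ (d : ℝ) ^ 3 * k ^ (Nat.clog 2 k + 2) := by
        exact_mod_cast Nat.mul_pos (pow_pos hd1 3) (pow_pos hk _)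
      have := Real.exp_pos (-(γ * k))
      nlinarith
    have key := freq_two_mul_le_ncard
      (fun v => {ρ : Fin (2 * k * d) → Fin q | bfsBall G k v ∩ centers n θ ρ = ∅})
      (fun u v => ¬ Disjoint (bfsBall G k u) (bfsBall G k v)) (2 * d ^ 3 * k ^ (Nat.clog 2 k + 2))
      (fun u v huv => ?_) (fun v => ncard_overlap_le hG hd hd1 hk v) hγn
      (hsum.trans (by rw [mul_comm]; gcongr))
    · refine key.trans ?_
      rw [div_le_div_iff₀ (by positivity) hγn]
      push_cast
      calc _ ≤ 2 * (d : ℝ) ^ 3 * k ^ (Nat.clog 2 k + 2) * (n * Real.exp (-(γ * k))) * (γ * n) := by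
            gcongr
        _ = (2 * (d : ℝ) ^ 3 * k ^ (Nat.clog 2 k + 2) * Real.exp (-(γ * k))) * (γ * n ^ 2) := by ring
        _ ≤ γ * (γ * n ^ 2) := by gcongr
        _ = _ := by ring
    · have huv := not_not.1 huv
      have h3 : {ρ : Fin (2 * k * d) → Fin q | bfsBall G k u ∩ centers n θ ρ = ∅} ∩
          {ρ | bfsBall G k v ∩ centers n θ ρ = ∅} =
          {ρ | (bfsBall G k u ∪ bfsBall G k v) ∩ centers n θ ρ = ∅} := by
        ext ρ
        simp only [Set.mem_inter_iff, Set.mem_ofPred_eq, Set.union_inter_distrib_right,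
          Set.union_empty_iff]
      have h4 := Set.ncard_union_eq huv
      have h5 := hcard u
      have h6 := hcard v
      rw [h3, h1, h1, freq_disjoint_centers hq hn hθ _ (by rw [h4, mul_assoc]; omega), h4, pow_add]

end Concentration


/-! ### The parameters -/

section Parameters

/-- The bias `γ` of the centers. -/
noncomputable def biasParam (ε : ℝ) (h : ℕ) : ℝ := ε / (16 * density h)

/-- The number of vertices `s` of a part. -/
noncomputable def sizeParam (ε : ℝ) (h : ℕ) : ℕ := ⌈4 * (density h : ℝ) / ε⌉₊

/-- The number of vertices `k` explored in search of a center. The square of the logarithm makes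
`exp (-γ k)` smaller than the quasi-polynomial number of balls that a ball may meet. -/
noncomputable def ballParam (ε : ℝ) (h d : ℕ) : ℕ :=
  ⌈4096 * Real.log (h * d / ε + 2) ^ 2 / biasParam ε h⌉₊

variable {ε : ℝ} {h : ℕ}

theorem one_le_density (hh : 1 ≤ h) : 1 ≤ density h := by
  unfold density
  have : 1 ≤ 1024 * h := by omega
  exact Nat.mul_pos this (Nat.succ_pos _)

theorem one_le_ratio (h0 : 0 < ε) (h1 : ε ≤ 1) (hh : 1 ≤ h) : 1 ≤ (h : ℝ) / ε := by
  rw [le_div_iff₀ h0, one_mul]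
  exact h1.trans (by exact_mod_cast hh)

theorem one_le_log {x : ℝ} (hx : 1 ≤ x) : 1 ≤ Real.log (x + 2) := by
  rw [Real.le_log_iff_exp_le (by linarith)]
  have := Real.exp_one_lt_d9
  linarith

theorem density_le (h0 : 0 < ε) (h1 : ε ≤ 1) (hh : 1 ≤ h) :
    (density h : ℝ) ≤ 3072 * h * Real.log (h / ε + 2) := by
  have hx := one_le_ratio h0 h1 hh
  have hl := one_le_log hx
  have hh' : (1 : ℝ) ≤ h := by exact_mod_cast hh
  have hlog : (Nat.log 2 h : ℝ) ≤ 2 * Real.log (h / ε + 2) := by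
    have h2 : ((2 : ℝ) ^ Nat.log 2 h) ≤ h := by exact_mod_cast Nat.pow_log_le_self 2 (by omega)
    have h3 := Real.log_le_log (by positivity) h2
    rw [Real.log_pow] at h3
    have h4 : Real.log h ≤ Real.log (h / ε + 2) := by
      refine Real.log_le_log (by linarith) ?_
      have : (h : ℝ) ≤ h / ε := by
        rw [le_div_iff₀ h0]
        nlinarith
      linarith
    have h5 := Real.log_two_gt_d9
    have h6 : (0 : ℝ) ≤ Nat.log 2 h := by positivity
    nlinarith
  unfold density
  push_cast
  nlinarith

theorem biasParam_pos (h0 : 0 < ε) (hh : 1 ≤ h) : 0 < biasParam ε h := by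
  have : (1 : ℝ) ≤ density h := by exact_mod_cast one_le_density hh
  unfold biasParam
  positivity

theorem biasParam_lt_one (h1 : ε ≤ 1) (hh : 1 ≤ h) : biasParam ε h < 1 := by
  have : (1 : ℝ) ≤ density h := by exact_mod_cast one_le_density hh
  unfold biasParam
  rw [div_lt_one (by positivity)]
  linarith

theorem inv_biasParam_le (h0 : 0 < ε) (h1 : ε ≤ 1) (hh : 1 ≤ h) :
    1 / biasParam ε h ≤ 49152 * (h / ε) * Real.log (h / ε + 2) := by
  have h2 := density_le h0 h1 hh
  unfold biasParam
  rw [one_div_div, div_le_iff₀ h0]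
  have e : 49152 * ((h : ℝ) / ε) * Real.log (h / ε + 2) * ε =
      16 * (3072 * h * Real.log (h / ε + 2)) := by
    field_simp
    ring
  rw [e]
  linarith

theorem two_le_sizeParam (h0 : 0 < ε) (h1 : ε ≤ 1) (hh : 1 ≤ h) : 2 ≤ sizeParam ε h := by
  have h2 : (1 : ℝ) ≤ density h := by exact_mod_cast one_le_density hh
  refine Nat.lt_ceil.2 ?_
  rw [lt_div_iff₀ h0]
  push_cast
  linarith

theorem sizeParam_le (h0 : 0 < ε) (h1 : ε ≤ 1) (hh : 1 ≤ h) :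
    (sizeParam ε h : ℝ) ≤ 2 ^ 14 * (h / ε) * Real.log (h / ε + 2) := by
  have h2 := density_le h0 h1 hh
  have hx := one_le_ratio h0 h1 hh
  have hl := one_le_log hx
  have h3 : (1 : ℝ) ≤ density h := by exact_mod_cast one_le_density hh
  have h4 : (sizeParam ε h : ℝ) < 4 * (density h : ℝ) / ε + 1 := Nat.ceil_lt_add_one (by positivity)
  have h5 : 4 * (density h : ℝ) / ε ≤ 4 * (3072 * (h / ε) * Real.log (h / ε + 2)) := by
    rw [div_le_iff₀ h0]
    have e : 4 * (3072 * ((h : ℝ) / ε) * Real.log (h / ε + 2)) * ε =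
        4 * (3072 * h * Real.log (h / ε + 2)) := by
      field_simp
    rw [e]
    linarith
  nlinarith

variable {d : ℕ}

theorem log_le_log_mul (h0 : 0 < ε) (hd : 1 ≤ d) :
    Real.log (h / ε + 2) ≤ Real.log (h * d / ε + 2) := by
  have hd' : (1 : ℝ) ≤ d := by exact_mod_cast hd
  refine Real.log_le_log (by positivity) ?_
  gcongr
  exact le_mul_of_one_le_right (by positivity) hd'

theorem two_le_ballParam (h0 : 0 < ε) (h1 : ε ≤ 1) (hh : 1 ≤ h) (d : ℕ) : 2 ≤ ballParam ε h d := by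
  have h2 := biasParam_pos h0 hh
  refine Nat.lt_ceil.2 ?_
  rw [lt_div_iff₀ h2]
  have h3 : Real.log 2 ≤ Real.log (h * d / ε + 2) := by
    refine Real.log_le_log (by norm_num) ?_
    have : 0 ≤ (h : ℝ) * d / ε := by positivity
    linarith
  have h4 := Real.log_two_gt_d9
  have h5 := biasParam_lt_one h1 hh
  push_cast
  nlinarith

theorem ballParam_le (h0 : 0 < ε) (h1 : ε ≤ 1) (hh : 1 ≤ h) (hd : 1 ≤ d) :
    (ballParam ε h d : ℝ) ≤ 2 ^ 28 * (h / ε) * Real.log (h * d / ε + 2) ^ 3 := by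
  have h2 := biasParam_pos h0 hh
  have h3 := inv_biasParam_le h0 h1 hh
  have hx := one_le_ratio h0 h1 hh
  have hl := one_le_log hx
  have hll := log_le_log_mul (h := h) h0 hd
  have h4 : (ballParam ε h d : ℝ) < 4096 * Real.log (h * d / ε + 2) ^ 2 / biasParam ε h + 1 :=
    Nat.ceil_lt_add_one (by positivity)
  generalize Real.log (h * d / ε + 2) = l at *
  generalize Real.log (h / ε + 2) = l' at *
  generalize (h : ℝ) / ε = x at *
  rw [div_eq_mul_one_div] at h4
  have h5 : 4096 * l ^ 2 * (1 / biasParam ε h) ≤ 4096 * l ^ 2 * (49152 * x * l) := by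
    gcongr
    exact h3.trans (by gcongr)
  have h6 : 1 ≤ x * l ^ 3 := by
    have : 1 ≤ l ^ 3 := one_le_pow₀ (by linarith)
    nlinarith
  nlinarith

theorem le_biasParam_mul_ballParam (h0 : 0 < ε) (hh : 1 ≤ h) :
    4096 * Real.log (h * d / ε + 2) ^ 2 ≤ biasParam ε h * ballParam ε h d := by
  have h2 := biasParam_pos h0 hh
  rw [mul_comm (biasParam ε h), ← div_le_iff₀ h2]
  exact Nat.le_ceil _

theorem two_pow_le_exp : (2 : ℝ) ^ 28 ≤ Real.exp 20 := by
  have h1 := Real.exp_one_gt_d9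
  have h2 : Real.exp 20 = Real.exp 1 ^ 20 := by rw [← Real.exp_nat_mul]; norm_num
  rw [h2]
  calc (2 : ℝ) ^ 28 ≤ 2.7 ^ 20 := by norm_num
    _ ≤ _ := by gcongr; linarith

theorem ballParam_le_exp (h0 : 0 < ε) (h1 : ε ≤ 1) (hh : 1 ≤ h) (hd : 1 ≤ d) :
    (ballParam ε h d : ℝ) ≤ Real.exp (24 * Real.log (h * d / ε + 2)) := by
  have hx := one_le_ratio h0 h1 hh
  have hl := one_le_log hx
  have hll := log_le_log_mul (h := h) h0 hd
  have hd' : (1 : ℝ) ≤ d := by exact_mod_cast hd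
  have h2 := ballParam_le h0 h1 hh hd
  have h3 : (h : ℝ) / ε ≤ Real.exp (Real.log (h * d / ε + 2)) := by
    rw [Real.exp_log (by positivity), mul_div_right_comm]
    nlinarith
  generalize Real.log (h * d / ε + 2) = l at *
  have h4 : l ≤ Real.exp l := by have := Real.add_one_le_exp l; linarith
  have h5 := two_pow_le_exp.trans (Real.exp_le_exp.2 (show (20 : ℝ) ≤ 20 * l by linarith))
  have hl0 : 0 ≤ l := by linarith
  calc (ballParam ε h d : ℝ) ≤ 2 ^ 28 * (h / ε) * l ^ 3 := h2
    _ ≤ Real.exp (20 * l) * Real.exp l * Real.exp l ^ 3 := by gcongr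
    _ = _ := by rw [← Real.exp_nat_mul, ← Real.exp_add, ← Real.exp_add]; push_cast; ring_nf

/-- The choice of `k` outweighs the number of balls that a ball may meet. -/
theorem overlap_mul_exp_le (h0 : 0 < ε) (h1 : ε ≤ 1) (hh : 1 ≤ h) (hd : 1 ≤ d) :
    2 * (d : ℝ) ^ 3 * ballParam ε h d ^ (Nat.clog 2 (ballParam ε h d) + 2) *
      Real.exp (-(biasParam ε h * ballParam ε h d)) ≤ biasParam ε h := by
  have hx := one_le_ratio h0 h1 hh
  have hl' := one_le_log hx
  have hll := log_le_log_mul (h := h) h0 hd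
  have hd' : (1 : ℝ) ≤ d := by exact_mod_cast hd
  have hγ := biasParam_pos h0 hh
  have hinv := inv_biasParam_le h0 h1 hh
  have hk := two_le_ballParam h0 h1 hh d
  have hkle := ballParam_le_exp h0 h1 hh hd
  have hγk := le_biasParam_mul_ballParam (d := d) h0 hh
  have h3 : (h : ℝ) / ε ≤ Real.exp (Real.log (h * d / ε + 2)) ∧
      d ≤ Real.exp (Real.log (h * d / ε + 2)) := by
    rw [Real.exp_log (by positivity), mul_div_right_comm]
    constructor <;> nlinarith
  generalize Real.log (h * d / ε + 2) = l at *
  have hl1 : 1 ≤ l := hl'.trans hll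
  have hclog : ((Nat.clog 2 (ballParam ε h d) + 2 : ℕ) : ℝ) ≤ 38 * l := by
    have h4 : (2 : ℝ) ^ (Nat.clog 2 (ballParam ε h d)).pred ≤ Real.exp (24 * l) := by
      refine le_trans ?_ hkle
      exact_mod_cast (Nat.pow_pred_clog_lt_self Nat.one_lt_two (by omega)).le
    have h5 := Real.log_le_log (by positivity) h4
    rw [Real.log_pow, Real.log_exp] at h5
    have h6 := Real.log_two_gt_d9
    have h7 := Nat.clog_pos Nat.one_lt_two hk
    have h8 : ((Nat.clog 2 (ballParam ε h d)).pred : ℝ) = Nat.clog 2 (ballParam ε h d) - 1 := by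
      rw [Nat.pred_eq_sub_one, Nat.cast_sub h7, Nat.cast_one]
    rw [h8] at h5
    have h9 : (1 : ℝ) ≤ Nat.clog 2 (ballParam ε h d) := by exact_mod_cast h7
    push_cast
    nlinarith
  generalize Nat.clog 2 (ballParam ε h d) + 2 = m at *
  have hpow : (ballParam ε h d : ℝ) ^ m ≤ Real.exp (912 * l ^ 2) := by
    calc (ballParam ε h d : ℝ) ^ m ≤ Real.exp (24 * l) ^ m := by gcongr
      _ = Real.exp (m * (24 * l)) := by rw [← Real.exp_nat_mul]
      _ ≤ _ := by rw [Real.exp_le_exp]; nlinarith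
  have h10 : l ≤ Real.exp l := by have := Real.add_one_le_exp l; linarith
  have h11 : (2 : ℝ) ^ 28 ≤ Real.exp (20 * l) :=
    two_pow_le_exp.trans (Real.exp_le_exp.2 (by linarith))
  have h12 : 1 / biasParam ε h * 2 ≤ Real.exp (22 * l) := by
    calc 1 / biasParam ε h * 2 ≤ (49152 * Real.exp l * Real.exp l) * 2 := by
          gcongr
          refine hinv.trans ?_
          gcongr
          · exact h3.1
          · exact hll.trans h10
      _ = 98304 * (Real.exp l * Real.exp l) := by ring
      _ ≤ Real.exp (20 * l) * (Real.exp l * Real.exp l) := by gcongr; linarith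
      _ = _ := by rw [← Real.exp_add, ← Real.exp_add]; ring_nf
  have h13 : 2 ≤ biasParam ε h * Real.exp (22 * l) := by
    rw [div_mul_eq_mul_div, one_mul, div_le_iff₀ hγ] at h12
    linarith
  calc _ ≤ 2 * Real.exp l ^ 3 * Real.exp (912 * l ^ 2) * Real.exp (-(4096 * l ^ 2)) := by
        gcongr
        exact h3.2
    _ ≤ biasParam ε h * Real.exp (22 * l) * Real.exp l ^ 3 * Real.exp (912 * l ^ 2) *
          Real.exp (-(4096 * l ^ 2)) := by gcongr
    _ = biasParam ε h * Real.exp (22 * l + 3 * l + 912 * l ^ 2 - 4096 * l ^ 2) := by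
        rw [← Real.exp_nat_mul, sub_eq_add_neg, Real.exp_add, Real.exp_add, Real.exp_add]
        push_cast
        ring
    _ ≤ biasParam ε h * 1 := by
        gcongr
        rw [Real.exp_le_one_iff]
        nlinarith
    _ = _ := mul_one _

end Parameters


/-! ### Guarantees of the algorithm -/

section Guarantees

theorem primeAbove_spec {n : ℕ} (hn : 1 ≤ n) :
    (primeAbove n).Prime ∧ n < primeAbove n ∧ primeAbove n ≤ 2 * n := by
  obtain ⟨p, hp, h1, h2⟩ := Nat.exists_prime_lt_and_le_two_mul n (by omega)
  have h3 : primeAbove n ∈ {p | p.Prime ∧ n < p} := Nat.sInf_mem ⟨p, hp, h1⟩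
  exact ⟨h3.1, h3.2, (Nat.sInf_le ⟨hp, h1⟩ : primeAbove n ≤ p).trans h2⟩

theorem threshold_le {γ : ℝ} (hγ : γ < 1) (q : ℕ) : ⌈γ * q⌉₊ ≤ q := by
  rw [Nat.ceil_le]
  have : (0 : ℝ) ≤ q := Nat.cast_nonneg q
  nlinarith

variable {ε : ℝ} {h n d : ℕ}

/-- Few centers and few remote vertices make few parts, and thus few edges. -/
theorem edges_lt (h0 : 0 < ε) (hh : 1 ≤ h) {G : SimpleGraph (Fin n)} (hG : G.Connected)
    (hs : 2 ≤ sizeParam ε h) (hH : ¬ HasClique h G Set.univ) {W : Set (Fin n)} {k : ℕ}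
    (hn : 8 * (density h : ℝ) ≤ ε * n)
    (hW : (W.ncard : ℝ) < 2 * (biasParam ε h * n + 1))
    (hR : ((remote G W k).ncard : ℝ) < 2 * (biasParam ε h * n)) :
    ((sparseSpanningGraph G W k (sizeParam ε h)).edgeSet.ncard : ℝ) < (1 + ε) * n := by
  have hD : (1 : ℝ) ≤ density h := by exact_mod_cast one_le_density hh
  have h1 : ((sparseSpanningGraph G W k (sizeParam ε h)).edgeSet.ncard : ℝ) ≤
      n + density h * (parts G W k (sizeParam ε h)).ncard := by
    exact_mod_cast ncard_edgeSet_le (W := W) (k := k) hG (by omega) hh hH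
  have h2 : ((parts G W k (sizeParam ε h)).ncard : ℝ) * sizeParam ε h ≤
      (remote G W k).ncard * sizeParam ε h + W.ncard * sizeParam ε h + n := by
    exact_mod_cast ncard_parts_mul_le (W := W) (k := k) (s := sizeParam ε h) hG
  have h3 : 4 * (density h : ℝ) / ε ≤ sizeParam ε h := Nat.le_ceil _
  rw [div_le_iff₀ h0] at h3
  have h4 : density h * (biasParam ε h * n) = ε * n / 16 := by
    unfold biasParam
    field_simp
  have hs0 : (0 : ℝ) < sizeParam ε h := by
    have : 0 < sizeParam ε h := by omega
    exact_mod_cast this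
  have hn0 : (0 : ℝ) ≤ n := Nat.cast_nonneg n
  -- a quarter of `ε * n` pays for the parts with `s` vertices
  have h5 : density h * ((parts G W k (sizeParam ε h)).ncard : ℝ) ≤
      density h * ((remote G W k).ncard + W.ncard) + ε * n / 4 := by
    refine le_of_mul_le_mul_right ?_ hs0
    nlinarith
  nlinarith

/-- With high probability the graph has few edges. For `n` below `8 * density h / ε` the bound is trivial. -/
theorem one_sub_le_freq (h0 : 0 < ε) (h1 : ε ≤ 1) (hh : 1 ≤ h) (hn : 1 ≤ n) (hd1 : 1 ≤ d)
    {G : SimpleGraph (Fin n)} (hG : G.Connected) (hd : ∀ v, (G.neighborSet v).ncard ≤ d)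
    (hH : ¬ HasClique h G Set.univ) :
    1 - 98304 * (h / ε) * Real.log (h / ε + 2) / n ≤
      freq {ρ : Fin (2 * ballParam ε h d * d) → Fin (primeAbove n) |
        ((sparseSpanningGraph G (centers n ⌈biasParam ε h * primeAbove n⌉₊ ρ) (ballParam ε h d)
          (sizeParam ε h)).edgeSet.ncard : ℝ) < (1 + ε) * n} := by
  have hD := density_le h0 h1 hh
  have hn0 : (0 : ℝ) < n := by exact_mod_cast hn
  have hγ := biasParam_pos h0 hh
  have hγ1 := biasParam_lt_one h1 hh
  obtain ⟨hq, hnq, -⟩ := primeAbove_spec hn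
  have : NeZero (primeAbove n) := ⟨hq.ne_zero⟩
  rcases lt_or_ge (ε * n) (8 * density h) with hsmall | hbig
  · refine le_trans ?_ (freq_nonneg _)
    rw [sub_nonpos, le_div_iff₀ hn0, one_mul, mul_div_assoc', div_mul_eq_mul_div, le_div_iff₀ h0]
    have hx := one_le_log (one_le_ratio h0 h1 hh)
    have : 0 ≤ (h : ℝ) * Real.log (h / ε + 2) := by positivity
    nlinarith
  · have hθ := threshold_le hγ1 (primeAbove n)
    have hk := two_le_ballParam h0 h1 hh d
    have hγq : 0 ≤ biasParam ε h * primeAbove n := by positivity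
    have hkd : 2 ≤ 2 * ballParam ε h d * d := by
      have := Nat.le_mul_of_pos_right (2 * ballParam ε h d) hd1
      omega
    have f1 := freq_many_centers_le (t := 2 * ballParam ε h d * d) hkd hq hnq hn hθ hγ
      (Nat.ceil_lt_add_one hγq).le
    have f2 := freq_many_remote_le hG hd hd1 (by omega : 1 ≤ ballParam ε h d) hq hnq hθ hγ
      (Nat.le_ceil _) (overlap_mul_exp_le h0 h1 hh hd1)
    generalize ⌈biasParam ε h * primeAbove n⌉₊ = θ at *
    obtain ⟨A, hA⟩ : ∃ A, A = {ρ : Fin (2 * ballParam ε h d * d) → Fin (primeAbove n) |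
      2 * (biasParam ε h * n + 1) ≤ ((centers n θ ρ).ncard : ℝ)} := ⟨_, rfl⟩
    obtain ⟨B, hB⟩ : ∃ B, B = {ρ : Fin (2 * ballParam ε h d * d) → Fin (primeAbove n) |
      2 * (biasParam ε h * n) ≤ ((remote G (centers n θ ρ) (ballParam ε h d)).ncard : ℝ)} := ⟨_, rfl⟩
    rw [← hA] at f1
    rw [← hB] at f2
    refine le_trans ?_ (freq_mono (S := (A ∪ B)ᶜ) ?_)
    · rw [freq_compl]
      have f3 := freq_union_le A B
      have h2 : 1 / (biasParam ε h * n) ≤ 49152 * (h / ε) * Real.log (h / ε + 2) / n := by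
        rw [← div_div]
        gcongr
        exact inv_biasParam_le h0 h1 hh
      have h3 : 98304 * ((h : ℝ) / ε) * Real.log (h / ε + 2) / n =
          2 * (49152 * (h / ε) * Real.log (h / ε + 2) / n) := by ring
      linarith
    · intro ρ hρ
      rw [Set.mem_compl_iff, Set.mem_union, not_or, hA, hB, Set.mem_ofPred_eq, Set.mem_ofPred_eq,
        not_le, not_le] at hρ
      exact edges_lt h0 hh hG (two_le_sizeParam h0 h1 hh) hH hbig hρ.1 hρ.2

/-- Words of logarithmic length hold all the numbers that the program handles. -/
theorem bound_lt_two_pow (h0 : 0 < ε) (h1 : ε ≤ 1) (hh : 1 ≤ h) (hn : 1 ≤ n) (hd : 1 ≤ d) {q θ w : ℕ}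
    (hq : q ≤ 2 * n) (hθ : θ ≤ q) (hw : 2 ^ 150 * Real.log ((n : ℝ) + d + h / ε + 2) ≤ w) :
    q * q + q + 2 * ballParam ε h d * d + 8 * (n + 2) + θ +
      ((sizeParam ε h * d + 1) * d + 1) + sizeParam ε h + ballParam ε h d * d + 10 < 2 ^ w := by
  have hx := one_le_ratio h0 h1 hh
  have hl := one_le_log hx
  have hll := log_le_log_mul (h := h) h0 hd
  have hk := ballParam_le h0 h1 hh hd
  have hs := sizeParam_le h0 h1 hh
  have hn' : (1 : ℝ) ≤ n := by exact_mod_cast hn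
  have hd' : (1 : ℝ) ≤ d := by exact_mod_cast hd
  have hq' : (q : ℝ) ≤ 2 * n := by exact_mod_cast hq
  have hθ' : (θ : ℝ) ≤ q := by exact_mod_cast hθ
  have e1 : Real.log (h / ε + 2) ≤ h / ε + 1 := by
    have := Real.log_le_sub_one_of_pos (show 0 < (h : ℝ) / ε + 2 by linarith)
    linarith
  have e2 : Real.log (h * d / ε + 2) ≤ h / ε * d + 1 := by
    rw [mul_div_right_comm]
    have := Real.log_le_sub_one_of_pos (show 0 < (h : ℝ) / ε * d + 2 by positivity)
    linarith
  generalize Real.log (h * d / ε + 2) = l at *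
  generalize Real.log (h / ε + 2) = l' at *
  generalize (h : ℝ) / ε = x at *
  generalize ballParam ε h d = k at *
  generalize sizeParam ε h = s at *
  obtain ⟨X, hX⟩ : ∃ X, X = (n : ℝ) + d + x + 2 := ⟨_, rfl⟩
  rw [← hX] at hw
  have h4 : 4 ≤ X := by linarith
  have hX1 : 1 ≤ X := by linarith
  have hl0 : 0 ≤ l := by linarith
  have hlX : l ≤ X ^ 2 := by nlinarith
  have up : ∀ {y : ℝ} {i j : ℕ}, y ≤ X ^ i → i ≤ j → y ≤ X ^ j := fun hy hij =>
    hy.trans (pow_le_pow_right₀ hX1 hij)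
  have two : ∀ i : ℕ, (2 : ℝ) ^ (2 * i) ≤ X ^ i := fun i => by
    rw [pow_mul]
    exact pow_le_pow_left₀ (by norm_num) (by linarith) i
  have hkX : (k : ℝ) ≤ X ^ 21 := by
    calc (k : ℝ) ≤ 2 ^ (2 * 14) * x * l ^ 3 := by norm_num at hk ⊢; exact hk
      _ ≤ X ^ 14 * X * (X ^ 2) ^ 3 := by
          gcongr
          · exact two 14
          · linarith
      _ = X ^ 21 := by ring
  have hsX : (s : ℝ) ≤ X ^ 9 := by
    calc (s : ℝ) ≤ 2 ^ (2 * 7) * x * l' := by norm_num at hs ⊢; exact hs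
      _ ≤ X ^ 7 * X * X := by
          gcongr
          · exact two 7
          · linarith
          · linarith
      _ = X ^ 9 := by ring
  have hdX : (d : ℝ) ≤ X := by linarith
  have hqX : (q : ℝ) ≤ X ^ 2 := by nlinarith
  have t1 : (q : ℝ) * q ≤ X ^ 25 := by
    refine up (i := 4) ?_ (by norm_num)
    calc (q : ℝ) * q ≤ X ^ 2 * X ^ 2 := by gcongr
      _ = X ^ 4 := by ring
  have t2 : (q : ℝ) ≤ X ^ 25 := up hqX (by norm_num)
  have t3 : (k : ℝ) * d ≤ X ^ 25 := by
    refine up (i := 22) ?_ (by norm_num)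
    calc (k : ℝ) * d ≤ X ^ 21 * X := by gcongr
      _ = X ^ 22 := by ring
  have t4 : (n : ℝ) + 2 ≤ X ^ 25 := up (i := 1) (by linarith) (by norm_num)
  have t5 : (s : ℝ) * d * d ≤ X ^ 25 := by
    refine up (i := 11) ?_ (by norm_num)
    calc (s : ℝ) * d * d ≤ X ^ 9 * X * X := by gcongr
      _ = X ^ 11 := by ring
  have t6 : (s : ℝ) ≤ X ^ 25 := up hsX (by norm_num)
  have t7 : (1 : ℝ) ≤ X ^ 25 := one_le_pow₀ hX1
  have t8 : (d : ℝ) ≤ X ^ 25 := up (i := 1) (by linarith) (by norm_num)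
  have hsum : (q * q + q + 2 * k * d + 8 * (n + 2) + θ + ((s * d + 1) * d + 1) + s + k * d + 10 : ℝ) <
      X ^ 28 := by
    have h5 : (32 : ℝ) * X ^ 25 ≤ X ^ 28 := by
      have : (32 : ℝ) ≤ X ^ 3 := by nlinarith [pow_le_pow_left₀ (by norm_num) h4 3]
      calc (32 : ℝ) * X ^ 25 ≤ X ^ 3 * X ^ 25 := by gcongr
        _ = X ^ 28 := by ring
    linarith
  have hpow : X ^ 28 ≤ (2 : ℝ) ^ w := by
    have h5 : 0 ≤ Real.log X := Real.log_nonneg hX1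
    have h6 := Real.log_two_gt_d9
    rw [← Real.log_le_log_iff (by positivity) (by positivity), Real.log_pow, Real.log_pow]
    push_cast
    nlinarith
  exact_mod_cast hsum.trans_le hpow

section Costs

variable {x l k s D : ℝ}

/-- Both summands are at most cubic in `x`, and the second one has the largest power of `D`. -/
theorem probes_bound (hx : 1 ≤ x) (hl : 1 ≤ l) (hD : 1 ≤ D) (hk0 : 0 ≤ k) (hs0 : 0 ≤ s)
    (hk : k ≤ 2 ^ 28 * x * l ^ 3) (hs : s ≤ 2 ^ 14 * x * l) :
    60 * (k * (s * D + k) * (k * D * D) + s * D * D * (s * D) * (k * D * D)) ≤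
      2 ^ 150 * x ^ 4 * D ^ 5 * l ^ 12 := by
  have h1 : s * D + k ≤ 2 ^ 29 * x * l ^ 3 * D := by
    have : l ≤ l ^ 3 := le_self_pow₀ hl (by norm_num)
    have e1 : s * D ≤ 2 ^ 14 * x * l ^ 3 * D := by
      gcongr
      exact hs.trans (by gcongr)
    have e2 : k ≤ 2 ^ 28 * x * l ^ 3 * D := hk.trans (le_mul_of_one_le_right (by positivity) hD)
    have : 0 ≤ x * l ^ 3 * D := by positivity
    nlinarith
  calc _ ≤ 60 * (2 ^ 28 * x * l ^ 3 * (2 ^ 29 * x * l ^ 3 * D) * (2 ^ 28 * x * l ^ 3 * D * D) +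
        2 ^ 14 * x * l * D * D * (2 ^ 14 * x * l * D) * (2 ^ 28 * x * l ^ 3 * D * D)) := by gcongr
    _ = 60 * (2 ^ 85 * (x ^ 3 * D ^ 3 * l ^ 9) + 2 ^ 56 * (x ^ 3 * D ^ 5 * l ^ 5)) := by ring
    _ ≤ 60 * (2 ^ 85 * (x ^ 4 * D ^ 5 * l ^ 12) + 2 ^ 56 * (x ^ 4 * D ^ 5 * l ^ 12)) := by
        gcongr <;> first | assumption | norm_num
    _ ≤ _ := by
        have : 0 ≤ x ^ 4 * D ^ 5 * l ^ 12 := by positivity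
        nlinarith

/-- As `probes_bound`, with one more factor `k`. -/
theorem time_bound (hx : 1 ≤ x) (hl : 1 ≤ l) (hD : 1 ≤ D) (hk0 : 0 ≤ k) (hs0 : 0 ≤ s)
    (hk : k ≤ 2 ^ 28 * x * l ^ 3) (hs : s ≤ 2 ^ 14 * x * l) :
    50100 * (k * (s * D + k) * (k * D * (k * D)) + s * D * D * (s * D) * (k * D * (k * D))) ≤
      2 ^ 150 * x ^ 5 * D ^ 5 * l ^ 12 := by
  have h1 : s * D + k ≤ 2 ^ 29 * x * l ^ 3 * D := by
    have : l ≤ l ^ 3 := le_self_pow₀ hl (by norm_num)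
    have e1 : s * D ≤ 2 ^ 14 * x * l ^ 3 * D := by
      gcongr
      exact hs.trans (by gcongr)
    have e2 : k ≤ 2 ^ 28 * x * l ^ 3 * D := hk.trans (le_mul_of_one_le_right (by positivity) hD)
    have : 0 ≤ x * l ^ 3 * D := by positivity
    nlinarith
  calc _ ≤ 50100 * (2 ^ 28 * x * l ^ 3 * (2 ^ 29 * x * l ^ 3 * D) *
          (2 ^ 28 * x * l ^ 3 * D * (2 ^ 28 * x * l ^ 3 * D)) +
        2 ^ 14 * x * l * D * D * (2 ^ 14 * x * l * D) *
          (2 ^ 28 * x * l ^ 3 * D * (2 ^ 28 * x * l ^ 3 * D))) := by gcongr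
    _ = 50100 * (2 ^ 113 * (x ^ 4 * D ^ 3 * l ^ 12) + 2 ^ 84 * (x ^ 4 * D ^ 5 * l ^ 8)) := by ring
    _ ≤ 50100 * (2 ^ 113 * (x ^ 5 * D ^ 5 * l ^ 12) + 2 ^ 84 * (x ^ 5 * D ^ 5 * l ^ 12)) := by
        gcongr <;> first | assumption | norm_num
    _ ≤ _ := by
        have : 0 ≤ x ^ 5 * D ^ 5 * l ^ 12 := by positivity
        nlinarith

end Costs

/-- The program answers every query, with the probe complexity and running time claimed. -/
theorem answers (h0 : 0 < ε) (h1 : ε ≤ 1) (hh : 1 ≤ h) (hn : 1 ≤ n) (hd1 : 1 ≤ d) {ω : ℕ → ℕ → ℕ}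
    (hw : 2 ^ 150 * Real.log ((n : ℝ) + d + h / ε + 2) ≤ ω n d)
    {G : SimpleGraph (Fin n)} (hG : G.Connected) (hd : ∀ v, (G.neighborSet v).ncard ≤ d)
    (L : IncidenceLists G)
    (ρ : (algorithm program (biasParam ε h) (ballParam ε h) (sizeParam ε h) ω).Seed n d) {u v : Fin n}
    (huv : G.Adj u v) :
    (algorithm program (biasParam ε h) (ballParam ε h) (sizeParam ε h) ω).Answers d L ρ u v
      ((output program (biasParam ε h) (ballParam ε h) (sizeParam ε h) ω n d G ρ).Adj u v)
      (2 ^ 150 * (h / ε) ^ 5 * d ^ 5 * Real.log (h * d / ε + 2) ^ 12)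
      (2 ^ 150 * (h / ε) ^ 4 * d ^ 5 * Real.log (h * d / ε + 2) ^ 12) := by
  obtain ⟨hq, hnq, hq2⟩ := primeAbove_spec hn
  have hk := two_le_ballParam h0 h1 hh d
  have hs := two_le_sizeParam h0 h1 hh
  have hθ := threshold_le (biasParam_lt_one h1 hh) (primeAbove n)
  have hB := bound_lt_two_pow h0 h1 hh hn hd1 hq2 hθ hw
  let P : Setup := ⟨n, d, ballParam ε h d, sizeParam ε h, ω n d, primeAbove n,
    ⌈biasParam ε h * primeAbove n⌉₊, G, L, ρ, hG, hd, hk, hs, hd1, hnq, hB⟩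
  have hdk : d ≤ ballParam ε h d * d := Nat.le_mul_of_pos_left _ (by omega)
  have hqq : primeAbove n ≤ primeAbove n * primeAbove n := Nat.le_mul_self _
  have hkd : ballParam ε h d ≤ ballParam ε h d * d := Nat.le_mul_of_pos_right _ hd1
  have hun := u.2
  have hvn := v.2
  have hinit : P.Init u v ((algorithm program (biasParam ε h) (ballParam ε h) (sizeParam ε h) ω).init
      n d ρ u v) := by
    constructor
    case seed =>
      intro j hj
      have hj' := (ρ ⟨j, hj⟩).2
      have hr : (ρ ⟨j, hj⟩ : ℕ) < primeAbove n := hj'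
      exact (dif_pos hj).trans (Nat.mod_eq_of_lt (by change _ < 2 ^ ω n d; omega))
    case rest => exact fun j hj => dif_neg (not_lt.2 hj)
    case r19 => exact Nat.zero_mod _
    case r0 => exact Nat.mod_eq_of_lt (show (u : ℕ) + 1 < 2 ^ ω n d by omega)
    case r1 => exact Nat.mod_eq_of_lt (show (v : ℕ) + 1 < 2 ^ ω n d by omega)
    case r2 => exact Nat.mod_eq_of_lt (show n < 2 ^ ω n d by omega)
    case r3 => exact Nat.mod_eq_of_lt (show d < 2 ^ ω n d by omega)
    case r4 => exact Nat.mod_eq_of_lt (show ballParam ε h d < 2 ^ ω n d by omega)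
    case r5 => exact Nat.mod_eq_of_lt (show sizeParam ε h < 2 ^ ω n d by omega)
    case r6 => exact Nat.mod_eq_of_lt (show 2 * ballParam ε h d * d < 2 ^ ω n d by omega)
    case r7 => exact Nat.mod_eq_of_lt (show primeAbove n < 2 ^ ω n d by omega)
    case r8 => exact Nat.mod_eq_of_lt (show ⌈biasParam ε h * primeAbove n⌉₊ < 2 ^ ω n d by omega)
  obtain ⟨σ, t, m, ex, ht, hm, hans⟩ := P.exec_program hinit huv
  have hx := one_le_ratio h0 h1 hh
  have hll := log_le_log_mul (h := h) h0 hd1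
  have hl := (one_le_log hx).trans hll
  have hd' : (1 : ℝ) ≤ d := by exact_mod_cast hd1
  have hk' := ballParam_le h0 h1 hh hd1
  have hs' : (sizeParam ε h : ℝ) ≤ 2 ^ 14 * (h / ε) * Real.log (h * d / ε + 2) :=
    (sizeParam_le h0 h1 hh).trans (by gcongr)
  refine ⟨σ, t, m, ex, le_trans ?_ (time_bound hx hl hd' (Nat.cast_nonneg _) (Nat.cast_nonneg _) hk' hs'),
    le_trans ?_ (probes_bound hx hl hd' (Nat.cast_nonneg _) (Nat.cast_nonneg _) hk' hs'), hans⟩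
  · exact_mod_cast ht
  · exact_mod_cast hm

theorem clog_primeAbove_le (hn : 1 ≤ n) :
    (Nat.clog 2 (primeAbove n) : ℝ) ≤ 6 * Real.log (n + 1) := by
  obtain ⟨hq, hnq, hq2⟩ := primeAbove_spec hn
  have hn' : (1 : ℝ) ≤ n := by exact_mod_cast hn
  have h1 : (2 : ℝ) ^ (Nat.clog 2 (primeAbove n)).pred ≤ 2 * (n + 1) := by
    have := (Nat.pow_pred_clog_lt_self Nat.one_lt_two hq.one_lt).le.trans
      (hq2.trans (show 2 * n ≤ 2 * (n + 1) by omega))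
    exact_mod_cast this
  have h2 := Real.log_le_log (by positivity) h1
  rw [Real.log_pow, Real.log_mul (by norm_num) (by positivity)] at h2
  have h3 := Nat.clog_pos Nat.one_lt_two hq.two_le
  rw [Nat.pred_eq_sub_one, Nat.cast_sub h3, Nat.cast_one] at h2
  have h4 := Real.log_two_gt_d9
  have h5 : Real.log 2 ≤ Real.log (n + 1) := Real.log_le_log (by norm_num) (by linarith)
  have h6 : (1 : ℝ) ≤ Nat.clog 2 (primeAbove n) := by exact_mod_cast h3
  nlinarith

end Guarantees

end SSG

theorem mainTheorem1 :
    ∃ (P : SSG.Prog) (c : ℝ) (a : ℕ)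
      (γ : ℝ → ℕ → ℝ) (k : ℝ → ℕ → ℕ → ℕ) (s : ℝ → ℕ → ℕ),
      0 < c ∧
      ∀ (ε : ℝ) (h : ℕ) (H : SimpleGraph (Fin h)), 0 < ε → ε ≤ 1 → 1 ≤ h →
        (0 < γ ε h ∧ γ ε h < 1 ∧ (∀ d, 1 < k ε h d) ∧ 1 < s ε h) ∧
        ∀ ω : ℕ → ℕ → ℕ, (∀ n d : ℕ, c * Real.log ((n : ℝ) + d + h / ε + 2) ≤ (ω n d : ℝ)) →
          (SSG.algorithm P (γ ε h) (k ε h) (s ε h) ω).IsLocalSSG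
            (SSG.output P (γ ε h) (k ε h) (s ε h) ω) ε
            (fun _ d => c * (h / ε) ^ 4 * d ^ 5 * Real.log (h * d / ε + 2) ^ a)
            (fun n _ => c * (h / ε) * Real.log (h / ε + 2) ^ a / n)
            (fun _ d => c * (h / ε) ^ 5 * d ^ 5 * Real.log (h * d / ε + 2) ^ a)
            (SSG.MinorFree H) ∧
          ∀ n d : ℕ, 1 ≤ n → 1 ≤ d →
            (((SSG.algorithm P (γ ε h) (k ε h) (s ε h) ω).seedBits n d : ℕ) : ℝ) ≤
              c * (h / ε) * d * Real.log (n + 1) * Real.log (h * d / ε + 2) ^ a ∧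
            ∀ G : SimpleGraph (Fin n), G.Connected → (∀ v, (G.neighborSet v).ncard ≤ d) →
              SSG.MinorFree H n G →
              ∀ ρ, SSG.HasStretch G (SSG.output P (γ ε h) (k ε h) (s ε h) ω n d G ρ)
                (c * (h / ε) * Real.log (d + 1) * Real.log (h / ε + 2) ^ a) := by
  -- `2 ^ 150` exceeds the constants of all the bounds, none of which is optimized.
  refine ⟨SSG.program, 2 ^ 150, 12, SSG.biasParam, SSG.ballParam, SSG.sizeParam, by positivity, ?_⟩
  intro ε h H h0 h1 hh
  have hx := SSG.one_le_ratio h0 h1 hh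
  have hl := SSG.one_le_log hx
  have hclique : ∀ {n : ℕ} {G : SimpleGraph (Fin n)}, SSG.MinorFree H n G →
      ¬ SSG.HasClique h G Set.univ := fun hH hc => hH (hc.isMinor H)
  have hs := SSG.two_le_sizeParam h0 h1 hh
  refine ⟨⟨SSG.biasParam_pos h0 hh, SSG.biasParam_lt_one h1 hh, fun d => SSG.two_le_ballParam h0 h1 hh d,
    hs⟩, fun ω hω => ⟨?_, fun n d hn hd => ⟨?_, ?_⟩⟩⟩
  · intro n d hn hd G hG hdeg hH
    refine ⟨fun ρ => ⟨SSG.sparseSpanningGraph_le, SSG.sparseSpanningGraph_connected hG _ _ (by omega)⟩,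
      ?_, fun L ρ u v huv => SSG.answers h0 h1 hh hn hd (hω n d) hG hdeg L ρ huv⟩
    refine le_trans ?_ (SSG.one_sub_le_freq h0 h1 hh hn hd hG hdeg (hclique hH))
    have hpow : Real.log (h / ε + 2) ≤ Real.log (h / ε + 2) ^ 12 := le_self_pow₀ hl (by norm_num)
    have : (98304 : ℝ) ≤ 2 ^ 150 := by norm_num
    beta_reduce
    gcongr
  · have hll := SSG.log_le_log_mul (h := h) h0 hd
    have hk := SSG.ballParam_le h0 h1 hh hd
    have hq := SSG.clog_primeAbove_le hn
    have hln : 0 ≤ Real.log ((n : ℝ) + 1) := Real.log_nonneg (by linarith [Nat.cast_nonneg (α := ℝ) n])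
    have hpow : Real.log (h * d / ε + 2) ^ 3 ≤ Real.log (h * d / ε + 2) ^ 12 :=
      pow_le_pow_right₀ (hl.trans hll) (by norm_num)
    have hl0 : 0 ≤ Real.log (h * d / ε + 2) := by linarith
    have e : (SSG.algorithm SSG.program (SSG.biasParam ε h) (SSG.ballParam ε h) (SSG.sizeParam ε h)
        ω).seedBits n d = 2 * SSG.ballParam ε h d * d * Nat.clog 2 (SSG.primeAbove n) := rfl
    rw [e]
    push_cast
    calc _ ≤ 2 * (2 ^ 28 * (h / ε) * Real.log (h * d / ε + 2) ^ 3) * d * (6 * Real.log (n + 1)) := by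
          gcongr
      _ = 2 ^ 28 * 12 * (h / ε * d * Real.log (n + 1) * Real.log (h * d / ε + 2) ^ 3) := by ring
      _ ≤ 2 ^ 150 * (h / ε * d * Real.log (n + 1) * Real.log (h * d / ε + 2) ^ 12) :=
          mul_le_mul (by norm_num) (by gcongr) (by positivity) (by positivity)
      _ = _ := by ring
  · intro G hG _ _ ρ u v
    have h2 := SSG.dist_sparseSpanningGraph_le hG
      (SSG.centers n ⌈SSG.biasParam ε h * SSG.primeAbove n⌉₊ ρ) (SSG.ballParam ε h d)
      (by omega : 1 ≤ SSG.sizeParam ε h) u v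
    have h3 : ((8 * SSG.sizeParam ε h + 1 : ℕ) : ℝ) ≤
        2 ^ 150 * (h / ε) * Real.log (d + 1) * Real.log (h / ε + 2) ^ 12 := by
      have hpow : Real.log (h / ε + 2) ≤ Real.log (h / ε + 2) ^ 12 := le_self_pow₀ hl (by norm_num)
      have hd' : (1 : ℝ) ≤ d := by exact_mod_cast hd
      have hlog : 1 / 2 ≤ Real.log ((d : ℝ) + 1) := by
        have h4 := Real.log_le_log (by norm_num) (show (2 : ℝ) ≤ d + 1 by linarith)
        have h5 := Real.log_two_gt_d9
        linarith
      have h6 : (2 : ℝ) ≤ SSG.sizeParam ε h := by exact_mod_cast hs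
      push_cast
      calc 8 * (SSG.sizeParam ε h : ℝ) + 1 ≤ 9 * (2 ^ 14 * (h / ε) * Real.log (h / ε + 2)) := by
            have := SSG.sizeParam_le h0 h1 hh
            linarith
        _ = 2 ^ 15 * 9 * (h / ε) * (1 / 2) * Real.log (h / ε + 2) := by ring
        _ ≤ _ := by
            gcongr
            norm_num
    refine le_trans ?_ (mul_le_mul_of_nonneg_right h3 (Nat.cast_nonneg _))
    exact_mod_cast h2
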